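/- Setting. Theories are finite lists of constant declarations \(c:A[=t]\) in LF (the dependently typed \(\lambda\)-calculus with \(\mathsf{type}\), \(\mathsf{kind}\), \(\Pi\), \(\lambda\), application; \(\equiv\) is definitional equality, generated by \(\beta\), \(\eta\) and unfolding of definitions). A morphism \(m:S\to T\) maps \(S\)-constants to closed \(T\)-expressions such that \(\vdash_T m(c):m(A)\) for every \(c:A\) in \(S\), and \(m(c)\equiv m(t)\) if \(c\) has a definition \(t\); it extends homomorphically to all expressions. Morphisms are identified if they agree on all constants up to \(\equiv\). An \(S\)-extension is a theory that includes \(S\); morphisms of \(S\)-extensions are the morphisms that fix \(S\). A partial logical relation \(r\) on \(m\) is a partial map from \(S\)-constants to \(T\)-expressions such that, for each \(c:A[=t]\) in \(S\): if \(r(c)\) is defined, then so is \(r(A)\), and \(\vdash_T r(c):r(A)\,m(c)\); and if \(c\) has a definition \(t\), then \(r(c)\) is defined if and only if \(r(t)\) is, and then \(r(c)\equiv r(t)\). Here \(r\) is extended to a partial map on expressions by \(r(\mathsf{type})=\lambda a{:}\mathsf{type}.\,a\to\mathsf{type}\), \(r(\Pi_{x:A}B)=\lambda f{:}m(\Pi_{x:A}B).\,\Pi_{r(x:A)}\,r(B)\,(f\,x)\),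 \(r(\lambda_{x:A}t)=\lambda_{r(x:A)}\,r(t)\), \(r(f\,t)=r(f)\,m(t)\,r(t)\) if \(r(t)\) is defined and \(r(f)\,m(t)\) otherwise, and \(r(x)=x^*\) if \(x^*\) has been declared; \(r(x:A)\) is \(x:m(A),\,x^*:r(A)\,x\) if \(r(A)\) is defined and \(x:m(A)\) otherwise; in all other cases \(r\) is undefined where a right-hand side is. (Applications of \(r(A)\) for a kind \(A\) are read as contracted.) \(r\) is term-total if, for all constants \(c:A\) with \(A:\mathsf{type}\), \(r(c)\) is defined whenever \(r(A)\) is. Let \(m:S\to T\) be a morphism and \(r\) a term-total partial logical relation on \(m\). Let \(D\) be a diagram of \(S\)-extensions, i.e. a functor from a category \(J\) to the category of \(S\)-extensions. Consider its pushout along \(m\) (which replaces \(S\) by \(T\) and applies \(m\) to all declarations and assignments), presented, up to \(\equiv\), by well-typed theories and morphisms. For every theory of the diagram let a set \(P\) of argument positions of its local constants be given (the choice of a heuristic) that is unused in this presentation: if the \(i\)-th position of \(c\) is in \(P\), then the type, the definition, and all assignments to \(c\) by morphisms out of the theory start with enough explicit bindings, and after removing from them the bindings and arguments at positions in \(P\)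 (\(\eta\)-expanding where a constant has too few arguments) the \(i\)-th bound variable no longer occurs. For each theory \(E\) of \(D\) let \(E^m\) be its pushout with the positions in \(P\) removed, and let \(m_E\) map \(S\)-constants as \(m\) does and every local constant \(c\) of \(E\) to \(\lambda x_1\dots x_n.\,c\,x_{i_1}\dots x_{i_k}\), where \(i_1<\dots<i_k\) are the positions that are kept. Let \(\mathrm{LR}_{m,r}(E)\) arise from \(E^m\) by adding, for each local declaration \(c:A[=t]\) of \(E\) in turn, the declaration \(c^*:r_E(A)\,m_E(c)\,[=r_E(t)]\) if \(r_E(A)\) (and \(r_E(t)\), if there is a definition \(t\)) is defined; here \(r_E\) extends \(r\) by \(r_E(c)=c^*\) for those \(c\) for which \(c^*\) is declared. For a morphism \(f:E\to E'\) of the diagram let \(\mathrm{LR}_{m,r}(f)\) map \(c\) to the image of \(c\) under the pushout of \(f\) with the positions in \(P\) removed, and \(c^*\) to \(r_{E'}(f(c))\). Theorem. (1) For every theory \(E\) of \(D\), \(\mathrm{LR}_{m,r}(E)\) is a (well-formed) \(T\)-extension, \(m_E:E\to \mathrm{LR}_{m,r}(E)\) is a morphism, and \(r_E\) is a term-total partial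 logical relation on \(m_E\). (2) Suppose that the translations that \(\mathrm{LR}_{m,r}(f)\) involves are defined for type-level constants, i.e. for every \(f:E\to E'\) in the diagram and every local constant \(c:A\) of \(E\) without definition such that \(A:\mathsf{kind}\), \(r_{E'}(f(c))\) is defined. Then \(\mathrm{LR}_{m,r}\) is a natural functor on \(D\): its values on the morphisms of \(D\) are morphisms of \(T\)-extensions, \(\mathrm{LR}_{m,r}\) preserves identities and composition, i.e. it is a functor from \(J\) to the category of \(T\)-extensions, and the morphisms \(m_E\) form a natural transformation from \(D\) to it (in the category of theories). -/

import Mathlib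

universe u v w

open CategoryTheory hiding pi

namespace LF

/-! ### LF expressions -/

/-- LF expressions over a type `N` of constant names, with de Bruijn indices for bound variables. -/
inductive Exp (N : Type u) : Type u
  | const (c : N)
  | var (i : ℕ)
  | type
  | kind
  | lam (A t : Exp N)
  | pi (A B : Exp N)
  | app (f t : Exp N)

/-- A constant declaration `name : type [= defn]`. -/
structure Decl (K N : Type u) : Type u where
  name : K
  type : Exp N
  defn : Option (Exp N)

namespace Exp

variable {N N' N'' : Type u}

/-- Renamings under a binder. -/
def upr (ρ : ℕ → ℕ) : ℕ → ℕ
  | 0 => 0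
  | i + 1 => ρ i + 1

def rename : (ℕ → ℕ) → Exp N → Exp N
  | _, const c => const c
  | ρ, var i => var (ρ i)
  | _, type => type
  | _, kind => kind
  | ρ, lam A t => lam (A.rename ρ) (t.rename (upr ρ))
  | ρ, pi A B => pi (A.rename ρ) (B.rename (upr ρ))
  | ρ, app f t => app (f.rename ρ) (t.rename ρ)

/-- Substitutions under a binder. -/
def ups (σ : ℕ → Exp N) : ℕ → Exp N
  | 0 => var 0
  | i + 1 => (σ i).rename Nat.succ

def subst : (ℕ → Exp N) → Exp N → Exp N
  | _, const c => const c
  | σ, var i => σ i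
  | _, type => type
  | _, kind => kind
  | σ, lam A t => lam (A.subst σ) (t.subst (ups σ))
  | σ, pi A B => pi (A.subst σ) (B.subst (ups σ))
  | σ, app f t => app (f.subst σ) (t.subst σ)

/-- The substitution of `s` for variable `0`. -/
def single (s : Exp N) : ℕ → Exp N
  | 0 => s
  | i + 1 => var i

/-- `t.inst s` is `t[x₀ := s]`. -/
def inst (t s : Exp N) : Exp N := t.subst (single s)

/-- `t` in a context with one more (innermost) variable. -/
def lift (t : Exp N) : Exp N := t.rename Nat.succ

/-- Variable `i` occurs freely. -/
def Occurs : ℕ → Exp N → Prop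
  | _, const _ => False
  | i, var j => i = j
  | _, type => False
  | _, kind => False
  | i, lam A t => A.Occurs i ∨ t.Occurs (i + 1)
  | i, pi A B => A.Occurs i ∨ B.Occurs (i + 1)
  | i, app f t => f.Occurs i ∨ t.Occurs i

def Closed (t : Exp N) : Prop := ∀ i, ¬ t.Occurs i

/-- The homomorphic extension of a map of constants to (closed) expressions. -/
def bind (m : N → Exp N') : Exp N → Exp N'
  | const c => m c
  | var i => var i
  | type => type
  | kind => kind
  | lam A t => lam (A.bind m) (t.bind m)
  | pi A B => pi (A.bind m) (B.bind m)
  | app f t => app (f.bind m) (t.bind m)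

def mapConst (g : N → N') (t : Exp N) : Exp N' := t.bind fun c => const (g c)

/-- Application, where a redex at the root is contracted. -/
def betaApp : Exp N → Exp N → Exp N
  | lam _ t, s => t.inst s
  | f, s => app f s

/-- The head of the application spine is a constant. -/
def constHead : Exp N → Bool
  | const _ => true
  | app f _ => f.constHead
  | _ => false

end Exp

open Exp

/-! ### Definitional equality, typing, theories -/

section Judgments

variable {N : Type u}

/-- One step of `β`, `η` or `δ` reduction (unfolding a definition) anywhere in an expression. -/
inductive Step (Th : List (Decl N N)) : Exp N → Exp N → Prop
  | beta (A t s : Exp N) : Step Th (app (lam A t) s) (t.inst s)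
  | eta (A f : Exp N) : Step Th (lam A (app f.lift (var 0))) f
  | delta (d : Decl N N) (t : Exp N) : d ∈ Th → d.defn = some t → Step Th (const d.name) t
  | lam_left {A A' : Exp N} (t : Exp N) : Step Th A A' → Step Th (lam A t) (lam A' t)
  | lam_right (A : Exp N) {t t' : Exp N} : Step Th t t' → Step Th (lam A t) (lam A t')
  | pi_left {A A' : Exp N} (B : Exp N) : Step Th A A' → Step Th (pi A B) (pi A' B)
  | pi_right (A : Exp N) {B B' : Exp N} : Step Th B B' → Step Th (pi A B) (pi A B')
  | app_left {f f' : Exp N} (t : Exp N) : Step Th f f' → Step Th (app f t) (app f' t)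
  | app_right (f : Exp N) {t t' : Exp N} : Step Th t t' → Step Th (app f t) (app f t')

/-- Definitional equality of LF. -/
def Conv (Th : List (Decl N N)) : Exp N → Exp N → Prop := Relation.EqvGen (Step Th)

def IsSort (s : Exp N) : Prop := s = type ∨ s = kind

/-- The typing judgment `Th; Γ ⊢ t : A` of LF. The head of the list `Γ` is the innermost variable. -/
inductive HasType (Th : List (Decl N N)) : List (Exp N) → Exp N → Exp N → Prop
  | type (Γ : List (Exp N)) : HasType Th Γ type kind
  | const (Γ : List (Exp N)) (d : Decl N N) : d ∈ Th → HasType Th Γ (const d.name) d.type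
  | var (Γ : List (Exp N)) (i : ℕ) (A : Exp N) : Γ[i]? = some A →
      HasType Th Γ (var i) (A.rename (· + (i + 1)))
  | pi {Γ : List (Exp N)} {A B s : Exp N} : HasType Th Γ A type → IsSort s →
      HasType Th (A :: Γ) B s → HasType Th Γ (pi A B) s
  | lam {Γ : List (Exp N)} {A B t s : Exp N} : HasType Th Γ A type → IsSort s →
      HasType Th (A :: Γ) B s → HasType Th (A :: Γ) t B → HasType Th Γ (lam A t) (pi A B)
  | app {Γ : List (Exp N)} {A B f t : Exp N} : HasType Th Γ f (pi A B) → HasType Th Γ t A →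
      HasType Th Γ (app f t) (B.inst t)
  | conv {Γ : List (Exp N)} {A B t s : Exp N} : HasType Th Γ t A → IsSort s →
      HasType Th Γ B s → Conv Th A B → HasType Th Γ t B

/-- Well-formed lists of declarations. The head of the list is the declaration made last. -/
inductive WF : List (Decl N N) → Prop
  | nil : WF []
  | cons {Th : List (Decl N N)} {d : Decl N N} {s : Exp N} : WF Th →
      (∀ e ∈ Th, e.name ≠ d.name) → IsSort s → HasType Th [] d.type s →
      (∀ t, d.defn = some t → HasType Th [] t d.type) → WF (d :: Th)

end Judgments

/-- A theory. -/
structure Thy : Type (u + 1) where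
  Con : Type u
  decls : List (Decl Con Con)
  wf : WF decls

/-! ### Morphisms and the category of theories -/

section Morphisms

variable {N N' N'' : Type u}

/-- `m` is a morphism: it preserves the types, and it respects the definitions. -/
def IsMorphism (S : List (Decl N N)) (T : List (Decl N' N')) (m : N → Exp N') : Prop :=
  ∀ d ∈ S, HasType T [] (m d.name) (d.type.bind m) ∧
    ∀ t, d.defn = some t → Conv T (m d.name) (t.bind m)

/-- Morphisms as maps of constants. (Names that the theory does not declare play no role; they
are mapped to arbitrary closed expressions.) -/
structure RawHom (S T : Thy.{u}) where
  toFun : S.Con → Exp T.Con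
  closed : ∀ c, (toFun c).Closed
  isMorphism : IsMorphism S.decls T.decls toFun

theorem rename_congr (t : Exp N) : ∀ {ρ ρ' : ℕ → ℕ}, (∀ i, t.Occurs i → ρ i = ρ' i) →
    t.rename ρ = t.rename ρ' := by
  induction t with
  | const c => intros; rfl
  | var i => intro ρ ρ' h; simp only [rename]; rw [h i rfl]
  | type => intros; rfl
  | kind => intros; rfl
  | lam A t ihA iht | pi A t ihA iht =>
    intro ρ ρ' h
    simp only [rename]
    rw [ihA fun i hi => h i (Or.inl hi), iht (ρ := upr ρ) (ρ' := upr ρ') _]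
    rintro (_ | i) hi
    · rfl
    · simp only [upr]; rw [h i (Or.inr hi)]
  | app f t ihf iht =>
    intro ρ ρ' h
    simp only [rename]
    rw [ihf fun i hi => h i (Or.inl hi), iht fun i hi => h i (Or.inr hi)]

theorem subst_congr (t : Exp N) : ∀ {σ σ' : ℕ → Exp N}, (∀ i, t.Occurs i → σ i = σ' i) →
    t.subst σ = t.subst σ' := by
  induction t with
  | const c => intros; rfl
  | var i => intro σ σ' h; exact h i rfl
  | type => intros; rfl
  | kind => intros; rfl
  | lam A t ihA iht | pi A t ihA iht =>
    intro σ σ' h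
    simp only [subst]
    rw [ihA fun i hi => h i (Or.inl hi), iht (σ := ups σ) (σ' := ups σ') _]
    rintro (_ | i) hi
    · rfl
    · simp only [ups]; rw [h i (Or.inr hi)]
  | app f t ihf iht =>
    intro σ σ' h
    simp only [subst]
    rw [ihf fun i hi => h i (Or.inl hi), iht fun i hi => h i (Or.inr hi)]

theorem upr_id : upr id = id := by funext i; cases i <;> rfl

theorem ups_var : ups (var : ℕ → Exp N) = var := by funext i; cases i <;> rfl

theorem rename_id (t : Exp N) : t.rename id = t := by
  induction t <;> simp_all [rename, upr_id]

theorem subst_var (t : Exp N) : t.subst var = t := by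
  induction t <;> simp_all [subst, ups_var]

theorem Exp.Closed.rename_eq {t : Exp N} (h : t.Closed) (ρ : ℕ → ℕ) : t.rename ρ = t :=
  (rename_congr t fun i hi => absurd hi (h i)).trans (rename_id t)

theorem Exp.Closed.subst_eq {t : Exp N} (h : t.Closed) (σ : ℕ → Exp N) : t.subst σ = t :=
  (subst_congr t fun i hi => absurd hi (h i)).trans (subst_var t)

theorem bind_rename {m : N → Exp N'} (hm : ∀ c, (m c).Closed) (t : Exp N) :
    ∀ ρ, (t.rename ρ).bind m = (t.bind m).rename ρ := by
  induction t with
  | const c => intro ρ; exact ((hm c).rename_eq ρ).symm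
  | _ => simp_all [Exp.bind, rename]

theorem bind_subst {m : N → Exp N'} (hm : ∀ c, (m c).Closed) (t : Exp N) :
    ∀ σ, (t.subst σ).bind m = (t.bind m).subst fun i => (σ i).bind m := by
  have hups : ∀ σ : ℕ → Exp N, (fun i => (ups σ i).bind m) = ups fun i => (σ i).bind m := by
    intro σ; funext i
    cases i with
    | zero => rfl
    | succ i => exact bind_rename hm _ _
  induction t with
  | const c => intro σ; exact ((hm c).subst_eq _).symm
  | _ => simp_all [Exp.bind, subst]

theorem bind_inst {m : N → Exp N'} (hm : ∀ c, (m c).Closed) (t s : Exp N) :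
    (t.inst s).bind m = (t.bind m).inst (s.bind m) := by
  unfold inst
  rw [bind_subst hm]
  congr 1
  funext i
  cases i <;> rfl

theorem bind_const (t : Exp N) : t.bind const = t := by
  induction t <;> simp_all [Exp.bind]

theorem bind_bind (m : N → Exp N') (n : N' → Exp N'') (t : Exp N) :
    (t.bind m).bind n = t.bind fun c => (m c).bind n := by
  induction t <;> simp_all [Exp.bind]

theorem Exp.Closed.bind {m : N → Exp N'} (hm : ∀ c, (m c).Closed) {t : Exp N} (ht : t.Closed) :
    (t.bind m).Closed := by
  have key : ∀ (t : Exp N) (i : ℕ), (t.bind m).Occurs i → t.Occurs i := by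
    intro t
    induction t with
    | const c => intro i hi; exact (hm c i hi).elim
    | var j => intro i hi; exact hi
    | type => intro i hi; exact hi
    | kind => intro i hi; exact hi
    | lam A t ihA iht | pi A t ihA iht =>
      intro i hi; exact hi.imp (ihA i) (iht (i + 1))
    | app f t ihf iht => intro i hi; exact hi.imp (ihf i) (iht i)
  exact fun i hi => ht i (key t i hi)

variable {S : List (Decl N N)} {T : List (Decl N' N')}

theorem Conv.refl (Th : List (Decl N N)) (a : Exp N) : Conv Th a a := Relation.EqvGen.refl a

theorem Conv.symm {Th : List (Decl N N)} {a b : Exp N} (h : Conv Th a b) : Conv Th b a :=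
  Relation.EqvGen.symm _ _ h

theorem Conv.trans {Th : List (Decl N N)} {a b c : Exp N} (h : Conv Th a b) (h' : Conv Th b c) :
    Conv Th a c := Relation.EqvGen.trans _ _ _ h h'

theorem Conv.congr {Th : List (Decl N N)} {F : Exp N → Exp N'} {Th' : List (Decl N' N')}
    (hF : ∀ a b, Step Th a b → Conv Th' (F a) (F b)) {a b : Exp N} (h : Conv Th a b) :
    Conv Th' (F a) (F b) := by
  induction h with
  | rel a b h => exact hF a b h
  | refl a => exact Conv.refl _ _
  | symm a b _ ih => exact ih.symm
  | trans a b c _ _ ih ih' => exact ih.trans ih'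

theorem Conv.lam {Th : List (Decl N N)} {A A' t t' : Exp N} (h : Conv Th A A')
    (h' : Conv Th t t') : Conv Th (lam A t) (lam A' t') :=
  (Conv.congr (F := fun x => Exp.lam x t)
    (fun _ _ s => Relation.EqvGen.rel _ _ (Step.lam_left t s)) h).trans
  (Conv.congr (F := fun x => Exp.lam A' x)
    (fun _ _ s => Relation.EqvGen.rel _ _ (Step.lam_right A' s)) h')

theorem Conv.pi {Th : List (Decl N N)} {A A' t t' : Exp N} (h : Conv Th A A')
    (h' : Conv Th t t') : Conv Th (pi A t) (pi A' t') :=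
  (Conv.congr (F := fun x => Exp.pi x t)
    (fun _ _ s => Relation.EqvGen.rel _ _ (Step.pi_left t s)) h).trans
  (Conv.congr (F := fun x => Exp.pi A' x)
    (fun _ _ s => Relation.EqvGen.rel _ _ (Step.pi_right A' s)) h')

theorem Conv.app {Th : List (Decl N N)} {f f' t t' : Exp N} (h : Conv Th f f')
    (h' : Conv Th t t') : Conv Th (app f t) (app f' t') :=
  (Conv.congr (F := fun x => Exp.app x t)
    (fun _ _ s => Relation.EqvGen.rel _ _ (Step.app_left t s)) h).trans
  (Conv.congr (F := fun x => Exp.app f' x)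
    (fun _ _ s => Relation.EqvGen.rel _ _ (Step.app_right f' s)) h')

theorem Conv.bind {m : N → Exp N'} (hc : ∀ c, (m c).Closed) (hm : IsMorphism S T m)
    {a b : Exp N} (h : Conv S a b) : Conv T (a.bind m) (b.bind m) := by
  refine Conv.congr (F := Exp.bind m) (fun a b h => ?_) h
  induction h with
  | beta A t s =>
    rw [bind_inst hc]
    exact Relation.EqvGen.rel _ _ (Step.beta _ _ _)
  | eta A f =>
    have : (Exp.lam A (Exp.app f.lift (Exp.var 0))).bind m =
        Exp.lam (A.bind m) (Exp.app (f.bind m).lift (Exp.var 0)) := by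
      simp only [Exp.bind, lift, bind_rename hc]
    rw [this]
    exact Relation.EqvGen.rel _ _ (Step.eta _ _)
  | delta d t hd ht => exact (hm d hd).2 t ht
  | lam_left t _ ih => exact Conv.lam ih (Conv.refl _ _)
  | lam_right A _ ih => exact Conv.lam (Conv.refl _ _) ih
  | pi_left t _ ih => exact Conv.pi ih (Conv.refl _ _)
  | pi_right A _ ih => exact Conv.pi (Conv.refl _ _) ih
  | app_left t _ ih => exact Conv.app ih (Conv.refl _ _)
  | app_right f _ ih => exact Conv.app (Conv.refl _ _) ih

theorem HasType.append {Γ : List (Exp N)} {t A : Exp N} (h : HasType S Γ t A)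
    (Δ : List (Exp N)) : HasType S (Γ ++ Δ) t A := by
  induction h with
  | type Γ => exact .type _
  | const Γ d hd => exact .const _ d hd
  | var Γ i A hA =>
    refine .var _ i A ?_
    obtain ⟨hi, _⟩ := List.getElem?_eq_some_iff.1 hA
    rw [List.getElem?_append_left hi, hA]
  | pi _ hs _ ih1 ih2 => exact .pi ih1 hs ih2
  | lam _ hs _ _ ih1 ih2 ih3 => exact .lam ih1 hs ih2 ih3
  | app _ _ ih1 ih2 => exact .app ih1 ih2
  | conv _ hs _ hc ih1 ih2 => exact .conv ih1 hs ih2 hc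

theorem IsSort.bind {m : N → Exp N'} {s : Exp N} (h : IsSort s) : IsSort (s.bind m) := by
  rcases h with rfl | rfl
  · exact Or.inl rfl
  · exact Or.inr rfl

/-- Morphisms preserve typing. -/
theorem HasType.bind {m : N → Exp N'} (hc : ∀ c, (m c).Closed) (hm : IsMorphism S T m)
    {Γ : List (Exp N)} {t A : Exp N} (h : HasType S Γ t A) :
    HasType T (Γ.map (Exp.bind m)) (t.bind m) (A.bind m) := by
  induction h with
  | type Γ => exact .type _
  | const Γ d hd => simpa [Exp.bind] using (hm d hd).1.append (Γ.map (Exp.bind m))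
  | var Γ i A hA =>
    rw [bind_rename hc]
    exact .var _ i _ (by simp [hA])
  | pi _ hs _ ih1 ih2 => exact .pi ih1 hs.bind ih2
  | lam _ hs _ _ ih1 ih2 ih3 => exact .lam ih1 hs.bind ih2 ih3
  | app _ _ ih1 ih2 => rw [bind_inst hc]; exact .app ih1 ih2
  | conv _ hs _ hcv ih1 ih2 => exact .conv ih1 hs.bind ih2 (hcv.bind hc hm)

theorem HasType.bind_conv {m m' : N → Exp N'} (h : ∀ d ∈ S, Conv T (m d.name) (m' d.name))
    {Γ : List (Exp N)} {t A : Exp N} (ht : HasType S Γ t A) :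
    Conv T (t.bind m) (t.bind m') := by
  induction ht with
  | type Γ => exact Conv.refl _ _
  | const Γ d hd => exact h d hd
  | var Γ i A hA => exact Conv.refl _ _
  | pi _ hs _ ih1 ih2 => exact Conv.pi ih1 ih2
  | lam _ _ _ _ ih1 _ ih3 => exact Conv.lam ih1 ih3
  | app _ _ ih1 ih2 => exact Conv.app ih1 ih2
  | conv _ _ _ _ ih _ => exact ih


end Morphisms

namespace RawHom

variable {R S T U : Thy.{u}}

def id (S : Thy.{u}) : RawHom S S where
  toFun := const
  closed := fun _ _ h => h
  isMorphism := fun d hd => by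
    simp only [bind_const]
    exact ⟨.const _ d hd, fun t ht => Relation.EqvGen.rel _ _ (.delta d t hd ht)⟩

def comp (f : RawHom R S) (g : RawHom S T) : RawHom R T where
  toFun := fun c => (f.toFun c).bind g.toFun
  closed := fun c => (f.closed c).bind g.closed
  isMorphism := fun d hd => by
    rw [← bind_bind]
    refine ⟨by simpa using (f.isMorphism d hd).1.bind g.closed g.isMorphism, fun t ht => ?_⟩
    rw [← bind_bind]
    exact ((f.isMorphism d hd).2 t ht).bind g.closed g.isMorphism

/-- Two morphisms are equal if they agree on all constants up to definitional equality. -/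
instance setoid (S T : Thy.{u}) : Setoid (RawHom S T) where
  r f g := ∀ d ∈ S.decls, Conv T.decls (f.toFun d.name) (g.toFun d.name)
  iseqv := ⟨fun _ _ _ => Conv.refl _ _, fun h d hd => (h d hd).symm,
    fun h h' d hd => (h d hd).trans (h' d hd)⟩

theorem comp_congr {f f' : RawHom R S} {g g' : RawHom S T} (hf : f ≈ f') (hg : g ≈ g') :
    f.comp g ≈ f'.comp g' := fun d hd =>
  ((hf d hd).bind g.closed g.isMorphism).trans ((f'.isMorphism d hd).1.bind_conv hg)

end RawHom

/-- The category of theories and theory morphisms. -/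
instance : Category Thy.{u} where
  Hom S T := Quotient (RawHom.setoid S T)
  id S := Quotient.mk _ (RawHom.id S)
  comp f g := Quotient.map₂ RawHom.comp
    (fun _ _ h _ _ h' => RawHom.comp_congr h h') f g
  id_comp f := by
    induction f using Quotient.inductionOn
    exact Quotient.sound fun d hd => Conv.refl _ _
  comp_id f := by
    induction f using Quotient.inductionOn with | _ f =>
    refine Quotient.sound fun d hd => ?_
    change Conv _ ((f.toFun d.name).bind const) _
    rw [bind_const]
    exact Conv.refl _ _
  assoc f g h := by
    induction f using Quotient.inductionOn with | _ f =>
    induction g using Quotient.inductionOn with | _ g =>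
    induction h using Quotient.inductionOn with | _ h =>
    refine Quotient.sound fun d hd => ?_
    change Conv _ (((f.toFun d.name).bind g.toFun).bind h.toFun) _
    rw [bind_bind]
    exact Conv.refl _ _

/-- `φ` is the (class of the) morphism that maps the declared constants as `a` does. -/
def Represents {S T : Thy.{u}} (φ : S ⟶ T) (a : S.Con → Exp T.Con) : Prop :=
  ∃ f : RawHom S T, φ = Quotient.mk _ f ∧ ∀ d ∈ S.decls, f.toFun d.name = a d.name

/-! ### Theories that include a given theory -/

section Extensions

variable {N L : Type u}

def Decl.base (L : Type u) (d : Decl N N) : Decl (N ⊕ L) (N ⊕ L) where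
  name := Sum.inl d.name
  type := d.type.mapConst Sum.inl
  defn := d.defn.map (mapConst Sum.inl)

def Decl.local (d : Decl L (N ⊕ L)) : Decl (N ⊕ L) (N ⊕ L) where
  name := Sum.inr d.name
  type := d.type
  defn := d.defn

/-- The declarations of the included theory `S`, followed by the local declarations `E`. -/
def full (S : List (Decl N N)) (E : List (Decl L (N ⊕ L))) : List (Decl (N ⊕ L) (N ⊕ L)) :=
  E.map Decl.local ++ S.map (Decl.base L)

end Extensions

/-- A theory that includes `S`, given by its local declarations, whose names are in `L`. -/
structure ThyOver (S : Thy.{u}) (L : Type u) : Type u where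
  decls : List (Decl L (S.Con ⊕ L))
  wf : WF (full S.decls decls)

namespace ThyOver

variable {S : Thy.{u}} {L : Type u}

/-- The underlying theory, in which the included constants count as declared. -/
def thy (E : ThyOver S L) : Thy.{u} := ⟨S.Con ⊕ L, full S.decls E.decls, E.wf⟩

/-- The inclusion of `S`. -/
def incl (E : ThyOver S L) : S ⟶ E.thy := Quotient.mk _
  { toFun := fun c => const (Sum.inl c)
    closed := fun _ _ h => h
    isMorphism := fun d hd => by
      have hd' : d.base L ∈ E.thy.decls :=
        List.mem_append_right _ (List.mem_map_of_mem hd)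
      refine ⟨.const [] (d.base L) hd', fun t ht => Relation.EqvGen.rel _ _ ?_⟩
      exact .delta (d.base L) _ hd' (by rw [Decl.base, ht]; rfl) }

/-- Morphisms of theories that include `S` are the theory morphisms that fix `S`. -/
instance : Category (ThyOver S L) where
  Hom E E' := {φ : E.thy ⟶ E'.thy // E.incl ≫ φ = E'.incl}
  id E := ⟨𝟙 E.thy, Category.comp_id _⟩
  comp φ ψ := ⟨φ.1 ≫ ψ.1, by rw [← Category.assoc, φ.2, ψ.2]⟩
  id_comp φ := Subtype.ext (Category.id_comp φ.1)
  comp_id φ := Subtype.ext (Category.comp_id φ.1)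
  assoc φ ψ χ := Subtype.ext (Category.assoc φ.1 ψ.1 χ.1)

def forget (S : Thy.{u}) (L : Type u) : ThyOver S L ⥤ Thy.{u} where
  obj E := E.thy
  map φ := φ.1

/-- The expressions that a morphism assigns to the local constants (a choice of representatives,
unique up to definitional equality). -/
noncomputable def assign {E E' : ThyOver S L} (φ : E ⟶ E') : L → Exp (S.Con ⊕ L) :=
  fun c => (Quotient.out φ.1).toFun (Sum.inr c)

end ThyOver

/-! ### Logical relations -/

section Relations

variable {N N' : Type u}

/-- The index of the copy in `r(Γ)` of variable `i` of `Γ`. The list records, innermost first,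
for which variables `x` of `Γ` the context `r(Γ)` has not only `x` but also `x*`. -/
def idx : List Bool → ℕ → ℕ
  | [], i => i
  | b :: _, 0 => if b then 1 else 0
  | b :: ε, i + 1 => idx ε i + if b then 2 else 1

/-- The index in `r(Γ)` of the starred copy of variable `i` of `Γ`, if there is one. -/
def starIdx : List Bool → ℕ → Option ℕ
  | [], _ => none
  | b :: _, 0 => if b then some 0 else none
  | b :: ε, i + 1 => (starIdx ε i).map (· + if b then 2 else 1)

/-- The partial map on expressions induced by a morphism `m` and a partial map `r` of constants.
Expressions are translated from a context `Γ` to `r(Γ)`. The value at a type `A` is a predicate on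
`m(A)`. The value at a kind stands for a predicate on the type families of that kind; it is only
used applied to such a family, and that application is contracted. -/
def rel (m : N → Exp N') (r : N → Option (Exp N')) : List Bool → Exp N → Option (Exp N')
  | _, const c => r c
  | ε, var i => (starIdx ε i).map var
  | _, type => some (lam type (pi (var 0) type))
  | _, kind => none
  | ε, pi A B =>
    let mA := (A.bind m).rename (idx ε)
    let mAB := ((pi A B).bind m).rename (idx ε)
    match rel m r ε A with
    | some RA => (rel m r (true :: ε) B).map fun RB =>
        lam mAB (pi mA.lift (pi (betaApp RA.lift.lift (var 0))
          (betaApp (RB.rename (upr (upr Nat.succ))) (app (var 2) (var 1)))))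
    | none => (rel m r (false :: ε) B).map fun RB =>
        lam mAB (pi mA.lift (betaApp (RB.rename (upr Nat.succ)) (app (var 1) (var 0))))
  | ε, lam A t =>
    let mA := (A.bind m).rename (idx ε)
    match rel m r ε A with
    | some RA => (rel m r (true :: ε) t).map fun Rt => lam mA (lam (betaApp RA.lift (var 0)) Rt)
    | none => (rel m r (false :: ε) t).map fun Rt => lam mA Rt
  | ε, app f t =>
    let mt := (t.bind m).rename (idx ε)
    match rel m r ε t with
    | some Rt => (rel m r ε f).map fun Rf => app (app Rf mt) Rt
    | none => (rel m r ε f).map fun Rf => app Rf mt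

/-- `r` is a partial logical relation on the morphism `m : S → T`. (As a morphism does, it respects
the definitions in `S`.) -/
def IsLogRel (S : List (Decl N N)) (T : List (Decl N' N')) (m : N → Exp N')
    (r : N → Option (Exp N')) : Prop :=
  ∀ d ∈ S,
    (∀ R, r d.name = some R →
      ∃ RA, rel m r [] d.type = some RA ∧ HasType T [] R (betaApp RA (m d.name))) ∧
    ∀ t, d.defn = some t → Option.Rel (Conv T) (r d.name) (rel m r [] t)

/-- `r` is defined for a typed constant if it is for the type. -/
def TermTotal (S : List (Decl N N)) (m : N → Exp N') (r : N → Option (Exp N')) : Prop :=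
  ∀ d ∈ S, HasType S [] d.type type → (rel m r [] d.type).isSome → (r d.name).isSome

end Relations

/-! ### Removal of argument positions -/

section Removal

variable {N L : Type u}

/-- All positions in `P` are less than `arity P`. -/
def arity (P : Finset ℕ) : ℕ := P.sup (· + 1)

/-- Among the first `k` bindings of an expression (which are `Π`-bindings for a type, and
`λ`-bindings for a definition), the number of the first one being `i`, remove those in `P`. -/
def dropBinders (P : Finset ℕ) : ℕ → ℕ → Exp N → Exp N
  | i, k + 1, pi A B =>
    let B' := dropBinders P (i + 1) k B
    if i ∈ P then B'.rename Nat.pred else pi A B'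
  | i, k + 1, lam A B =>
    let B' := dropBinders P (i + 1) k B
    if i ∈ P then B'.rename Nat.pred else lam A B'
  | _, _, e => e

/-- The expression starts with `k` bindings, and those in `P` bind variables that do not occur in
what `dropBinders` leaves. -/
def UnusedBinders (P : Finset ℕ) : ℕ → ℕ → Exp N → Prop
  | _, 0, _ => True
  | i, k + 1, pi _ B =>
    (i ∈ P → ¬ (dropBinders P (i + 1) k B).Occurs 0) ∧ UnusedBinders P (i + 1) k B
  | i, k + 1, lam _ B =>
    (i ∈ P → ¬ (dropBinders P (i + 1) k B).Occurs 0) ∧ UnusedBinders P (i + 1) k B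
  | _, _ + 1, _ => False

/-- Replace every constant `c` by `θ c`, contracting the redexes that arise where `c` is applied.
If `θ c` is `λ x₁ … xₙ, c xᵢ₁ … xᵢₖ`, then this removes arguments of `c`, `η`-expanding first where
`c` has fewer than `n` of them. -/
def eraseArgs (θ : N → Exp N) : Exp N → Exp N
  | const c => θ c
  | var i => var i
  | type => type
  | kind => kind
  | lam A t => lam (eraseArgs θ A) (eraseArgs θ t)
  | pi A B => pi (eraseArgs θ A) (eraseArgs θ B)
  | app f t =>
    if f.constHead then betaApp (eraseArgs θ f) (eraseArgs θ t)
    else app (eraseArgs θ f) (eraseArgs θ t)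

/-- `λ x₁ … xₖ, b`, where the variables have the types of the first `k` arguments of `A`. -/
def lamTele : ℕ → Exp N → Exp N → Exp N
  | k + 1, pi A B, b => lam A (lamTele k B b)
  | _, _, b => b

/-- The application of `h` to those of the `k` innermost variables that are not in `P`, the
outermost one of them having number `0`. -/
def keepArgs (P : Finset ℕ) (k : ℕ) (h : Exp N) : Exp N :=
  ((List.range k).filter (· ∉ P)).foldl (fun a i => app a (var (k - 1 - i))) h

/-- Extend a map of the local constants by the identity on the included constants. -/
def fix (a : L → Exp (N ⊕ L)) : N ⊕ L → Exp (N ⊕ L) := Sum.elim (fun c => const (Sum.inl c)) a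

variable [DecidableEq L] (P : L → Finset ℕ)

/-- The map of every local constant `c` of the theory with local declarations `E` to
`λ x₁ … xₙ, c xᵢ₁ … xᵢₖ`, where `i₁ < … < iₖ` are the positions that are not in `P c`. -/
def eraser : List (Decl L (N ⊕ L)) → L → Exp (N ⊕ L)
  | [], c => const (Sum.inr c)
  | d :: E, c =>
    if c = d.name then
      lamTele (arity (P c)) (eraseArgs (fix (eraser E)) d.type)
        (keepArgs (P c) (arity (P c)) (const (Sum.inr c)))
    else eraser E c

/-- The removal of argument positions from a declaration `d` that is made after `E`. -/
def cleanDecl (E : List (Decl L (N ⊕ L))) (d : Decl L (N ⊕ L)) : Decl L (N ⊕ L) where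
  name := d.name
  type := dropBinders (P d.name) 0 (arity (P d.name)) (eraseArgs (fix (eraser P E)) d.type)
  defn := d.defn.map fun t =>
    dropBinders (P d.name) 0 (arity (P d.name)) (eraseArgs (fix (eraser P E)) t)

/-- The positions in `P` are unused in the local declarations: in the type and in the definition
of `c`, the variables at the positions in `P c` occur at most inside of arguments that are at
removed positions themselves. -/
def Unused : List (Decl L (N ⊕ L)) → Prop
  | [] => True
  | d :: E => Unused E ∧
    UnusedBinders (P d.name) 0 (arity (P d.name)) (eraseArgs (fix (eraser P E)) d.type) ∧
    ∀ t, d.defn = some t →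
      UnusedBinders (P d.name) 0 (arity (P d.name)) (eraseArgs (fix (eraser P E)) t)

end Removal

/-! ### The operator -/

section Operator

variable {N N' L : Type u}

/-- The extension of `m : S → T` to expressions over a theory that includes `S`, as used in the
pushout. -/
def push (L : Type u) (m : N → Exp N') : N ⊕ L → Exp (N' ⊕ L) :=
  Sum.elim (fun c => (m c).mapConst Sum.inl) (fun c => const (Sum.inr c))

/-- The local declarations `E'` are, up to definitional equality over `T`, those of the pushout
along `m` of the theory with local declarations `E`. -/
inductive IsPushout (T : List (Decl N' N')) (m : N → Exp N') :
    List (Decl L (N ⊕ L)) → List (Decl L (N' ⊕ L)) → Prop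
  | nil : IsPushout T m [] []
  | cons {E : List (Decl L (N ⊕ L))} {E' : List (Decl L (N' ⊕ L))} {d : Decl L (N ⊕ L)}
      {d' : Decl L (N' ⊕ L)} : IsPushout T m E E' → d'.name = d.name →
      Conv (full T E') (d.type.bind (push L m)) d'.type →
      Option.Rel (Conv (full T E')) (d.defn.map (Exp.bind (push L m))) d'.defn →
      IsPushout T m (d :: E) (d' :: E')

/-- In the target, the local names are `c` (as `Sum.inl c`) and `c*` (as `Sum.inr c`). -/
def plain : N' ⊕ L → N' ⊕ (L ⊕ L) := Sum.map id Sum.inl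

/-- The extension of `r` by a partial map of the local constants. -/
def extendRel (r : N → Option (Exp N')) (a : L → Option (Exp (N' ⊕ (L ⊕ L)))) :
    N ⊕ L → Option (Exp (N' ⊕ (L ⊕ L))) :=
  Sum.elim (fun c => (r c).map (mapConst Sum.inl)) a

/-- The declaration `c* : r_E(A) m_E(c) [= r_E(t)]` for `c : A [= t]`, if `r_E` is defined for `A`
(and for `t`). -/
def starDecl (mE : N ⊕ L → Exp (N' ⊕ (L ⊕ L))) (rE : N ⊕ L → Option (Exp (N' ⊕ (L ⊕ L))))
    (d : Decl L (N ⊕ L)) : Option (Decl (L ⊕ L) (N' ⊕ (L ⊕ L))) :=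
  match rel mE rE [] d.type, d.defn with
  | some RA, none => some ⟨Sum.inr d.name, betaApp RA (mE (Sum.inr d.name)), none⟩
  | some RA, some t => (rel mE rE [] t).map fun Rt =>
      ⟨Sum.inr d.name, betaApp RA (mE (Sum.inr d.name)), some Rt⟩
  | none, _ => none

variable [DecidableEq L] (m : N → Exp N') (r : N → Option (Exp N')) (P : L → Finset ℕ)

/-- The morphism `m_E` from a theory `E` to its translation; `E'` are the declarations of the
pushout. -/
def softMor (E' : List (Decl L (N' ⊕ L))) : N ⊕ L → Exp (N' ⊕ (L ⊕ L)) :=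
  Sum.elim (fun c => (m c).mapConst Sum.inl) (fun c => (eraser P E' c).mapConst plain)

/-- The local part of the relation `r_E`: it maps `c` to `c*` if that is declared. -/
def localRel : List (Decl L (N ⊕ L)) → List (Decl L (N' ⊕ L)) → L → Option (Exp (N' ⊕ (L ⊕ L)))
  | d :: E, d' :: E', c =>
    if c = d.name then
      (starDecl (softMor m P (d' :: E')) (extendRel r (localRel E E')) d).map
        fun s => const (Sum.inr s.name)
    else localRel E E' c
  | _, _, _ => none

/-- The logical relation `r_E`. -/
def softRel (E : List (Decl L (N ⊕ L))) (E' : List (Decl L (N' ⊕ L))) :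
    N ⊕ L → Option (Exp (N' ⊕ (L ⊕ L))) := extendRel r (localRel m r P E E')

/-- The local declarations of the translation of `E`: those of the pushout `E'` without the
positions in `P`, each one followed by the starred one, if any. -/
def softDecls : List (Decl L (N ⊕ L)) → List (Decl L (N' ⊕ L)) →
    List (Decl (L ⊕ L) (N' ⊕ (L ⊕ L)))
  | d :: E, d' :: E' =>
    let c := cleanDecl P E' d'
    (starDecl (softMor m P (d' :: E')) (softRel m r P E E') d).toList ++
      ⟨Sum.inl c.name, c.type.mapConst plain, c.defn.map (mapConst plain)⟩ :: softDecls E E'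
  | _, _ => []

end Operator

/-- A heuristic for a diagram `D` of theories that include `S`: the positions to remove from the
pushout of the diagram along `m`, together with a presentation of that pushout, up to definitional
equality, in which the bindings are explicit and in which the positions are unused. -/
structure Heuristic {S T : Thy.{u}} {L : Type u} [DecidableEq L] (m : RawHom S T)
    {J : Type v} [Category.{w} J] (D : J ⥤ ThyOver S L) where
  /-- The positions to remove. -/
  pos : J → L → Finset ℕ
  /-- The local declarations of the pushout of `D.obj j`. -/
  decls : J → List (Decl L (T.Con ⊕ L))
  decls_wf : ∀ j, WF (full T.decls (decls j))
  isPushout : ∀ j, IsPushout T.decls m.toFun (D.obj j).decls (decls j)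
  unused : ∀ j, Unused (pos j) (decls j)
  /-- The assignments to local constants of the pushout of `D.map f`. -/
  arr : ∀ {i j : J}, (i ⟶ j) → L → Exp (T.Con ⊕ L)
  arr_isMorphism : ∀ {i j : J} (f : i ⟶ j),
    IsMorphism (full T.decls (decls i)) (full T.decls (decls j)) (fix (arr f))
  arr_conv : ∀ {i j : J} (f : i ⟶ j), ∀ d ∈ (D.obj i).decls,
    Conv (full T.decls (decls j)) ((ThyOver.assign (D.map f) d.name).bind (push L m.toFun))
      (arr f d.name)
  arr_unused : ∀ {i j : J} (f : i ⟶ j), ∀ d ∈ (D.obj i).decls,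
    UnusedBinders (pos i d.name) 0 (arity (pos i d.name))
      (eraseArgs (fix (eraser (pos j) (decls j))) (arr f d.name))

namespace Heuristic

variable {S T : Thy.{u}} {L : Type u} [DecidableEq L] {m : RawHom S T}
  {J : Type v} [Category.{w} J] {D : J ⥤ ThyOver S L} (H : Heuristic m D)
  (r : S.Con → Option (Exp T.Con))

/-- The local declarations of `LR(E)` for `E = D.obj j`. -/
def lrDecls (j : J) : List (Decl (L ⊕ L) (T.Con ⊕ (L ⊕ L))) :=
  softDecls m.toFun r (H.pos j) (D.obj j).decls (H.decls j)

/-- The morphism `m_E` for `E = D.obj j`. -/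
def mor (j : J) : S.Con ⊕ L → Exp (T.Con ⊕ (L ⊕ L)) := softMor m.toFun (H.pos j) (H.decls j)

/-- The logical relation `r_E` for `E = D.obj j`. -/
def logRel (j : J) : S.Con ⊕ L → Option (Exp (T.Con ⊕ (L ⊕ L))) :=
  softRel m.toFun r (H.pos j) (D.obj j).decls (H.decls j)

/-- The morphism `LR(f) : LR(E) → LR(E')` for a morphism `f : E → E'` of the diagram: it maps `c`
to the image of `c` in the pushout of `f`, with positions removed, and `c*` to `r_E'(f(c))`. -/
noncomputable def lrMap {i j : J} (f : i ⟶ j) : T.Con ⊕ (L ⊕ L) → Exp (T.Con ⊕ (L ⊕ L)) :=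
  fix (Sum.elim
    (fun c => (dropBinders (H.pos i c) 0 (arity (H.pos i c))
      (eraseArgs (fix (eraser (H.pos j) (H.decls j))) (H.arr f c))).mapConst plain)
    (fun c => (rel (H.mor j) (H.logRel r j) [] (ThyOver.assign (D.map f) c)).getD type))

/-- Every morphism `f : E → E'` of the diagram maps the primitive type-level constants of `E` to
expressions for which `r_E'` is defined. -/
def StarsDefined : Prop :=
  ∀ {i j : J} (f : i ⟶ j), ∀ d ∈ (D.obj i).decls, d.defn = none →
    HasType (D.obj i).thy.decls [] d.type kind →
    (rel (H.mor j) (H.logRel r j) [] (ThyOver.assign (D.map f) d.name)).isSome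

end Heuristic

end LF

open LF

namespace LF

open Exp

variable {N N' : Type u}

/-! ### Substitution calculus -/

/-! The engine is the basic lemma `RelData.basic`: if t : A is well-typed and r is defined for t,
then r is defined for A, and r(t) has type r(A) m(t). Granted this, the claim about theories is an
induction on the local declarations: the type and the definition of each c* are built from values of
the relation at expressions over earlier constants, hence they are well-typed, and sending c to c*
extends the logical relation (`SoftData.cons`). Term-totality persists because the relation is
defined for an object exactly when it is defined for its type.

The obstacle is the conversion rule, which requires r(A) ≡ r(B) whenever A ≡ B. Conversion is
untyped, so the expressions between A and B may be ill-typed, while the number of arguments that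
`rel` produces depends on whether it is defined for the domains. Two devices overcome this. Shapes
forget the dependency on terms and record in a bit whether the relation is defined at the target of
a type; for well-typed expressions, definedness can be read off the shape (`RelBits.isSome_rel`).
The doubled translation `dbl` gives a second copy to every variable and every argument. It is total,
and invariant under reduction of raw expressions (`dbl_par`). The Kripke relation `Sim`, with
reification and reflection (`Sim.reify_reflect`), recovers `rel` from `dbl` on well-typed
expressions (`DblData.sim_rel`), and `RelData.rel_conv` follows.

Underneath lies the metatheory of LF: confluence of βηδ-reduction, for expressions whose
abstractions have had their domains erased, and its consequence that Π is injective up to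
conversion. Shapes take the place of normalization where a type is to be converted to a Π-type
(`HasType.exists_pi`), which strengthening needs.

Removing argument positions is itself a morphism from the pushout to the cleaned pushout
(`EraserData.of_wf`), so that m_E is a composite of morphisms. The operations `dropBinders` and
`keepTele` are inverse to each other up to conversion where the positions are unused.

For a morphism f : E → E', one induction (`soft_arr`) shows that LR(f) is a morphism and that
applying it after r_E agrees with applying r_E' after f. The image r_E'(f(c)) of c* is typed by the
basic lemma over E'. It exists for objects by term-totality and for defined constants because of
their definitions; only primitive type families need the extra hypothesis. Finally, a morphism out
of LR(E) that fixes T is determined by its composites with m_E and r_E (`soft_ext`). Hence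
preservation of identities and composition follows from the functoriality of D, and naturality is
the square `mor_lrFun`. -/

theorem rename_rename (t : Exp N) : ∀ (ρ ρ' : ℕ → ℕ),
    (t.rename ρ).rename ρ' = t.rename fun i => ρ' (ρ i) := by
  have hup : ∀ ρ ρ' : ℕ → ℕ, (fun i => upr ρ' (upr ρ i)) = upr fun i => ρ' (ρ i) := by
    intro ρ ρ'; funext i; cases i <;> rfl
  induction t <;> simp_all [rename]

theorem rename_subst (t : Exp N) : ∀ (ρ : ℕ → ℕ) (σ : ℕ → Exp N),
    (t.rename ρ).subst σ = t.subst fun i => σ (ρ i) := by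
  have hup : ∀ (ρ : ℕ → ℕ) (σ : ℕ → Exp N), (fun i => ups σ (upr ρ i)) = ups fun i => σ (ρ i) := by
    intro ρ σ; funext i; cases i <;> rfl
  induction t <;> simp_all [rename, subst]

theorem subst_rename (t : Exp N) : ∀ (σ : ℕ → Exp N) (ρ : ℕ → ℕ),
    (t.subst σ).rename ρ = t.subst fun i => (σ i).rename ρ := by
  have hup : ∀ (σ : ℕ → Exp N) (ρ : ℕ → ℕ),
      (fun i => (ups σ i).rename (upr ρ)) = ups fun i => (σ i).rename ρ := by
    intro σ ρ; funext i
    cases i with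
    | zero => rfl
    | succ i => simp only [ups, rename_rename]; rfl
  induction t <;> simp_all [rename, subst]

theorem ups_subst (σ τ : ℕ → Exp N) :
    (fun i => (ups σ i).subst (ups τ)) = ups fun i => (σ i).subst τ := by
  funext i
  cases i with
  | zero => rfl
  | succ i => simp only [ups, rename_subst, subst_rename]

theorem subst_subst (t : Exp N) : ∀ (σ τ : ℕ → Exp N),
    (t.subst σ).subst τ = t.subst fun i => (σ i).subst τ := by
  induction t <;> simp_all [subst, ups_subst]

theorem ups_var_comp (ρ : ℕ → ℕ) : (ups fun i => (var (ρ i) : Exp N)) = fun i => var (upr ρ i) := by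
  funext i; cases i <;> rfl

theorem rename_eq_subst (t : Exp N) : ∀ ρ : ℕ → ℕ, t.rename ρ = t.subst fun i => var (ρ i) := by
  induction t <;> simp_all [rename, subst, ups_var_comp]

theorem inst_rename (t s : Exp N) (ρ : ℕ → ℕ) :
    (t.inst s).rename ρ = (t.rename (upr ρ)).inst (s.rename ρ) := by
  simp only [inst, subst_rename, rename_subst]
  congr 1; funext i; cases i <;> rfl

theorem lift_inst (t s : Exp N) : t.lift.inst s = t := by
  simp only [inst, lift, rename_subst]
  exact subst_var t

theorem inst_subst (t s : Exp N) (σ : ℕ → Exp N) :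
    (t.inst s).subst σ = (t.subst (ups σ)).inst (s.subst σ) := by
  simp only [inst, subst_subst]
  congr 1; funext i
  cases i with
  | zero => rfl
  | succ i => exact (lift_inst (σ i) _).symm

theorem lift_subst_ups (t : Exp N) (σ : ℕ → Exp N) : t.lift.subst (ups σ) = (t.subst σ).lift := by
  simp only [lift, rename_subst, subst_rename]; rfl

theorem lift_rename_upr (t : Exp N) (ρ : ℕ → ℕ) : t.lift.rename (upr ρ) = (t.rename ρ).lift := by
  simp only [lift, rename_rename]; rfl

/-- The β-contraction that occurs whenever a weakened abstraction is applied to the fresh variable.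
-/
theorem rename_upr_succ_inst (t : Exp N) : (t.rename (upr Nat.succ)).inst (var 0) = t := by
  simp only [inst, rename_subst]
  conv_rhs => rw [← subst_var t]
  congr 1; funext i; cases i <;> rfl

theorem rename_leftInverse {ρ ρ' : ℕ → ℕ} (h : ∀ i, ρ' (ρ i) = i) (t : Exp N) :
    (t.rename ρ).rename ρ' = t := by
  rw [rename_rename]
  exact (rename_congr t fun i _ => h i).trans (rename_id t)

theorem lift_injective {s t : Exp N} (h : s.lift = t.lift) : s = t := by
  rw [← rename_leftInverse (ρ := Nat.succ) (ρ' := Nat.pred) (fun _ => rfl) s,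
    ← rename_leftInverse (ρ := Nat.succ) (ρ' := Nat.pred) (fun _ => rfl) t]
  exact congrArg _ h

theorem occurs_rename (t : Exp N) : ∀ (ρ : ℕ → ℕ) (j : ℕ),
    (t.rename ρ).Occurs j ↔ ∃ i, t.Occurs i ∧ ρ i = j := by
  have hup : ∀ (t : Exp N) (ρ : ℕ → ℕ) (j : ℕ), (∃ i, t.Occurs i ∧ upr ρ i = j + 1) ↔
      ∃ i, t.Occurs (i + 1) ∧ ρ i = j := by
    intro t ρ j
    constructor
    · rintro ⟨_ | i, hi, h⟩
      · exact absurd h (by simp [upr])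
      · exact ⟨i, hi, by simpa [upr] using h⟩
    · rintro ⟨i, hi, h⟩; exact ⟨i + 1, hi, by simp [upr, h]⟩
  induction t with
  | const c => simp [rename, Occurs]
  | var i => intro ρ j; simp only [rename, Occurs]; constructor
             · intro h; exact ⟨i, rfl, h.symm⟩
             · rintro ⟨_, rfl, h⟩; exact h.symm
  | type => simp [rename, Occurs]
  | kind => simp [rename, Occurs]
  | lam A t ihA iht | pi A t ihA iht =>
    intro ρ j; simp only [rename, Occurs, ihA, iht, hup, or_and_right, exists_or]
  | app f t ihf iht => intro ρ j; simp only [rename, Occurs, ihf, iht, or_and_right, exists_or]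

theorem occurs_subst (t : Exp N) : ∀ (σ : ℕ → Exp N) (j : ℕ),
    (t.subst σ).Occurs j → ∃ i, t.Occurs i ∧ (σ i).Occurs j := by
  have hup : ∀ (t : Exp N) (σ : ℕ → Exp N) (j : ℕ), (∃ i, t.Occurs i ∧ (ups σ i).Occurs (j + 1)) →
      ∃ i, t.Occurs (i + 1) ∧ (σ i).Occurs j := by
    rintro t σ j ⟨_ | i, hi, h⟩
    · exact absurd h (by simp [ups, Occurs])
    · obtain ⟨k, hk, hk'⟩ := (occurs_rename _ _ _).1 h
      exact ⟨i, hi, by obtain rfl := Nat.succ_injective hk'; exact hk⟩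
  induction t with
  | const c => intro σ j h; exact h.elim
  | var i => intro σ j h; exact ⟨i, rfl, h⟩
  | type => intro σ j h; exact h.elim
  | kind => intro σ j h; exact h.elim
  | lam A t ihA iht | pi A t ihA iht =>
    rintro σ j (h | h)
    · obtain ⟨i, hi, h⟩ := ihA _ _ h; exact ⟨i, Or.inl hi, h⟩
    · obtain ⟨i, hi, h⟩ := hup _ _ _ (iht _ _ h); exact ⟨i, Or.inr hi, h⟩
  | app f t ihf iht =>
    rintro σ j (h | h)
    · obtain ⟨i, hi, h⟩ := ihf _ _ h; exact ⟨i, Or.inl hi, h⟩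
    · obtain ⟨i, hi, h⟩ := iht _ _ h; exact ⟨i, Or.inr hi, h⟩

theorem occurs_inst {t s : Exp N} {j : ℕ} (h : (t.inst s).Occurs j) :
    t.Occurs (j + 1) ∨ s.Occurs j := by
  obtain ⟨_ | i, hi, h⟩ := occurs_subst _ _ _ h
  · exact Or.inr h
  · obtain rfl : j = i := h
    exact Or.inl hi

theorem not_occurs_lift (t : Exp N) : ¬ t.lift.Occurs 0 := by
  intro h
  obtain ⟨i, _, h⟩ := (occurs_rename _ _ _).1 h
  exact Nat.succ_ne_zero _ h

theorem occurs_lift {t : Exp N} {i : ℕ} : t.lift.Occurs (i + 1) ↔ t.Occurs i := by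
  rw [lift, occurs_rename]
  constructor
  · rintro ⟨j, hj, h⟩; obtain rfl := Nat.succ_injective h; exact hj
  · intro h; exact ⟨i, h, rfl⟩

theorem lift_rename_pred {t : Exp N} (h : ¬ t.Occurs 0) : (t.rename Nat.pred).lift = t := by
  rw [lift, rename_rename]
  refine (rename_congr t fun i hi => ?_).trans (rename_id t)
  cases i with
  | zero => exact absurd hi h
  | succ i => rfl

/-- Renaming never creates an abstraction, so it commutes with contraction unconditionally;
substitution does so only under the hypothesis of `betaApp_subst`. -/
theorem betaApp_rename (f s : Exp N) (ρ : ℕ → ℕ) :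
    (betaApp f s).rename ρ = betaApp (f.rename ρ) (s.rename ρ) := by
  cases f <;> first | rfl | exact inst_rename _ _ _

/-! ### Constants -/

/-- The constants that occur in an expression satisfy `P`. -/
def Consts (P : N → Prop) : Exp N → Prop
  | const c => P c
  | var _ => True
  | type => True
  | kind => True
  | lam A t => Consts P A ∧ Consts P t
  | pi A B => Consts P A ∧ Consts P B
  | app f t => Consts P f ∧ Consts P t

theorem Consts.mono {P Q : N → Prop} (h : ∀ c, P c → Q c) {t : Exp N} (ht : Consts P t) :
    Consts Q t := by
  induction t <;> simp_all [Consts]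

theorem bind_congr {P : N → Prop} {m m' : N → Exp N'} (h : ∀ c, P c → m c = m' c) {t : Exp N}
    (ht : Consts P t) : t.bind m = t.bind m' := by
  induction t <;> simp_all [Consts, Exp.bind]

/-- The constant `c` is declared. -/
def Declared (Th : List (Decl N N)) (c : N) : Prop := ∃ d ∈ Th, d.name = c

/-! ### Conversion -/

/-- Names are unique, and types and definitions are closed. -/
structure Sane (Th : List (Decl N N)) : Prop where
  eq : ∀ d ∈ Th, ∀ e ∈ Th, d.name = e.name → d = e
  type_closed : ∀ d ∈ Th, d.type.Closed
  defn_closed : ∀ d ∈ Th, ∀ t, d.defn = some t → t.Closed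

theorem Conv.of_step {Th : List (Decl N N)} {a b : Exp N} (h : Step Th a b) : Conv Th a b :=
  Relation.EqvGen.rel _ _ h

theorem Conv.of_eq {Th : List (Decl N N)} {a b : Exp N} (h : a = b) : Conv Th a b :=
  h ▸ Conv.refl _ _

theorem Step.mono {Th Th' : List (Decl N N)} (h : ∀ d ∈ Th, d ∈ Th') {a b : Exp N}
    (s : Step Th a b) : Step Th' a b := by
  induction s with
  | beta A t s => exact .beta A t s
  | eta A f => exact .eta A f
  | delta d t hd ht => exact .delta d t (h d hd) ht
  | lam_left t _ ih => exact .lam_left t ih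
  | lam_right A _ ih => exact .lam_right A ih
  | pi_left t _ ih => exact .pi_left t ih
  | pi_right A _ ih => exact .pi_right A ih
  | app_left t _ ih => exact .app_left t ih
  | app_right f _ ih => exact .app_right f ih

theorem Conv.mono {Th Th' : List (Decl N N)} (h : ∀ d ∈ Th, d ∈ Th') {a b : Exp N}
    (hc : Conv Th a b) : Conv Th' a b :=
  Conv.congr (F := fun x => x) (fun _ _ s => .of_step (s.mono h)) hc

theorem HasType.mono {Th Th' : List (Decl N N)} (h : ∀ d ∈ Th, d ∈ Th') {Γ : List (Exp N)}
    {t A : Exp N} (ht : HasType Th Γ t A) : HasType Th' Γ t A := by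
  induction ht with
  | type Γ => exact .type _
  | const Γ d hd => exact .const _ d (h d hd)
  | var Γ i A hA => exact .var _ i A hA
  | pi _ hs _ ih1 ih2 => exact .pi ih1 hs ih2
  | lam _ hs _ _ ih1 ih2 ih3 => exact .lam ih1 hs ih2 ih3
  | app _ _ ih1 ih2 => exact .app ih1 ih2
  | conv _ hs _ hc ih1 ih2 => exact .conv ih1 hs ih2 (hc.mono h)

theorem Step.subst {Th : List (Decl N N)} (hT : Sane Th) {a b : Exp N} (s : Step Th a b) :
    ∀ σ, Step Th (a.subst σ) (b.subst σ) := by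
  induction s with
  | beta A t s => intro σ; rw [inst_subst]; exact .beta _ _ _
  | eta A f =>
    intro σ
    have : (Exp.lam A (Exp.app f.lift (Exp.var 0))).subst σ =
        Exp.lam (A.subst σ) (Exp.app (f.subst σ).lift (Exp.var 0)) := by
      simp only [Exp.subst, lift_subst_ups]; rfl
    rw [this]; exact .eta _ _
  | delta d t hd ht =>
    intro σ; rw [(hT.defn_closed d hd t ht).subst_eq]; exact .delta d t hd ht
  | lam_left t _ ih => intro σ; exact .lam_left _ (ih _)
  | lam_right A _ ih => intro σ; exact .lam_right _ (ih _)
  | pi_left t _ ih => intro σ; exact .pi_left _ (ih _)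
  | pi_right A _ ih => intro σ; exact .pi_right _ (ih _)
  | app_left t _ ih => intro σ; exact .app_left _ (ih _)
  | app_right f _ ih => intro σ; exact .app_right _ (ih _)

theorem Conv.subst {Th : List (Decl N N)} (hT : Sane Th) {a b : Exp N} (h : Conv Th a b)
    (σ : ℕ → Exp N) : Conv Th (a.subst σ) (b.subst σ) :=
  Conv.congr (F := Exp.subst σ) (fun _ _ s => .of_step (s.subst hT σ)) h

theorem Conv.rename {Th : List (Decl N N)} (hT : Sane Th) {a b : Exp N} (h : Conv Th a b)
    (ρ : ℕ → ℕ) : Conv Th (a.rename ρ) (b.rename ρ) := by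
  simp only [rename_eq_subst]; exact h.subst hT _

theorem Conv.of_rename {Th : List (Decl N N)} (hT : Sane Th) {ρ ρ' : ℕ → ℕ}
    (hρ : ∀ i, ρ' (ρ i) = i) {a b : Exp N} (h : Conv Th (a.rename ρ) (b.rename ρ)) :
    Conv Th a b := by
  simpa only [rename_leftInverse hρ] using h.rename hT ρ'

theorem Conv.lift {Th : List (Decl N N)} (hT : Sane Th) {a b : Exp N} (h : Conv Th a b) :
    Conv Th a.lift b.lift := h.rename hT _

theorem Conv.subst_right {Th : List (Decl N N)} (hT : Sane Th) (t : Exp N) :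
    ∀ {σ τ : ℕ → Exp N}, (∀ i, Conv Th (σ i) (τ i)) → Conv Th (t.subst σ) (t.subst τ) := by
  have hup : ∀ {σ τ : ℕ → Exp N}, (∀ i, Conv Th (σ i) (τ i)) →
      ∀ i, Conv Th (ups σ i) (ups τ i) := by
    rintro σ τ h (_ | i)
    · exact Conv.refl _ _
    · exact (h i).rename hT _
  induction t with
  | const c => intro σ τ _; exact Conv.refl _ _
  | var i => intro σ τ h; exact h i
  | type => intro σ τ _; exact Conv.refl _ _
  | kind => intro σ τ _; exact Conv.refl _ _
  | lam A t ihA iht => intro σ τ h; exact Conv.lam (ihA h) (iht (hup h))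
  | pi A t ihA iht => intro σ τ h; exact Conv.pi (ihA h) (iht (hup h))
  | app f t ihf iht => intro σ τ h; exact Conv.app (ihf h) (iht h)

theorem Conv.substs {Th : List (Decl N N)} (hT : Sane Th) {a b : Exp N} (h : Conv Th a b)
    {σ τ : ℕ → Exp N} (hστ : ∀ i, Conv Th (σ i) (τ i)) : Conv Th (a.subst σ) (b.subst τ) :=
  (h.subst hT σ).trans (Conv.subst_right hT b hστ)

theorem Conv.inst {Th : List (Decl N N)} (hT : Sane Th) {a b s t : Exp N} (h : Conv Th a b)
    (h' : Conv Th s t) : Conv Th (a.inst s) (b.inst t) := by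
  refine h.substs hT ?_
  rintro (_ | i)
  · exact h'
  · exact Conv.refl _ _

theorem Conv.beta {Th : List (Decl N N)} (A t s : Exp N) :
    Conv Th (Exp.app (Exp.lam A t) s) (t.inst s) :=
  .of_step (.beta A t s)

theorem Conv.eta {Th : List (Decl N N)} (A f : Exp N) :
    Conv Th (Exp.lam A (Exp.app f.lift (Exp.var 0))) f :=
  .of_step (.eta A f)

theorem Conv.betaApp {Th : List (Decl N N)} (f s : Exp N) :
    Conv Th (betaApp f s) (Exp.app f s) := by
  cases f <;> first | exact Conv.refl _ _ | exact (Conv.beta _ _ _).symm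

theorem Conv.betaApp_congr {Th : List (Decl N N)} {f f' s s' : Exp N} (h : Conv Th f f')
    (h' : Conv Th s s') : Conv Th (Exp.betaApp f s) (Exp.betaApp f' s') :=
  (Conv.betaApp _ _).trans ((Conv.app h h').trans (Conv.betaApp _ _).symm)

/-- The domains of `λ`-abstractions are irrelevant for conversion. -/
theorem Conv.lam_dom {Th : List (Decl N N)} (A A' t : Exp N) :
    Conv Th (Exp.lam A t) (Exp.lam A' t) := by
  -- The middle expression reduces to both sides: by β in its body and by η at its root.
  refine Conv.trans (b := Exp.lam A (Exp.app (Exp.lam A' t).lift (Exp.var 0))) ?_ (Conv.eta _ _)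
  refine Conv.lam (Conv.refl _ _) (Conv.symm ?_)
  refine (Conv.beta _ _ _).trans (.of_eq ?_)
  exact rename_upr_succ_inst t

theorem Conv.lam_body {Th : List (Decl N N)} (A A' : Exp N) {t t' : Exp N} (h : Conv Th t t') :
    Conv Th (Exp.lam A t) (Exp.lam A' t') :=
  (Conv.lam (Conv.refl _ A) h).trans (Conv.lam_dom _ _ _)

/-- Weaken both abstractions, apply them to the fresh variable and contract. -/
theorem Conv.of_lam {Th : List (Decl N N)} (hT : Sane Th) {A A' t t' : Exp N}
    (h : Conv Th (Exp.lam A t) (Exp.lam A' t')) : Conv Th t t' := by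
  have h' := Conv.app (h.lift hT) (Conv.refl Th (Exp.var 0))
  have key : ∀ A t : Exp N, Conv Th (Exp.app (Exp.lam A t).lift (Exp.var 0)) t := fun A t =>
    (Conv.beta _ _ _).trans (.of_eq (rename_upr_succ_inst t))
  exact (key A t).symm.trans (h'.trans (key A' t'))

/-- Replace the domains of all `λ`-abstractions by `type`. -/
def er : Exp N → Exp N
  | const c => const c
  | var i => var i
  | type => type
  | kind => kind
  | lam _ t => lam type (er t)
  | pi A B => pi (er A) (er B)
  | app f t => app (er f) (er t)

/-- Erasure stays within the class of convertible expressions, so it suffices to prove confluence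
for erased ones. With domains, λx:A.(λy:B.t)x reduces to λx:A.t and to λy:B.t, and for raw
expressions A and B need not have a common reduct. -/
theorem Conv.er {Th : List (Decl N N)} (t : Exp N) : Conv Th (er t) t := by
  induction t with
  | const c => exact Conv.refl _ _
  | var i => exact Conv.refl _ _
  | type => exact Conv.refl _ _
  | kind => exact Conv.refl _ _
  | lam A t _ ih => exact Conv.lam_body _ _ ih
  | pi A B ih1 ih2 => exact Conv.pi ih1 ih2
  | app A B ih1 ih2 => exact Conv.app ih1 ih2

theorem er_rename (t : Exp N) : ∀ ρ, er (t.rename ρ) = (er t).rename ρ := by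
  induction t <;> simp_all [er, rename]

theorem er_subst (t : Exp N) : ∀ σ, er (t.subst σ) = (er t).subst fun i => er (σ i) := by
  have hup : ∀ σ : ℕ → Exp N, (fun i => er (ups σ i)) = ups fun i => er (σ i) := by
    intro σ; funext i
    cases i with
    | zero => rfl
    | succ i => exact er_rename _ _
  induction t <;> simp_all [er, subst]

theorem er_inst (t s : Exp N) : er (t.inst s) = (er t).inst (er s) := by
  rw [inst, er_subst, inst]
  congr 1; funext i; cases i <;> rfl

theorem er_occurs {t : Exp N} : ∀ {i}, (er t).Occurs i → t.Occurs i := by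
  induction t with
  | lam A t _ ih => rintro i (h | h); exacts [h.elim, Or.inr (ih h)]
  | pi A B ihA ihB | app A B ihA ihB => rintro i (h | h); exacts [Or.inl (ihA h), Or.inr (ihB h)]
  | _ => exact id

/-! ### Confluence -/

/-- The number of constructors. -/
def size : Exp N → ℕ
  | const _ => 1
  | var _ => 1
  | type => 1
  | kind => 1
  | lam A t => size A + size t + 1
  | pi A B => size A + size B + 1
  | app f t => size f + size t + 1

theorem size_rename (t : Exp N) : ∀ ρ, size (t.rename ρ) = size t := by
  induction t <;> simp_all [size, rename]

/-- Parallel `βηδ`-reduction of expressions in which all `λ`-abstractions have domain `type`. -/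
inductive Par (Th : List (Decl N N)) : Exp N → Exp N → Prop
  | const (c : N) : Par Th (const c) (const c)
  | var (i : ℕ) : Par Th (var i) (var i)
  | type : Par Th type type
  | kind : Par Th kind kind
  | lam {t t' : Exp N} : Par Th t t' → Par Th (lam type t) (lam type t')
  | pi {A A' B B' : Exp N} : Par Th A A' → Par Th B B' → Par Th (pi A B) (pi A' B')
  | app {f f' t t' : Exp N} : Par Th f f' → Par Th t t' → Par Th (app f t) (app f' t')
  | beta {t t' s s' : Exp N} : Par Th t t' → Par Th s s' →
      Par Th (app (lam type t) s) (t'.inst s')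
  | eta {f f' : Exp N} : Par Th f f' → Par Th (lam type (app f.lift (var 0))) f'
  | delta (d : Decl N N) (t : Exp N) : d ∈ Th → d.defn = some t → Par Th (const d.name) (er t)

namespace Par

variable {Th : List (Decl N N)}

/-- Reflexivity is available only for erased expressions, since `Par.lam` asks for the domain
`type`. -/
theorem er_refl (t : Exp N) : Par Th (er t) (er t) := by
  induction t with
  | const c => exact .const c
  | var i => exact .var i
  | type => exact .type
  | kind => exact .kind
  | lam A t _ ih => exact .lam ih
  | pi A B ih1 ih2 => exact .pi ih1 ih2
  | app A B ih1 ih2 => exact .app ih1 ih2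

theorem conv {a b : Exp N} (h : Par Th a b) : Conv Th a b := by
  induction h with
  | const c => exact Conv.refl _ _
  | var i => exact Conv.refl _ _
  | type => exact Conv.refl _ _
  | kind => exact Conv.refl _ _
  | lam _ ih => exact Conv.lam (Conv.refl _ _) ih
  | pi _ _ ih1 ih2 => exact Conv.pi ih1 ih2
  | app _ _ ih1 ih2 => exact Conv.app ih1 ih2
  | beta _ _ ih1 ih2 =>
    exact (Conv.app (Conv.lam (Conv.refl _ _) ih1) ih2).trans (Conv.beta _ _ _)
  | eta _ ih => exact (Conv.eta _ _).trans ih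
  | delta d t hd ht => exact (Conv.of_step (.delta d t hd ht)).trans (Conv.er t).symm

theorem rename (hT : Sane Th) {a b : Exp N} (h : Par Th a b) :
    ∀ ρ, Par Th (a.rename ρ) (b.rename ρ) := by
  induction h with
  | const c => intro ρ; exact .const c
  | var i => intro ρ; exact .var _
  | type => intro ρ; exact .type
  | kind => intro ρ; exact .kind
  | lam _ ih => intro ρ; exact .lam (ih _)
  | pi _ _ ih1 ih2 => intro ρ; exact .pi (ih1 _) (ih2 _)
  | app _ _ ih1 ih2 => intro ρ; exact .app (ih1 _) (ih2 _)
  | beta _ _ ih1 ih2 => intro ρ; rw [inst_rename]; exact .beta (ih1 _) (ih2 _)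
  | @eta f f' _ ih =>
    intro ρ
    have := Par.eta (ih ρ)
    rwa [← lift_rename_upr] at this
  | delta d t hd ht =>
    intro ρ
    rw [← er_rename, (hT.defn_closed d hd t ht).rename_eq]
    exact .delta d t hd ht

theorem ups_par (hT : Sane Th) {σ τ : ℕ → Exp N} (h : ∀ i, Par Th (σ i) (τ i)) :
    ∀ i, Par Th (ups σ i) (ups τ i)
  | 0 => .var 0
  | i + 1 => (h i).rename hT _

theorem subst (hT : Sane Th) {a b : Exp N} (h : Par Th a b) :
    ∀ {σ τ : ℕ → Exp N}, (∀ i, Par Th (σ i) (τ i)) → Par Th (a.subst σ) (b.subst τ) := by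
  induction h with
  | const c => intro σ τ h; exact .const c
  | var i => intro σ τ h; exact h i
  | type => intro σ τ h; exact .type
  | kind => intro σ τ h; exact .kind
  | lam _ ih => intro σ τ h; exact .lam (ih (ups_par hT h))
  | pi _ _ ih1 ih2 => intro σ τ h; exact .pi (ih1 h) (ih2 (ups_par hT h))
  | app _ _ ih1 ih2 => intro σ τ h; exact .app (ih1 h) (ih2 h)
  | beta _ _ ih1 ih2 => intro σ τ h; rw [inst_subst]; exact .beta (ih1 (ups_par hT h)) (ih2 h)
  | @eta f f' _ ih =>
    intro σ τ h
    have := Par.eta (ih h)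
    rwa [← lift_subst_ups] at this
  | delta d t hd ht =>
    intro σ τ h
    have hc := hT.defn_closed d hd t ht
    rw [Exp.Closed.subst_eq (t := er t) (fun i hi => hc i (er_occurs hi))]
    exact .delta d t hd ht

theorem inst (hT : Sane Th) {t t' s s' : Exp N} (h : Par Th t t') (h' : Par Th s s') :
    Par Th (t.inst s) (t'.inst s') :=
  h.subst hT fun
    | 0 => h'
    | i + 1 => .var i

/-- Definitions being closed, no reduction creates a free variable. Hence a reduct of a weakened
expression is again a weakening, which is `of_lift`. -/
theorem occurs (hT : Sane Th) {a b : Exp N} (h : Par Th a b) :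
    ∀ {i}, b.Occurs i → a.Occurs i := by
  induction h with
  | const c => intro i h; exact h
  | var i => intro i h; exact h
  | type => intro i h; exact h
  | kind => intro i h; exact h
  | lam _ ih => intro i h; exact h.imp id ih
  | pi _ _ ih1 ih2 => intro i h; exact h.imp ih1 ih2
  | app _ _ ih1 ih2 => intro i h; exact h.imp ih1 ih2
  | beta _ _ ih1 ih2 =>
    intro i h
    rcases occurs_inst h with h | h
    · exact Or.inl (Or.inr (ih1 h))
    · exact Or.inr (ih2 h)
  | eta _ ih => intro i h; exact Or.inr (Or.inl (occurs_lift.2 (ih h)))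
  | delta d t hd ht => intro i h; exact (hT.defn_closed d hd t ht i (er_occurs h)).elim

theorem of_lift (hT : Sane Th) {f g : Exp N} (h : Par Th f.lift g) :
    ∃ g', g = g'.lift ∧ Par Th f g' := by
  refine ⟨g.rename Nat.pred,
    (lift_rename_pred fun h0 => not_occurs_lift f (h.occurs hT h0)).symm, ?_⟩
  have := h.rename hT Nat.pred
  rwa [lift, rename_leftInverse (fun _ => rfl)] at this

theorem lift_eq_lam {f A t : Exp N} (h : f.lift = Exp.lam A t) :
    ∃ A' t', f = Exp.lam A' t' ∧ A = A'.lift ∧ t = t'.rename (upr Nat.succ) := by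
  cases f <;> simp [lift, Exp.rename] at h ⊢
  exact ⟨h.1.symm, h.2.symm⟩

theorem const_inv {c : N} {P : Exp N} (h : Par Th (Exp.const c) P) : P = Exp.const c ∨
    ∃ d ∈ Th, d.name = c ∧ ∃ t, d.defn = some t ∧ P = er t := by
  generalize hM : Exp.const c = M at h
  cases h with
  | const c => injection hM with hM; subst hM; exact Or.inl rfl
  | delta d t hd ht => injection hM with hM; exact Or.inr ⟨d, hd, hM.symm, t, ht, rfl⟩
  | _ => cases hM

theorem lam_inv {A t P : Exp N} (h : Par Th (Exp.lam A t) P) :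
    (∃ t', Par Th t t' ∧ P = Exp.lam Exp.type t') ∨
      ∃ f, t = Exp.app f.lift (Exp.var 0) ∧ Par Th f P := by
  generalize hM : Exp.lam A t = M at h
  cases h with
  | lam h => injection hM with _ hM; subst hM; exact Or.inl ⟨_, h, rfl⟩
  | @eta f _ h => injection hM with _ hM; exact Or.inr ⟨f, hM, h⟩
  | _ => cases hM

theorem app_inv {f s P : Exp N} (h : Par Th (Exp.app f s) P) :
    (∃ f' s', Par Th f f' ∧ Par Th s s' ∧ P = Exp.app f' s') ∨
      ∃ t t' s', f = Exp.lam Exp.type t ∧ Par Th t t' ∧ Par Th s s' ∧ P = t'.inst s' := by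
  cases h with
  | app h1 h2 => exact Or.inl ⟨_, _, h1, h2, rfl⟩
  | beta h1 h2 => exact Or.inr ⟨_, _, _, rfl, h1, h2, rfl⟩

/-- Takahashi's method: a single expression is reached from all parallel reducts of M, which gives
the diamond property at once. The induction is on the size because in the η-case the hypothesis is
needed at f, while the structural subterm is `f.lift`. -/
theorem triangle (hT : Sane Th) : ∀ (n : ℕ) (M : Exp N), size M ≤ n → 
    ∃ M', ∀ P, Par Th M P → Par Th P M' := by
  intro n
  induction n with
  | zero => intro M hM; cases M <;> simp [size] at hM
  | succ n ih =>
  intro M hM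
  cases M with
  | const c =>
    by_cases hc : ∃ d ∈ Th, d.name = c ∧ ∃ t, d.defn = some t
    · obtain ⟨d, hd, rfl, t, ht⟩ := hc
      refine ⟨er t, fun P hP => ?_⟩
      rcases const_inv hP with rfl | ⟨e, he, hn, s, hs, rfl⟩
      · exact .delta d t hd ht
      · obtain rfl := hT.eq d hd e he hn.symm
        obtain rfl : t = s := Option.some.inj (ht.symm.trans hs)
        exact er_refl _
    · refine ⟨Exp.const c, fun P hP => ?_⟩
      rcases const_inv hP with rfl | ⟨e, he, hn, s, hs, rfl⟩
      · exact .const c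
      · exact (hc ⟨e, he, hn, s, hs⟩).elim
  | var i => exact ⟨Exp.var i, fun P hP => by cases hP; exact .var i⟩
  | type => exact ⟨Exp.type, fun P hP => by cases hP; exact .type⟩
  | kind => exact ⟨Exp.kind, fun P hP => by cases hP; exact .kind⟩
  | pi A B =>
    simp only [size] at hM
    obtain ⟨A', hA⟩ := ih A (by omega)
    obtain ⟨B', hB⟩ := ih B (by omega)
    refine ⟨Exp.pi A' B', fun P hP => ?_⟩
    cases hP with
    | pi h1 h2 => exact .pi (hA _ h1) (hB _ h2)
  | lam A t =>
    simp only [size] at hM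
    by_cases hη : ∃ f : Exp N, t = Exp.app f.lift (Exp.var 0)
    · obtain ⟨f, rfl⟩ := hη
      simp only [size, lift, size_rename] at hM
      obtain ⟨f', hf⟩ := ih f (by omega)
      refine ⟨f', fun P hP => ?_⟩
      rcases lam_inv hP with ⟨t', h, rfl⟩ | ⟨g, hfg, hg⟩
      · rcases app_inv h with ⟨g, s, hg, hs, rfl⟩ | ⟨u, u', s', h2, h1, hs, rfl⟩
        · cases hs
          obtain ⟨g', rfl, hg'⟩ := of_lift hT hg
          exact .eta (hf _ hg')
        -- β in the body overlaps with η at the root: f is itself an abstraction, and since all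
        -- domains are `type`, the contracted expression is a parallel reduct of f.
        · cases hs
          obtain ⟨A', u0, rfl, _, rfl⟩ := lift_eq_lam h2
          have h3 : Par Th (Exp.lam A' u0).lift (Exp.lam Exp.type u') := by
            rw [h2]; exact .lam h1
          obtain ⟨g', hg, hg'⟩ := of_lift hT h3
          obtain ⟨A'', u0', rfl, hA'', rfl⟩ := lift_eq_lam hg.symm
          have : A'' = Exp.type := by cases A'' <;> simp [lift, Exp.rename] at hA'' ⊢
          subst this
          rw [rename_upr_succ_inst]
          exact hf _ hg'
      · injection hfg with hfg
        obtain rfl := lift_injective hfg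
        exact hf _ hg
    · obtain ⟨t', ht⟩ := ih t (by omega)
      refine ⟨Exp.lam Exp.type t', fun P hP => ?_⟩
      rcases lam_inv hP with ⟨t', h, rfl⟩ | ⟨f, rfl, _⟩
      · exact .lam (ht _ h)
      · exact (hη ⟨f, rfl⟩).elim
  | app f s =>
    simp only [size] at hM
    obtain ⟨s', hs⟩ := ih s (by omega)
    by_cases hβ : ∃ A t, f = Exp.lam A t
    · obtain ⟨A, t, rfl⟩ := hβ
      simp only [size] at hM
      obtain ⟨t', ht⟩ := ih t (by omega)
      refine ⟨t'.inst s', fun P hP => ?_⟩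
      cases hP with
      | beta h1 h2 => exact (ht _ h1).inst hT (hs _ h2)
      | @app _ g _ u hf hu =>
        rcases lam_inv hf with ⟨t', h, rfl⟩ | ⟨f, rfl, hf'⟩
        · exact .beta (ht _ h) (hs _ hu)
        -- η on the function overlaps with β at the root: the body `app f.lift (var 0)` reduces
        -- along f, and instantiating it gives back an application to the argument.
        · have := (ht _ (.app (hf'.rename hT Nat.succ) (.var 0))).inst hT (hs _ hu)
          have h' : (Exp.app (g.rename Nat.succ) (Exp.var 0)).inst u = Exp.app g u := by
            change Exp.app (g.lift.inst u) u = _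
            rw [lift_inst]
          rwa [h'] at this
    · obtain ⟨f', hf⟩ := ih f (by omega)
      refine ⟨Exp.app f' s', fun P hP => ?_⟩
      cases hP with
      | beta h1 h2 => exact (hβ ⟨_, _, rfl⟩).elim
      | app h1 h2 => exact .app (hf _ h1) (hs _ h2)

/-- Iterated parallel reduction. -/
abbrev Star (Th : List (Decl N N)) : Exp N → Exp N → Prop := Relation.ReflTransGen (Par Th)

theorem church_rosser (hT : Sane Th) {a b c : Exp N} (h : Star Th a b) (h' : Star Th a c) :
    ∃ d, Star Th b d ∧ Star Th c d := by
  refine Relation.church_rosser (fun a b c hab hac => ?_) h h'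
  obtain ⟨d, hd⟩ := triangle hT _ a le_rfl
  exact ⟨d, .single (hd _ hab), .single (hd _ hac)⟩

/-- A step inside the domain of an abstraction vanishes under erasure and is simulated by
reflexivity. -/
theorem of_step {a b : Exp N} (h : Step Th a b) : Par Th (er a) (er b) := by
  induction h with
  | beta A t s => rw [er_inst]; exact .beta (er_refl t) (er_refl s)
  | eta A f =>
    have := Par.eta (er_refl (Th := Th) f)
    rwa [lift, ← er_rename] at this
  | delta d t hd ht => exact .delta d t hd ht
  | lam_left t _ ih => exact .lam (er_refl t)
  | lam_right A _ ih => exact .lam ih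
  | pi_left t _ ih => exact .pi ih (er_refl t)
  | pi_right A _ ih => exact .pi (er_refl _) ih
  | app_left t _ ih => exact .app ih (er_refl t)
  | app_right f _ ih => exact .app (er_refl _) ih

end Par

theorem Conv.common_reduct {Th : List (Decl N N)} (hT : Sane Th) {a b : Exp N} (h : Conv Th a b) :
    ∃ c, Par.Star Th (LF.er a) c ∧ Par.Star Th (LF.er b) c := by
  induction h with
  | rel a b h => exact ⟨_, .single (Par.of_step h), .refl⟩
  | refl a => exact ⟨_, .refl, .refl⟩
  | symm a b _ ih => obtain ⟨c, h1, h2⟩ := ih; exact ⟨c, h2, h1⟩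
  | trans a b c _ _ ih ih' =>
    obtain ⟨d, h1, h2⟩ := ih
    obtain ⟨e, h3, h4⟩ := ih'
    obtain ⟨x, h5, h6⟩ := Par.church_rosser hT h2 h3
    exact ⟨x, h1.trans h5, h4.trans h6⟩

theorem Par.Star.conv {Th : List (Decl N N)} {a b : Exp N} (h : Par.Star Th a b) : Conv Th a b := by
  induction h with
  | refl => exact Conv.refl _ _
  | tail _ h ih => exact ih.trans h.conv

theorem Par.Star.of_pi {Th : List (Decl N N)} {A B c : Exp N} (h : Par.Star Th (Exp.pi A B) c) :
    ∃ A' B', c = Exp.pi A' B' ∧ Par.Star Th A A' ∧ Par.Star Th B B' := by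
  induction h with
  | refl => exact ⟨A, B, rfl, .refl, .refl⟩
  | tail _ h ih =>
    obtain ⟨A', B', rfl, h1, h2⟩ := ih
    cases h with
    | pi h3 h4 => exact ⟨_, _, rfl, h1.tail h3, h2.tail h4⟩

/-- Parallel reduction of a Π-expression only reduces its two components, so a common reduct of two
of them splits. Generation and subject reduction rest on this. -/
theorem Conv.pi_injective {Th : List (Decl N N)} (hT : Sane Th) {A A' B B' : Exp N}
    (h : Conv Th (Exp.pi A B) (Exp.pi A' B')) : Conv Th A A' ∧ Conv Th B B' := by
  obtain ⟨c, h1, h2⟩ := h.common_reduct hT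
  obtain ⟨C, D, rfl, h3, h4⟩ := Par.Star.of_pi h1
  obtain ⟨C', D', he, h5, h6⟩ := Par.Star.of_pi h2
  cases he
  exact ⟨(Conv.er A).symm.trans (h3.conv.trans (h5.conv.symm.trans (Conv.er A'))),
    (Conv.er B).symm.trans (h4.conv.trans (h6.conv.symm.trans (Conv.er B')))⟩

/-! ### Well-formed theories -/

theorem HasType.consts {Th : List (Decl N N)} {Γ : List (Exp N)} {t A : Exp N}
    (h : HasType Th Γ t A) : Consts (Declared Th) t := by
  induction h with
  | type Γ => trivial
  | const Γ d hd => exact ⟨d, hd, rfl⟩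
  | var Γ i A hA => trivial
  | pi _ _ _ ih1 ih2 => exact ⟨ih1, ih2⟩
  | lam _ _ _ _ ih1 _ ih3 => exact ⟨ih1, ih3⟩
  | app _ _ ih1 ih2 => exact ⟨ih1, ih2⟩
  | conv _ _ _ _ ih _ => exact ih

theorem HasType.occurs_lt {Th : List (Decl N N)} {Γ : List (Exp N)} {t A : Exp N}
    (h : HasType Th Γ t A) : ∀ {i}, t.Occurs i → i < Γ.length := by
  induction h with
  | type Γ => exact False.elim
  | const Γ d hd => exact False.elim
  | var Γ i A hA => rintro _ rfl; exact (List.getElem?_eq_some_iff.1 hA).1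
  | pi _ _ _ ih1 ih2 => rintro i (h | h); exacts [ih1 h, Nat.lt_of_succ_lt_succ (ih2 h)]
  | lam _ _ _ _ ih1 _ ih3 => rintro i (h | h); exacts [ih1 h, Nat.lt_of_succ_lt_succ (ih3 h)]
  | app _ _ ih1 ih2 => rintro i (h | h); exacts [ih1 h, ih2 h]
  | conv _ _ _ _ ih _ => exact ih

theorem HasType.closed {Th : List (Decl N N)} {t A : Exp N} (h : HasType Th [] t A) : t.Closed :=
  fun _ hi => absurd (h.occurs_lt hi) (Nat.not_lt_zero _)

theorem WF.typed {Th : List (Decl N N)} (h : WF Th) : ∀ d ∈ Th,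
    (∃ s, IsSort s ∧ HasType Th [] d.type s) ∧ ∀ t, d.defn = some t → HasType Th [] t d.type := by
  induction h with
  | nil => intro d hd; cases hd
  | @cons Th d s _ _ hs hty hdef ih =>
    have hm : ∀ e ∈ Th, e ∈ d :: Th := fun e he => List.mem_cons_of_mem _ he
    intro e he
    rcases List.mem_cons.1 he with rfl | he
    · exact ⟨⟨s, hs, hty.mono hm⟩, fun t ht => (hdef t ht).mono hm⟩
    · obtain ⟨⟨s, hs, h1⟩, h2⟩ := ih e he
      exact ⟨⟨s, hs, h1.mono hm⟩, fun t ht => (h2 t ht).mono hm⟩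

theorem WF.sane {Th : List (Decl N N)} (h : WF Th) : Sane Th where
  eq := by
    induction h with
    | nil => intro d hd; cases hd
    | @cons Th d s _ hn _ _ _ ih =>
      intro e he e' he' heq
      rcases List.mem_cons.1 he with h1 | h1 <;> rcases List.mem_cons.1 he' with h2 | h2
      · exact h1.trans h2.symm
      · exact (hn _ h2 (by rw [← heq, h1])).elim
      · exact (hn _ h1 (by rw [heq, h2])).elim
      · exact ih e h1 e' h2 heq
  type_closed := fun d hd => by obtain ⟨⟨s, _, h1⟩, _⟩ := h.typed d hd; exact h1.closed
  defn_closed := fun d hd t ht => ((h.typed d hd).2 t ht).closed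

/-! ### Shapes -/

/-- The shape of a type, in which the dependency on terms is forgotten. A base type carries a bit.
Kinds have shapes that end in `star`, and `box` is the shape of `kind`. -/
inductive Sh
  | base (b : Bool)
  | star
  | box
  | arr (σ τ : Sh)

namespace Sh

/-- The level of a shape: `0` for types, `1` for kinds, `2` for `kind`. -/
def lev : Sh → ℕ
  | base _ => 0
  | star => 1
  | box => 2
  | arr _ τ => lev τ

/-- The bit of the target of a shape. -/
def bit : Sh → Bool
  | base b => b
  | star => true
  | box => true
  | arr _ τ => bit τ

/-- Replace the targets `star` and `box` by a base type. -/
def setStar (b : Bool) : Sh → Sh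
  | base b => base b
  | star => base b
  | box => base b
  | arr σ τ => arr σ (setStar b τ)

end Sh

open Sh

/-- The shape of an expression, given those of the type-level constants. -/
def shape (sh : N → Option Sh) : Exp N → Option Sh
  | const c => sh c
  | var _ => none
  | type => some star
  | kind => some box
  | lam _ t => shape sh t
  | pi A B => (shape sh A).bind fun a => (shape sh B).map (arr a)
  | app f _ => shape sh f

section Shape

variable {sh : N → Option Sh} {Th : List (Decl N N)}

theorem shape_pi {A B : Exp N} {σ : Sh} :
    shape sh (pi A B) = some σ ↔
      ∃ a b, shape sh A = some a ∧ shape sh B = some b ∧ σ = arr a b := by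
  simp only [shape, Option.bind_eq_some_iff, Option.map_eq_some_iff]
  constructor
  · rintro ⟨a, ha, b, hb, rfl⟩; exact ⟨a, b, ha, hb, rfl⟩
  · rintro ⟨a, b, ha, hb, rfl⟩; exact ⟨a, ha, b, hb, rfl⟩

theorem shape_rename (t : Exp N) : ∀ ρ, shape sh (t.rename ρ) = shape sh t := by
  induction t <;> simp_all [shape, rename]

/-- Only existing shapes are preserved: a variable has none, but what is substituted for it may have
one. This is the reason for the side conditions `DomOK` and `BindOK`. -/
theorem shape_subst {t : Exp N} : ∀ {σ : ℕ → Exp N} {a : Sh}, shape sh t = some a →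
    shape sh (t.subst σ) = some a := by
  induction t with
  | const c => intro σ a h; exact h
  | var i => intro σ a h; cases h
  | type => intro σ a h; exact h
  | kind => intro σ a h; exact h
  | lam A t _ ih => intro σ a h; exact ih (σ := ups σ) h
  | pi A B ihA ihB =>
    intro σ a h
    obtain ⟨a, b, ha, hb, rfl⟩ := shape_pi.1 h
    exact shape_pi.2 ⟨a, b, ihA ha, ihB hb, rfl⟩
  | app f t ih _ => intro σ a h; exact ih (σ := σ) h

theorem shape_inst {t s : Exp N} {a : Sh} (h : shape sh t = some a) :
    shape sh (t.inst s) = some a := shape_subst h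

theorem shape_er (t : Exp N) : shape sh (er t) = shape sh t := by
  induction t <;> simp_all [shape, er]

theorem shape_congr {P : N → Prop} {sh' : N → Option Sh} (h : ∀ c, P c → sh c = sh' c) {t : Exp N}
    (ht : Consts P t) : shape sh t = shape sh' t := by
  induction t <;> simp_all [Consts, shape]

/-- The shapes `sh` of the type-level constants fit to the theory; those without definition are
base types with bits given by `p`. -/
structure Shaping (Th : List (Decl N N)) (p : N → Bool) (sh : N → Option Sh) : Prop where
  type : ∀ d ∈ Th, ∃ σ, shape sh d.type = some σ ∧
    (lev σ = 1 ∧ (∃ τ, sh d.name = some τ ∧ lev τ = 0) ∨ lev σ = 0 ∧ sh d.name = none)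
  defn : ∀ d ∈ Th, ∀ t, d.defn = some t → ∀ τ, sh d.name = some τ → shape sh t = some τ
  prim : ∀ d ∈ Th, d.defn = none → ∀ τ, sh d.name = some τ → τ = base (p d.name)

variable {p : N → Bool}

/-- The shape of a family ignores both its arguments and the domains of its abstractions, so
contracting a redex leaves the shape of the body. Unfolding is covered by the field `defn`. -/
theorem Shaping.par (hs : Shaping Th p sh) {a b : Exp N} (h : Par Th a b) :
    ∀ {σ}, shape sh a = some σ → shape sh b = some σ := by
  induction h with
  | const c => exact id
  | var i => exact id
  | type => exact id
  | kind => exact id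
  | lam _ ih => exact ih
  | pi _ _ ih1 ih2 =>
    intro σ h
    obtain ⟨a, b, ha, hb, rfl⟩ := shape_pi.1 h
    exact shape_pi.2 ⟨a, b, ih1 ha, ih2 hb, rfl⟩
  | app _ _ ih _ => exact ih
  | beta _ _ ih _ => intro σ h; exact shape_inst (ih h)
  | eta _ ih => intro σ h; exact ih ((shape_rename _ _).symm.trans h)
  | delta d t hd ht => intro σ h; rw [shape_er]; exact hs.defn d hd t ht σ h

theorem Shaping.star (hs : Shaping Th p sh) {a b : Exp N} (h : Par.Star Th a b) {σ : Sh}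
    (ha : shape sh a = some σ) : shape sh b = some σ := by
  induction h with
  | refl => exact ha
  | tail _ h ih => exact hs.par h ih

/-- Both shapes persist down to a common reduct. The expressions need not be well-typed, as long as
both have shapes. -/
theorem Shaping.conv (hs : Shaping Th p sh) (hT : Sane Th) {a b : Exp N} (h : Conv Th a b)
    {σ τ : Sh} (ha : shape sh a = some σ) (hb : shape sh b = some τ) : σ = τ := by
  obtain ⟨c, h1, h2⟩ := h.common_reduct hT
  rw [← shape_er] at ha hb
  exact Option.some.inj ((hs.star h1 ha).symm.trans (hs.star h2 hb))

/-- The types in a context have shapes. -/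
def CtxSh (sh : N → Option Sh) (Γ : List (Exp N)) : Prop :=
  ∀ A ∈ Γ, ∃ σ, shape sh A = some σ ∧ lev σ = 0

theorem CtxSh.cons {Γ : List (Exp N)} (h : CtxSh sh Γ) {A : Exp N} {σ : Sh}
    (hA : shape sh A = some σ) (hσ : lev σ = 0) : CtxSh sh (A :: Γ) :=
  List.forall_mem_cons.2 ⟨⟨σ, hA, hσ⟩, h⟩

theorem CtxSh.nil : CtxSh sh ([] : List (Exp N)) := fun A h => by cases h

/-- The classification of well-typed expressions as objects, type families, and kinds. -/
theorem Shaping.hasType (hs : Shaping Th p sh) (hT : Sane Th) {Γ : List (Exp N)} {t A : Exp N}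
    (h : HasType Th Γ t A) : CtxSh sh Γ → ∃ σ, shape sh A = some σ ∧
      (lev σ = 2 → ∃ τ, shape sh t = some τ ∧ lev τ = 1) ∧
      (lev σ = 1 → ∃ τ, shape sh t = some τ ∧ lev τ = 0) := by
  induction h with
  | type Γ => intro _; exact ⟨box, rfl, fun _ => ⟨.star, rfl, rfl⟩, fun h => by cases h⟩
  | const Γ d hd =>
    intro _
    obtain ⟨σ, hσ, h | h⟩ := hs.type d hd
    · exact ⟨σ, hσ, fun h' => by omega, fun _ => h.2⟩
    · exact ⟨σ, hσ, fun h' => by omega, fun _ => by omega⟩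
  | var Γ i A hA =>
    intro hΓ
    obtain ⟨σ, hσ, h⟩ := hΓ A (List.mem_of_getElem? hA)
    exact ⟨σ, (shape_rename _ _).trans hσ, fun h' => by omega, fun _ => by omega⟩
  | pi _ hsort _ ih1 ih2 =>
    intro hΓ
    obtain ⟨_, ⟨⟩, -, h1⟩ := ih1 hΓ
    obtain ⟨a, ha, ha0⟩ := h1 rfl
    obtain ⟨σ, hσ, h2, h3⟩ := ih2 (hΓ.cons ha ha0)
    refine ⟨σ, hσ, fun h => ?_, fun h => ?_⟩
    · obtain ⟨b, hb, hb'⟩ := h2 h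
      exact ⟨arr a b, shape_pi.2 ⟨a, b, ha, hb, rfl⟩, hb'⟩
    · obtain ⟨b, hb, hb'⟩ := h3 h
      exact ⟨arr a b, shape_pi.2 ⟨a, b, ha, hb, rfl⟩, hb'⟩
  | lam _ hsort _ _ ih1 ih2 ih3 =>
    intro hΓ
    obtain ⟨_, ⟨⟩, -, h1⟩ := ih1 hΓ
    obtain ⟨a, ha, ha0⟩ := h1 rfl
    obtain ⟨b, hb, h4, h5⟩ := ih3 (hΓ.cons ha ha0)
    exact ⟨arr a b, shape_pi.2 ⟨a, b, ha, hb, rfl⟩, h4, h5⟩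
  | app _ _ ih1 ih2 =>
    intro hΓ
    obtain ⟨_, hσ, h1, h2⟩ := ih1 hΓ
    obtain ⟨a, b, ha, hb, rfl⟩ := shape_pi.1 hσ
    exact ⟨b, shape_inst hb, h1, h2⟩
  | @conv _ _ B _ _ _ hsort _ hc ih1 ih2 =>
    intro hΓ
    obtain ⟨σ, hσ, h1, h2⟩ := ih1 hΓ
    obtain ⟨τ, hτ, h3, h4⟩ := ih2 hΓ
    -- `Shaping.conv` compares only shapes that exist; that B has one follows from its having a sort
    -- as type.
    have : ∃ τ, shape sh B = some τ := by
      rcases hsort with rfl | rfl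
      · cases hτ; obtain ⟨τ, h, -⟩ := h4 rfl; exact ⟨τ, h⟩
      · cases hτ; obtain ⟨τ, h, -⟩ := h3 rfl; exact ⟨τ, h⟩
    obtain ⟨τ', hτ'⟩ := this
    obtain rfl := hs.conv hT hc hσ hτ'
    exact ⟨σ, hτ', h1, h2⟩

/-- The level of a sorted expression. -/
theorem Shaping.hasType_sort (hs : Shaping Th p sh) (hT : Sane Th) {Γ : List (Exp N)} {t s : Exp N}
    (h : HasType Th Γ t s) (hsort : IsSort s) (hΓ : CtxSh sh Γ) : ∃ σ, shape sh t = some σ ∧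
      (s = Exp.type ∧ lev σ = 0 ∨ s = Exp.kind ∧ lev σ = 1) := by
  obtain ⟨σ, hσ, h1, h2⟩ := hs.hasType hT h hΓ
  rcases hsort with rfl | rfl <;> cases hσ
  · obtain ⟨τ, h, h'⟩ := h2 rfl; exact ⟨τ, h, Or.inl ⟨rfl, h'⟩⟩
  · obtain ⟨τ, h, h'⟩ := h1 rfl; exact ⟨τ, h, Or.inr ⟨rfl, h'⟩⟩

theorem Shaping.hasType_type (hs : Shaping Th p sh) (hT : Sane Th) {Γ : List (Exp N)} {A : Exp N}
    (h : HasType Th Γ A Exp.type) (hΓ : CtxSh sh Γ) : ∃ σ, shape sh A = some σ ∧ lev σ = 0 := by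
  obtain ⟨σ, h, ⟨_, h'⟩ | ⟨h', _⟩⟩ := hs.hasType_sort hT h (Or.inl rfl) hΓ
  · exact ⟨σ, h, h'⟩
  · cases h'

end Shape

-- By induction on the theory: a type-level constant takes the shape of its definition or, if it is
-- primitive, a base shape with the bit prescribed by `p`. For logical relations, `p` will record
-- where the relation is defined; elsewhere the bits are arbitrary.
open Classical in
theorem WF.exists_shaping {Th : List (Decl N N)} (h : WF Th) (p : N → Bool) :
    ∃ sh, Shaping Th p sh := by
  induction h with
  | nil => exact ⟨fun _ => none, by constructor <;> intro d hd <;> cases hd⟩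
  | @cons Th d s hTh hn hsort hty hdef ih =>
    obtain ⟨sh, hs⟩ := ih
    have hT := hTh.sane
    obtain ⟨σ, hσ, hσ'⟩ := hs.hasType_sort hT hty hsort CtxSh.nil
    have key : ∀ o : Option Sh, ∀ t, Consts (Declared Th) t →
        shape (Function.update sh d.name o) t = shape sh t := by
      intro o t ht
      refine shape_congr ?_ ht
      rintro c ⟨e, he, rfl⟩
      rw [Function.update_of_ne (hn e he)]
    have htc := hty.consts
    have old : ∀ o : Option Sh, ∀ e ∈ Th,
        (∃ σ, shape (Function.update sh d.name o) e.type = some σ ∧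
          (lev σ = 1 ∧ (∃ τ, Function.update sh d.name o e.name = some τ ∧ lev τ = 0) ∨
            lev σ = 0 ∧ Function.update sh d.name o e.name = none)) ∧
        (∀ t, e.defn = some t → ∀ τ, Function.update sh d.name o e.name = some τ →
          shape (Function.update sh d.name o) t = some τ) ∧
        (e.defn = none → ∀ τ, Function.update sh d.name o e.name = some τ →
          τ = base (p e.name)) := by
      intro o e he
      obtain ⟨⟨s, _, h1⟩, h2⟩ := hTh.typed e he
      rw [Function.update_of_ne (hn e he), key o _ h1.consts]
      refine ⟨hs.type e he, fun t ht τ hτ => ?_, hs.prim e he⟩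
      rw [key o _ (h2 t ht).consts]
      exact hs.defn e he t ht τ hτ
    have new : ∀ o : Option Sh,
        (∃ σ, shape sh d.type = some σ ∧
          (lev σ = 1 ∧ (∃ τ, o = some τ ∧ lev τ = 0) ∨ lev σ = 0 ∧ o = none)) →
        (∀ t, d.defn = some t → ∀ τ, o = some τ → shape sh t = some τ) →
        (d.defn = none → ∀ τ, o = some τ → τ = base (p d.name)) →
        Shaping (d :: Th) p (Function.update sh d.name o) := by
      intro o h1 h2 h3
      constructor
      · intro e he
        rcases List.mem_cons.1 he with rfl | he
        · rw [key o _ htc, Function.update_self]; exact h1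
        · exact (old o e he).1
      · intro e he
        rcases List.mem_cons.1 he with rfl | he
        · intro t ht τ hτ
          rw [Function.update_self] at hτ
          rw [key o _ (hdef t ht).consts]; exact h2 t ht τ hτ
        · exact (old o e he).2.1
      · intro e he
        rcases List.mem_cons.1 he with rfl | he
        · rw [Function.update_self]; exact h3
        · exact (old o e he).2.2
    rcases hσ' with ⟨_, h0⟩ | ⟨_, h1⟩
    · exact ⟨_, new none ⟨σ, hσ, Or.inr ⟨h0, rfl⟩⟩ (fun _ _ _ h => by cases h)
        fun _ _ h => by cases h⟩
    · cases hd : d.defn with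
      | none =>
        exact ⟨_, new (some (base (p d.name))) ⟨σ, hσ, Or.inl ⟨h1, _, rfl, rfl⟩⟩
          (fun t ht => by rw [hd] at ht; cases ht) fun _ _ h => (Option.some.inj h).symm⟩
      | some t =>
        obtain ⟨σ', hσ', _, h2⟩ := hs.hasType hT (hdef t hd) CtxSh.nil
        obtain rfl := Option.some.inj (hσ.symm.trans hσ')
        obtain ⟨τ, hτ, hτ0⟩ := h2 h1
        refine ⟨_, new (some τ) ⟨σ, hσ, Or.inl ⟨h1, _, rfl, hτ0⟩⟩ (fun t' ht' τ' h => ?_)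
          fun h => by rw [hd] at h; cases h⟩
        obtain rfl : t = t' := Option.some.inj (hd.symm.trans ht')
        rw [hτ, h]

/-! ### Metatheory of LF -/

section Meta

variable {Th : List (Decl N N)} {Γ Δ : List (Exp N)}

/-- The renaming `ρ` maps the variables of `Γ` to variables of `Δ` of the same types. -/
def Ren (Γ : List (Exp N)) (ρ : ℕ → ℕ) (Δ : List (Exp N)) : Prop :=
  ∀ i A, Γ[i]? = some A →
    ∃ A', Δ[ρ i]? = some A' ∧ A'.rename (· + (ρ i + 1)) = (A.rename (· + (i + 1))).rename ρ

theorem Ren.cons {ρ : ℕ → ℕ} (h : Ren Γ ρ Δ) (A : Exp N) :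
    Ren (A :: Γ) (upr ρ) (A.rename ρ :: Δ) := by
  rintro (_ | i) B hB
  · cases hB
    exact ⟨_, rfl, (lift_rename_upr A ρ).symm⟩
  · obtain ⟨A', hA', h'⟩ := h i B hB
    refine ⟨A', hA', ?_⟩
    have := congrArg Exp.lift h'
    simp only [Exp.lift, rename_rename] at this ⊢
    exact this

theorem Ren.succ (A : Exp N) : Ren Γ Nat.succ (A :: Γ) := by
  intro i B hB
  refine ⟨B, hB, ?_⟩
  simp only [rename_rename]; rfl

theorem Ren.id : Ren Γ (fun i => i) Γ := fun i A hA => ⟨A, hA, by simp only [rename_rename]⟩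

theorem Ren.comp {Ξ : List (Exp N)} {ρ ρ' : ℕ → ℕ} (h : Ren Γ ρ Δ) (h' : Ren Δ ρ' Ξ) :
    Ren Γ (fun i => ρ' (ρ i)) Ξ := by
  intro i A hA
  obtain ⟨B, hB, hB'⟩ := h i A hA
  obtain ⟨C, hC, hC'⟩ := h' _ B hB
  exact ⟨C, hC, by rw [hC', hB', rename_rename _ ρ ρ']⟩

theorem IsSort.rename {s : Exp N} (h : IsSort s) (ρ : ℕ → ℕ) : s.rename ρ = s := by
  rcases h with rfl | rfl <;> rfl

theorem IsSort.subst {s : Exp N} (h : IsSort s) (σ : ℕ → Exp N) : s.subst σ = s := by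
  rcases h with rfl | rfl <;> rfl

theorem HasType.rename (hT : Sane Th) {t A : Exp N} (h : HasType Th Γ t A) :
    ∀ {ρ Δ}, Ren Γ ρ Δ → HasType Th Δ (t.rename ρ) (A.rename ρ) := by
  induction h with
  | type Γ => intro ρ Δ _; exact .type _
  | const Γ d hd => intro ρ Δ _; rw [(hT.type_closed d hd).rename_eq]; exact .const _ d hd
  | var Γ i A hA =>
    intro ρ Δ h
    obtain ⟨A', hA', h'⟩ := h i A hA
    rw [← h']; exact .var _ _ A' hA'
  | pi _ hs _ ih1 ih2 =>
    intro ρ Δ h; rw [hs.rename]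
    have := ih2 (h.cons _)
    rw [hs.rename] at this; exact .pi (ih1 h) hs this
  | lam _ hs _ _ ih1 ih2 ih3 =>
    intro ρ Δ h
    have := ih2 (h.cons _)
    rw [hs.rename] at this; exact .lam (ih1 h) hs this (ih3 (h.cons _))
  | app _ _ ih1 ih2 => intro ρ Δ h; rw [inst_rename]; exact .app (ih1 h) (ih2 h)
  | conv _ hs _ hc ih1 ih2 =>
    intro ρ Δ h
    have := ih2 h
    rw [hs.rename] at this; exact .conv (ih1 h) hs this (hc.rename hT ρ)

theorem HasType.lift (hT : Sane Th) {t A : Exp N} (h : HasType Th Γ t A) (B : Exp N) :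
    HasType Th (B :: Γ) t.lift A.lift := h.rename hT (Ren.succ B)

/-- The substitution `σ` maps the variables of `Γ` to expressions of the same types. -/
def Sub (Th : List (Decl N N)) (Γ : List (Exp N)) (σ : ℕ → Exp N) (Δ : List (Exp N)) : Prop :=
  ∀ i A, Γ[i]? = some A → HasType Th Δ (σ i) ((A.rename (· + (i + 1))).subst σ)

theorem Sub.cons (hT : Sane Th) {σ : ℕ → Exp N} (h : Sub Th Γ σ Δ) (A : Exp N) :
    Sub Th (A :: Γ) (ups σ) (A.subst σ :: Δ) := by
  rintro (_ | i) B hB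
  · cases hB
    have := HasType.var (Th := Th) (A.subst σ :: Δ) 0 _ rfl
    have e : (A.subst σ).rename (· + (0 + 1)) = (A.rename (· + (0 + 1))).subst (ups σ) :=
      (lift_subst_ups A σ).symm
    rwa [e] at this
  · have := (h i B hB).lift hT (A.subst σ)
    rw [← lift_subst_ups, Exp.lift, Exp.lift, rename_rename] at this
    exact this

theorem HasType.subst (hT : Sane Th) {t A : Exp N} (h : HasType Th Γ t A) :
    ∀ {σ Δ}, Sub Th Γ σ Δ → HasType Th Δ (t.subst σ) (A.subst σ) := by
  induction h with
  | type Γ => intro σ Δ _; exact .type _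
  | const Γ d hd => intro σ Δ _; rw [(hT.type_closed d hd).subst_eq]; exact .const _ d hd
  | var Γ i A hA => intro σ Δ h; exact h i A hA
  | pi _ hs _ ih1 ih2 =>
    intro σ Δ h; rw [hs.subst]
    have := ih2 (h.cons hT _)
    rw [hs.subst] at this; exact .pi (ih1 h) hs this
  | lam _ hs _ _ ih1 ih2 ih3 =>
    intro σ Δ h
    have := ih2 (h.cons hT _)
    rw [hs.subst] at this; exact .lam (ih1 h) hs this (ih3 (h.cons hT _))
  | app _ _ ih1 ih2 => intro σ Δ h; rw [inst_subst]; exact .app (ih1 h) (ih2 h)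
  | conv _ hs _ hc ih1 ih2 =>
    intro σ Δ h
    have := ih2 h
    rw [hs.subst] at this; exact .conv (ih1 h) hs this (hc.subst hT σ)

theorem HasType.inst (hT : Sane Th) {t s A B : Exp N} (h : HasType Th (A :: Γ) t B)
    (hs : HasType Th Γ s A) : HasType Th Γ (t.inst s) (B.inst s) := by
  refine h.subst hT ?_
  rintro (_ | i) C hC
  · cases hC
    have : (A.rename (· + (0 + 1))).subst (single s) = A := lift_inst A s
    rw [this]; exact hs
  · have : (C.rename (· + (i + 1 + 1))).subst (single s) = C.rename (· + (i + 1)) := by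
      rw [rename_subst, rename_eq_subst]; rfl
    rw [this]; exact .var _ i C hC

/-- The identity substitution is well-typed from the one context to the other. -/
theorem HasType.conv_ctx (hT : Sane Th) {A A' t B : Exp N} (h : HasType Th (A :: Γ) t B)
    (hA : HasType Th Γ A Exp.type) (hc : Conv Th A A') : HasType Th (A' :: Γ) t B := by
  have := h.subst hT (σ := Exp.var) (Δ := A' :: Γ) ?_
  · rwa [subst_var, subst_var] at this
  rintro (_ | i) C hC <;> rw [subst_var]
  · cases hC
    exact .conv (.var _ 0 A' rfl) (Or.inl rfl) (hA.lift hT A') (hc.symm.rename hT _)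
  · exact .var _ (i + 1) C hC

/-! Generation -/

theorem HasType.app_inv {f t C : Exp N} (h : HasType Th Γ (Exp.app f t) C) :
    ∃ A B, HasType Th Γ f (Exp.pi A B) ∧ HasType Th Γ t A ∧ Conv Th (B.inst t) C := by
  generalize he : Exp.app f t = e at h
  induction h with
  | app h1 h2 => cases he; exact ⟨_, _, h1, h2, Conv.refl _ _⟩
  | conv _ _ _ hc ih _ =>
    obtain ⟨A, B, h1, h2, h3⟩ := ih he
    exact ⟨A, B, h1, h2, h3.trans hc⟩
  | _ => cases he

theorem HasType.lam_inv {A t C : Exp N} (h : HasType Th Γ (Exp.lam A t) C) :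
    ∃ B s, IsSort s ∧ HasType Th Γ A Exp.type ∧ HasType Th (A :: Γ) B s ∧ HasType Th (A :: Γ) t B ∧
      Conv Th (Exp.pi A B) C := by
  generalize he : Exp.lam A t = e at h
  induction h with
  | lam h1 hs h2 h3 => cases he; exact ⟨_, _, hs, h1, h2, h3, Conv.refl _ _⟩
  | conv _ _ _ hc ih _ =>
    obtain ⟨B, s, hs, h1, h2, h3, h4⟩ := ih he
    exact ⟨B, s, hs, h1, h2, h3, h4.trans hc⟩
  | _ => cases he

theorem HasType.pi_inv {A B C : Exp N} (h : HasType Th Γ (Exp.pi A B) C) :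
    ∃ s, IsSort s ∧ HasType Th Γ A Exp.type ∧ HasType Th (A :: Γ) B s ∧ Conv Th s C := by
  generalize he : Exp.pi A B = e at h
  induction h with
  | pi h1 hs h2 => cases he; exact ⟨_, hs, h1, h2, Conv.refl _ _⟩
  | conv _ _ _ hc ih _ =>
    obtain ⟨s, hs, h1, h2, h4⟩ := ih he
    exact ⟨s, hs, h1, h2, h4.trans hc⟩
  | _ => cases he

theorem Par.Star.of_type {c : Exp N} (h : Par.Star Th Exp.type c) : c = Exp.type := by
  induction h with
  | refl => rfl
  | tail _ h ih => subst ih; cases h; rfl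

theorem Par.Star.of_kind {c : Exp N} (h : Par.Star Th Exp.kind c) : c = Exp.kind := by
  induction h with
  | refl => rfl
  | tail _ h ih => subst ih; cases h; rfl

theorem IsSort.star {s c : Exp N} (hs : IsSort s) (h : Par.Star Th (er s) c) : c = s := by
  rcases hs with rfl | rfl
  · exact h.of_type
  · exact h.of_kind

theorem IsSort.eq_of_conv (hT : Sane Th) {s s' : Exp N} (hs : IsSort s) (hs' : IsSort s')
    (h : Conv Th s s') : s = s' := by
  obtain ⟨c, h1, h2⟩ := h.common_reduct hT
  exact (hs.star h1).symm.trans (hs'.star h2)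

theorem IsSort.not_conv_pi (hT : Sane Th) {s A B : Exp N} (hs : IsSort s) :
    ¬ Conv Th (Exp.pi A B) s := by
  intro h
  obtain ⟨c, h1, h2⟩ := h.common_reduct hT
  obtain rfl := hs.star h2
  obtain ⟨A', B', h, -⟩ := Par.Star.of_pi h1
  rcases hs with rfl | rfl <;> cases h

/-- Well-formed contexts. -/
def Ctx (Th : List (Decl N N)) : List (Exp N) → Prop
  | [] => True
  | A :: Γ => Ctx Th Γ ∧ HasType Th Γ A Exp.type

theorem Ctx.ctxSh {p : N → Bool} {sh : N → Option Sh} (hs : Shaping Th p sh) (hT : Sane Th)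
    (hΓ : Ctx Th Γ) : CtxSh sh Γ := by
  induction Γ with
  | nil => exact CtxSh.nil
  | cons A Γ ih =>
    obtain ⟨σ, h, h'⟩ := hs.hasType_type hT hΓ.2 (ih hΓ.1)
    exact (ih hΓ.1).cons h h'

theorem Ctx.get (hT : Sane Th) (hΓ : Ctx Th Γ) : ∀ {i : ℕ} {A : Exp N}, Γ[i]? = some A →
    HasType Th Γ (A.rename (· + (i + 1))) type := by
  induction Γ with
  | nil => intro i A h; cases h
  | cons B Γ ih =>
    rintro (_ | i) A hA
    · cases hA; exact hΓ.2.lift hT _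
    · have := (ih hΓ.1 hA).lift hT B
      rw [Exp.lift, rename_rename] at this
      exact this

theorem HasType.type_correct (hW : WF Th) {t A : Exp N} (h : HasType Th Γ t A) :
    Ctx Th Γ → A = Exp.kind ∨ ∃ s, IsSort s ∧ HasType Th Γ A s := by
  have hT := hW.sane
  induction h with
  | type Γ => intro _; exact Or.inl rfl
  | const Γ d hd =>
    intro _
    obtain ⟨⟨s, hs, h⟩, -⟩ := hW.typed d hd
    exact Or.inr ⟨s, hs, by simpa using h.append Γ⟩
  | var Γ i A hA => intro hΓ; exact Or.inr ⟨_, Or.inl rfl, hΓ.get hT hA⟩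
  | pi _ hs _ _ _ =>
    intro _
    rcases hs with rfl | rfl
    · exact Or.inr ⟨_, Or.inr rfl, .type _⟩
    · exact Or.inl rfl
  | lam h1 hs h2 _ _ _ _ => intro _; exact Or.inr ⟨_, hs, .pi h1 hs h2⟩
  | app _ h2 ih1 _ =>
    intro hΓ
    obtain h | ⟨s, hs, h⟩ := ih1 hΓ
    · cases h
    · obtain ⟨s', hs', _, h3, _⟩ := h.pi_inv
      refine Or.inr ⟨s', hs', ?_⟩
      have := h3.inst hT h2
      rwa [Exp.inst, Exp.inst, hs'.subst] at this
  | conv _ hs h _ _ _ => intro _; exact Or.inr ⟨_, hs, h⟩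

/-- Levels of shapes tell them apart: `kind` has level 2, while an expression that has a sort as
type has level 0 or 1. -/
theorem HasType.not_conv_kind (hW : WF Th) (hΓ : Ctx Th Γ) {A s : Exp N} (hs : IsSort s)
    (h : HasType Th Γ A s) : ¬ Conv Th A kind := by
  intro hc
  obtain ⟨sh, hsh⟩ := hW.exists_shaping fun _ => false
  obtain ⟨σ, hσ, h'⟩ := hsh.hasType_sort hW.sane h hs (hΓ.ctxSh hsh hW.sane)
  obtain rfl := hsh.conv hW.sane hc hσ rfl
  rcases h' with ⟨_, h'⟩ | ⟨_, h'⟩ <;> cases h'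

/-- A conversion between types of well-typed expressions. -/
theorem HasType.conv_of_hasType (hW : WF Th) (hΓ : Ctx Th Γ) {t t' A B s : Exp N}
    (h : HasType Th Γ t A) (hs : IsSort s) (hA : HasType Th Γ A s) (h' : HasType Th Γ t' B)
    (hc : Conv Th A B) : HasType Th Γ t B := by
  obtain rfl | ⟨s', hs', hB⟩ := h'.type_correct hW hΓ
  · exact (hA.not_conv_kind hW hΓ hs hc).elim
  · exact h.conv hs' hB hc

/-- Subject reduction for `β`-reduction at the root. -/
theorem HasType.beta (hW : WF Th) (hΓ : Ctx Th Γ) {A t s C : Exp N}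
    (h : HasType Th Γ (Exp.app (Exp.lam A t) s) C) : HasType Th Γ (t.inst s) C := by
  have hT := hW.sane
  obtain ⟨A₁, B₁, h1, h2, h3⟩ := h.app_inv
  obtain ⟨B, s', hs', h4, h5, h6, h7⟩ := h1.lam_inv
  obtain ⟨h8, h9⟩ := h7.pi_injective hT
  have h10 := h2.conv (Or.inl rfl) h4 h8.symm
  have h11 := h5.inst hT h10
  rw [Exp.inst, Exp.inst, hs'.subst] at h11
  exact (h6.inst hT h10).conv_of_hasType hW hΓ hs' h11 h ((h9.inst hT (Conv.refl _ _)).trans h3)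

theorem HasType.betaApp (hW : WF Th) (hΓ : Ctx Th Γ) {f s C : Exp N}
    (h : HasType Th Γ (Exp.app f s) C) : HasType Th Γ (Exp.betaApp f s) C := by
  cases f with
  | lam A t => exact h.beta hW hΓ
  | _ => exact h

/-- The components of a well-typed `Π`-type. -/
theorem HasType.pi_inv_sort (hW : WF Th) {A B s : Exp N} (hs : IsSort s)
    (h : HasType Th Γ (Exp.pi A B) s) : HasType Th Γ A Exp.type ∧ HasType Th (A :: Γ) B s := by
  obtain ⟨s', hs', h1, h2, h3⟩ := h.pi_inv
  obtain rfl := hs'.eq_of_conv hW.sane hs h3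
  exact ⟨h1, h2⟩

/-- The type of a function is a well-typed `Π`-type. -/
theorem HasType.pi_of_fun (hW : WF Th) (hΓ : Ctx Th Γ) {f A B : Exp N}
    (h : HasType Th Γ f (Exp.pi A B)) :
    ∃ s, IsSort s ∧ HasType Th Γ A Exp.type ∧ HasType Th (A :: Γ) B s := by
  obtain h' | ⟨s, hs, h'⟩ := h.type_correct hW hΓ
  · cases h'
  · exact ⟨s, hs, h'.pi_inv_sort hW hs⟩

/-- Application with a function and an argument whose types fit up to conversion. -/
theorem HasType.lam_inv_pi (hW : WF Th) (hΓ : Ctx Th Γ) {A t A' B' : Exp N}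
    (h : HasType Th Γ (Exp.lam A t) (Exp.pi A' B')) :
    HasType Th Γ A Exp.type ∧ Conv Th A A' ∧ HasType Th (A :: Γ) t B' := by
  have hT := hW.sane
  obtain ⟨B, s, hs, h1, h2, h3, h4⟩ := h.lam_inv
  obtain ⟨h5, h6⟩ := h4.pi_injective hT
  obtain ⟨s', hs', h7, h8⟩ := h.pi_of_fun hW hΓ
  exact ⟨h1, h5, h3.conv hs' (h8.conv_ctx hT h7 h5.symm) h6⟩

/-! Weak head normal forms of types -/

/-- The application of an expression to several arguments. -/
def apps (f : Exp N) (as : List (Exp N)) : Exp N := as.foldl Exp.app f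

/-- Head reduction under a spine of arguments preserves types; it is used with β-steps and with
unfolding on the way to a Π-type. -/
theorem HasType.apps_head (hW : WF Th) (hΓ : Ctx Th Γ) {g : Exp N} (as : List (Exp N)) :
    ∀ {f C : Exp N}, (∀ C, HasType Th Γ f C → HasType Th Γ g C) →
      HasType Th Γ (apps f as) C → HasType Th Γ (apps g as) C := by
  induction as generalizing g with
  | nil => intro f C hfg h; exact hfg C h
  | cons a as ih =>
    intro f C hfg h
    refine ih (fun C h => ?_) h
    obtain ⟨A, B, h1, h2, h3⟩ := h.app_inv
    have h4 := (hfg _ h1).app h2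
    obtain h5 | ⟨s, hs, h5⟩ := h4.type_correct hW hΓ
    · rw [h5] at h3
      obtain rfl | ⟨s, hs, h6⟩ := h.type_correct hW hΓ
      · rwa [h5] at h4
      · exact (h6.not_conv_kind hW hΓ hs h3.symm).elim
    · exact h4.conv_of_hasType hW hΓ hs h5 h h3

theorem Conv.apps {f g : Exp N} (h : Conv Th f g) (as : List (Exp N)) :
    Conv Th (LF.apps f as) (LF.apps g as) := by
  induction as generalizing f g with
  | nil => exact h
  | cons a as ih => exact ih (Conv.app h (Conv.refl _ _))

/-- A Π-expression has a sort as its type, and sorts are not convertible to Π-types, so it cannot be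
applied to anything. -/
theorem HasType.apps_pi (hT : Sane Th) {A B C : Exp N} {as : List (Exp N)}
    (h : HasType Th Γ (apps (Exp.pi A B) as) C) : as = [] := by
  cases as with
  | nil => rfl
  | cons a as =>
    have : ∀ (as : List (Exp N)) (f C : Exp N), HasType Th Γ (apps f as) C →
        ∃ C', HasType Th Γ f C' := by
      intro as
      induction as with
      | nil => intro f C h; exact ⟨C, h⟩
      | cons a as ih =>
        intro f C h
        obtain ⟨C', h'⟩ := ih _ _ h
        obtain ⟨A, B, h1, _⟩ := h'.app_inv
        exact ⟨_, h1⟩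
    obtain ⟨C', h'⟩ := this as _ _ h
    obtain ⟨A', B', h1, _⟩ := h'.app_inv
    obtain ⟨s, hs, _, _, h2⟩ := h1.pi_inv
    exact (hs.not_conv_pi hT h2.symm).elim

/-- Weak head reduction by structural recursion on F, which carries the arrow shape, so that no
normalization theorem is needed. The list `as` collects the pending arguments, and σ the arguments
of the abstractions already contracted; thus F is never substituted into before the recursion. A
variable, `type` or `kind` at the head has no arrow shape, and constants are left to `hP`. -/
theorem exists_pi_of_const (hW : WF Th) {sh : N → Option Sh} {P : N → Prop}
    (hP : ∀ c, P c → ∀ (Γ : List (Exp N)) (as : List (Exp N)), Ctx Th Γ →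
      HasType Th Γ (apps (const c) as) Exp.type → ∀ a b, sh c = some (.arr a b) →
      ∃ A B, HasType Th Γ (Exp.pi A B) Exp.type ∧ Conv Th (apps (const c) as) (Exp.pi A B))
    (F : Exp N) : Consts P F →
    ∀ (Γ : List (Exp N)) (σ : ℕ → Exp N) (as : List (Exp N)), Ctx Th Γ →
      HasType Th Γ (apps (F.subst σ) as) Exp.type → ∀ a b, shape sh F = some (.arr a b) →
      ∃ A B, HasType Th Γ (Exp.pi A B) Exp.type ∧
        Conv Th (apps (F.subst σ) as) (Exp.pi A B) := by
  have hT := hW.sane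
  induction F with
  | const c => intro h Γ σ as; exact hP c h Γ as
  | var i => intro _ _ _ _ _ _ a b h; cases h
  | type => intro _ _ _ _ _ _ a b h; cases h
  | kind => intro _ _ _ _ _ _ a b h; cases h
  | pi A B _ _ =>
    intro _ Γ σ as hΓ h a b _
    obtain rfl := h.apps_pi hT
    exact ⟨_, _, h, Conv.refl _ _⟩
  | app f t ihf _ =>
    intro hF Γ σ as hΓ h a b hsh
    exact ihf hF.1 Γ σ (t.subst σ :: as) hΓ h a b hsh
  | lam A t _ iht =>
    intro hF Γ σ as hΓ h a b hsh
    cases as with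
    | nil =>
      obtain ⟨B, s, _, _, _, _, h⟩ := HasType.lam_inv h
      exact (IsSort.not_conv_pi hT (Or.inl rfl) h).elim
    | cons u as =>
      have e : (t.subst (ups σ)).inst u = t.subst (fun | 0 => u | i + 1 => σ i) := by
        rw [Exp.inst, subst_subst]
        congr 1; funext i
        cases i with
        | zero => rfl
        | succ i => exact lift_inst _ _
      have h' : HasType Th Γ (apps ((t.subst (ups σ)).inst u) as) Exp.type :=
        HasType.apps_head hW hΓ as (f := Exp.app ((Exp.lam A t).subst σ) u)
          (fun C h => h.beta hW hΓ) h
      rw [e] at h'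
      obtain ⟨A', B', h1, h2⟩ := iht hF.2 Γ _ as hΓ h' a b hsh
      refine ⟨A', B', h1, Conv.trans ?_ h2⟩
      rw [← e]
      exact Conv.apps (Conv.beta _ _ _) as

/-- Subject reduction for the unfolding of a definition at the root. -/
theorem HasType.delta (hW : WF Th) {d : Decl N N} (hd : d ∈ Th) {t C : Exp N}
    (ht : d.defn = some t) (h : HasType Th Γ (Exp.const d.name) C) : HasType Th Γ t C := by
  have htt : HasType Th Γ t d.type := by simpa using ((hW.typed d hd).2 t ht).append Γ
  have key : d.type = C ∨ Conv Th d.type C ∧ ∃ s, IsSort s ∧ HasType Th Γ C s := by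
    clear htt
    generalize hk : Exp.const d.name = k at h
    induction h with
    | const Γ d' hd' =>
      injection hk with hk
      obtain rfl := hW.sane.eq _ hd _ hd' hk
      exact Or.inl rfl
    | conv _ hs hB hc ih _ =>
      refine Or.inr ⟨?_, _, hs, hB⟩
      rcases ih hk with rfl | ⟨h2, _⟩
      · exact hc
      · exact h2.trans hc
    | _ => cases hk
  obtain rfl | ⟨h1, s, hs, h2⟩ := key
  · exact htt
  · exact htt.conv hs h2 h1

/-- By induction on the theory: a constant of arrow shape cannot be primitive, and its definition
mentions only earlier constants. -/
theorem exists_pi_of_apps_const (hW : WF Th) {sh : N → Option Sh} {p : N → Bool}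
    (hs : Shaping Th p sh) {Th' : List (Decl N N)} (hW' : WF Th') : (∀ d ∈ Th', d ∈ Th) →
    ∀ c, Declared Th' c → ∀ (Γ : List (Exp N)) (as : List (Exp N)), Ctx Th Γ →
      HasType Th Γ (apps (const c) as) Exp.type → ∀ a b, sh c = some (.arr a b) →
      ∃ A B, HasType Th Γ (Exp.pi A B) Exp.type ∧ Conv Th (apps (const c) as) (Exp.pi A B) := by
  induction hW' with
  | nil => rintro _ c ⟨d, hd, _⟩; cases hd
  | @cons Th' d s hTh' hn hsort hty hdef ih =>
    rintro hsub c ⟨e, he, rfl⟩ Γ as hΓ h a b hsh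
    have ih := ih fun e he => hsub e (List.mem_cons_of_mem _ he)
    rcases List.mem_cons.1 he with rfl | he'
    · have hd := hsub e he
      cases ht : e.defn with
      | none => cases hs.prim e hd ht _ hsh
      | some t =>
        have hcl := (hdef t ht).closed
        have h' := HasType.apps_head hW hΓ as (fun C h => h.delta hW hd ht) h
        rw [← hcl.subst_eq Exp.var] at h'
        obtain ⟨A, B, h1, h2⟩ := exists_pi_of_const hW ih t (hdef t ht).consts Γ _ as hΓ h' a b
          (hs.defn e hd t ht _ hsh)
        refine ⟨A, B, h1, Conv.trans (Conv.apps ?_ as) h2⟩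
        rw [hcl.subst_eq]
        exact .of_step (.delta e t hd ht)
    · exact ih _ ⟨e, he', rfl⟩ Γ as hΓ h a b hsh

/-- A type that has the shape of a `Π`-type is convertible to a well-typed `Π`-type. -/
theorem HasType.exists_pi (hW : WF Th) {sh : N → Option Sh} {p : N → Bool} (hs : Shaping Th p sh)
    (hΓ : Ctx Th Γ) {F : Exp N} (h : HasType Th Γ F Exp.type) {a b : Sh}
    (hF : shape sh F = some (.arr a b)) :
    ∃ A B, HasType Th Γ (Exp.pi A B) Exp.type ∧ Conv Th F (Exp.pi A B) := by
  have := exists_pi_of_const hW (exists_pi_of_apps_const hW hs hW fun d hd => hd) F h.consts Γ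
    Exp.var [] hΓ (by rwa [subst_var]) a b hF
  rwa [subst_var] at this

/-! Strengthening -/

/-- A kind is `type` or a `Π`-kind. -/
theorem HasType.kind_cases (hW : WF Th) (hΓ : Ctx Th Γ) {K : Exp N}
    (h : HasType Th Γ K Exp.kind) : K = Exp.type ∨
      ∃ A B, K = Exp.pi A B ∧ HasType Th Γ A Exp.type ∧ HasType Th (A :: Γ) B Exp.kind := by
  have no : ∀ {Γ : List (Exp N)} {t s : Exp N}, Ctx Th Γ → IsSort s →
      ¬ HasType Th Γ Exp.kind s := by
    intro Γ t s hΓ hs h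
    exact h.not_conv_kind hW hΓ hs (Conv.refl _ _)
  generalize hk : Exp.kind = k at h
  cases h with
  | type => exact Or.inl rfl
  | const _ d hd =>
    obtain ⟨⟨s, hs, h⟩, -⟩ := hW.typed d hd
    rw [← hk] at h
    exact (no (t := Exp.kind) (Γ := []) trivial hs h).elim
  | var _ i A hA =>
    have h := hΓ.get hW.sane hA
    rw [← hk] at h
    exact (no (t := Exp.kind) hΓ (Or.inl rfl) h).elim
  | pi h1 hs h2 => subst hk; exact Or.inr ⟨_, _, rfl, h1, h2⟩
  | lam => cases hk
  | app h1 h2 =>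
    obtain ⟨s, hs, h3, h4⟩ := h1.pi_of_fun hW hΓ
    have := h4.inst hW.sane h2
    rw [← hk, Exp.inst, hs.subst] at this
    exact (no (t := Exp.kind) hΓ hs this).elim
  | conv h1 hs h2 hc => subst hk; exact (no (t := Exp.kind) hΓ hs h2).elim

/-- A kind that has the shape of a `Π`-kind is one. -/
theorem HasType.kind_pi (hW : WF Th) {sh : N → Option Sh} (hΓ : Ctx Th Γ) {K : Exp N}
    (h : HasType Th Γ K Exp.kind) {a b : Sh}
    (hK : shape sh K = some (.arr a b)) : ∃ A B, K = Exp.pi A B := by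
  obtain rfl | ⟨A, B, rfl, _⟩ := h.kind_cases hW hΓ
  · cases hK
  · exact ⟨A, B, rfl⟩


/-- The renaming `ρ`, with left inverse `ρ'`, embeds the context `Γ` into `Δ`, and the variables
that are mapped to variables of `Δ` are those of `Γ`. -/
structure Emb (Γ : List (Exp N)) (ρ ρ' : ℕ → ℕ) (Δ : List (Exp N)) : Prop where
  ren : Ren Γ ρ Δ
  leftInv : ∀ i, ρ' (ρ i) = i
  lt : ∀ i, ρ i < Δ.length → i < Γ.length

theorem Emb.cons {ρ ρ' : ℕ → ℕ} (h : Emb Γ ρ ρ' Δ) (A : Exp N) :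
    Emb (A :: Γ) (upr ρ) (upr ρ') (A.rename ρ :: Δ) where
  ren := h.ren.cons A
  leftInv
    | 0 => rfl
    | i + 1 => congrArg Nat.succ (h.leftInv i)
  lt
    | 0, _ => Nat.succ_pos _
    | i + 1, hi => Nat.succ_lt_succ (h.lt i (Nat.lt_of_succ_lt_succ hi))

/-- Strengthening: variables that do not occur in an expression can be removed from the context. -/
theorem HasType.strengthen_exists (hW : WF Th) {t₀ B₀ : Exp N} (h : HasType Th Δ t₀ B₀) :
    ∀ {Γ ρ ρ' t}, Emb Γ ρ ρ' Δ → Ctx Th Γ → Ctx Th Δ → t₀ = t.rename ρ →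
      ∃ B, HasType Th Γ t B ∧ Conv Th (B.rename ρ) B₀ := by
  have hT := hW.sane
  obtain ⟨sh, hs⟩ := hW.exists_shaping fun _ => false
  have sort : ∀ {Γ : List (Exp N)} {ρ ρ' : ℕ → ℕ} {t B s : Exp N}, (∀ i, ρ' (ρ i) = i) →
      Ctx Th Γ → IsSort s → HasType Th Γ t B → Conv Th (B.rename ρ) s → HasType Th Γ t s := by
    intro Γ ρ ρ' t B s hρ hΓ hsort h hc
    rw [← hsort.rename ρ] at hc
    have hc := hc.of_rename hT hρ
    rcases hsort with rfl | rfl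
    · exact h.conv (Or.inr rfl) (.type _) hc
    · obtain rfl | ⟨s, hs, h'⟩ := h.type_correct hW hΓ
      · exact h
      · exact (h'.not_conv_kind hW hΓ hs hc).elim
  induction h with
  | type Δ =>
    intro Γ ρ ρ' t _ _ _ ht
    cases t <;> cases ht
    exact ⟨_, .type _, Conv.refl _ _⟩
  | const Δ d hd =>
    intro Γ ρ ρ' t _ _ _ ht
    cases t <;> cases ht
    exact ⟨_, .const _ d hd, .of_eq ((hT.type_closed d hd).rename_eq _)⟩
  | var Δ i A hA =>
    intro Γ ρ ρ' t hρ _ _ ht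
    cases t <;> cases ht
    rename_i i
    have hi := hρ.lt i (List.getElem?_eq_some_iff.1 hA).1
    have hB := List.getElem?_eq_getElem hi
    obtain ⟨A', hA', h'⟩ := hρ.ren i _ hB
    obtain rfl := Option.some.inj (hA.symm.trans hA')
    exact ⟨_, .var _ i _ hB, .of_eq h'.symm⟩
  | pi hA₀ hsort _ ih1 ih2 =>
    intro Γ ρ ρ' t hρ hΓ hΔ ht
    cases t <;> cases ht
    obtain ⟨C, h1, h2⟩ := ih1 hρ hΓ hΔ rfl
    have h1 := sort hρ.leftInv hΓ (Or.inl rfl) h1 h2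
    have hΓ' : Ctx Th (_ :: Γ) := ⟨hΓ, h1⟩
    have hΔ' : Ctx Th (_ :: _) := ⟨hΔ, hA₀⟩
    obtain ⟨D, h3, h4⟩ := ih2 (hρ.cons _) hΓ' hΔ' rfl
    have h3 := sort (hρ.cons Exp.type).leftInv hΓ' hsort h3 h4
    exact ⟨_, .pi h1 hsort h3, .of_eq (hsort.rename _)⟩
  | lam hA₀ hsort hB₀ _ ih1 _ ih3 =>
    intro Γ ρ ρ' t hρ hΓ hΔ ht
    cases t <;> cases ht
    obtain ⟨C, h1, h2⟩ := ih1 hρ hΓ hΔ rfl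
    have h1 := sort hρ.leftInv hΓ (Or.inl rfl) h1 h2
    have hΓ' : Ctx Th (_ :: Γ) := ⟨hΓ, h1⟩
    have hΔ' : Ctx Th (_ :: _) := ⟨hΔ, hA₀⟩
    obtain ⟨D, h3, h4⟩ := ih3 (hρ.cons _) hΓ' hΔ' rfl
    obtain rfl | ⟨s, hs, h5⟩ := h3.type_correct hW hΓ'
    · exact (hB₀.not_conv_kind hW hΔ' hsort h4.symm).elim
    · exact ⟨_, .lam h1 hs h5 h3, Conv.pi (Conv.refl _ _) h4⟩
  | app hf₀ _ ih1 ih2 =>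
    intro Γ ρ ρ' t hρ hΓ hΔ ht
    cases t <;> cases ht
    obtain ⟨F, h1, h2⟩ := ih1 hρ hΓ hΔ rfl
    obtain ⟨C, h3, h4⟩ := ih2 hρ hΓ hΔ rfl
    obtain ⟨σ, hσ, _⟩ := hs.hasType hT hf₀ (hΔ.ctxSh hs hT)
    obtain ⟨a, b, _, _, rfl⟩ := shape_pi.1 hσ
    obtain ⟨τ, hτ, _⟩ := hs.hasType hT h1 (hΓ.ctxSh hs hT)
    obtain rfl := hs.conv hT h2 ((shape_rename _ _).trans hτ) hσ
    -- So far the type F of the function is convertible to a Π-type over the larger context only.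
    -- Its arrow shape produces one over the smaller context.
    have : ∃ A B s, IsSort s ∧ HasType Th Γ (Exp.pi A B) s ∧ Conv Th F (Exp.pi A B) := by
      obtain rfl | ⟨s, hsort, h5⟩ := h1.type_correct hW hΓ
      · cases hτ
      rcases hsort with rfl | rfl
      · obtain ⟨A, B, h6, h7⟩ := h5.exists_pi hW hs hΓ hτ
        exact ⟨A, B, _, Or.inl rfl, h6, h7⟩
      · obtain ⟨A, B, rfl⟩ := h5.kind_pi hW hΓ hτ
        exact ⟨A, B, _, Or.inr rfl, h5, Conv.refl _ _⟩
    obtain ⟨A, B, s, hsort, h5, h6⟩ := this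
    obtain ⟨h7, h8⟩ := ((h6.rename hT ρ).symm.trans h2).pi_injective hT
    obtain ⟨h9, h10⟩ := h5.pi_inv_sort hW hsort
    have h11 := h3.conv (Or.inl rfl) h9 ((h4.trans h7.symm).of_rename hT hρ.leftInv)
    refine ⟨_, .app (h1.conv hsort h5 h6) h11, ?_⟩
    rw [inst_rename]
    exact h8.inst hT (Conv.refl _ _)
  | conv _ _ _ hc ih1 _ =>
    intro Γ ρ ρ' t hρ hΓ hΔ ht
    obtain ⟨B, h1, h2⟩ := ih1 hρ hΓ hΔ ht
    exact ⟨B, h1, h2.trans hc⟩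

/-- The form in which strengthening justifies dropping an unused binder. The alternatives in `hs`
are needed because the type may be `kind`, which has no type itself. -/
theorem HasType.of_lift (hW : WF Th) (hΓ : Ctx Th Γ) {A t B s : Exp N}
    (hA : HasType Th Γ A Exp.type)
    (h : HasType Th (A :: Γ) t.lift B.lift) (hs : B = s ∧ IsSort s ∨ IsSort s ∧ HasType Th Γ B s) :
    HasType Th Γ t B := by
  have hT := hW.sane
  have hρ : ∀ i, Nat.pred (Nat.succ i) = i := fun _ => rfl
  obtain ⟨C, h1, h2⟩ := h.strengthen_exists hW
    (⟨Ren.succ A, hρ, fun i hi => Nat.lt_of_succ_lt_succ hi⟩ : Emb Γ Nat.succ Nat.pred (A :: Γ))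
    hΓ ⟨hΓ, hA⟩ rfl
  have h2 := h2.of_rename hT hρ
  rcases hs with ⟨rfl, rfl | rfl⟩ | ⟨hs, h'⟩
  · exact h1.conv (Or.inr rfl) (.type _) h2
  · obtain rfl | ⟨s, hs, h'⟩ := h1.type_correct hW hΓ
    · exact h1
    · exact (h'.not_conv_kind hW hΓ hs h2).elim
  · exact h1.conv hs h' h2

end Meta

/-! ### Where logical relations are defined -/

section Defined

theorem isSort_index {s : Exp N} (hs : IsSort s) (sh : N → Option Sh) :
    ∃ σ, shape sh s = some σ ∧ ∀ b, setStar b σ = base b := by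
  rcases hs with rfl | rfl
  · exact ⟨_, rfl, fun _ => rfl⟩
  · exact ⟨_, rfl, fun _ => rfl⟩

theorem setStar_of_lev {σ : Sh} (h : lev σ = 0) (b : Bool) : setStar b σ = σ := by
  induction σ with
  | base b => rfl
  | star => cases h
  | box => cases h
  | arr σ τ _ ih => exact congrArg _ (ih h)

theorem bit_setStar {σ : Sh} (h : lev σ ≠ 0) (b : Bool) : bit (setStar b σ) = b := by
  induction σ with
  | base b => exact (h rfl).elim
  | star => rfl
  | box => rfl
  | arr σ τ _ ih => exact ih h

/-- The bit of the shape of an expression. -/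
def ebit (sh : N → Option Sh) (t : Exp N) : Bool :=
  match shape sh t with
  | some τ => bit τ
  | none => false

theorem ebit_of_shape {sh : N → Option Sh} {t : Exp N} {τ : Sh} (h : shape sh t = some τ) :
    ebit sh t = bit τ := by
  rw [ebit, h]

/-- The shape of the translation of an expression `t` of type `A`. -/
def index (sh : N → Option Sh) (t A : Exp N) : Sh :=
  match shape sh A with
  | some τ => setStar (ebit sh t) τ
  | none => base false

theorem index_of_shape {sh : N → Option Sh} {t A : Exp N} {τ : Sh} (h : shape sh A = some τ) :
    index sh t A = setStar (ebit sh t) τ := by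
  rw [index, h]

variable {m : N → Exp N'} {r : N → Option (Exp N')}

/-- The value of `rel` at a `Π`-type. -/
def piRel (mA mAB : Exp N') (oA : Option (Exp N')) (RB : Exp N') : Exp N' :=
  match oA with
  | some RA => lam mAB (pi mA.lift (pi (betaApp RA.lift.lift (var 0))
      (betaApp (RB.rename (upr (upr Nat.succ))) (app (var 2) (var 1)))))
  | none => lam mAB (pi mA.lift (betaApp (RB.rename (upr Nat.succ)) (app (var 1) (var 0))))

/-- The value of `rel` at a `λ`-abstraction. -/
def lamRel (mA : Exp N') (oA : Option (Exp N')) (Rt : Exp N') : Exp N' :=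
  match oA with
  | some RA => lam mA (lam (betaApp RA.lift (var 0)) Rt)
  | none => lam mA Rt

/-- The value of `rel` at an application. -/
def appRel (mt : Exp N') (ot : Option (Exp N')) (Rf : Exp N') : Exp N' :=
  match ot with
  | some Rt => app (app Rf mt) Rt
  | none => app Rf mt

theorem rel_pi (ε : List Bool) (A B : Exp N) : rel m r ε (pi A B) =
    (rel m r ((rel m r ε A).isSome :: ε) B).map (piRel ((A.bind m).rename (idx ε))
      (((pi A B).bind m).rename (idx ε)) (rel m r ε A)) := by
  rw [rel]
  cases rel m r ε A <;> rfl

theorem rel_lam (ε : List Bool) (A t : Exp N) : rel m r ε (lam A t) =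
    (rel m r ((rel m r ε A).isSome :: ε) t).map
      (lamRel ((A.bind m).rename (idx ε)) (rel m r ε A)) := by
  rw [rel]
  cases rel m r ε A <;> rfl

theorem rel_app (ε : List Bool) (f t : Exp N) : rel m r ε (app f t) =
    (rel m r ε f).map (appRel ((t.bind m).rename (idx ε)) (rel m r ε t)) := by
  rw [rel]
  cases rel m r ε t <;> rfl

theorem starIdx_isSome : ∀ (ε : List Bool) (i : ℕ),
    (starIdx ε i).isSome = (ε[i]?).getD false
  | [], i => rfl
  | b :: ε, 0 => by cases b <;> rfl
  | b :: ε, i + 1 => by simp [starIdx, starIdx_isSome ε i]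

/-- `r` is defined for a constant if the bit of its shape is set. -/
def RelBits (S : List (Decl N N)) (r : N → Option (Exp N')) (sh : N → Option Sh) : Prop :=
  ∀ d ∈ S, (r d.name).isSome = bit (index sh (const d.name) d.type)

variable {S : List (Decl N N)} {sh : N → Option Sh} {p : N → Bool}

theorem index_sort {s : Exp N} (hsort : IsSort s)
    (t : Exp N) : index sh t s = base (ebit sh t) := by
  obtain ⟨σ, h, h'⟩ := isSort_index hsort sh
  rw [index_of_shape h, h']

/-- Whether a logical relation is defined for a well-typed expression. -/
theorem RelBits.isSome_rel (hS : WF S) (hs : Shaping S p sh) (hr : RelBits S r sh)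
    {Γ : List (Exp N)} {t A : Exp N} (h : HasType S Γ t A) : Ctx S Γ →
    (rel m r (Γ.map (ebit sh)) t).isSome = bit (index sh t A) := by
  have hT := hS.sane
  have sort : ∀ {s : Exp N} (t : Exp N), IsSort s → index sh t s = base (ebit sh t) :=
    fun t hsort => index_sort hsort t
  -- For an argument or a domain that is not translated, `rel` drops the starred copy instead of
  -- failing. So definedness is always inherited from the body, the codomain or the function, that
  -- is, from the target of the shape.
  induction h with
  | type Γ => intro _; rfl
  | const Γ d hd => intro _; exact hr d hd
  | var Γ i A hA =>
    intro hΓ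
    obtain ⟨σ, hσ, h0⟩ := hΓ.ctxSh hs hT A (List.mem_of_getElem? hA)
    rw [index_of_shape ((shape_rename _ _).trans hσ), setStar_of_lev h0, rel, Option.isSome_map,
      starIdx_isSome, List.getElem?_map, hA]
    exact ebit_of_shape hσ
  | pi h1 hsort h2 ih1 ih2 =>
    intro hΓ
    obtain ⟨a, ha, _⟩ := hs.hasType_type hT h1 (hΓ.ctxSh hs hT)
    obtain ⟨b, hb, _⟩ := hs.hasType_sort hT h2 hsort (Ctx.ctxSh (Γ := _ :: _) hs hT ⟨hΓ, h1⟩)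
    rw [rel_pi, Option.isSome_map, ih1 hΓ, sort _ (Or.inl rfl), sort _ hsort]
    refine (ih2 ⟨hΓ, h1⟩).trans ?_
    rw [sort _ hsort, Sh.bit, Sh.bit, ebit_of_shape hb,
      ebit_of_shape (shape_pi.2 ⟨a, b, ha, hb, rfl⟩)]
    rfl
  | lam h1 hsort h2 h3 ih1 ih2 ih3 =>
    intro hΓ
    obtain ⟨a, ha, _⟩ := hs.hasType_type hT h1 (hΓ.ctxSh hs hT)
    obtain ⟨b, hb, _⟩ := hs.hasType_sort hT h2 hsort (Ctx.ctxSh (Γ := _ :: _) hs hT ⟨hΓ, h1⟩)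
    rw [rel_lam, Option.isSome_map, ih1 hΓ, sort _ (Or.inl rfl)]
    refine (ih3 ⟨hΓ, h1⟩).trans ?_
    rw [index_of_shape hb, index_of_shape (shape_pi.2 ⟨a, b, ha, hb, rfl⟩)]
    rfl
  | app h1 h2 ih1 ih2 =>
    intro hΓ
    obtain ⟨_, hσ, _⟩ := hs.hasType hT h1 (hΓ.ctxSh hs hT)
    obtain ⟨a, b, ha, hb, rfl⟩ := shape_pi.1 hσ
    rw [rel_app, Option.isSome_map, ih1 hΓ, index_of_shape hσ, index_of_shape (shape_inst hb)]
    rfl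
  | conv h1 hsort h2 hc ih1 ih2 =>
    intro hΓ
    obtain ⟨σ, hσ, _⟩ := hs.hasType hT h1 (hΓ.ctxSh hs hT)
    obtain ⟨τ, hτ, _⟩ := hs.hasType_sort hT h2 hsort (hΓ.ctxSh hs hT)
    obtain rfl := hs.conv hT hc hσ hτ
    rw [ih1 hΓ, index_of_shape hσ, index_of_shape hτ]

/-- The index of convertible expressions of the same type. -/
theorem Shaping.index_eq (hS : WF S) (hs : Shaping S p sh) {Γ : List (Exp N)} {t t' A : Exp N}
    (hΓ : CtxSh sh Γ) (h : HasType S Γ t A) (h' : HasType S Γ t' A) (hc : Conv S t t') :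
    index sh t A = index sh t' A := by
  obtain ⟨σ, hσ, h1, h2⟩ := hs.hasType hS.sane h hΓ
  obtain ⟨σ', hσ', h3, h4⟩ := hs.hasType hS.sane h' hΓ
  obtain rfl := Option.some.inj (hσ.symm.trans hσ')
  rw [index_of_shape hσ, index_of_shape hσ]
  have key : (∃ τ, shape sh t = some τ) → (∃ τ, shape sh t' = some τ) → 
      ebit sh t = ebit sh t' := by
    rintro ⟨τ, hτ⟩ ⟨τ', hτ'⟩
    obtain rfl := hs.conv hS.sane hc hτ hτ'
    rw [ebit_of_shape hτ, ebit_of_shape hτ']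
  obtain h0 | h0 | h0 : lev σ = 0 ∨ lev σ = 1 ∨ lev σ = 2 := by
    have : lev σ ≤ 2 := by
      clear * -
      induction σ with
      | arr σ τ _ ih => exact ih
      | _ => simp [lev]
    omega
  · rw [setStar_of_lev h0, setStar_of_lev h0]
  · rw [key ((h2 h0).imp fun _ h => h.1) ((h4 h0).imp fun _ h => h.1)]
  · rw [key ((h1 h0).imp fun _ h => h.1) ((h3 h0).imp fun _ h => h.1)]

theorem Shaping.mono {S' : List (Decl N N)} (h : ∀ d ∈ S', d ∈ S) (hs : Shaping S p sh) :
    Shaping S' p sh :=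
  ⟨fun d hd => hs.type d (h d hd), fun d hd => hs.defn d (h d hd), fun d hd => hs.prim d (h d hd)⟩

theorem Shaping.ebit_type (hS : WF S) (hs : Shaping S p sh) {Γ : List (Exp N)} {A : Exp N}
    (hΓ : CtxSh sh Γ) (h : HasType S Γ A Exp.type) :
    ∃ σ, shape sh A = some σ ∧ lev σ = 0 ∧ ebit sh A = bit σ := by
  obtain ⟨σ, hσ, h0⟩ := hs.hasType_type hS.sane h hΓ
  exact ⟨σ, hσ, h0, ebit_of_shape hσ⟩

/-- By induction on the theory. The bit of a type-level constant is prescribed by the shaping or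
inherited from the definition, which the relation respects. For a term constant, the relation is
defined for it only if it is for the type, by the definition of logical relations, and conversely by
term-totality. -/
theorem RelBits.of_isLogRel {T : List (Decl N' N')} (hS : WF S)
    (hs : Shaping S (fun c => (r c).isSome) sh) (hr : IsLogRel S T m r) (ht : TermTotal S m r) :
    RelBits S r sh := by
  induction hS with
  | nil => intro d hd; cases hd
  | @cons S d s hS hn hsort hty hdef ih =>
    have hm : ∀ e ∈ S, e ∈ d :: S := fun e he => List.mem_cons_of_mem _ he
    have ih := ih (hs.mono hm) (fun e he => hr e (hm e he))
      fun e he h => ht e (hm e he) (h.mono hm)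
    have hs' := hs.mono hm
    have hT := hS.sane
    intro e he
    rcases List.mem_cons.1 he with rfl | he
    · have hd : e ∈ e :: S := List.mem_cons_self
      obtain ⟨σ, hσ, ⟨h1, τ, hτ, _⟩ | ⟨h0, h⟩⟩ := hs.type e hd
      · rw [index_of_shape hσ, bit_setStar (by omega), ebit_of_shape (t := Exp.const e.name) hτ]
        cases hde : e.defn with
        | none => rw [hs.prim e hd hde τ hτ]; rfl
        | some t =>
          have h3 := ih.isSome_rel (m := m) hS hs' (hdef t hde) trivial
          rw [index_of_shape hσ, bit_setStar (by omega),
            ebit_of_shape (hs.defn e hd t hde τ hτ)] at h3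
          rw [← h3]
          have h4 := (hr e hd).2 t hde
          simp only [List.map_nil]
          revert h4
          generalize r e.name = a
          generalize rel m r [] t = b
          rintro (_ | _) <;> rfl
      · rw [index_of_shape hσ, setStar_of_lev h0]
        have htype : s = Exp.type := by
          obtain ⟨σ', hσ', h⟩ := hs'.hasType_sort hT hty hsort CtxSh.nil
          obtain rfl := Option.some.inj (hσ.symm.trans hσ')
          rcases h with ⟨h, _⟩ | ⟨_, h⟩
          · exact h
          · omega
        subst htype
        have h3 := ih.isSome_rel (m := m) hS hs' hty trivial
        rw [index_of_shape (A := Exp.type) rfl, ebit_of_shape hσ] at h3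
        change _ = bit σ at h3
        rw [← h3, Bool.eq_iff_iff]
        constructor
        · intro h
          obtain ⟨R, hR⟩ := Option.isSome_iff_exists.1 h
          obtain ⟨RA, hRA, _⟩ := (hr e hd).1 R hR
          exact Option.isSome_iff_exists.2 ⟨RA, hRA⟩
        · exact ht e hd (hty.mono hm)
    · exact ih e he

end Defined

/-! ### The doubled translation -/

section Doubled

/-- Coercions between translations, in which all variables have copies, and the values of `rel`:
to the former for `true`, and to the latter for `false`. -/
def coer : Bool → Sh → Exp N → Exp N
  | u, arr σ τ, f =>
    if bit σ then
      lam type (lam type (coer u τ (app (app f.lift.lift (var 1)) (coer (!u) σ (var 0)))))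
    -- An argument that `rel` drops: towards the doubled form its starred copy is accepted and
    -- ignored, and in the other direction the dummy `type` is supplied for it.
    else if u then lam type (lam type (coer true τ (app f.lift.lift (var 1))))
    else lam type (coer false τ (app (app f.lift (var 0)) type))
  | _, _, f => f

theorem coer_subst (σ : Sh) : ∀ (u : Bool) (f : Exp N) (s : ℕ → Exp N),
    (coer u σ f).subst s = coer u σ (f.subst s) := by
  induction σ with
  | base b => intro u f s; rfl
  | star => intro u f s; rfl
  | box => intro u f s; rfl
  | arr σ τ ih1 ih2 =>
    intro u f s
    simp only [coer]
    split_ifs with h1 h2 <;> simp [subst, ih1, ih2, lift_subst_ups, ups, rename]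

theorem coer_rename (σ : Sh) (u : Bool) (f : Exp N) (ρ : ℕ → ℕ) :
    (coer u σ f).rename ρ = coer u σ (f.rename ρ) := by
  simp only [rename_eq_subst, coer_subst]

theorem coer_conv {T : List (Decl N N)} (hT : Sane T) (σ : Sh) : ∀ (u : Bool) {f g : Exp N},
    Conv T f g → Conv T (coer u σ f) (coer u σ g) := by
  induction σ with
  | base b => intro u f g h; exact h
  | star => intro u f g h; exact h
  | box => intro u f g h; exact h
  | arr σ τ ih1 ih2 =>
    intro u f g h
    simp only [coer]
    split_ifs with h1 h2
    · exact Conv.lam_body _ _ (Conv.lam_body _ _ (ih2 _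
        (Conv.app (Conv.app ((h.lift hT).lift hT) (Conv.refl _ _)) (Conv.refl _ _))))
    · exact Conv.lam_body _ _ (Conv.lam_body _ _ (ih2 _
        (Conv.app ((h.lift hT).lift hT) (Conv.refl _ _))))
    · exact Conv.lam_body _ _ (ih2 _
        (Conv.app (Conv.app (h.lift hT) (Conv.refl _ _)) (Conv.refl _ _)))

/-- Extend a substitution by two expressions. -/
def cons2 (X x : Exp N) (γ : ℕ → Exp N) : ℕ → Exp N
  | 0 => X
  | 1 => x
  | i + 2 => γ i

/-- The doubled translation of a `Π`-type. -/
def dblPi (o : Option Sh) (mA RA RB : Exp N) : Exp N :=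
  lam type (pi mA.lift (match o with
    | some σ =>
      if bit σ then pi (app RA.lift.lift (var 0))
        (app (RB.subst (cons2 (coer true σ (var 0)) (var 1) fun i => var (i + 3)))
          (app (var 2) (var 1)))
      else app (RB.subst (cons2 type (var 0) fun i => var (i + 2))) (app (var 1) (var 0))
    | none => app (RB.subst (cons2 type (var 0) fun i => var (i + 2))) (app (var 1) (var 0))))

theorem dblPi_subst (o : Option Sh) (mA RA RB : Exp N) (s : ℕ → Exp N) :
    (dblPi o mA RA RB).subst s = dblPi o (mA.subst s) (RA.subst s) (RB.subst (ups (ups s))) := by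
  have h1 : (RB.subst (cons2 type (var 0) fun i => var (i + 2))).subst (ups (ups s)) =
      (RB.subst (ups (ups s))).subst (cons2 type (var 0) fun i => var (i + 2)) := by
    simp only [subst_subst]
    congr 1; funext i
    rcases i with _ | _ | i
    · rfl
    · rfl
    · simp only [cons2, subst, ups, rename_subst, rename_rename]
      rw [rename_eq_subst]
  cases o with
  | none =>
    simp only [dblPi, subst, lift_subst_ups, h1]; rfl
  | some σ =>
    simp only [dblPi]
    split_ifs with h
    · simp only [subst, lift_subst_ups, subst_subst]
      have h2 : (fun i => (cons2 (coer true σ (var 0)) (var 1) (fun i => var (i + 3)) i).subst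
            (ups (ups (ups s)))) =
          fun i => (ups (ups s) i).subst
            (cons2 (coer true σ (var 0)) (var 1) fun i => var (i + 3)) := by
        funext i
        rcases i with _ | _ | i
        · simp only [cons2, coer_subst, ups, subst]
        · rfl
        · simp only [cons2, subst, ups, rename_subst, rename_rename]
          rw [rename_eq_subst]
      rw [h2]; rfl
    · simp only [subst, lift_subst_ups, h1]; rfl

theorem dblPi_rename (o : Option Sh) (mA RA RB : Exp N) (ρ : ℕ → ℕ) : (dblPi o mA RA RB).rename ρ =
    dblPi o (mA.rename ρ) (RA.rename ρ) (RB.rename (upr (upr ρ))) := by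
  simp only [rename_eq_subst, dblPi_subst, ups_var_comp]

theorem dblPi_conv {T : List (Decl N N)} (hT : Sane T) (o : Option Sh)
    {mA RA RB mA' RA' RB' : Exp N}
    (h1 : Conv T mA mA') (h2 : Conv T RA RA') (h3 : Conv T RB RB') :
    Conv T (dblPi o mA RA RB) (dblPi o mA' RA' RB') := by
  refine Conv.lam_body _ _ (Conv.pi (h1.lift hT) ?_)
  cases o with
  | none => exact Conv.app (h3.subst hT _) (Conv.refl _ _)
  | some σ =>
    simp only
    split_ifs with h
    · exact Conv.pi (Conv.app ((h2.lift hT).lift hT) (Conv.refl _ _))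
        (Conv.app (h3.subst hT _) (Conv.refl _ _))
    · exact Conv.app (h3.subst hT _) (Conv.refl _ _)

/-- The copy with even numbers gets the values of `a`, and that with odd numbers those of `b`. -/
def interleave {α : Type*} (a b : ℕ → α) (j : ℕ) : α := if j % 2 = 0 then a (j / 2) else b (j / 2)

theorem interleave_even {α : Type*} (a b : ℕ → α) (i : ℕ) : interleave a b (2 * i) = a i := by
  simp [interleave]

theorem interleave_odd {α : Type*} (a b : ℕ → α) (i : ℕ) : interleave a b (2 * i + 1) = b i := by
  have h1 : (2 * i + 1) % 2 ≠ 0 := by omega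
  have h2 : (2 * i + 1) / 2 = i := by omega
  rw [interleave, if_neg h1, h2]

theorem even_or_odd_ind {P : ℕ → Prop} (h0 : ∀ i, P (2 * i)) (h1 : ∀ i, P (2 * i + 1)) (j : ℕ) :
    P j := by
  obtain ⟨i, rfl | rfl⟩ : ∃ i, j = 2 * i ∨ j = 2 * i + 1 := ⟨j / 2, by omega⟩
  · exact h0 i
  · exact h1 i

theorem interleave_ups (a b a' b' : ℕ → Exp N) (ha0 : a' 0 = var 0) (hb0 : b' 0 = var 1)
    (ha : ∀ i, a' (i + 1) = (a i).lift.lift) (hb : ∀ i, b' (i + 1) = (b i).lift.lift) :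
    interleave a' b' = ups (ups (interleave a b)) := by
  funext j
  revert j
  refine even_or_odd_ind (fun i => ?_) fun i => ?_
  · rw [interleave_even]
    cases i with
    | zero => exact ha0
    | succ i =>
      change _ = ((interleave a b (2 * i)).rename Nat.succ).rename Nat.succ
      rw [interleave_even, ha]; rfl
  · rw [interleave_odd]
    cases i with
    | zero => exact hb0
    | succ i =>
      change _ = ((interleave a b (2 * i + 1)).rename Nat.succ).rename Nat.succ
      rw [interleave_odd, hb]; rfl

variable (m : N → Exp N') (c : N → Exp N') (sh : N → Option Sh)

/-- The image of an expression under `m`, over a context with copies of all variables. -/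
def dblMor (t : Exp N) : Exp N' := (t.bind m).rename fun i => 2 * i + 1

/-- The variant of `rel` in which all variables and all arguments have copies. -/
def dbl : Exp N → Exp N'
  | const x => c x
  | var i => var (2 * i)
  | type => lam type (pi (var 0) type)
  -- A dummy value that makes the translation total.
  | kind => type
  | lam _ t => lam type (lam type (dbl t))
  | pi A B => dblPi (shape sh A) (dblMor m A) (dbl A) (dbl B)
  | app f t => app (app (dbl f) (dblMor m t)) (dbl t)

/-- The renaming of a context with copies. -/
def dblRen (ρ : ℕ → ℕ) : ℕ → ℕ := interleave (fun i => 2 * ρ i) fun i => 2 * ρ i + 1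

theorem dblRen_upr (ρ : ℕ → ℕ) : upr (upr (dblRen ρ)) = dblRen (upr ρ) := by
  funext j
  revert j
  refine even_or_odd_ind (fun i => ?_) fun i => ?_
  · change _ = interleave (fun i => 2 * upr ρ i) _ (2 * i)
    rw [interleave_even]
    cases i with
    | zero => rfl
    | succ i =>
      change dblRen ρ (2 * i) + 1 + 1 = _
      rw [dblRen, interleave_even]; rfl
  · change _ = interleave _ (fun i => 2 * upr ρ i + 1) (2 * i + 1)
    rw [interleave_odd]
    cases i with
    | zero => rfl
    | succ i =>
      change dblRen ρ (2 * i + 1) + 1 + 1 = _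
      rw [dblRen, interleave_odd]; rfl

variable {m c sh}

theorem dblMor_rename (hm : ∀ c, (m c).Closed) (t : Exp N) (ρ : ℕ → ℕ) :
    dblMor m (t.rename ρ) = (dblMor m t).rename (dblRen ρ) := by
  simp only [dblMor, bind_rename hm, rename_rename, dblRen, interleave_odd]

theorem dblMor_subst (hm : ∀ c, (m c).Closed) (t : Exp N) (σ : ℕ → Exp N) (a : ℕ → Exp N') :
    dblMor m (t.subst σ) = (dblMor m t).subst (interleave a fun i => dblMor m (σ i)) := by
  simp only [dblMor, bind_subst hm, rename_subst, subst_rename, interleave_odd]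

theorem dbl_rename (hm : ∀ c, (m c).Closed) (hc : ∀ x, (c x).Closed) (t : Exp N) :
    ∀ ρ : ℕ → ℕ, dbl m c sh (t.rename ρ) = (dbl m c sh t).rename (dblRen ρ) := by
  induction t with
  | const x => intro ρ; exact ((hc x).rename_eq _).symm
  | var i =>
    intro ρ
    simp only [rename, dbl, dblRen, interleave_even]
  | type => intro ρ; rfl
  | kind => intro ρ; rfl
  | lam A t _ ih => intro ρ; simp only [rename, dbl, ih, dblRen_upr]
  | pi A B ih1 ih2 =>
    intro ρ
    simp only [rename, dbl, ih1, ih2, dblPi_rename, dblRen_upr, dblMor_rename hm, shape_rename]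
  | app f t ih1 ih2 => intro ρ; simp only [rename, dbl, ih1, ih2, dblMor_rename hm]

/-- The domains of `Π`-types have shapes. -/
def DomOK (sh : N → Option Sh) : Exp N → Prop
  | const _ => True
  | var _ => True
  | type => True
  | kind => True
  | lam _ t => DomOK sh t
  | pi A B => (∃ σ, shape sh A = some σ) ∧ DomOK sh A ∧ DomOK sh B
  | app f t => DomOK sh f ∧ DomOK sh t

theorem dblRen_succ : dblRen Nat.succ = fun i => i + 2 := by
  funext j
  revert j
  refine even_or_odd_ind (fun i => ?_) fun i => ?_
  · rw [dblRen, interleave_even]; rfl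
  · rw [dblRen, interleave_odd]; rfl

theorem lift_lift_eq (t : Exp N) : t.lift.lift = t.rename fun i => i + 2 := by
  rw [lift, lift, rename_rename]

theorem dbl_lift (hm : ∀ c, (m c).Closed) (hc : ∀ x, (c x).Closed) (t : Exp N) :
    dbl m c sh (t.rename Nat.succ) = (dbl m c sh t).lift.lift := by
  rw [dbl_rename hm hc, dblRen_succ, lift_lift_eq]

theorem dblMor_lift (hm : ∀ c, (m c).Closed) (t : Exp N) :
    dblMor m (t.rename Nat.succ) = (dblMor m t).lift.lift := by
  rw [dblMor_rename hm, dblRen_succ, lift_lift_eq]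

/-- The substitution that corresponds to `σ` in contexts with copies. -/
def dblSub (m : N → Exp N') (c : N → Exp N') (sh : N → Option Sh) (σ : ℕ → Exp N) : ℕ → Exp N' :=
  interleave (fun i => dbl m c sh (σ i)) fun i => dblMor m (σ i)

theorem dblSub_ups (hm : ∀ c, (m c).Closed) (hc : ∀ x, (c x).Closed) (σ : ℕ → Exp N) :
    dblSub m c sh (ups σ) = ups (ups (dblSub m c sh σ)) :=
  interleave_ups _ _ _ _ rfl rfl (fun _ => dbl_lift hm hc _) fun _ => dblMor_lift hm _

/-- As all variables have both copies, the translation needs no record of the context and does not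
look at the domains of abstractions. So it commutes with substitution even for ill-typed
expressions, provided that the domains of Π-types have shapes, on which `dblPi` branches. -/
theorem dbl_subst (hm : ∀ c, (m c).Closed) (hc : ∀ x, (c x).Closed) (t : Exp N) :
    DomOK sh t → ∀ σ : ℕ → Exp N,
      dbl m c sh (t.subst σ) = (dbl m c sh t).subst (dblSub m c sh σ) := by
  induction t with
  | const x => intro _ σ; exact ((hc x).subst_eq _).symm
  | var i => intro _ σ; simp only [subst, dbl, dblSub, interleave_even]
  | type => intro _ σ; rfl
  | kind => intro _ σ; rfl
  | lam A t _ ih => intro h σ; simp only [subst, dbl, ih h, dblSub_ups hm hc]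
  | pi A B ih1 ih2 =>
    rintro ⟨⟨a, ha⟩, h1, h2⟩ σ
    simp only [subst, dbl, ih1 h1, ih2 h2, dblPi_subst, dblSub_ups hm hc, ha, shape_subst ha]
    congr 1
    exact dblMor_subst hm _ _ _
  | app f t ih1 ih2 =>
    rintro ⟨h1, h2⟩ σ
    simp only [subst, dbl, ih1 h1, ih2 h2]
    congr 2
    exact dblMor_subst hm _ _ _

theorem dbl_inst (hm : ∀ c, (m c).Closed) (hc : ∀ x, (c x).Closed) {t : Exp N} (ht : DomOK sh t)
    (s : Exp N) : dbl m c sh (t.inst s) =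
      (dbl m c sh t).subst (cons2 (dbl m c sh s) (dblMor m s) var) := by
  rw [inst, dbl_subst hm hc t ht]
  congr 1; funext j
  revert j
  refine even_or_odd_ind (fun i => ?_) fun i => ?_
  · rw [dblSub, interleave_even]
    cases i <;> rfl
  · rw [dblSub, interleave_odd]
    cases i <;> rfl

theorem conv_lam_lam {T : List (Decl N N)} (A B t x X : Exp N) :
    Conv T (app (app (lam A (lam B t)) x) X) (t.subst (cons2 X x var)) := by
  refine (Conv.app (Conv.beta _ _ _) (Conv.refl _ _)).trans ((Conv.beta _ _ _).trans (.of_eq ?_))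
  simp only [inst, subst_subst]
  congr 1; funext i
  rcases i with _ | _ | i
  · rfl
  · simp only [cons2, ups, single, rename_subst]
    exact subst_var x
  · rfl

variable {S : List (Decl N N)} {T : List (Decl N' N')} {p : N → Bool}

theorem DomOK.rename {t : Exp N} : ∀ {ρ : ℕ → ℕ}, DomOK sh t → DomOK sh (t.rename ρ) := by
  induction t with
  | lam A t _ ih => intro ρ h; exact ih (ρ := upr ρ) h
  | pi A B ih1 ih2 =>
    rintro ρ ⟨⟨a, ha⟩, h1, h2⟩
    exact ⟨⟨a, (shape_rename _ _).trans ha⟩, ih1 h1, ih2 h2⟩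
  | app f t ih1 ih2 => rintro ρ ⟨h1, h2⟩; exact ⟨ih1 h1, ih2 h2⟩
  | _ => intro ρ h; exact trivial

theorem DomOK.of_rename {t : Exp N} : ∀ {ρ : ℕ → ℕ}, DomOK sh (t.rename ρ) → DomOK sh t := by
  induction t with
  | lam A t _ ih => intro ρ h; exact ih (ρ := upr ρ) h
  | pi A B ih1 ih2 =>
    rintro ρ ⟨⟨a, ha⟩, h1, h2⟩
    exact ⟨⟨a, (shape_rename _ _).symm.trans ha⟩, ih1 h1, ih2 h2⟩
  | app f t ih1 ih2 => rintro ρ ⟨h1, h2⟩; exact ⟨ih1 h1, ih2 h2⟩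
  | _ => intro ρ h; exact trivial

theorem DomOK.subst {t : Exp N} : ∀ {σ : ℕ → Exp N}, DomOK sh t → (∀ i, DomOK sh (σ i)) →
    DomOK sh (t.subst σ) := by
  have hup : ∀ {σ : ℕ → Exp N}, (∀ i, DomOK sh (σ i)) → ∀ i, DomOK sh (ups σ i) := by
    rintro σ h (_ | i)
    · trivial
    · exact (h i).rename
  induction t with
  | var i => intro σ _ h; exact h i
  | lam A t _ ih => intro σ h h'; exact ih (σ := ups σ) h (hup h')
  | pi A B ih1 ih2 =>
    rintro σ ⟨⟨a, ha⟩, h1, h2⟩ h'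
    exact ⟨⟨a, shape_subst ha⟩, ih1 h1 h', ih2 h2 (hup h')⟩
  | app f t ih1 ih2 => rintro σ ⟨h1, h2⟩ h'; exact ⟨ih1 h1 h', ih2 h2 h'⟩
  | _ => intro σ h _; exact trivial

theorem DomOK.er {t : Exp N} : DomOK sh (er t) ↔ DomOK sh t := by
  induction t <;> simp_all [DomOK, LF.er, shape_er]

theorem DomOK.par (hs : Shaping S p sh)
    (hd : ∀ d ∈ S, ∀ t, d.defn = some t → DomOK sh t) {a b : Exp N} (h : Par S a b) :
    DomOK sh a → DomOK sh b := by
  induction h with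
  | const c => exact id
  | var i => exact id
  | type => exact id
  | kind => exact id
  | lam _ ih => exact ih
  | pi h _ ih1 ih2 => rintro ⟨⟨a, ha⟩, h1, h2⟩; exact ⟨⟨a, hs.par h ha⟩, ih1 h1, ih2 h2⟩
  | app _ _ ih1 ih2 => rintro ⟨h1, h2⟩; exact ⟨ih1 h1, ih2 h2⟩
  | beta _ _ ih1 ih2 =>
    rintro ⟨h1, h2⟩
    refine DomOK.subst (ih1 h1) ?_
    rintro (_ | i)
    · exact ih2 h2
    · trivial
  | eta _ ih => rintro ⟨h1, _⟩; exact ih h1.of_rename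
  | delta d t hd' ht => intro _; exact DomOK.er.2 (hd d hd' t ht)

theorem dblMor_conv (hT : Sane T) (hm : ∀ c, (m c).Closed) (hmor : IsMorphism S T m) {a b : Exp N}
    (h : Conv S a b) : Conv T (dblMor m a) (dblMor m b) := (h.bind hm hmor).rename hT _

theorem dbl_er (hT : Sane T) (hm : ∀ c, (m c).Closed) (hmor : IsMorphism S T m) (t : Exp N) :
    Conv T (dbl m c sh (er t)) (dbl m c sh t) := by
  have h : ∀ t : Exp N, Conv T (dblMor m (er t)) (dblMor m t) := fun t =>
    dblMor_conv hT hm hmor (Conv.er t)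
  induction t with
  | lam A t _ ih => exact Conv.lam_body _ _ (Conv.lam_body _ _ ih)
  | pi A B ih1 ih2 =>
    simp only [LF.er, dbl, shape_er]
    exact dblPi_conv hT _ (h A) ih1 ih2
  | app f t ih1 ih2 => exact Conv.app (Conv.app ih1 (h t)) ih2
  | _ => exact Conv.refl _ _

/-- The doubled translation is invariant under reduction. -/
theorem dbl_par (hT : Sane T) (hm : ∀ c, (m c).Closed) (hc : ∀ x, (c x).Closed)
    (hmor : IsMorphism S T m) (hs : Shaping S p sh)
    (hd : ∀ d ∈ S, ∀ t, d.defn = some t → DomOK sh t ∧ Conv T (c d.name) (dbl m c sh t))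
    {a b : Exp N} (h : Par S a b) : DomOK sh a → Conv T (dbl m c sh a) (dbl m c sh b) := by
  have hd' := fun d hd' t ht => (hd d hd' t ht).1
  induction h with
  | const c => intro _; exact Conv.refl _ _
  | var i => intro _; exact Conv.refl _ _
  | type => intro _; exact Conv.refl _ _
  | kind => intro _; exact Conv.refl _ _
  | lam _ ih => intro h; exact Conv.lam_body _ _ (Conv.lam_body _ _ (ih h))
  | pi h _ ih1 ih2 =>
    rintro ⟨⟨a, ha⟩, h1, h2⟩
    simp only [dbl, ha, hs.par h ha]
    exact dblPi_conv hT _ (dblMor_conv hT hm hmor h.conv) (ih1 h1) (ih2 h2)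
  | app _ h ih1 ih2 =>
    rintro ⟨h1, h2⟩
    exact Conv.app (Conv.app (ih1 h1) (dblMor_conv hT hm hmor h.conv)) (ih2 h2)
  | beta h h' ih1 ih2 =>
    rintro ⟨h1, h2⟩
    rw [dbl_inst hm hc (DomOK.par hs hd' h h1)]
    refine (Conv.app (Conv.app (Conv.lam_body _ type (Conv.lam_body _ type (ih1 h1)))
      (dblMor_conv hT hm hmor h'.conv)) (ih2 h2)).trans ?_
    exact conv_lam_lam _ _ _ _ _
  | @eta f f' _ ih =>
    rintro ⟨h1, _⟩
    refine Conv.trans ?_ (ih h1.of_rename)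
    simp only [dbl, lift, dbl_lift hm hc]
    -- Two η-steps, one for each copy of the argument.
    exact (Conv.lam_body _ type (Conv.eta type (app (dbl m c sh f).lift (var 0)))).trans
      (Conv.eta type _)
  | delta d t hd₀ ht =>
    intro _
    exact (hd d hd₀ t ht).2.trans (dbl_er hT hm hmor t).symm

/-- The two reductions to a common reduct may pass through ill-typed expressions. What survives
along them is `DomOK`, and that suffices for the invariance of `dbl`. -/
theorem dbl_conv (hS : Sane S) (hT : Sane T) (hm : ∀ c, (m c).Closed) (hc : ∀ x, (c x).Closed)
    (hmor : IsMorphism S T m) (hs : Shaping S p sh)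
    (hd : ∀ d ∈ S, ∀ t, d.defn = some t → DomOK sh t ∧ Conv T (c d.name) (dbl m c sh t))
    {a b : Exp N} (h : Conv S a b) (ha : DomOK sh a) (hb : DomOK sh b) :
    Conv T (dbl m c sh a) (dbl m c sh b) := by
  have key : ∀ {a b : Exp N}, Par.Star S a b → DomOK sh a → 
      DomOK sh b ∧ Conv T (dbl m c sh a) (dbl m c sh b) := by
    intro a b h ha
    induction h with
    | refl => exact ⟨ha, Conv.refl _ _⟩
    | tail _ h ih =>
      exact ⟨ih.1.par hs (fun d hd' t ht => (hd d hd' t ht).1) h,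
        ih.2.trans (dbl_par hT hm hc hmor hs hd h ih.1)⟩
  obtain ⟨e, h1, h2⟩ := h.common_reduct hS
  exact (dbl_er hT hm hmor a).symm.trans ((key h1 (DomOK.er.2 ha)).2.trans
    ((key h2 (DomOK.er.2 hb)).2.symm.trans (dbl_er hT hm hmor b)))

theorem DomOK.of_hasType (hS : WF S) (hs : Shaping S p sh) {Γ : List (Exp N)} {t A : Exp N}
    (h : HasType S Γ t A) : Ctx S Γ → DomOK sh t := by
  induction h with
  | pi h1 _ h2 ih1 ih2 =>
    intro hΓ
    exact ⟨(hs.hasType_type hS.sane h1 (hΓ.ctxSh hs hS.sane)).imp fun _ h => h.1, ih1 hΓ,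
      ih2 ⟨hΓ, h1⟩⟩
  | lam h1 _ _ _ _ _ ih3 => intro hΓ; exact ih3 ⟨hΓ, h1⟩
  | app _ _ ih1 ih2 => intro hΓ; exact ⟨ih1 hΓ, ih2 hΓ⟩
  | conv _ _ _ _ ih _ => exact ih
  | _ => intro _; exact trivial

end Doubled

/-! ### Logical relations respect conversion -/

section Similar

/-- The relation between values of `rel` and of `dbl`. -/
def Sim (T : List (Decl N N)) : Sh → Exp N → Exp N → Prop
  | base true, f, F => Conv T f F
  | base false, _, _ => True
  | Sh.star, f, F => Conv T f F
  | box, f, F => Conv T f F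
  -- The quantification over renamings makes the relation stable under weakening. The plain argument
  -- x is common to both sides; only the starred arguments X and Y differ, and the left side gets
  -- one only if the bit is set.
  | arr σ τ, f, F => ∀ (ρ : ℕ → ℕ) (x X Y : Exp N), Sim T σ X Y →
      Sim T τ (if bit σ then app (app (f.rename ρ) x) X else app (f.rename ρ) x)
        (app (app (F.rename ρ) x) Y)

variable {T : List (Decl N N)}

theorem Sim.conv (hT : Sane T) {σ : Sh} : ∀ {f f' F F' : Exp N}, Sim T σ f F → Conv T f f' →
    Conv T F F' → Sim T σ f' F' := by
  induction σ with
  | base b =>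
    intro f f' F F' h h1 h2
    cases b with
    | false => trivial
    | true => exact Conv.trans h1.symm (Conv.trans h h2)
  | star => intro f f' F F' h h1 h2; exact Conv.trans h1.symm (Conv.trans h h2)
  | box => intro f f' F F' h h1 h2; exact Conv.trans h1.symm (Conv.trans h h2)
  | arr σ τ ih1 ih2 =>
    intro f f' F F' h h1 h2 ρ x X Y hXY
    refine ih2 (h ρ x X Y hXY) ?_ (Conv.app (Conv.app (h2.rename hT ρ) (Conv.refl _ _))
      (Conv.refl _ _))
    split_ifs
    · exact Conv.app (Conv.app (h1.rename hT ρ) (Conv.refl _ _)) (Conv.refl _ _)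
    · exact Conv.app (h1.rename hT ρ) (Conv.refl _ _)

theorem Sim.rename (hT : Sane T) {σ : Sh} {f F : Exp N} (h : Sim T σ f F) (ρ : ℕ → ℕ) :
    Sim T σ (f.rename ρ) (F.rename ρ) := by
  cases σ with
  | base b =>
    cases b with
    | false => trivial
    | true => exact Conv.rename hT h ρ
  | star => exact Conv.rename hT h ρ
  | box => exact Conv.rename hT h ρ
  | arr σ τ =>
    intro ρ' x X Y hXY
    rw [rename_rename, rename_rename]
    exact h _ x X Y hXY

theorem Sim.of_bit {σ : Sh} (h : bit σ = false) : ∀ {f F : Exp N}, Sim T σ f F := by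
  induction σ with
  | base b => intro f F; cases h; trivial
  | star => cases h
  | box => cases h
  | arr σ τ _ ih => intro f F ρ x X Y _; exact ih h

theorem Sim.base {f F : Exp N} {b : Bool} (h : Conv T f F) : Sim T (base b) f F := by
  cases b
  · trivial
  · exact h

/-- Reification and reflection as in normalization by evaluation. They are proved together because
`coer` changes its direction at domains. Reification needs the bit: where it is not set, `Sim` says
nothing. -/
theorem Sim.reify_reflect (hT : Sane T) (σ : Sh) :
    (bit σ = true → ∀ {f F : Exp N}, Sim T σ f F → Conv T f (coer false σ F)) ∧
      ∀ f : Exp N, Sim T σ f (coer true σ f) := by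
  induction σ with
  | base b => exact ⟨fun h f F h' => by cases h; exact h', fun f => Sim.base (Conv.refl _ _)⟩
  | star => exact ⟨fun h f F h' => h', fun f => Conv.refl _ _⟩
  | box => exact ⟨fun h f F h' => h', fun f => Conv.refl _ _⟩
  | arr σ τ ih1 ih2 =>
    refine ⟨fun hb f F h => ?_, fun f => ?_⟩
    · simp only [coer]
      split_ifs with h1 h2
      · have h3 := h (fun i => i + 2) (var 1) (var 0) _ (ih1.2 (var 0))
        rw [if_pos h1] at h3
        have h4 := ih2.1 hb h3
        rw [← lift_lift_eq, ← lift_lift_eq] at h4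
        refine Conv.trans (Conv.symm ?_) (Conv.lam_body type _ (Conv.lam_body type _ h4))
        exact (Conv.lam_body _ type (Conv.eta type (app f.lift (var 0)))).trans (Conv.eta type _)
      · simp at h2
      · have h3 := h Nat.succ (var 0) type type (Sim.of_bit (by simpa using h1))
        rw [if_neg h1] at h3
        have h4 := ih2.1 hb h3
        exact (Conv.eta type f).symm.trans (Conv.lam_body type _ h4)
    · intro ρ x X Y hXY
      simp only [coer]
      split_ifs with h1
      · have h2 := ih1.1 h1 hXY
        refine (ih2.2 (app (app (f.rename ρ) x) X)).conv hT (Conv.refl _ _) (Conv.symm ?_)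
        refine (conv_lam_lam _ _ _ _ _).trans ?_
        rw [coer_rename, coer_subst]
        refine coer_conv hT _ _ ?_
        have e : ((f.rename (upr (upr ρ) ∘ Nat.succ ∘ Nat.succ)).subst (cons2 Y x var)) =
            f.rename ρ := by
          rw [rename_subst, rename_eq_subst]; rfl
        have e' : (f.lift.lift.rename (upr (upr ρ))).subst (cons2 Y x var) = f.rename ρ := by
          simp only [lift, rename_rename]; exact e
        simp only [Exp.rename, subst, coer_rename, coer_subst, Bool.not_true]
        rw [e']
        exact Conv.app (Conv.refl _ _) h2.symm
      · refine (ih2.2 (app (f.rename ρ) x)).conv hT (Conv.refl _ _) (Conv.symm ?_)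
        refine (conv_lam_lam _ _ _ _ _).trans ?_
        rw [coer_rename, coer_subst]
        refine coer_conv hT _ _ (.of_eq ?_)
        have e' : (f.lift.lift.rename (upr (upr ρ))).subst (cons2 Y x var) = f.rename ρ := by
          simp only [lift, rename_rename, rename_subst]
          rw [rename_eq_subst]; rfl
        simp only [Exp.rename, subst, e']
        rfl

end Similar

/-! ### Comparison of the partial with the doubled translation -/

section Fundamental

variable {S : List (Decl N N)} {T : List (Decl N' N')} {p : N → Bool} {m : N → Exp N'}
  {r : N → Option (Exp N')} {c : N → Exp N'} {sh : N → Option Sh}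

/-- Related substitutions. -/
def SimSub (T : List (Decl N' N')) (sh : N → Option Sh) (Γ : List (Exp N))
    (γ γ' : ℕ → Exp N') : Prop :=
  (∀ i, Conv T (γ (idx (Γ.map (ebit sh)) i)) (γ' (2 * i + 1))) ∧
  ∀ i A σ, Γ[i]? = some A → shape sh A = some σ →
    ∀ j, starIdx (Γ.map (ebit sh)) i = some j → Sim T σ (γ j) (γ' (2 * i))

theorem SimSub.cons_true {Γ : List (Exp N)} {γ γ' : ℕ → Exp N'} {A : Exp N} {σ : Sh}
    (h : SimSub T sh Γ γ γ') (hA : shape sh A = some σ) (hb : bit σ = true) {x x' X Y : Exp N'}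
    (hx : Conv T x x') (hX : Sim T σ X Y) :
    SimSub T sh (A :: Γ) (cons2 X x γ) (cons2 Y x' γ') := by
  have hbit : ebit sh A = true := (ebit_of_shape hA).trans hb
  constructor
  · rintro (_ | i)
    · simp only [List.map_cons, hbit, idx]; exact hx
    · simp only [List.map_cons, hbit, idx]; exact h.1 i
  · rintro (_ | i) B τ hB hτ j hj
    · cases hB
      obtain rfl := Option.some.inj (hA.symm.trans hτ)
      simp only [List.map_cons, hbit, starIdx] at hj
      cases hj; exact hX
    · simp only [List.map_cons, hbit, starIdx, Option.map_eq_some_iff] at hj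
      obtain ⟨j, hj, rfl⟩ := hj
      exact h.2 i B τ hB hτ j hj

/-- Extend a substitution by one expression. -/
def cons1 (x : Exp N) (γ : ℕ → Exp N) : ℕ → Exp N
  | 0 => x
  | i + 1 => γ i

theorem SimSub.cons_false {Γ : List (Exp N)} {γ γ' : ℕ → Exp N'} {A : Exp N} {σ : Sh}
    (h : SimSub T sh Γ γ γ') (hA : shape sh A = some σ) (hb : bit σ = false) {x x' Y : Exp N'}
    (hx : Conv T x x') : SimSub T sh (A :: Γ) (cons1 x γ) (cons2 Y x' γ') := by
  have hbit : ebit sh A = false := (ebit_of_shape hA).trans hb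
  constructor
  · rintro (_ | i)
    · simp only [List.map_cons, hbit, idx]; exact hx
    · simp only [List.map_cons, hbit, idx]; exact h.1 i
  · rintro (_ | i) B τ hB hτ j hj
    · simp [List.map_cons, hbit, starIdx] at hj
    · simp only [List.map_cons, hbit, starIdx, Option.map_eq_some_iff] at hj
      obtain ⟨j, hj, rfl⟩ := hj
      exact h.2 i B τ hB hτ j hj

theorem SimSub.rename (hT : Sane T) {Γ : List (Exp N)} {γ γ' : ℕ → Exp N'}
    (h : SimSub T sh Γ γ γ') (ρ : ℕ → ℕ) :
    SimSub T sh Γ (fun i => (γ i).rename ρ) fun i => (γ' i).rename ρ :=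
  ⟨fun i => (h.1 i).rename hT ρ, fun i A σ hA hσ j hj => (h.2 i A σ hA hσ j hj).rename hT ρ⟩

theorem SimSub.dblMor (hT : Sane T) {Γ : List (Exp N)} {γ γ' : ℕ → Exp N'}
    (h : SimSub T sh Γ γ γ') (t : Exp N) :
    Conv T (((t.bind m).rename (idx (Γ.map (ebit sh)))).subst γ) ((dblMor m t).subst γ') := by
  rw [LF.dblMor, rename_subst, rename_subst]
  exact Conv.subst_right hT _ h.1

/-- The hypotheses under which `rel` and `dbl` are compared. -/
structure DblData (S : List (Decl N N)) (T : List (Decl N' N')) (m : N → Exp N')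
    (r : N → Option (Exp N')) (sh : N → Option Sh) (c : N → Exp N') : Prop where
  rClosed : ∀ d ∈ S, ∀ R, r d.name = some R → R.Closed
  cClosed : ∀ x, (c x).Closed
  sim : ∀ d ∈ S, ∀ R, r d.name = some R → Sim T (index sh (const d.name) d.type) R (c d.name)
  defn : ∀ d ∈ S, ∀ t, d.defn = some t → Conv T (c d.name) (dbl m c sh t)

/-- The codomain on the doubled side expects the doubled form of the bound starred variable, which
is why this variable enters `h3` through `coer true σ`. -/
theorem piRel_some_conv (hT : Sane T) {σ : Sh} (hσ : bit σ = true)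
    {mA mAB RA RB mA' RA' RB' : Exp N'}
    {γ γ' : ℕ → Exp N'} (h1 : Conv T (mA.subst γ) (mA'.subst γ'))
    (h2 : Conv T (RA.subst γ) (RA'.subst γ'))
    (h3 : Conv T (RB.subst (cons2 (var 0) (var 1) fun i => (γ i).rename (· + 3)))
      (RB'.subst (cons2 (coer true σ (var 0)) (var 1) fun i => (γ' i).rename (· + 3)))) :
    Conv T ((piRel mA mAB (some RA) RB).subst γ) ((dblPi (some σ) mA' RA' RB').subst γ') := by
  rw [dblPi_subst]
  simp only [piRel, dblPi, hσ, if_true, subst, lift_subst_ups]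
  refine Conv.lam_body _ _ (Conv.pi (h1.lift hT) (Conv.pi ?_ ?_))
  · refine ((Conv.betaApp _ _).subst hT _).trans ?_
    simp only [subst, lift_subst_ups]
    exact Conv.app ((h2.lift hT).lift hT) (Conv.refl _ _)
  · refine ((Conv.betaApp _ _).subst hT _).trans ?_
    refine Conv.app ?_ (Conv.refl _ _)
    rw [rename_subst, subst_subst]
    convert h3 using 2
    · funext i
      rcases i with _ | _ | i
      · rfl
      · rfl
      · simp only [upr, ups, cons2, rename_rename]
    · funext i
      rcases i with _ | _ | i
      · rfl
      · rfl
      · simp only [ups, cons2, rename_subst, rename_rename]; rw [rename_eq_subst]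

theorem piRel_none_conv (hT : Sane T) {σ : Sh} (hσ : bit σ = false) {mA mAB RB mA' RA' RB' : Exp N'}
    {γ γ' : ℕ → Exp N'} (h1 : Conv T (mA.subst γ) (mA'.subst γ'))
    (h3 : Conv T (RB.subst (cons1 (var 0) fun i => (γ i).rename (· + 2)))
      (RB'.subst (cons2 type (var 0) fun i => (γ' i).rename (· + 2)))) :
    Conv T ((piRel mA mAB none RB).subst γ) ((dblPi (some σ) mA' RA' RB').subst γ') := by
  rw [dblPi_subst]
  simp only [piRel, dblPi, hσ, subst, lift_subst_ups]
  refine Conv.lam_body _ _ (Conv.pi (h1.lift hT) ?_)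
  refine ((Conv.betaApp _ _).subst hT _).trans ?_
  refine Conv.app ?_ (Conv.refl _ _)
  rw [rename_subst, subst_subst]
  convert h3 using 2
  · funext i
    rcases i with _ | i
    · rfl
    · simp only [upr, ups, cons1, rename_rename]
  · funext i
    rcases i with _ | _ | i
    · rfl
    · rfl
    · simp only [ups, cons2, rename_subst, rename_rename]; rw [rename_eq_subst]

/-- The values of `rel` and of `dbl` at a well-typed expression are related. -/
theorem DblData.sim_rel (hS : WF S) (hT : Sane T) (hs : Shaping S p sh) (hr : RelBits S r sh)
    (h : DblData S T m r sh c) {Γ : List (Exp N)} {t A : Exp N} (ht : HasType S Γ t A) :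
    Ctx S Γ → ∀ {γ γ' : ℕ → Exp N'}, SimSub T sh Γ γ γ' → ∀ {R : Exp N'},
      rel m r (Γ.map (ebit sh)) t = some R →
      Sim T (index sh t A) (R.subst γ) ((dbl m c sh t).subst γ') := by
  have hS' := hS.sane
  have isSome_type : ∀ {Γ : List (Exp N)} {A : Exp N}, Ctx S Γ → HasType S Γ A type →
      (rel m r (Γ.map (ebit sh)) A).isSome = ebit sh A := by
    intro Γ A hΓ hA
    rw [hr.isSome_rel hS hs hA hΓ, index_sort (Or.inl rfl)]; rfl
  induction ht with
  | type Γ =>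
    intro _ γ γ' _ R hR
    cases hR
    exact Sim.base (Conv.refl _ _)
  | const Γ d hd =>
    intro _ γ γ' _ R hR
    have hR : r d.name = some R := hR
    rw [(h.rClosed d hd R hR).subst_eq, dbl, (h.cClosed _).subst_eq]
    exact h.sim d hd R hR
  | var Γ i A hA =>
    intro hΓ γ γ' hγ R hR
    obtain ⟨σ, hσ, h0⟩ := hΓ.ctxSh hs hS' A (List.mem_of_getElem? hA)
    rw [index_of_shape ((shape_rename _ _).trans hσ), setStar_of_lev h0]
    rw [rel, Option.map_eq_some_iff] at hR
    obtain ⟨j, hj, rfl⟩ := hR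
    exact hγ.2 i A σ hA hσ j hj
  | pi h1 hsort h2 ih1 ih2 =>
    rename_i Γ A B s
    intro hΓ γ γ' hγ R hR
    have hΓ' : Ctx S (A :: Γ) := ⟨hΓ, h1⟩
    obtain ⟨σ, hσ, h0, hbit⟩ := hs.ebit_type hS (hΓ.ctxSh hs hS') h1
    rw [rel_pi, isSome_type hΓ h1] at hR
    obtain ⟨RB, hRB, rfl⟩ := Option.map_eq_some_iff.1 hR
    have ihB := fun {γ γ' : ℕ → Exp N'} (h : SimSub T sh (A :: Γ) γ γ') => ih2 hΓ' h hRB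
    have bitB := hr.isSome_rel (m := m) hS hs h2 hΓ'
    rw [index_sort hsort, List.map_cons, hRB] at bitB
    rw [index_sort hsort, (show ebit sh B = true from bitB.symm)] at ihB
    rw [index_sort hsort]
    refine Sim.base ?_
    rw [dbl, hσ]
    have hoA := isSome_type hΓ h1
    cases hRA : rel m r (Γ.map (ebit sh)) A with
    | some RA =>
      rw [hRA] at hoA
      have hb : bit σ = true := hbit.symm.trans hoA.symm
      refine piRel_some_conv hT hb (hγ.dblMor hT A) ?_ ?_
      · have := ih1 hΓ hγ hRA
        rwa [index_sort (Or.inl rfl), ← hoA] at this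
      -- By reflection, the bound starred variable is related to its own coercion.
      · exact ihB (SimSub.cons_true (hγ.rename hT (· + 3)) hσ hb (Conv.refl _ _)
          ((Sim.reify_reflect hT σ).2 _))
    | none =>
      rw [hRA] at hoA
      have hb : bit σ = false := hbit.symm.trans hoA.symm
      refine piRel_none_conv hT hb (hγ.dblMor hT A) ?_
      exact ihB (SimSub.cons_false (hγ.rename hT (· + 2)) hσ hb (Conv.refl _ _))
  | lam h1 hsort h2 h3 ih1 ih2 ih3 =>
    rename_i Γ A B t s
    intro hΓ γ γ' hγ R hR
    have hΓ' : Ctx S (A :: Γ) := ⟨hΓ, h1⟩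
    obtain ⟨σ, hσ, h0, hbit⟩ := hs.ebit_type hS (hΓ.ctxSh hs hS') h1
    obtain ⟨τ, hτ, _⟩ := hs.hasType_sort hS' h2 hsort (hΓ'.ctxSh hs hS')
    rw [rel_lam, isSome_type hΓ h1] at hR
    obtain ⟨Rt, hRt, rfl⟩ := Option.map_eq_some_iff.1 hR
    have iht := fun {γ γ' : ℕ → Exp N'} (h : SimSub T sh (A :: Γ) γ γ') => ih3 hΓ' h hRt
    have e : index sh (Exp.lam A t) (Exp.pi A B) = arr σ (index sh t B) := by
      rw [index_of_shape (shape_pi.2 ⟨σ, τ, hσ, hτ, rfl⟩), index_of_shape hτ]; rfl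
    rw [e]
    intro ρ x X Y hXY
    have hoA := isSome_type hΓ h1
    have hbody : Conv T (app (app (((dbl m c sh (Exp.lam A t)).subst γ').rename ρ) x) Y)
        ((dbl m c sh t).subst (cons2 Y x fun i => (γ' i).rename ρ)) := by
      refine (conv_lam_lam _ _ _ _ _).trans (.of_eq ?_)
      simp only [subst_subst, rename_eq_subst]
      congr 1; funext i
      rcases i with _ | _ | i
      · rfl
      · rfl
      · simp only [cons2, ups, subst, rename_subst]; rfl
    cases hRA : rel m r (Γ.map (ebit sh)) A with
    | some RA =>
      rw [hRA] at hoA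
      have hb : bit σ = true := hbit.symm.trans hoA.symm
      rw [if_pos hb]
      refine (iht (SimSub.cons_true (hγ.rename hT ρ) hσ hb (Conv.refl _ x) hXY)).conv hT
        (Conv.symm ?_) hbody.symm
      refine (conv_lam_lam _ _ _ _ _).trans (.of_eq ?_)
      simp only [subst_subst, rename_eq_subst]
      congr 1; funext i
      rcases i with _ | _ | i
      · rfl
      · rfl
      · simp only [cons2, ups, subst, rename_subst]; rfl
    | none =>
      rw [hRA] at hoA
      have hb : bit σ = false := hbit.symm.trans hoA.symm
      rw [if_neg (by rw [hb]; decide)]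
      refine (iht (SimSub.cons_false (hγ.rename hT ρ) hσ hb (Conv.refl _ x))).conv hT
        (Conv.symm ?_) hbody.symm
      refine (Conv.beta _ _ _).trans (.of_eq ?_)
      simp only [inst, subst_subst, rename_eq_subst]
      congr 1; funext i
      rcases i with _ | i
      · rfl
      · simp only [cons1, single, ups, subst, rename_subst]; rfl
  | app h1 h2 ih1 ih2 =>
    rename_i Γ A B f t
    intro hΓ γ γ' hγ R hR
    obtain ⟨_, hσ, _⟩ := hs.hasType hS' h1 (hΓ.ctxSh hs hS')
    obtain ⟨a, b, ha, hb, rfl⟩ := shape_pi.1 hσ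
    rw [rel_app] at hR
    obtain ⟨Rf, hRf, rfl⟩ := Option.map_eq_some_iff.1 hR
    obtain ⟨s, hsort, hA, _⟩ := h1.pi_of_fun hS hΓ
    obtain ⟨a', ha', h0, hbit⟩ := hs.ebit_type hS (hΓ.ctxSh hs hS') hA
    obtain rfl := Option.some.inj (ha.symm.trans ha')
    have hidx : index sh t A = a := by rw [index_of_shape ha, setStar_of_lev h0]
    have hbt := hr.isSome_rel (m := m) hS hs h2 hΓ
    rw [hidx] at hbt
    have ihf := ih1 hΓ hγ hRf
    have e : index sh f (Exp.pi A B) = arr a (index sh (Exp.app f t) (B.inst t)) := by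
      rw [index_of_shape hσ, index_of_shape (shape_inst hb)]; rfl
    rw [e] at ihf
    have hid : ∀ t : Exp N', t.rename (fun i => i) = t := rename_id
    -- If the argument is not translated, the bit of its shape is not set; then `Sim` relates any
    -- two expressions, and the default `type` is harmless.
    have key : Sim T a (((rel m r (Γ.map (ebit sh)) t).getD type).subst γ)
        ((dbl m c sh t).subst γ') := by
      cases hRt : rel m r (Γ.map (ebit sh)) t with
      | some Rt => rw [← hidx]; exact ih2 hΓ hγ hRt
      | none => rw [hRt] at hbt; exact Sim.of_bit hbt.symm
    have := ihf (fun i => i) (((t.bind m).rename (idx (Γ.map (ebit sh)))).subst γ) _ _ key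
    rw [hid, hid] at this
    refine this.conv hT (.of_eq ?_) (Conv.app (Conv.app (Conv.refl _ _) (hγ.dblMor hT t))
      (Conv.refl _ _))
    cases hRt : rel m r (Γ.map (ebit sh)) t with
    | some Rt =>
      have hbt : true = bit a := by rw [hRt] at hbt; exact hbt
      rw [if_pos hbt.symm]; rfl
    | none =>
      have hbt : false = bit a := by rw [hRt] at hbt; exact hbt
      rw [if_neg (by rw [← hbt]; decide)]; rfl
  | conv h1 hsort h2 hc ih1 ih2 =>
    intro hΓ γ γ' hγ R hR
    obtain ⟨σ, hσ, _⟩ := hs.hasType hS' h1 (hΓ.ctxSh hs hS')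
    obtain ⟨τ, hτ, _⟩ := hs.hasType_sort hS' h2 hsort (hΓ.ctxSh hs hS')
    obtain rfl := hs.conv hS' hc hσ hτ
    have := ih1 hΓ hγ hR
    rwa [index_of_shape hσ, ← index_of_shape hτ] at this

/-- A logical relation `r` that is term-total, on a morphism `m` of well-formed theories, and the
shapes of the type-level constants of its domain. -/
structure RelData (S : List (Decl N N)) (T : List (Decl N' N')) (m : N → Exp N')
    (r : N → Option (Exp N')) (sh : N → Option Sh) : Prop where
  wf : WF S
  wfT : WF T
  closed : ∀ x, (m x).Closed
  mor : IsMorphism S T m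
  log : IsLogRel S T m r
  total : TermTotal S m r
  shaping : Shaping S (fun x => (r x).isSome) sh

theorem dbl_congr {P : N → Prop} {c c' : N → Exp N'} (h : ∀ x, P x → c x = c' x) {t : Exp N}
    (ht : Consts P t) : dbl m c sh t = dbl m c' sh t := by
  induction t <;> simp_all [Consts, dbl]

/-- A closed expression is unchanged when `type` is substituted for all variables, and the doubled
form of this substitution leaves no variables. -/
theorem closed_dbl (hm : ∀ x, (m x).Closed) (hc : ∀ x, (c x).Closed) {t : Exp N}
    (ht : t.Closed) (hd : DomOK sh t) : (dbl m c sh t).Closed := by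
  intro j hj
  rw [← ht.subst_eq fun _ => type, dbl_subst hm hc t hd] at hj
  obtain ⟨i, _, h⟩ := occurs_subst _ _ _ hj
  revert h
  revert i
  refine even_or_odd_ind (fun i => ?_) fun i => ?_
  · intro _
    rw [dblSub, interleave_even]
    rintro (h | h | h)
    · exact h
    · cases h
    · exact h
  · intro _
    rw [dblSub, interleave_odd]
    exact False.elim

theorem coer_closed {σ : Sh} {u : Bool} {f : Exp N} (hf : f.Closed) : (coer u σ f).Closed := by
  intro j hj
  rw [← hf.subst_eq fun _ => type, ← coer_subst] at hj
  obtain ⟨i, _, h⟩ := occurs_subst _ _ _ hj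
  exact h

-- By induction on S. A defined constant gets the doubled translation of its definition, as
-- δ-invariance demands; that this is related to the given value is the fundamental lemma for the
-- earlier constants. A primitive one gets the coercion of its value, which is related to it by
-- reflection, or a dummy if there is no value.
open Classical in
theorem RelData.exists_dblData (h : RelData S T m r sh) : ∃ c, DblData S T m r sh c := by
  obtain ⟨hS, hTW, hm, hmor, hr, ht, hs⟩ := h
  have hT := hTW.sane
  induction hS with
  | nil =>
    exact ⟨fun _ => type, fun d hd => by (cases hd), fun _ _ h => h, fun d hd => by (cases hd),
      fun d hd => by (cases hd)⟩
  | @cons S d s hS hn hsort hty hdef ih =>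
    have hsub : ∀ e ∈ S, e ∈ d :: S := fun e he => List.mem_cons_of_mem _ he
    have hs' := hs.mono hsub
    have hr' : IsLogRel S T m r := fun e he => hr e (hsub e he)
    have ht' : TermTotal S m r := fun e he h => ht e (hsub e he) (h.mono hsub)
    obtain ⟨c, hc⟩ := ih (fun e he => hmor e (hsub e he)) hr' ht' hs'
    have hbits := RelBits.of_isLogRel hS hs' hr' ht'
    have hd : d ∈ d :: S := List.mem_cons_self
    have hRcl : ∀ e ∈ d :: S, ∀ R, r e.name = some R → R.Closed := by
      intro e he R hR
      obtain ⟨RA, _, h⟩ := (hr e he).1 R hR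
      exact h.closed
    have key : ∀ X : Exp N', ∀ t, Consts (Declared S) t →
        dbl m (Function.update c d.name X) sh t = dbl m c sh t := by
      intro X t ht
      refine dbl_congr ?_ ht
      rintro x ⟨e, he, rfl⟩
      rw [Function.update_of_ne (hn e he)]
    have new : ∀ X : Exp N', X.Closed →
        (∀ R, r d.name = some R → Sim T (index sh (const d.name) d.type) R X) →
        (∀ t, d.defn = some t → Conv T X (dbl m c sh t)) →
        DblData (d :: S) T m r sh (Function.update c d.name X) := by
      intro X hX h1 h2
      refine ⟨hRcl, fun x => ?_, fun e he => ?_, fun e he => ?_⟩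
      · by_cases hx : x = d.name
        · subst hx; rwa [Function.update_self]
        · rw [Function.update_of_ne hx]; exact hc.cClosed x
      · rcases List.mem_cons.1 he with rfl | he
        · rw [Function.update_self]; exact h1
        · rw [Function.update_of_ne (hn e he)]; exact hc.sim e he
      · rcases List.mem_cons.1 he with rfl | he
        · rw [Function.update_self]
          intro t ht
          rw [key X t (hdef t ht).consts]; exact h2 t ht
        · rw [Function.update_of_ne (hn e he)]
          intro t ht
          rw [key X t ((hS.typed e he).2 t ht).consts]; exact hc.defn e he t ht
    cases hdd : d.defn with
    | none =>
      cases hrd : r d.name with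
      | none =>
        exact ⟨_, new type (fun _ h => h) (fun R hR => by rw [hrd] at hR; cases hR)
          fun t ht => by rw [hdd] at ht; cases ht⟩
      | some R =>
        refine ⟨_, new (coer true (index sh (const d.name) d.type) R)
          (coer_closed (hRcl d hd R hrd)) (fun R' hR' => ?_)
          fun t ht => by rw [hdd] at ht; cases ht⟩
        obtain rfl := Option.some.inj (hrd.symm.trans hR')
        exact (Sim.reify_reflect hT _).2 R
    | some t =>
      have htt := hdef t hdd
      have hcl := closed_dbl (sh := sh) hm hc.cClosed htt.closed
          (DomOK.of_hasType hS hs' htt trivial)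
      refine ⟨_, new (dbl m c sh t) hcl (fun R hR => ?_) fun t' ht' => ?_⟩
      · have h1 := (hr d hd).2 t hdd
        rw [hR] at h1
        generalize hR' : rel m r [] t = o at h1
        cases h1 with
        | some h1 =>
        rename_i R'
        have h2 := hc.sim_rel hS hT hs' hbits htt trivial (γ := var)
          (γ' := interleave var var) ⟨fun i => by rw [interleave_odd]; exact Conv.refl _ _,
            fun i A σ hA => by cases hA⟩ hR'
        rw [hcl.subst_eq, subst_var] at h2
        -- Unfolding does not change the index: a type-level constant has the shape of its
        -- definition, and for a term only the shape of the type counts.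
        have e : index sh (const d.name) d.type = index sh t d.type := by
          obtain ⟨σ, hσ, ⟨_, τ, hτ, _⟩ | ⟨h0, _⟩⟩ := hs.type d hd
          · rw [index_of_shape hσ, index_of_shape hσ, ebit_of_shape (hs.defn d hd t hdd τ hτ),
              ebit_of_shape (t := const d.name) hτ]
          · rw [index_of_shape hσ, index_of_shape hσ, setStar_of_lev h0, setStar_of_lev h0]
        rw [e]
        exact h2.conv hT h1.symm (Conv.refl _ _)
      · obtain rfl := Option.some.inj (hdd.symm.trans ht')
        exact Conv.refl _ _

theorem RelData.bits (h : RelData S T m r sh) : RelBits S r sh :=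
  RelBits.of_isLogRel h.wf h.shaping h.log h.total

/-- Logical relations respect conversion of well-typed expressions. -/
theorem RelData.rel_conv (h : RelData S T m r sh) {Γ : List (Exp N)} (hΓ : Ctx S Γ) {t t' A : Exp N}
    (ht : HasType S Γ t A) (ht' : HasType S Γ t' A) (hc : Conv S t t') :
    Option.Rel (Conv T) (rel m r (Γ.map (ebit sh)) t) (rel m r (Γ.map (ebit sh)) t') := by
  have hidx := h.shaping.index_eq h.wf (hΓ.ctxSh h.shaping h.wf.sane) ht ht' hc
  have h1 := h.bits.isSome_rel (m := m) h.wf h.shaping ht hΓ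
  have h2 := h.bits.isSome_rel (m := m) h.wf h.shaping ht' hΓ
  rw [← hidx] at h2
  obtain ⟨c, hd⟩ := h.exists_dblData
  have hT := h.wfT.sane
  cases hR : rel m r (Γ.map (ebit sh)) t with
  | none =>
    cases hR' : rel m r (Γ.map (ebit sh)) t' with
    | none => exact .none
    | some R' => rw [hR] at h1; rw [hR', ← h1] at h2; cases h2
  | some R =>
    cases hR' : rel m r (Γ.map (ebit sh)) t' with
    | none => rw [hR] at h1; rw [hR', ← h1] at h2; cases h2
    | some R' =>
      refine .some ?_
      rw [hR] at h1
      -- The variables of the translated context, starred ones being coerced to doubled form. Both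
      -- values of `rel` are then reified from the doubled translations under this substitution, and
      -- these are convertible.
      have hγ : SimSub T sh Γ var (interleave
          (fun i => match Γ[i]? with
            | some A => coer true ((shape sh A).getD star)
              (var ((starIdx (Γ.map (ebit sh)) i).getD 0))
            | none => type) fun i => var (idx (Γ.map (ebit sh)) i)) := by
        constructor
        · intro i; rw [interleave_odd]; exact Conv.refl _ _
        · intro i A σ hA hσ j hj
          rw [interleave_even]
          simp only [hA, hσ, hj, Option.getD_some]
          exact (Sim.reify_reflect hT σ).2 _
      have h3 := hd.sim_rel h.wf hT h.shaping h.bits ht hΓ hγ hR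
      have h4 := hd.sim_rel h.wf hT h.shaping h.bits ht' hΓ hγ hR'
      rw [subst_var] at h3 h4
      rw [← hidx] at h4
      have h5 := dbl_conv (c := c) h.wf.sane hT h.closed hd.cClosed h.mor h.shaping
        (fun d hd' t ht => ⟨DomOK.of_hasType h.wf h.shaping ((h.wf.typed d hd').2 t ht) trivial,
          hd.defn d hd' t ht⟩) hc
        (DomOK.of_hasType h.wf h.shaping ht hΓ) (DomOK.of_hasType h.wf h.shaping ht' hΓ)
      exact ((Sim.reify_reflect hT _).1 h1.symm h3).trans
        ((coer_conv hT _ _ (h5.subst hT _)).trans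
          ((Sim.reify_reflect hT _).1 h1.symm h4).symm)

end Fundamental

/-! ### Logical relations and substitution -/

section Substitution

variable {m : N → Exp N'} {r : N → Option (Exp N')} {sh : N → Option Sh}

theorem occurs_bind {m : N → Exp N'} (hm : ∀ c, (m c).Closed) {t : Exp N} :
    ∀ {i : ℕ}, (t.bind m).Occurs i → t.Occurs i := by
  induction t with
  | const c => intro i hi; exact (hm c i hi).elim
  | var j => intro i hi; exact hi
  | type => intro i hi; exact hi
  | kind => intro i hi; exact hi
  | lam A t ihA iht | pi A t ihA iht => intro i hi; exact hi.imp ihA iht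
  | app f t ihf iht => intro i hi; exact hi.imp ihf iht

/-- A renaming under a binder, for a variable with or without starred copy. -/
def uprs (b : Bool) (ρ : ℕ → ℕ) : ℕ → ℕ := if b then upr (upr ρ) else upr ρ

/-- A substitution under a binder, for a variable with or without starred copy. -/
def upss (b : Bool) (τ : ℕ → Exp N) : ℕ → Exp N := if b then ups (ups τ) else ups τ

theorem piRel_rename (mA mAB : Exp N') (oA : Option (Exp N')) (RB : Exp N') (ρ : ℕ → ℕ) :
    (piRel mA mAB oA RB).rename ρ = piRel (mA.rename ρ) (mAB.rename ρ) (oA.map (rename ρ))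
      (RB.rename (uprs oA.isSome ρ)) := by
  have h : ∀ (RB : Exp N') (ρ : ℕ → ℕ), (RB.rename (upr Nat.succ)).rename (upr (upr ρ)) =
      (RB.rename (upr ρ)).rename (upr Nat.succ) := by
    intro RB ρ; simp only [rename_rename]; congr 1; funext i; cases i <;> rfl
  have h' : ∀ (RB : Exp N') (ρ : ℕ → ℕ),
      (RB.rename (upr (upr Nat.succ))).rename (upr (upr (upr ρ))) =
      (RB.rename (upr (upr ρ))).rename (upr (upr Nat.succ)) := by
    intro RB ρ; simp only [rename_rename]; congr 1; funext i; rcases i with _ | _ | i <;> rfl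
  cases oA with
  | none => simp only [piRel, rename, betaApp_rename, lift_rename_upr, h]; rfl
  | some RA => simp only [piRel, rename, betaApp_rename, lift_rename_upr, h', Option.map]; rfl

theorem lamRel_rename (mA : Exp N') (oA : Option (Exp N')) (Rt : Exp N') (ρ : ℕ → ℕ) :
    (lamRel mA oA Rt).rename ρ = lamRel (mA.rename ρ) (oA.map (rename ρ))
      (Rt.rename (uprs oA.isSome ρ)) := by
  cases oA with
  | none => rfl
  | some RA => simp only [lamRel, rename, betaApp_rename, lift_rename_upr, Option.map]; rfl

theorem appRel_rename (mt : Exp N') (ot : Option (Exp N')) (Rf : Exp N') (ρ : ℕ → ℕ) :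
    (appRel mt ot Rf).rename ρ = appRel (mt.rename ρ) (ot.map (rename ρ)) (Rf.rename ρ) := by
  cases ot <;> rfl

/-- The value of `r` at `c` is closed. -/
def RelClosed (r : N → Option (Exp N')) (c : N) : Prop := ∀ R, r c = some R → R.Closed

theorem uprs_vars {ε ε' : List Bool} {ρ ρ' : ℕ → ℕ} (b : Bool) {i : ℕ}
    (h : starIdx ε' (ρ i) = (starIdx ε i).map ρ' ∧ idx ε' (ρ i) = ρ' (idx ε i)) :
    starIdx (b :: ε') (upr ρ (i + 1)) = (starIdx (b :: ε) (i + 1)).map (uprs b ρ') ∧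
      idx (b :: ε') (upr ρ (i + 1)) = uprs b ρ' (idx (b :: ε) (i + 1)) := by
  obtain ⟨h1, h2⟩ := h
  cases b
  · refine ⟨?_, ?_⟩
    · simp only [upr, starIdx, h1, Option.map_map]; rfl
    · simp only [upr, idx, h2]; rfl
  · refine ⟨?_, ?_⟩
    · simp only [upr, starIdx, h1, Option.map_map]; rfl
    · simp only [upr, idx, h2]; rfl

/-- This is an equation and requires no typing. The hypothesis concerns only the variables that
occur, so it is void for closed expressions; that is how `rel_of_closed` follows. -/
theorem rel_rename (hm : ∀ c, (m c).Closed) (e : Exp N) : Consts (RelClosed r) e →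
    ∀ {ε ε' : List Bool} {ρ ρ' : ℕ → ℕ},
    (∀ i, e.Occurs i → starIdx ε' (ρ i) = (starIdx ε i).map ρ' ∧ idx ε' (ρ i) = ρ' (idx ε i)) →
    rel m r ε' (e.rename ρ) = (rel m r ε e).map (rename ρ') := by
  have hmor : ∀ (e : Exp N) {ε ε' : List Bool} {ρ ρ' : ℕ → ℕ},
      (∀ i, e.Occurs i → starIdx ε' (ρ i) = (starIdx ε i).map ρ' ∧ idx ε' (ρ i) = ρ' (idx ε i)) →
      ((e.rename ρ).bind m).rename (idx ε') = ((e.bind m).rename (idx ε)).rename ρ' := by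
    intro e ε ε' ρ ρ' h
    rw [bind_rename hm, rename_rename, rename_rename]
    exact rename_congr _ fun i hi => (h i (occurs_bind hm hi)).2
  have hup : ∀ (b : Bool) {e : Exp N} {ε ε' : List Bool} {ρ ρ' : ℕ → ℕ},
      (∀ i, e.Occurs (i + 1) →
        starIdx ε' (ρ i) = (starIdx ε i).map ρ' ∧ idx ε' (ρ i) = ρ' (idx ε i)) →
      ∀ i, e.Occurs i → starIdx (b :: ε') (upr ρ i) = (starIdx (b :: ε) i).map (uprs b ρ') ∧
        idx (b :: ε') (upr ρ i) = uprs b ρ' (idx (b :: ε) i) := by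
    rintro b e ε ε' ρ ρ' h (_ | i) hi
    · cases b <;> exact ⟨rfl, rfl⟩
    · exact uprs_vars b (h i hi)
  induction e with
  | const c =>
    intro hc ε ε' ρ ρ' _
    have hc : RelClosed r c := hc
    simp only [rename, rel]
    cases hR : r c with
    | none => rfl
    | some R => exact congrArg some ((hc R hR).rename_eq _).symm
  | var i =>
    intro _ ε ε' ρ ρ' h
    simp only [rename, rel, (h i rfl).1, Option.map_map]; rfl
  | type => intro _ ε ε' ρ ρ' _; rfl
  | kind => intro _ ε ε' ρ ρ' _; rfl
  | lam A t ih1 ih2 =>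
    intro hc ε ε' ρ ρ' h
    have h1 := ih1 hc.1 fun i hi => h i (Or.inl hi)
    have h2 := ih2 hc.2 (hup (rel m r ε A).isSome fun i hi => h i (Or.inr hi))
    simp only [rename, rel_lam, h1, Option.isSome_map, h2, Option.map_map,
      hmor A fun i hi => h i (Or.inl hi)]
    congr 1; funext R
    exact (lamRel_rename _ _ _ _).symm
  | pi A B ih1 ih2 =>
    intro hc ε ε' ρ ρ' h
    have h1 := ih1 hc.1 fun i hi => h i (Or.inl hi)
    have h2 := ih2 hc.2 (hup (rel m r ε A).isSome fun i hi => h i (Or.inr hi))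
    have h3 := hmor (Exp.pi A B) h
    rw [rename] at h3
    simp only [rename, rel_pi, h1, Option.isSome_map, h2, Option.map_map, h3,
      hmor A fun i hi => h i (Or.inl hi)]
    congr 1; funext R
    exact (piRel_rename _ _ _ _ _).symm
  | app f t ih1 ih2 =>
    intro hc ε ε' ρ ρ' h
    have h1 := ih1 hc.1 fun i hi => h i (Or.inl hi)
    have h2 := ih2 hc.2 fun i hi => h i (Or.inr hi)
    simp only [rename, rel_app, h1, h2, Option.map_map, hmor t fun i hi => h i (Or.inr hi)]
    congr 1; funext R
    exact (appRel_rename _ _ _ _).symm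

/-- The renaming that corresponds to `succ`. -/
def succs (b : Bool) : ℕ → ℕ := (· + if b then 2 else 1)

theorem rel_lift (hm : ∀ c, (m c).Closed) {e : Exp N} (hc : Consts (RelClosed r) e)
    (b : Bool) (ε : List Bool) :
    rel m r (b :: ε) (e.rename Nat.succ) = (rel m r ε e).map (rename (succs b)) :=
  rel_rename hm e hc fun _ _ => ⟨rfl, rfl⟩

theorem mor_lift (hm : ∀ c, (m c).Closed) (e : Exp N) (b : Bool) (ε : List Bool) :
    ((e.rename Nat.succ).bind m).rename (idx (b :: ε)) =
      ((e.bind m).rename (idx ε)).rename (succs b) := by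
  rw [bind_rename hm, rename_rename, rename_rename]; rfl

theorem rel_of_closed (hm : ∀ c, (m c).Closed) {e : Exp N} (hc : Consts (RelClosed r) e)
    (he : e.Closed) (ε : List Bool) : rel m r ε e = rel m r [] e := by
  have := rel_rename (ρ := fun i => i) (ρ' := fun i => i) (ε := []) (ε' := ε) hm e hc
    fun i hi => (he i hi).elim
  rw [he.rename_eq] at this
  rw [this]
  have h : rename (fun i => i) = (fun t : Exp N' => t) := funext rename_id
  rw [h]; simp

/-- The excluded case is a variable in function position: it may be replaced by an abstraction,
which `betaApp` would contract on one side only. -/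
theorem betaApp_subst {f : Exp N} (hf : ∀ i, f ≠ var i) (s : Exp N) (σ : ℕ → Exp N) :
    (betaApp f s).subst σ = betaApp (f.subst σ) (s.subst σ) := by
  cases f with
  | var i => exact (hf i rfl).elim
  | lam A t => exact inst_subst _ _ _
  | _ => rfl

theorem rename_ne_var {t : Exp N} (ht : ∀ i, t ≠ var i) (ρ : ℕ → ℕ) : ∀ i, t.rename ρ ≠ var i := by
  intro i hi
  cases t with
  | var j => exact ht j rfl
  | _ => cases hi

theorem piRel_subst {mA mAB : Exp N'} {oA : Option (Exp N')} {RB : Exp N'}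
    (hA : ∀ RA ∈ oA, ∀ i, RA ≠ var i) (hB : ∀ i, RB ≠ var i) (τ : ℕ → Exp N') :
    (piRel mA mAB oA RB).subst τ = piRel (mA.subst τ) (mAB.subst τ) (oA.map (subst τ))
      (RB.subst (upss oA.isSome τ)) := by
  have h : ∀ (RB : Exp N') (τ : ℕ → Exp N'), (RB.rename (upr Nat.succ)).subst (ups (ups τ)) =
      (RB.subst (ups τ)).rename (upr Nat.succ) := by
    intro RB τ; simp only [rename_subst, subst_rename]; congr 1; funext i
    cases i with
    | zero => rfl
    | succ i => simp only [upr, ups, rename_rename]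
  have h' : ∀ (RB : Exp N') (τ : ℕ → Exp N'),
      (RB.rename (upr (upr Nat.succ))).subst (ups (ups (ups τ))) =
      (RB.subst (ups (ups τ))).rename (upr (upr Nat.succ)) := by
    intro RB τ; simp only [rename_subst, subst_rename]; congr 1; funext i
    rcases i with _ | _ | i
    · rfl
    · rfl
    · simp only [upr, ups, rename_rename]
  cases oA with
  | none =>
    simp only [piRel, subst, betaApp_subst (rename_ne_var hB _), lift_subst_ups, h]; rfl
  | some RA =>
    have hA := hA RA rfl
    simp only [piRel, subst, betaApp_subst (rename_ne_var hB _),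
      betaApp_subst (rename_ne_var (rename_ne_var hA _) _), lift, Option.map]
    simp only [← lift.eq_1, lift_subst_ups, h']; rfl

theorem lamRel_subst {mA : Exp N'} {oA : Option (Exp N')} {Rt : Exp N'}
    (hA : ∀ RA ∈ oA, ∀ i, RA ≠ var i) (τ : ℕ → Exp N') :
    (lamRel mA oA Rt).subst τ = lamRel (mA.subst τ) (oA.map (subst τ))
      (Rt.subst (upss oA.isSome τ)) := by
  cases oA with
  | none => rfl
  | some RA =>
    have hA := hA RA rfl
    simp only [lamRel, subst, lift, betaApp_subst (rename_ne_var hA _), Option.map]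
    simp only [← lift.eq_1, lift_subst_ups]; rfl

theorem appRel_subst (mt : Exp N') (ot : Option (Exp N')) (Rf : Exp N') (τ : ℕ → Exp N') :
    (appRel mt ot Rf).subst τ = appRel (mt.subst τ) (ot.map (subst τ)) (Rf.subst τ) := by
  cases ot <;> rfl

/-- Only a variable, or a constant whose value is a variable, is translated to a variable. The
former has no shape, and the latter would have a value that is not closed. -/
theorem rel_ne_var {e : Exp N} (hc : Consts (RelClosed r) e) {σ : Sh} (hσ : shape sh e = some σ)
    {ε : List Bool} {R : Exp N'} (hR : rel m r ε e = some R) : ∀ i, R ≠ var i := by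
  rintro i rfl
  cases e with
  | const c => exact (show RelClosed r c from hc) _ hR i rfl
  | var j => cases hσ
  | type => cases hR
  | kind => cases hR
  | lam A t =>
    rw [rel_lam, Option.map_eq_some_iff] at hR
    obtain ⟨R, _, h⟩ := hR
    revert h; cases rel m r ε A <;> exact fun h => by cases h
  | pi A t =>
    rw [rel_pi, Option.map_eq_some_iff] at hR
    obtain ⟨R, _, h⟩ := hR
    revert h; cases rel m r ε A <;> exact fun h => by cases h
  | app f t =>
    rw [rel_app, Option.map_eq_some_iff] at hR
    obtain ⟨R, _, h⟩ := hR
    revert h; cases rel m r ε t <;> exact fun h => by cases h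

/-- The domains of abstractions and the codomains of `Π`-types have shapes. -/
def BindOK (sh : N → Option Sh) : Exp N → Prop
  | const _ => True
  | var _ => True
  | type => True
  | kind => True
  | lam A t => (∃ σ, shape sh A = some σ) ∧ BindOK sh A ∧ BindOK sh t
  | pi A B => (∃ σ, shape sh A = some σ) ∧ (∃ σ, shape sh B = some σ) ∧ BindOK sh A ∧ BindOK sh B
  | app f t => BindOK sh f ∧ BindOK sh t

theorem BindOK.of_hasType {S : List (Decl N N)} {p : N → Bool} (hS : Sane S)
    (hs : Shaping S p sh) {Γ : List (Exp N)}
    {t A : Exp N} (h : HasType S Γ t A) : CtxSh sh Γ → BindOK sh t := by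
  induction h with
  | type => intro _; trivial
  | const => intro _; trivial
  | var => intro _; trivial
  | pi h1 hsort h2 ih1 ih2 =>
    intro hΓ
    obtain ⟨a, ha, h0⟩ := hs.hasType_type hS h1 hΓ
    obtain ⟨b, hb, _⟩ := hs.hasType_sort hS h2 hsort (hΓ.cons ha h0)
    exact ⟨⟨a, ha⟩, ⟨b, hb⟩, ih1 hΓ, ih2 (hΓ.cons ha h0)⟩
  | lam h1 _ _ _ ih1 _ ih3 =>
    intro hΓ
    obtain ⟨a, ha, h0⟩ := hs.hasType_type hS h1 hΓ
    exact ⟨⟨a, ha⟩, ih1 hΓ, ih3 (hΓ.cons ha h0)⟩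
  | app _ _ ih1 ih2 => intro hΓ; exact ⟨ih1 hΓ, ih2 hΓ⟩
  | conv _ _ _ _ ih _ => exact ih

/-- An equation, not merely a conversion. Here σ acts on the original context and τ on the
translated one. `BindOK` ensures that the predicates that `rel` contracts are not variables, so that
contraction commutes with τ. -/
theorem rel_subst (hm : ∀ c, (m c).Closed) (e : Exp N) : Consts (RelClosed r) e → BindOK sh e →
    ∀ {ε ε' : List Bool} {σ : ℕ → Exp N} {τ : ℕ → Exp N'},
    (∀ i, Consts (RelClosed r) (σ i) ∧ rel m r ε' (σ i) = (starIdx ε i).map τ ∧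
      ((σ i).bind m).rename (idx ε') = τ (idx ε i)) →
    rel m r ε' (e.subst σ) = (rel m r ε e).map (subst τ) := by
  have consts_rename : ∀ (t : Exp N) (ρ : ℕ → ℕ), Consts (RelClosed r) t →
      Consts (RelClosed r) (t.rename ρ) := by
    intro t
    induction t with
    | lam A t ih1 ih2 | pi A t ih1 ih2 => intro ρ h; exact ⟨ih1 _ h.1, ih2 _ h.2⟩
    | app f t ih1 ih2 => intro ρ h; exact ⟨ih1 _ h.1, ih2 _ h.2⟩
    | _ => intro ρ h; exact h
  have hmor : ∀ (e : Exp N) {ε ε' : List Bool} {σ : ℕ → Exp N} {τ : ℕ → Exp N'},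
      (∀ i, Consts (RelClosed r) (σ i) ∧ rel m r ε' (σ i) = (starIdx ε i).map τ ∧
        ((σ i).bind m).rename (idx ε') = τ (idx ε i)) →
      ((e.subst σ).bind m).rename (idx ε') = ((e.bind m).rename (idx ε)).subst τ := by
    intro e ε ε' σ τ h
    rw [bind_subst hm, subst_rename, rename_subst]
    congr 1; funext i; exact (h i).2.2
  have hup : ∀ (b : Bool) {ε ε' : List Bool} {σ : ℕ → Exp N} {τ : ℕ → Exp N'},
      (∀ i, Consts (RelClosed r) (σ i) ∧ rel m r ε' (σ i) = (starIdx ε i).map τ ∧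
        ((σ i).bind m).rename (idx ε') = τ (idx ε i)) →
      ∀ i, Consts (RelClosed r) (ups σ i) ∧
        rel m r (b :: ε') (ups σ i) = (starIdx (b :: ε) i).map (upss b τ) ∧
        ((ups σ i).bind m).rename (idx (b :: ε')) = upss b τ (idx (b :: ε) i) := by
    rintro b ε ε' σ τ h (_ | i)
    · cases b <;> exact ⟨trivial, rfl, rfl⟩
    · obtain ⟨h1, h2, h3⟩ := h i
      refine ⟨consts_rename _ _ h1, ?_, ?_⟩
      · rw [ups, rel_lift hm h1, h2]
        simp only [starIdx, Option.map_map]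
        congr 1; funext j
        cases b
        · rfl
        · exact (rename_rename (τ j) Nat.succ Nat.succ).symm
      · rw [ups, mor_lift hm, h3]
        cases b
        · rfl
        · exact (rename_rename _ Nat.succ Nat.succ).symm
  induction e with
  | const c =>
    intro hc _ ε ε' σ τ _
    have hc : RelClosed r c := hc
    simp only [subst, rel]
    cases hR : r c with
    | none => rfl
    | some R => exact congrArg some ((hc R hR).subst_eq _).symm
  | var i =>
    intro _ _ ε ε' σ τ h
    simp only [subst, rel, (h i).2.1, Option.map_map]; rfl
  | type => intros; rfl
  | kind => intros; rfl
  | lam A t ih1 ih2 =>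
    rintro hc ⟨⟨a, ha⟩, hA, ht⟩ ε ε' σ τ h
    have h1 := ih1 hc.1 hA h
    have h2 := ih2 hc.2 ht (hup (rel m r ε A).isSome h)
    simp only [subst, rel_lam, h1, Option.isSome_map, h2, Option.map_map, hmor A h]
    congr 1; funext R
    exact (lamRel_subst (fun RA hRA => rel_ne_var hc.1 ha hRA) _).symm
  | pi A B ih1 ih2 =>
    rintro hc ⟨⟨a, ha⟩, ⟨b, hb⟩, hA, ht⟩ ε ε' σ τ h
    have h1 := ih1 hc.1 hA h
    have h2 := ih2 hc.2 ht (hup (rel m r ε A).isSome h)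
    have h3 := hmor (Exp.pi A B) h
    rw [subst] at h3
    simp only [subst, rel_pi, h1, Option.isSome_map, h2, Option.map_map, h3, hmor A h]
    cases hR : rel m r ((rel m r ε A).isSome :: ε) B with
    | none => rfl
    | some R => exact congrArg some (piRel_subst (fun RA hRA => rel_ne_var hc.1 ha hRA)
        (rel_ne_var hc.2 hb hR) _).symm
  | app f t ih1 ih2 =>
    rintro hc ⟨hf, ht⟩ ε ε' σ τ h
    simp only [subst, rel_app, ih1 hc.1 hf h, ih2 hc.2 ht h, Option.map_map, hmor t h]
    congr 1; funext R
    exact (appRel_subst _ _ _ _).symm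

/-- The substitution of an expression and of its translation, if any. -/
def instRel (o : Option (Exp N')) (x : Exp N') : ℕ → Exp N' :=
  match o with
  | some X => cons2 X x var
  | none => single x

theorem rel_inst (hm : ∀ c, (m c).Closed) {e s : Exp N} (hc : Consts (RelClosed r) e)
    (he : BindOK sh e) (hs : Consts (RelClosed r) s) (ε : List Bool) :
    rel m r ε (e.inst s) = (rel m r ((rel m r ε s).isSome :: ε) e).map
      (subst (instRel (rel m r ε s) ((s.bind m).rename (idx ε)))) := by
  refine rel_subst hm e hc he ?_
  rintro (_ | i)
  · refine ⟨hs, ?_, ?_⟩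
    · rw [single]; cases rel m r ε s <;> rfl
    · cases rel m r ε s <;> rfl
  · refine ⟨trivial, ?_, ?_⟩
    · simp only [starIdx, Option.map_map, single, rel]
      congr 1; funext j
      cases rel m r ε s <;> rfl
    · simp only [single, idx, Exp.bind, Exp.rename]
      cases rel m r ε s <;> rfl

end Substitution
/-! ### The basic lemma -/

section BasicLemma

variable {S : List (Decl N N)} {T : List (Decl N' N')} {m : N → Exp N'}
  {r : N → Option (Exp N')} {sh : N → Option Sh}

/-- The translation of a context. -/
def relCtx (m : N → Exp N') (r : N → Option (Exp N')) (sh : N → Option Sh) :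
    List (Exp N) → List (Exp N')
  | [] => []
  | A :: Γ =>
    match rel m r (Γ.map (ebit sh)) A with
    | some RA => betaApp RA.lift (var 0) ::
        (A.bind m).rename (idx (Γ.map (ebit sh))) :: relCtx m r sh Γ
    | none => (A.bind m).rename (idx (Γ.map (ebit sh))) :: relCtx m r sh Γ

theorem relCtx_some {Γ : List (Exp N)} {A : Exp N} {RA : Exp N'}
    (h : rel m r (Γ.map (ebit sh)) A = some RA) : relCtx m r sh (A :: Γ) =
      betaApp RA.lift (var 0) :: (A.bind m).rename (idx (Γ.map (ebit sh))) :: relCtx m r sh Γ := by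
  rw [relCtx, h]

theorem relCtx_none {Γ : List (Exp N)} {A : Exp N}
    (h : rel m r (Γ.map (ebit sh)) A = none) : relCtx m r sh (A :: Γ) =
      (A.bind m).rename (idx (Γ.map (ebit sh))) :: relCtx m r sh Γ := by
  rw [relCtx, h]

theorem rename_add_one_comp (A : Exp N) (i : ℕ) :
    A.rename (· + (i + 1 + 1)) = (A.rename (· + (i + 1))).rename Nat.succ := by
  rw [rename_rename]; rfl

theorem Consts.of_declared {r : N → Option (Exp N')} {t : Exp N}
    (hcl : ∀ d ∈ S, RelClosed r d.name) (h : Consts (Declared S) t) :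
    Consts (RelClosed r) t := h.mono fun _ ⟨d, hd, e⟩ => e ▸ hcl d hd

theorem IsLogRel.closed (h : IsLogRel S T m r) : ∀ d ∈ S, RelClosed r d.name := by
  intro d hd R hR
  obtain ⟨RA, _, h⟩ := (h d hd).1 R hR
  exact h.closed

theorem RelData.relClosed (h : RelData S T m r sh) {Γ : List (Exp N)} {t A : Exp N}
    (ht : HasType S Γ t A) : Consts (RelClosed r) t := ht.consts.of_declared h.log.closed

theorem Ctx.consts {P : N → Prop} {Γ : List (Exp N)} (hP : ∀ d ∈ S, P d.name) (hΓ : Ctx S Γ) :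
    ∀ A ∈ Γ, Consts P A := by
  induction Γ with
  | nil => intro A hA; cases hA
  | cons B Γ ih =>
    intro A hA
    rcases List.mem_cons.1 hA with rfl | hA
    · exact hΓ.2.consts.mono fun c ⟨d, hd, e⟩ => e ▸ hP d hd
    · exact ih hΓ.1 A hA

theorem rel_isSome_ctx (h : RelData S T m r sh) {Γ : List (Exp N)} (hΓ : Ctx S Γ) {A : Exp N}
    (hA : HasType S Γ A Exp.type) : (rel m r (Γ.map (ebit sh)) A).isSome = ebit sh A := by
  rw [h.bits.isSome_rel h.wf h.shaping hA hΓ, index_sort (Or.inl rfl)]; rfl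

/-- The variables of the translation of a context. -/
theorem RelData.vars (h : RelData S T m r sh) : ∀ {Γ : List (Exp N)}, Ctx S Γ →
    ∀ {i : ℕ} {A : Exp N}, Γ[i]? = some A →
    HasType T (relCtx m r sh Γ) (var (idx (Γ.map (ebit sh)) i))
      (((A.rename (· + (i + 1))).bind m).rename (idx (Γ.map (ebit sh)))) ∧
    ∀ j, starIdx (Γ.map (ebit sh)) i = some j → ∃ RA,
      rel m r (Γ.map (ebit sh)) (A.rename (· + (i + 1))) = some RA ∧
      HasType T (relCtx m r sh Γ) (var j) (betaApp RA (var (idx (Γ.map (ebit sh)) i))) := by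
  intro Γ
  have hT := h.wfT.sane
  induction Γ with
  | nil => intro _ i A hA; cases hA
  | cons B Γ ih =>
    rintro ⟨hΓ, hB⟩ i A hA
    have hsome := rel_isSome_ctx h hΓ hB
    have hBc := h.relClosed hB
    cases hR : rel m r (Γ.map (ebit sh)) B with
    | none =>
      rw [hR] at hsome
      have hb : ebit sh B = false := hsome.symm
      rw [List.map_cons, hb, relCtx_none hR]
      cases i with
      | zero =>
        cases hA
        refine ⟨?_, fun j hj => by cases hj⟩
        have := HasType.var (Th := T)
          ((B.bind m).rename (idx (Γ.map (ebit sh))) :: relCtx m r sh Γ) 0 _ rfl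
        rwa [show (fun x => x + (0 + 1)) = Nat.succ from rfl, mor_lift h.closed]
      | succ i =>
        obtain ⟨h1, h2⟩ := ih hΓ hA
        have hAc := ((Ctx.consts h.log.closed hΓ) A (List.mem_of_getElem? hA))
        have hAc' : Consts (RelClosed r) (A.rename (· + (i + 1))) :=
          h.relClosed (hΓ.get h.wf.sane hA)
        refine ⟨?_, fun j hj => ?_⟩
        · rw [rename_add_one_comp, mor_lift h.closed]
          exact h1.lift hT _
        · simp only [starIdx, Option.map_eq_some_iff] at hj
          obtain ⟨j, hj, rfl⟩ := hj
          obtain ⟨RA, hRA, h3⟩ := h2 j hj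
          refine ⟨RA.lift, ?_, ?_⟩
          · rw [rename_add_one_comp, rel_lift h.closed hAc', hRA]; rfl
          · have := h3.lift hT ((B.bind m).rename (idx (Γ.map (ebit sh))))
            rw [Exp.lift, Exp.lift, betaApp_rename] at this
            exact this
    | some RB =>
      rw [hR] at hsome
      have hb : ebit sh B = true := hsome.symm
      rw [List.map_cons, hb, relCtx_some hR]
      cases i with
      | zero =>
        cases hA
        refine ⟨?_, fun j hj => ?_⟩
        · have := HasType.var (Th := T) (betaApp RB.lift (var 0) ::
            (B.bind m).rename (idx (Γ.map (ebit sh))) :: relCtx m r sh Γ) 1 _ rfl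
          rwa [show (fun x => x + (0 + 1)) = Nat.succ from rfl, mor_lift h.closed]
        · cases hj
          refine ⟨RB.rename (succs true), ?_, ?_⟩
          · rw [show (fun x => x + (0 + 1)) = Nat.succ from rfl, rel_lift h.closed hBc, hR]; rfl
          · have := HasType.var (Th := T) (betaApp RB.lift (var 0) ::
              (B.bind m).rename (idx (Γ.map (ebit sh))) :: relCtx m r sh Γ) 0 _ rfl
            rw [betaApp_rename, Exp.lift, rename_rename] at this
            exact this
      | succ i =>
        obtain ⟨h1, h2⟩ := ih hΓ hA
        have hAc' : Consts (RelClosed r) (A.rename (· + (i + 1))) :=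
          h.relClosed (hΓ.get h.wf.sane hA)
        refine ⟨?_, fun j hj => ?_⟩
        · rw [rename_add_one_comp, mor_lift h.closed]
          have := (h1.lift hT ((B.bind m).rename (idx (Γ.map (ebit sh))))).lift hT
            (betaApp RB.lift (var 0))
          simp only [Exp.lift, Exp.rename, rename_rename] at this ⊢
          exact this
        · simp only [starIdx, Option.map_eq_some_iff] at hj
          obtain ⟨j, hj, rfl⟩ := hj
          obtain ⟨RA, hRA, h3⟩ := h2 j hj
          refine ⟨RA.rename (succs true), ?_, ?_⟩
          · rw [rename_add_one_comp, rel_lift h.closed hAc', hRA]; rfl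
          · have := (h3.lift hT ((B.bind m).rename (idx (Γ.map (ebit sh))))).lift hT
              (betaApp RB.lift (var 0))
            simp only [Exp.lift, Exp.rename, betaApp_rename, rename_rename] at this
            exact this

/-- The translated context contains the image of Γ under m at the positions that `idx` computes, and
further variables in between. So images under m remain well-typed in it. -/
theorem RelData.ren (h : RelData S T m r sh) {Γ : List (Exp N)} (hΓ : Ctx S Γ) :
    Ren (Γ.map (Exp.bind m)) (idx (Γ.map (ebit sh))) (relCtx m r sh Γ) := by
  have key : ∀ {Γ : List (Exp N')} {i : ℕ} {C : Exp N'}, HasType T Γ (var i) C →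
      ∃ A, Γ[i]? = some A := by
    intro Γ i C hC
    have := hC.occurs_lt (i := i) rfl
    exact ⟨_, List.getElem?_eq_getElem this⟩
  induction Γ with
  | nil => intro i A hA; cases hA
  | cons B Γ ih =>
    obtain ⟨hΓ, hB⟩ := hΓ
    have hsome := rel_isSome_ctx h hΓ hB
    have ih := (ih hΓ)
    have step : Ren (B.bind m :: Γ.map (Exp.bind m)) (upr (idx (Γ.map (ebit sh)))) _ := ih.cons _
    cases hR : rel m r (Γ.map (ebit sh)) B with
    | none =>
      rw [hR] at hsome
      have hb : ebit sh B = false := hsome.symm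
      rw [List.map_cons, List.map_cons, hb, relCtx_none hR]
      convert step using 1
      funext i; cases i <;> rfl
    | some RB =>
      rw [hR] at hsome
      have hb : ebit sh B = true := hsome.symm
      rw [List.map_cons, List.map_cons, hb, relCtx_some hR]
      convert step.comp (Ren.succ (betaApp RB.lift (var 0))) using 1
      funext i; cases i <;> rfl

theorem RelData.hasType_mor (h : RelData S T m r sh) {Γ : List (Exp N)} (hΓ : Ctx S Γ)
    {t A : Exp N} (ht : HasType S Γ t A) :
    HasType T (relCtx m r sh Γ) ((t.bind m).rename (idx (Γ.map (ebit sh))))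
      ((A.bind m).rename (idx (Γ.map (ebit sh)))) :=
  (ht.bind h.closed h.mor).rename h.wfT.sane (h.ren hΓ)

/-- The translation of an expression of type `s`, where `s` is a sort, is a predicate. -/
def IsPred (T : List (Decl N' N')) (Γ : List (Exp N')) (R C s : Exp N') : Prop :=
  -- Stated for all arguments in all extensions of the context, since a predicate on the families of
  -- a kind is not a function of LF: the domain of an abstraction must be a type.
  ∀ (Δ : List (Exp N')) (ρ : ℕ → ℕ) (F : Exp N'), Ctx T Δ → Ren Γ ρ Δ →
    HasType T Δ F (C.rename ρ) → HasType T Δ (betaApp (R.rename ρ) F) s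

theorem IsPred.of_hasType (hT : WF T) {Γ : List (Exp N')} {R C : Exp N'}
    (h : HasType T Γ R (pi C type)) : IsPred T Γ R C type := by
  intro Δ ρ F hΔ hρ hF
  exact HasType.betaApp hT hΔ (HasType.app (h.rename hT.sane hρ) hF)

theorem IsPred.betaApp (hT : WF T) {Γ : List (Exp N')} {R C s : Exp N'} (hΓ : Ctx T Γ)
    (h : IsPred T Γ R C s) {F : Exp N'} (hF : HasType T Γ F C) :
    HasType T Γ (Exp.betaApp R F) s := by
  have hid : ∀ t : Exp N', t.rename (fun i => i) = t := rename_id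
  have := h Γ (fun i => i) F hΓ Ren.id (by rwa [hid])
  rwa [hid] at this

theorem IsPred.ctx (hT : WF T) {Γ : List (Exp N')} {R C : Exp N'} (hΓ : Ctx T Γ)
    (hC : HasType T Γ C type) (h : IsPred T Γ R C type) :
    Ctx T (Exp.betaApp R.lift (var 0) :: C :: Γ) :=
  ⟨⟨hΓ, hC⟩, h _ _ _ ⟨hΓ, hC⟩ (Ren.succ C) (.var _ 0 _ rfl)⟩

theorem betaApp_lam (A t s : Exp N) : betaApp (lam A t) s = t.inst s := rfl

/-- The translation of a `Π`-type, applied to a renamed argument. -/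
theorem betaApp_piRel_some {mA mAB RA RB : Exp N'} (hB : ∀ i, RB ≠ var i) (ρ : ℕ → ℕ)
    (F : Exp N') : betaApp ((piRel mA mAB (some RA) RB).rename ρ) F =
      pi (mA.rename ρ) (pi (betaApp (RA.rename ρ).lift (var 0))
        (betaApp (RB.rename (upr (upr ρ))) (app F.lift.lift (var 1)))) := by
  rw [piRel_rename]
  simp only [piRel, Option.map, betaApp_lam, inst, subst]
  congr 1
  · exact lift_inst _ _
  · congr 1
    · have : ∀ (X : Exp N'), betaApp X.lift.lift (var 0) =
          (betaApp X.lift (var 0)).rename (upr Nat.succ) := by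
        intro X
        rw [betaApp_rename]
        simp only [Exp.lift, rename_rename]; rfl
      rw [this, rename_subst]
      conv_rhs => rw [← subst_var (Exp.betaApp _ _)]
      congr 1; funext i; cases i <;> rfl
    · rw [betaApp_subst (rename_ne_var (rename_ne_var hB _) _)]
      congr 1
      · rw [rename_subst]
        conv_rhs => rw [← subst_var (rename _ _)]
        congr 1; funext i; rcases i with _ | _ | i <;> rfl

theorem betaApp_piRel_none {mA mAB RB : Exp N'} (hB : ∀ i, RB ≠ var i) (ρ : ℕ → ℕ)
    (F : Exp N') : betaApp ((piRel mA mAB none RB).rename ρ) F =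
      pi (mA.rename ρ) (betaApp (RB.rename (upr ρ)) (app F.lift (var 0))) := by
  rw [piRel_rename]
  simp only [piRel, Option.map, betaApp_lam, inst, subst]
  congr 1
  · exact lift_inst _ _
  · rw [betaApp_subst (rename_ne_var (rename_ne_var hB _) _)]
    congr 1
    rw [rename_subst]
    conv_rhs => rw [← subst_var (rename _ _)]
    congr 1; funext i; rcases i with _ | i <;> rfl

/-- Both the Π-case and the λ-case of the basic lemma need this, for types as well as for kinds. In
the latter case the induction hypothesis concerns the translation of the type of the body. -/
theorem RelData.basic_pi (h : RelData S T m r sh) {Γ : List (Exp N)} {A B s : Exp N} {s' : Exp N'}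
    (hs' : IsSort s')
    (hΓ : Ctx S Γ) (hA : HasType S Γ A Exp.type) (hsort : IsSort s) (hB : HasType S (A :: Γ) B s)
    {RB : Exp N'} (hRB : rel m r ((rel m r (Γ.map (ebit sh)) A).isSome :: Γ.map (ebit sh)) B
      = some RB)
    (ihA : ∀ RA, rel m r (Γ.map (ebit sh)) A = some RA →
      IsPred T (relCtx m r sh Γ) RA ((A.bind m).rename (idx (Γ.map (ebit sh)))) type)
    (ihB : IsPred T (relCtx m r sh (A :: Γ)) RB
      ((B.bind m).rename (idx ((rel m r (Γ.map (ebit sh)) A).isSome :: Γ.map (ebit sh)))) s') :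
    IsPred T (relCtx m r sh Γ) (piRel ((A.bind m).rename (idx (Γ.map (ebit sh))))
        (((Exp.pi A B).bind m).rename (idx (Γ.map (ebit sh))))
        (rel m r (Γ.map (ebit sh)) A) RB)
      (((Exp.pi A B).bind m).rename (idx (Γ.map (ebit sh)))) s' := by
  intro Δ ρ F hΔ hρ hF
  have hT := h.wfT.sane
  obtain ⟨b, hb, _⟩ := h.shaping.hasType_sort h.wf.sane hB hsort
    (Ctx.ctxSh (Γ := _ :: _) h.shaping h.wf.sane ⟨hΓ, hA⟩)
  have hne := rel_ne_var (h.relClosed hB) hb hRB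
  have hmA := (h.hasType_mor hΓ hA).rename hT hρ
  cases hR : rel m r (Γ.map (ebit sh)) A with
  | some RA =>
    rw [hR] at ihB
    rw [betaApp_piRel_some hne]
    rw [relCtx_some hR] at ihB
    have hren := (hρ.cons ((A.bind m).rename (idx (Γ.map (ebit sh))))).cons
      (betaApp RA.lift (var 0))
    rw [betaApp_rename, lift_rename_upr] at hren
    have hctx := IsPred.ctx (R := RA.rename ρ) h.wfT hΔ hmA (by
      intro Δ' ρ' F' hΔ' hρ' hF'
      rw [rename_rename] at hF' ⊢
      exact ihA RA hR Δ' _ F' hΔ' (hρ.comp hρ') hF')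
    refine .pi hmA hs' (.pi hctx.2 hs' ?_)
    refine ihB _ _ _ hctx hren ?_
    have hF2 := (hF.lift hT ((A.bind m).rename (idx (Γ.map (ebit sh))) |>.rename ρ)).lift hT
      (betaApp (RA.rename ρ).lift (var 0))
    have := HasType.app (B := (((B.bind m).rename (upr (idx (Γ.map (ebit sh))))).rename
      (upr ρ)).rename (upr (fun i => i + 2))) (t := var 1)
      (A := ((A.bind m).rename (idx (Γ.map (ebit sh))) |>.rename ρ).lift.lift) (by
        convert hF2 using 1
        simp only [Exp.bind, Exp.rename, Exp.lift, rename_rename]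
        congr 2; funext i; cases i <;> rfl) (by
        have := HasType.var (Th := T) (betaApp (RA.rename ρ).lift (var 0) ::
          ((A.bind m).rename (idx (Γ.map (ebit sh))) |>.rename ρ) :: Δ) 1 _ rfl
        convert this using 1
        simp only [Exp.lift, rename_rename])
    convert this using 1
    simp only [inst, rename_subst, rename_rename]
    rw [rename_eq_subst]
    congr 1; funext i; rcases i with _ | i <;> rfl
  | none =>
    rw [hR] at ihB
    rw [betaApp_piRel_none hne]
    rw [relCtx_none hR] at ihB
    have hren := (hρ.cons ((A.bind m).rename (idx (Γ.map (ebit sh)))))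
    have hctx : Ctx T (((A.bind m).rename (idx (Γ.map (ebit sh)))).rename ρ :: Δ) := ⟨hΔ, hmA⟩
    refine .pi hmA hs' ?_
    refine ihB _ _ _ hctx hren ?_
    have hF2 := (hF.lift hT ((A.bind m).rename (idx (Γ.map (ebit sh))) |>.rename ρ))
    have := HasType.app (B := (((B.bind m).rename (upr (idx (Γ.map (ebit sh))))).rename
      (upr ρ)).rename (upr Nat.succ)) (t := var 0)
      (A := ((A.bind m).rename (idx (Γ.map (ebit sh))) |>.rename ρ).lift) (by
        exact hF2) (by
        exact HasType.var (Th := T) 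
          (((A.bind m).rename (idx (Γ.map (ebit sh))) |>.rename ρ) :: Δ) 0 _ rfl)
    convert this using 1
    simp only [inst, rename_subst, rename_rename]
    rw [rename_eq_subst]
    congr 1; funext i; rcases i with _ | i <;> rfl

/-- The basic lemma of logical relations. -/
theorem RelData.basic (h : RelData S T m r sh) {Γ : List (Exp N)} {t A : Exp N}
    (ht : HasType S Γ t A) : Ctx S Γ → Ctx T (relCtx m r sh Γ) → ∀ {R : Exp N'},
      rel m r (Γ.map (ebit sh)) t = some R →
      (A = Exp.kind → IsPred T (relCtx m r sh Γ) R
        ((t.bind m).rename (idx (Γ.map (ebit sh)))) Exp.kind) ∧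
      (A ≠ Exp.kind → ∃ RA, rel m r (Γ.map (ebit sh)) A = some RA ∧
        HasType T (relCtx m r sh Γ) R
          (betaApp RA ((t.bind m).rename (idx (Γ.map (ebit sh)))))) := by
  have hT := h.wfT.sane
  have hS := h.wf.sane
  have pred : ∀ {Γ : List (Exp N)} {t s : Exp N} {R : Exp N'}, IsSort s →
      ((s = Exp.kind → IsPred T (relCtx m r sh Γ) R
        ((t.bind m).rename (idx (Γ.map (ebit sh)))) Exp.kind) ∧
      (s ≠ Exp.kind → ∃ RA, rel m r (Γ.map (ebit sh)) s = some RA ∧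
        HasType T (relCtx m r sh Γ) R
          (betaApp RA ((t.bind m).rename (idx (Γ.map (ebit sh))))))) →
      IsPred T (relCtx m r sh Γ) R ((t.bind m).rename (idx (Γ.map (ebit sh)))) (s.bind m) := by
    rintro Γ t s R (rfl | rfl) ⟨h1, h2⟩
    · obtain ⟨RA, hRA, h2⟩ := h2 (by simp)
      cases hRA
      exact IsPred.of_hasType h.wfT h2
    · exact h1 rfl
  have untyped : ∀ {Γ : List (Exp N)} {s : Exp N}, Ctx S Γ → IsSort s →
      ¬ HasType S Γ Exp.kind s := fun hΓ hs hk => hk.not_conv_kind h.wf hΓ hs (Conv.refl _ _)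
  have ctx_cons : ∀ {Γ : List (Exp N)} {A : Exp N}, Ctx S Γ → Ctx T (relCtx m r sh Γ) →
      HasType S Γ A Exp.type →
      (∀ RA, rel m r (Γ.map (ebit sh)) A = some RA →
        IsPred T (relCtx m r sh Γ) RA ((A.bind m).rename (idx (Γ.map (ebit sh)))) Exp.type) →
      Ctx T (relCtx m r sh (A :: Γ)) := by
    intro Γ A hΓ hΔ hA ih
    have hmA := h.hasType_mor hΓ hA
    cases hR : rel m r (Γ.map (ebit sh)) A with
    | none => rw [relCtx_none hR]; exact ⟨hΔ, hmA⟩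
    | some RA => rw [relCtx_some hR]; exact (ih RA hR).ctx h.wfT hΔ hmA
  induction ht with
  | type Γ =>
    intro _ _ R hR
    cases hR
    refine ⟨fun _ => ?_, fun hk => (hk rfl).elim⟩
    intro Δ ρ F hΔ _ hF
    exact .pi hF (Or.inr rfl) (.type _)
  | const Γ d hd =>
    intro hΓ _ R hR
    obtain ⟨⟨s, hs, hty⟩, _⟩ := h.wf.typed d hd
    refine ⟨fun hk => ?_, fun _ => ?_⟩
    · rw [hk] at hty; exact (untyped (Γ := []) trivial hs hty).elim
    · obtain ⟨RA, hRA, h1⟩ := (h.log d hd).1 R hR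
      refine ⟨RA, ?_, ?_⟩
      · rw [rel_of_closed h.closed (h.relClosed hty) hty.closed, hRA]
      · have := h1.append (relCtx m r sh Γ)
        simp only [List.nil_append] at this
        rw [Exp.bind, (h.closed _).rename_eq]
        exact this
  | var Γ i A hA =>
    intro hΓ _ R hR
    refine ⟨fun hk => ?_, fun _ => ?_⟩
    · have := hΓ.get hS hA
      rw [hk] at this
      exact (untyped hΓ (Or.inl rfl) this).elim
    · rw [rel, Option.map_eq_some_iff] at hR
      obtain ⟨j, hj, rfl⟩ := hR
      exact (h.vars hΓ hA).2 j hj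
  | pi h1 hsort h2 ih1 ih2 =>
    rename_i Γ A B s
    intro hΓ hΔ R hR
    rw [rel_pi, Option.map_eq_some_iff] at hR
    obtain ⟨RB, hRB, rfl⟩ := hR
    have ihA : ∀ RA, rel m r (Γ.map (ebit sh)) A = some RA → IsPred T (relCtx m r sh Γ) RA
      ((A.bind m).rename (idx (Γ.map (ebit sh)))) Exp.type :=
      fun RA hRA => pred (Or.inl rfl) (ih1 hΓ hΔ hRA)
    have hRB' := hRB
    rw [rel_isSome_ctx h hΓ h1] at hRB'
    have ihB := pred hsort (ih2 ⟨hΓ, h1⟩ (ctx_cons hΓ hΔ h1 ihA) hRB')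
    rw [List.map_cons, ← rel_isSome_ctx h hΓ h1] at ihB
    have key := h.basic_pi hsort.bind hΓ h1 hsort h2 hRB ihA ihB
    refine ⟨fun hk => by subst hk; exact key, fun hk => ?_⟩
    obtain rfl : s = Exp.type := hsort.resolve_right hk
    refine ⟨_, rfl, ?_⟩
    have hm := h.hasType_mor hΓ (h1.pi (Or.inl rfl) h2)
    have h3 := key (((Exp.pi A B).bind m).rename (idx (Γ.map (ebit sh))) :: relCtx m r sh Γ)
      Nat.succ (var 0) ⟨hΔ, hm⟩ (Ren.succ _) (.var _ 0 _ rfl)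
    have hm' := hm
    -- The translation of a Π-type is an abstraction, and weakening it and applying it to the fresh
    -- variable recovers its body. So the predicate property just proved types that body.
    have e : ∀ {o : Option (Exp N')} {mA mAB RB : Exp N'}, ∃ b, piRel mA mAB o RB =
        Exp.lam mAB b ∧ betaApp ((piRel mA mAB o RB).rename Nat.succ) (var 0) = b := by
      intro o mA mAB RB
      cases o
      · exact ⟨_, rfl, rename_upr_succ_inst _⟩
      · exact ⟨_, rfl, rename_upr_succ_inst _⟩
    obtain ⟨b, e1, e2⟩ := e (o := rel m r (Γ.map (ebit sh)) A)
      (mA := (A.bind m).rename (idx (Γ.map (ebit sh))))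
      (mAB := ((Exp.pi A B).bind m).rename (idx (Γ.map (ebit sh)))) (RB := RB)
    rw [e2] at h3
    rw [e1]
    exact .lam hm' (Or.inr rfl) (.type _) h3
  | lam h1 hsort h2 h3 ih1 ih2 ih3 =>
    rename_i Γ A B t s
    intro hΓ hΔ R hR
    refine ⟨fun hk => (by cases hk), fun _ => ?_⟩
    have hΓ' : Ctx S (A :: Γ) := ⟨hΓ, h1⟩
    rw [rel_lam, Option.map_eq_some_iff] at hR
    obtain ⟨Rt, hRt, rfl⟩ := hR
    have ihA : ∀ RA, rel m r (Γ.map (ebit sh)) A = some RA → IsPred T (relCtx m r sh Γ) RA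
      ((A.bind m).rename (idx (Γ.map (ebit sh)))) Exp.type :=
      fun RA hRA => pred (Or.inl rfl) (ih1 hΓ hΔ hRA)
    have hΔ' := ctx_cons hΓ hΔ h1 ihA
    have hb := rel_isSome_ctx h hΓ h1
    have hRt' := hRt
    rw [hb] at hRt'
    obtain ⟨RB, hRB, h4⟩ := (ih3 hΓ' hΔ' hRt').2 fun hk => by
      rw [hk] at h2; exact untyped hΓ' hsort h2
    have ihB := pred hsort (ih2 hΓ' hΔ' hRB)
    rw [List.map_cons, ← hb] at ihB hRB h4
    have hpi := h.basic_pi hsort.bind hΓ h1 hsort h2 hRB ihA ihB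
    have hm := h.hasType_mor hΓ (h1.lam hsort h2 h3)
    have hmt := h.hasType_mor hΓ' h3
    have hmA := h.hasType_mor hΓ h1
    have hP := hpi.betaApp h.wfT hΔ hm
    have hid : ∀ t : Exp N', t.rename (fun i => i) = t := rename_id
    have hne := rel_ne_var (h.relClosed h2) (h.shaping.hasType_sort hS h2 hsort
      (hΓ'.ctxSh h.shaping hS)).choose_spec.1 hRB
    rw [rel_pi, hRB]
    refine ⟨_, rfl, ?_⟩
    rw [List.map_cons, ← hb] at hmt
    cases hRA : rel m r (Γ.map (ebit sh)) A with
    | some RA =>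
      rw [hRA] at hP hmt h4
      rw [relCtx_some hRA] at hmt h4 hΔ'
      have e := betaApp_piRel_some (mA := (A.bind m).rename (idx (Γ.map (ebit sh))))
        (mAB := ((Exp.pi A B).bind m).rename (idx (Γ.map (ebit sh)))) (RA := RA)
        hne (fun i => i) (((Exp.lam A t).bind m).rename (idx (Γ.map (ebit sh))))
      simp only [hid] at e
      rw [e] at hP ⊢
      obtain ⟨hP1, hP2⟩ := hP.pi_inv_sort h.wfT hsort.bind
      obtain ⟨hP3, hP4⟩ := hP2.pi_inv_sort h.wfT hsort.bind
      refine .lam hP1 hsort.bind hP2 (.lam hP3 hsort.bind hP4 ?_)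
      -- By induction the body satisfies the predicate at m(t), whereas the Π-type demands it at the
      -- application of m(λx.t) to x; the two differ by a β-step.
      refine h4.conv hsort.bind hP4 ?_
      rw [show upr (upr fun i => i) = fun i => i by funext i; rcases i with _ | _ | i <;> rfl, hid]
      refine Conv.betaApp_congr (Conv.refl _ _) (Conv.symm ?_)
      refine (Conv.beta _ _ _).trans (.of_eq ?_)
      simp only [inst, rename_subst, rename_rename]
      rw [rename_eq_subst]
      congr 1; funext i; cases i <;> rfl
    | none =>
      rw [hRA] at hP hmt h4
      rw [relCtx_none hRA] at hmt h4 hΔ'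
      have e := betaApp_piRel_none (mA := (A.bind m).rename (idx (Γ.map (ebit sh))))
        (mAB := ((Exp.pi A B).bind m).rename (idx (Γ.map (ebit sh))))
        hne (fun i => i) (((Exp.lam A t).bind m).rename (idx (Γ.map (ebit sh))))
      simp only [hid] at e
      rw [e] at hP ⊢
      obtain ⟨hP1, hP2⟩ := hP.pi_inv_sort h.wfT hsort.bind
      refine .lam hP1 hsort.bind hP2 ?_
      refine h4.conv hsort.bind hP2 ?_
      rw [show upr (fun i => i) = fun i => i by funext i; rcases i with _ | i <;> rfl, hid]
      refine Conv.betaApp_congr (Conv.refl _ _) (Conv.symm ?_)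
      refine (Conv.beta _ _ _).trans (.of_eq ?_)
      simp only [inst, rename_subst, rename_rename]
      rw [rename_eq_subst]
      congr 1; funext i; cases i <;> rfl
  | app h1 h2 ih1 ih2 =>
    rename_i Γ A B f t
    intro hΓ hΔ R hR
    obtain ⟨s, hsort, hA, hB⟩ := h1.pi_of_fun h.wf hΓ
    refine ⟨fun hk => ?_, fun _ => ?_⟩
    · have := hB.inst hS h2
      rw [hk, show s.inst t = s from hsort.subst _] at this
      exact (untyped hΓ hsort this).elim
    rw [rel_app, Option.map_eq_some_iff] at hR
    obtain ⟨Rf, hRf, rfl⟩ := hR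
    obtain ⟨Rp, hRp, h3⟩ := (ih1 hΓ hΔ hRf).2 (by simp)
    rw [rel_pi, Option.map_eq_some_iff] at hRp
    obtain ⟨RB, hRB, rfl⟩ := hRp
    have hb := rel_isSome_ctx h hΓ hA
    obtain ⟨a, ha, h0, hbit⟩ := h.shaping.ebit_type h.wf (hΓ.ctxSh h.shaping hS) hA
    have hbt := h.bits.isSome_rel (m := m) h.wf h.shaping h2 hΓ
    rw [index_of_shape ha, setStar_of_lev h0, ← hbit, ← hb] at hbt
    have hsh := (h.shaping.hasType_sort hS hB hsort
      (Ctx.ctxSh (Γ := _ :: _) h.shaping hS ⟨hΓ, hA⟩)).choose_spec.1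
    have hne := rel_ne_var (h.relClosed hB) hsh hRB
    have hid : ∀ t : Exp N', t.rename (fun i => i) = t := rename_id
    have hmt := h.hasType_mor hΓ h2
    have hinst := rel_inst (sh := sh) h.closed (h.relClosed hB)
      (BindOK.of_hasType hS h.shaping hB (Ctx.ctxSh (Γ := _ :: _) h.shaping hS ⟨hΓ, hA⟩))
      (h.relClosed h2) (Γ.map (ebit sh))
    rw [hbt, hRB] at hinst
    refine ⟨_, hinst, ?_⟩
    cases hRA : rel m r (Γ.map (ebit sh)) A with
    | some RA =>
      rw [hRA] at hbt h3
      obtain ⟨Rt, hRt⟩ := Option.isSome_iff_exists.1 hbt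
      obtain ⟨RA', hRA', h4⟩ := (ih2 hΓ hΔ hRt).2 fun hk => by
        rw [hk] at hA; exact untyped hΓ (Or.inl rfl) hA
      obtain rfl := Option.some.inj (hRA.symm.trans hRA')
      have e := betaApp_piRel_some (mA := (A.bind m).rename (idx (Γ.map (ebit sh))))
        (mAB := ((Exp.pi A B).bind m).rename (idx (Γ.map (ebit sh)))) (RA := RA)
        hne (fun i => i) ((f.bind m).rename (idx (Γ.map (ebit sh))))
      simp only [hid] at e
      rw [e] at h3
      have hneA := rel_ne_var (h.relClosed hA) ha hRA
      have h5 := HasType.app h3 hmt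
      have e2 : (betaApp RA.lift (var 0)).inst ((t.bind m).rename (idx (Γ.map (ebit sh)))) =
          betaApp RA ((t.bind m).rename (idx (Γ.map (ebit sh)))) := by
        rw [inst, betaApp_subst (show ∀ i, RA.lift ≠ var i from rename_ne_var hneA _)]
        congr 1
        exact lift_inst _ _
      rw [inst, subst] at h5
      have h6 := HasType.app h5 (by rw [← inst, e2]; exact h4)
      rw [hRt]
      convert h6 using 1
      · rfl
      rw [inst, betaApp_subst (rename_ne_var hne _), betaApp_subst (by
        intro i hi
        cases RB with
        | var j => exact hne j rfl
        | _ => cases hi)]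
      simp only [instRel, rename_subst, subst_subst]
      congr 1
      · congr 1; funext i
        rcases i with _ | _ | i
        · rfl
        · exact (lift_inst _ _).symm
        · rfl
      · simp only [subst, Exp.lift, rename_subst, Exp.bind, Exp.rename]
        congr 1
        · rw [rename_eq_subst]; rfl
        · exact (lift_inst _ _).symm
    | none =>
      rw [hRA] at hbt h3
      have hRt : rel m r (Γ.map (ebit sh)) t = none := by
        cases hR : rel m r (Γ.map (ebit sh)) t with
        | none => rfl
        | some R => rw [hR] at hbt; cases hbt
      have e := betaApp_piRel_none (mA := (A.bind m).rename (idx (Γ.map (ebit sh))))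
        (mAB := ((Exp.pi A B).bind m).rename (idx (Γ.map (ebit sh))))
        hne (fun i => i) ((f.bind m).rename (idx (Γ.map (ebit sh))))
      simp only [hid] at e
      rw [e] at h3
      have h5 := HasType.app h3 hmt
      rw [hRt]
      convert h5 using 1
      · rfl
      rw [inst, betaApp_subst (rename_ne_var hne _)]
      simp only [instRel, rename_subst]
      congr 1
      · congr 1; funext i
        rcases i with _ | i <;> rfl
      · simp only [subst, Exp.bind, Exp.rename]
        congr 1
        exact (lift_inst _ _).symm
  | conv h1 hsort h2 hc ih1 ih2 =>
    rename_i Γ A B t s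
    intro hΓ hΔ R hR
    have hAk : A ≠ Exp.kind := by
      rintro rfl
      exact h2.not_conv_kind h.wf hΓ hsort hc.symm
    refine ⟨fun hk => ?_, fun _ => ?_⟩
    · rw [hk] at h2; exact (untyped hΓ hsort h2).elim
    obtain ⟨RA, hRA, h3⟩ := (ih1 hΓ hΔ hR).2 hAk
    obtain hk | ⟨s', hs', hA⟩ := h1.type_correct h.wf hΓ
    · exact (hAk hk).elim
    -- `rel_conv` compares expressions of one and the same type. That A and B have the same sort is
    -- seen from the level of their common shape.
    have hss : s' = s := by
      have hC := hΓ.ctxSh h.shaping hS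
      obtain ⟨a, ha, h4⟩ := h.shaping.hasType_sort hS hA hs' hC
      obtain ⟨b, hb, h5⟩ := h.shaping.hasType_sort hS h2 hsort hC
      obtain rfl := h.shaping.conv hS hc ha hb
      rcases h4 with ⟨rfl, h4⟩ | ⟨rfl, h4⟩ <;> rcases h5 with ⟨rfl, h5⟩ | ⟨rfl, h5⟩ <;>
        first | rfl | omega
    subst hss
    have hcv := h.rel_conv hΓ hA h2 hc
    rw [hRA] at hcv
    generalize hRB : rel m r (Γ.map (ebit sh)) B = o at hcv
    cases hcv with
    | some hcv =>
    rename_i RB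
    refine ⟨RB, rfl, ?_⟩
    refine h3.conv hsort.bind ((pred hsort (ih2 hΓ hΔ hRB)).betaApp h.wfT hΔ
      (h.hasType_mor hΓ (h1.conv hsort h2 hc))) ?_
    exact Conv.betaApp_congr hcv (Conv.refl _ _)

end BasicLemma
/-! ### Removal of arguments -/

section Removal

variable {T : List (Decl N N)} {Γ : List (Exp N)}

theorem Ctx.nil : Ctx T [] := trivial

theorem Ctx.cons (hΓ : Ctx T Γ) {A : Exp N} (hA : HasType T Γ A Exp.type) : Ctx T (A :: Γ) :=
  ⟨hΓ, hA⟩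

theorem IsMorphism.comp {N'' : Type u} {R : List (Decl N N)} {S : List (Decl N' N')}
    {T : List (Decl N'' N'')} {f : N → Exp N'} {g : N' → Exp N''} (hf : IsMorphism R S f)
    (hg : IsMorphism S T g) (hc : ∀ c, (g c).Closed) : IsMorphism R T fun c => (f c).bind g := by
  intro d hd
  rw [← bind_bind]
  refine ⟨by simpa using (hf d hd).1.bind hc hg, fun t ht => ?_⟩
  rw [← bind_bind]
  exact ((hf d hd).2 t ht).bind hc hg

theorem HasType.sort_unique (hW : WF T) (hΓ : Ctx T Γ) {t s s' : Exp N} (hs : IsSort s)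
    (hs' : IsSort s') (h : HasType T Γ t s) (h' : HasType T Γ t s') : s = s' := by
  obtain ⟨sh, hsh⟩ := hW.exists_shaping fun _ => true
  obtain ⟨a, ha, h1⟩ := hsh.hasType_sort hW.sane h hs (hΓ.ctxSh hsh hW.sane)
  obtain ⟨b, hb, h2⟩ := hsh.hasType_sort hW.sane h' hs' (hΓ.ctxSh hsh hW.sane)
  obtain rfl := Option.some.inj (ha.symm.trans hb)
  rcases h1 with ⟨rfl, h1⟩ | ⟨rfl, h1⟩ <;> rcases h2 with ⟨rfl, h2⟩ | ⟨rfl, h2⟩ <;>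
    first | rfl | omega

/-- The expression t only witnesses that C is `kind` or has a sort, which the conversion rule
requires. -/
theorem HasType.of_conv_type (hW : WF T) (hΓ : Ctx T Γ) {t A B C : Exp N}
    (h : HasType T Γ t C) (h' : HasType T Γ A B) (hc : Conv T B C) : HasType T Γ A C := by
  have hB := h'.type_correct hW hΓ
  rcases h.type_correct hW hΓ with rfl | ⟨s, hs, hC⟩
  · rcases hB with rfl | ⟨s, hs, hB⟩
    · exact h'
    · exact (hB.not_conv_kind hW hΓ hs hc).elim
  · exact h'.conv hs hC hc

theorem eraseArgs_conv (θ : N → Exp N) (e : Exp N) : Conv T (eraseArgs θ e) (e.bind θ) := by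
  induction e with
  | lam A t ih1 ih2 => exact Conv.lam ih1 ih2
  | pi A t ih1 ih2 => exact Conv.pi ih1 ih2
  | app f t ih1 ih2 =>
    rw [eraseArgs]
    split_ifs
    · exact (Conv.betaApp _ _).trans (Conv.app ih1 ih2)
    · exact Conv.app ih1 ih2
  | _ => exact Conv.refl _ _

/-- `eraseArgs` differs from the homomorphic extension by the contraction of β-redexes, so this is
an instance of subject reduction. Since subterms change up to conversion, contexts and argument
types are converted along the way. -/
theorem HasType.eraseArgs_of_bind (hW : WF T) {θ : N → Exp N} (e : Exp N) :
    ∀ {Γ : List (Exp N)} {C : Exp N}, Ctx T Γ → HasType T Γ (e.bind θ) C →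
      HasType T Γ (eraseArgs θ e) C := by
  have hT := hW.sane
  induction e with
  | lam A t ih1 ih2 =>
    intro Γ C hΓ h
    obtain ⟨B, s, hs, hA, hB, ht, hc⟩ := HasType.lam_inv (A := A.bind θ) (t := t.bind θ) h
    have hA' := ih1 hΓ hA
    have hcA := eraseArgs_conv (T := T) θ A
    refine h.of_conv_type hW hΓ (.lam hA' hs (hB.conv_ctx hT hA hcA.symm)
      ((ih2 (hΓ.cons hA) ht).conv_ctx hT hA hcA.symm)) ?_
    exact (Conv.pi hcA (Conv.refl _ _)).trans hc
  | pi A B ih1 ih2 =>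
    intro Γ C hΓ h
    obtain ⟨s, hs, hA, hB, hc⟩ := HasType.pi_inv (A := A.bind θ) (B := B.bind θ) h
    have hA' := ih1 hΓ hA
    have hcA := eraseArgs_conv (T := T) θ A
    exact h.of_conv_type hW hΓ (.pi hA' hs ((ih2 (hΓ.cons hA) hB).conv_ctx hT hA hcA.symm)) hc
  | app f t ih1 ih2 =>
    intro Γ C hΓ h
    obtain ⟨A, B, hf, ht, hc⟩ := HasType.app_inv (f := f.bind θ) (t := t.bind θ) h
    have := HasType.app (ih1 hΓ hf) (ih2 hΓ ht)
    have h' : HasType T Γ (Exp.app (eraseArgs θ f) (eraseArgs θ t)) C := h.of_conv_type hW hΓ this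
      ((Conv.inst hT (Conv.refl _ _) (eraseArgs_conv θ t)).trans hc)
    rw [eraseArgs]
    split_ifs
    · exact h'.betaApp hW hΓ
    · exact h'
  | _ => intro Γ C _ h; exact h

theorem HasType.eraseArgs {S : List (Decl N N)} (hT : WF T) {θ : N → Exp N}
    (hc : ∀ c, (θ c).Closed) (hθ : IsMorphism S T θ) {t A s : Exp N} (h : HasType S [] t A)
    (hs : IsSort s) (hA : HasType S [] A s) :
    HasType T [] (eraseArgs θ t) (LF.eraseArgs θ A) ∧ HasType T [] (LF.eraseArgs θ A) s := by
  have h1 := HasType.eraseArgs_of_bind hT t Ctx.nil (h.bind hc hθ)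
  have h2 := HasType.eraseArgs_of_bind hT A Ctx.nil (hA.bind hc hθ)
  have e : s.bind θ = s := by rcases hs with rfl | rfl <;> rfl
  rw [e] at h2
  exact ⟨h1.conv hs h2 (eraseArgs_conv θ A).symm, h2⟩

/-- The abstraction over the arguments of `A` of the application of `h` to those not in `P`. -/
def keepTele (P : Finset ℕ) : ℕ → ℕ → Exp N → Exp N → Exp N
  | i, k + 1, pi A B, h =>
    lam A (keepTele P (i + 1) k B (if i ∈ P then h.lift else app h.lift (var 0)))
  | _, _, _, h => h

/-- The application of `h` to those of the variables that are not in `P`, the first ones of `n`. -/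
def keepFirst (P : Finset ℕ) (i n : ℕ) (h : Exp N) : Exp N :=
  ((List.range i).filter (· ∉ P)).foldl (fun a j => app a (var (n - 1 - j))) h

theorem keepFirst_lift (P : Finset ℕ) (i : ℕ) {h : Exp N} (hh : h.Closed) :
    (keepFirst P i i h).lift = keepFirst P i (i + 1) h := by
  have key : ∀ (l : List ℕ) (h : Exp N), (∀ j ∈ l, j < i) →
      (l.foldl (fun a j => app a (var (i - 1 - j))) h).rename Nat.succ =
        l.foldl (fun a j => app a (var (i + 1 - 1 - j))) (h.rename Nat.succ) := by
    intro l
    induction l with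
    | nil => intro h _; rfl
    | cons j l ih =>
      intro h hl
      simp only [List.foldl_cons]
      rw [ih _ fun j hj => hl j (List.mem_cons_of_mem _ hj), rename, rename]
      have := hl j List.mem_cons_self
      rw [show (i - 1 - j).succ = i + 1 - 1 - j by omega]
  rw [lift, keepFirst, key _ _ fun j hj => List.mem_range.1 (List.mem_of_mem_filter hj),
    hh.rename_eq, keepFirst]

theorem keepFirst_succ (P : Finset ℕ) (i : ℕ) {h : Exp N} (hh : h.Closed) :
    keepFirst P (i + 1) (i + 1) h =
      if i ∈ P then (keepFirst P i i h).lift else app (keepFirst P i i h).lift (var 0) := by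
  rw [keepFirst_lift P i hh]
  conv_lhs => rw [keepFirst, List.range_succ, List.filter_append, List.foldl_append]
  split_ifs with hi
  · rw [List.filter_cons_of_neg (by simpa using hi)]; rfl
  · rw [List.filter_cons_of_pos (by simpa using hi)]
    simp [keepFirst]

theorem keepTele_eq (P : Finset ℕ) {h : Exp N} (hh : h.Closed) : ∀ (k i : ℕ) (A : Exp N)
    (s : Exp N), IsSort s → ∀ Γ, HasType T Γ A s → UnusedBinders P i k A → WF T →
    keepTele P i k A (keepFirst P i i h) = lamTele k A (keepFirst P (i + k) (i + k) h) := by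
  intro k
  induction k with
  | zero => intro i A s _ Γ _ _ _; cases A <;> rfl
  | succ k ih =>
    intro i A s hs Γ hA hU hW
    cases A with
    | pi A B =>
      rw [keepTele, ← keepFirst_succ P i hh, lamTele]
      rw [ih (i + 1) B s hs _ (hA.pi_inv_sort hW hs).2 hU.2 hW]
      rw [show i + 1 + k = i + (k + 1) by omega]
    | lam A B =>
      obtain ⟨B, s', _, _, _, _, h⟩ := hA.lam_inv
      exact (hs.not_conv_pi hW.sane h).elim
    | _ => exact hU.elim

/-- The variable of a removed binder does not occur in what remains, so strengthening takes it out
of the context. -/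
theorem HasType.dropBinders_type (hW : WF T) {P : Finset ℕ} : ∀ (k i : ℕ) {Γ : List (Exp N)}
    {A s : Exp N}, Ctx T Γ → IsSort s → HasType T Γ A s → UnusedBinders P i k A →
    HasType T Γ (dropBinders P i k A) s := by
  intro k
  induction k with
  | zero => intro i Γ A s _ _ h _; cases A <;> exact h
  | succ k ih =>
    intro i Γ A s hΓ hs h hU
    cases A with
    | pi A B =>
      obtain ⟨hA, hB⟩ := h.pi_inv_sort hW hs
      have hB' := ih (i + 1) (hΓ.cons hA) hs hB hU.2
      rw [dropBinders]
      split_ifs with hi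
      · refine HasType.of_lift hW hΓ hA ?_ (Or.inl ⟨rfl, hs⟩)
        rw [lift_rename_pred (hU.1 hi), Exp.lift, hs.rename]
        exact hB'
      · exact .pi hA hs hB'
    | lam A B =>
      obtain ⟨B, s', _, _, _, _, h⟩ := h.lam_inv
      exact (hs.not_conv_pi hW.sane h).elim
    | _ => exact hU.elim

/-- Type and expression lose the same positions. The domains in the expression are only convertible
to those in the type, hence the changes of context. -/
theorem HasType.dropBinders (hW : WF T) {P : Finset ℕ} : ∀ (k i : ℕ) {Γ : List (Exp N)}
    {t A s : Exp N}, Ctx T Γ → IsSort s → HasType T Γ A s → UnusedBinders P i k A →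
    HasType T Γ t A → UnusedBinders P i k t →
    HasType T Γ (LF.dropBinders P i k t) (LF.dropBinders P i k A) := by
  intro k
  induction k with
  | zero => intro i Γ t A s _ _ _ _ h _; cases A <;> cases t <;> exact h
  | succ k ih =>
    intro i Γ t A s hΓ hs hA hU ht hU'
    cases A with
    | pi A B =>
      obtain ⟨hA, hB⟩ := hA.pi_inv_sort hW hs
      cases t with
      | lam A' t =>
        obtain ⟨hA', hc, ht⟩ := ht.lam_inv_pi hW hΓ
        have hBd := HasType.dropBinders_type hW k (i + 1) (hΓ.cons hA) hs hB hU.2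
        have ht' := ih (i + 1) (Γ := A' :: Γ) (hΓ.cons hA') hs
          (hB.conv_ctx hW.sane hA hc.symm) hU.2 ht hU'.2
        rw [LF.dropBinders, LF.dropBinders]
        split_ifs with hi
        · have e : (LF.dropBinders P (i + 1) k B) =
            ((LF.dropBinders P (i + 1) k B).rename Nat.pred).lift :=
            (lift_rename_pred (hU.1 hi)).symm
          refine HasType.of_lift hW hΓ hA' ?_ (Or.inr ⟨hs, ?_⟩)
          · rwa [lift_rename_pred (hU'.1 hi), ← e]
          · refine HasType.of_lift hW hΓ hA ?_ (Or.inl ⟨rfl, hs⟩)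
            rw [← e, Exp.lift, hs.rename]
            exact hBd
        · refine HasType.conv (.lam hA' hs (hBd.conv_ctx hW.sane hA hc.symm) ht') hs
            (.pi hA hs hBd) (Conv.pi hc (Conv.refl _ _))
      | pi A' t =>
        obtain ⟨s', hs', _, _, h⟩ := ht.pi_inv
        exact (hs'.not_conv_pi hW.sane h.symm).elim
      | _ => exact hU'.elim
    | lam A B =>
      obtain ⟨B, s', _, _, _, _, h⟩ := hA.lam_inv
      exact (hs.not_conv_pi hW.sane h).elim
    | _ => exact hU.elim

/-- The way back from a type with positions removed to the original one: the arguments at these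
positions are abstracted and ignored. -/
theorem HasType.keepTele (hW : WF T) {P : Finset ℕ} : ∀ (k i : ℕ) {Γ : List (Exp N)}
    {h A s : Exp N}, Ctx T Γ → IsSort s → HasType T Γ A s → UnusedBinders P i k A →
    HasType T Γ h (LF.dropBinders P i k A) → HasType T Γ (LF.keepTele P i k A h) A := by
  intro k
  induction k with
  | zero => intro i Γ h A s _ _ _ _ h; cases A <;> exact h
  | succ k ih =>
    intro i Γ h A s hΓ hs hA hU hh
    cases A with
    | pi A B =>
      obtain ⟨hA, hB⟩ := hA.pi_inv_sort hW hs
      rw [LF.keepTele]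
      refine .lam hA hs hB (ih (i + 1) (hΓ.cons hA) hs hB hU.2 ?_)
      rw [LF.dropBinders] at hh
      have hl := hh.lift hW.sane A
      split_ifs at hl ⊢ with hi
      · rwa [lift_rename_pred (hU.1 hi)] at hl
      · have := HasType.app hl (.var _ 0 _ rfl)
        rwa [rename_upr_succ_inst] at this
    | lam A B =>
      obtain ⟨B, s', _, _, _, _, h⟩ := hA.lam_inv
      exact (hs.not_conv_pi hW.sane h).elim
    | _ => exact hU.elim

/-- `keepTele` undoes `dropBinders` up to conversion: at a removed position, weakening restores what
was dropped, and at a kept position the application to the variable contracts. -/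
theorem keepTele_conv (hW : WF T) {P : Finset ℕ} : ∀ (k i : ℕ) {Γ : List (Exp N)}
    {h t A s : Exp N}, Ctx T Γ → IsSort s → HasType T Γ A s → UnusedBinders P i k A →
    HasType T Γ t A → UnusedBinders P i k t → Conv T h (dropBinders P i k t) →
    Conv T (keepTele P i k A h) t := by
  intro k
  induction k with
  | zero => intro i Γ h t A s _ _ _ _ _ _ h; cases A <;> cases t <;> exact h
  | succ k ih =>
    intro i Γ h t A s hΓ hs hA hU ht hU' hh
    cases A with
    | pi A B =>
      obtain ⟨hA, hB⟩ := hA.pi_inv_sort hW hs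
      cases t with
      | lam A' t =>
        obtain ⟨hA', hc, ht⟩ := ht.lam_inv_pi hW hΓ
        rw [keepTele]
        refine Conv.lam hc.symm (ih (i + 1) (Γ := A :: Γ) (hΓ.cons hA) hs hB hU.2
          (ht.conv_ctx hW.sane hA' hc) hU'.2 ?_)
        rw [dropBinders] at hh
        have hl := hh.lift hW.sane
        split_ifs at hl ⊢ with hi
        · rwa [lift_rename_pred (hU'.1 hi)] at hl
        · refine (Conv.app hl (Conv.refl _ _)).trans ((Conv.beta _ _ _).trans (.of_eq ?_))
          exact rename_upr_succ_inst _
      | pi A' t =>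
        obtain ⟨s', hs', _, _, h⟩ := ht.pi_inv
        exact (hs'.not_conv_pi hW.sane h.symm).elim
      | _ => exact hU'.elim
    | lam A B =>
      obtain ⟨B, s', _, _, _, _, h⟩ := hA.lam_inv
      exact (hs.not_conv_pi hW.sane h).elim
    | _ => exact hU.elim

/-- The values of `keepTele` determine the last argument. -/
theorem Conv.of_keepTele (hW : WF T) {P : Finset ℕ} : ∀ (k i : ℕ) {Γ Γ' : List (Exp N)}
    {h h' A A' s s' : Exp N}, IsSort s → IsSort s' → HasType T Γ A s → HasType T Γ' A' s' →
    UnusedBinders P i k A → UnusedBinders P i k A' →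
    Conv T (LF.keepTele P i k A h) (LF.keepTele P i k A' h') → Conv T h h' := by
  intro k
  induction k with
  | zero => intro i Γ Γ' h h' A A' s s' _ _ _ _ _ _ h; cases A <;> cases A' <;> exact h
  | succ k ih =>
    intro i Γ Γ' h h' A A' s s' hs hs' hA hA' hU hU' hc
    cases A with
    | pi A B =>
      cases A' with
      | pi A' B' =>
        obtain ⟨_, hB⟩ := hA.pi_inv_sort hW hs
        obtain ⟨_, hB'⟩ := hA'.pi_inv_sort hW hs'
        rw [LF.keepTele, LF.keepTele] at hc
        have := ih (i + 1) hs hs' hB hB' hU.2 hU'.2 (Conv.of_lam hW.sane hc)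
        -- At a removed position the expression was only weakened, which is injective up to
        -- conversion; at a kept one, it is recovered by η.
        split_ifs at this with hi
        · exact Conv.of_rename (ρ := Nat.succ) (ρ' := Nat.pred) hW.sane (fun _ => rfl) this
        · exact (Conv.eta A h).symm.trans ((Conv.lam_body _ _ this).trans (Conv.eta A' h'))
      | lam A B =>
        obtain ⟨B, s', _, _, _, _, h⟩ := hA'.lam_inv
        exact (hs'.not_conv_pi hW.sane h).elim
      | _ => exact hU'.elim
    | lam A B =>
      obtain ⟨B, s', _, _, _, _, h⟩ := hA.lam_inv
      exact (hs.not_conv_pi hW.sane h).elim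
    | _ => exact hU.elim

theorem keepTele_bind (P : Finset ℕ) {m : N → Exp N'} (hm : ∀ c, (m c).Closed) :
    ∀ (k i : ℕ) (A h : Exp N) (s Γ), IsSort s → HasType T Γ A s → UnusedBinders P i k A → WF T →
    (keepTele P i k A h).bind m = keepTele P i k (A.bind m) (h.bind m) := by
  intro k
  induction k with
  | zero => intro i A h s Γ _ _ _ _; cases A <;> simp [keepTele]
  | succ k ih =>
    intro i A h s Γ hs hA hU hW
    cases A with
    | pi A B =>
      obtain ⟨hA, hB⟩ := hA.pi_inv_sort hW hs
      simp only [keepTele, Exp.bind]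
      rw [ih _ _ _ _ _ hs hB hU.2 hW]
      split_ifs
      · rw [lift, bind_rename hm]; rfl
      · rw [Exp.bind, lift, bind_rename hm]; rfl
    | lam A B =>
      obtain ⟨B, s', _, _, _, _, h⟩ := hA.lam_inv
      exact (hs.not_conv_pi hW.sane h).elim
    | _ => exact hU.elim

end Removal

/-! ### The removal of argument positions as a morphism -/

section Eraser

variable {L : Type u} [DecidableEq L] {T : List (Decl N N)} (P : L → Finset ℕ)

/-- The removal of argument positions from all local declarations. -/
def cleanDecls : List (Decl L (N ⊕ L)) → List (Decl L (N ⊕ L))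
  | [] => []
  | d :: E => cleanDecl P E d :: cleanDecls E

theorem cleanDecls_names {E : List (Decl L (N ⊕ L))} {e : Decl (N ⊕ L) (N ⊕ L)}
    (he : e ∈ full T (cleanDecls P E)) : ∃ e' ∈ full T E, e'.name = e.name := by
  induction E with
  | nil => exact ⟨e, he, rfl⟩
  | cons d E ih =>
    rcases List.mem_cons.1 he with rfl | he
    · exact ⟨d.local, List.mem_cons_self, rfl⟩
    · obtain ⟨e', he', h⟩ := ih he
      exact ⟨e', List.mem_cons_of_mem _ he', h⟩

/-- The removal of arguments is a morphism. -/
structure EraserData (T : List (Decl N N)) (P : L → Finset ℕ) (E : List (Decl L (N ⊕ L))) :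
    Prop where
  wf : WF (full T (cleanDecls P E))
  closed : ∀ c, (fix (eraser P E) c).Closed
  mor : IsMorphism (full T E) (full T (cleanDecls P E)) (fix (eraser P E))

variable {P}

theorem cleanDecl_hasType {E : List (Decl L (N ⊕ L))} (h : EraserData T P E)
    {d : Decl L (N ⊕ L)} {s : Exp (N ⊕ L)} (hs : IsSort s) (hd : HasType (full T E) [] d.type s)
    (hdef : ∀ t, d.defn = some t → HasType (full T E) [] t d.type)
    (hU : Unused P (d :: E)) :
    HasType (full T (cleanDecls P E)) [] (eraseArgs (fix (eraser P E)) d.type) s ∧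
    HasType (full T (cleanDecls P E)) [] (cleanDecl P E d).type s ∧
    ∀ t, (cleanDecl P E d).defn = some t →
      HasType (full T (cleanDecls P E)) [] t (cleanDecl P E d).type := by
  obtain ⟨_, hU1, hU2⟩ := hU
  have h0 := HasType.eraseArgs_of_bind h.wf d.type Ctx.nil (hd.bind h.closed h.mor)
  have e : s.bind (fix (eraser P E)) = s := by rcases hs with rfl | rfl <;> rfl
  rw [e] at h0
  refine ⟨h0, HasType.dropBinders_type h.wf _ _ Ctx.nil hs h0 hU1, ?_⟩
  intro t ht
  obtain ⟨t, ht', rfl⟩ := Option.map_eq_some_iff.1 ht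
  obtain ⟨h1, _⟩ := (hdef t ht').eraseArgs h.wf h.closed h.mor hs hd
  exact HasType.dropBinders h.wf _ _ Ctx.nil hs h0 hU1 h1 (hU2 t ht')

/-- By induction on the local declarations. `dropBinders` turns the type and the definition,
translated so far, into a well-typed declaration. Then `keepTele` produces from its constant an
expression of the original type, and `keepTele_conv` shows that definitions are respected. -/
theorem EraserData.of_wf {E : List (Decl L (N ⊕ L))} : WF (full T E) → Unused P E →
    EraserData T P E := by
  induction E with
  | nil =>
    intro hW _
    refine ⟨hW, ?_, ?_⟩
    · rintro (c | c) i hi <;> exact hi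
    · have : fix (eraser P ([] : List (Decl L (N ⊕ L)))) = const := by
        funext c; cases c <;> rfl
      rw [this]
      exact (RawHom.id ⟨_, _, hW⟩).isMorphism
  | cons d E ih =>
    intro hW hU
    cases hW with
    | @cons _ _ s hW hn hs hd hdef =>
    have h := ih hW hU.1
    obtain ⟨hA, hty, htdef⟩ := cleanDecl_hasType h hs hd hdef hU
    have hW' : WF (full T (cleanDecls P (d :: E))) := by
      refine .cons h.wf ?_ hs hty htdef
      intro e he
      obtain ⟨e', he', hname⟩ := cleanDecls_names P he
      rw [← hname]
      exact hn e' he'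
    have hsub : ∀ e ∈ full T (cleanDecls P E), e ∈ full T (cleanDecls P (d :: E)) :=
      fun e he => List.mem_cons_of_mem _ he
    have hmem : (cleanDecl P E d).local ∈ full T (cleanDecls P (d :: E)) := List.mem_cons_self
    have hcl : (const (Sum.inr d.name) : Exp (N ⊕ L)).Closed := fun _ h => h
    have hconst : HasType (full T (cleanDecls P (d :: E))) [] (const (Sum.inr d.name))
      (cleanDecl P E d).type := .const [] (cleanDecl P E d).local hmem
    have e0 : eraser P (d :: E) d.name = keepTele (P d.name) 0 (arity (P d.name))
        (eraseArgs (fix (eraser P E)) d.type) (const (Sum.inr d.name)) := by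
      rw [eraser, if_pos rfl]
      have := keepTele_eq (P d.name) hcl _ _ _ _ hs _ hA hU.2.1 h.wf
      rw [Nat.zero_add] at this
      exact this.symm
    have hty0 := HasType.keepTele hW' (arity (P d.name)) 0 Ctx.nil hs (hA.mono hsub) hU.2.1 hconst
    rw [← e0] at hty0
    have hθ : ∀ c, Declared (full T E) c → fix (eraser P (d :: E)) c = fix (eraser P E) c := by
      rintro _ ⟨e, he, rfl⟩
      have := hn e he
      cases hc : e.name with
      | inl c => rfl
      | inr c =>
        have hcd : c ≠ d.name := by rintro rfl; exact this hc
        exact if_neg hcd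
    refine ⟨hW', ?_, ?_⟩
    · rintro (c | c)
      · exact fun _ h => h
      · by_cases hc : c = d.name
        · subst hc; exact hty0.closed
        · have : fix (eraser P (d :: E)) (Sum.inr c) = fix (eraser P E) (Sum.inr c) := if_neg hc
          rw [this]; exact h.closed _
    · intro e he
      rcases List.mem_cons.1 he with rfl | he
      · have h1 := (hd.bind h.closed h.mor).mono hsub
        have hs' : IsSort (s.bind (fix (eraser P E))) := hs.bind
        refine ⟨?_, fun t ht => ?_⟩
        · rw [bind_congr hθ hd.consts]
          exact hty0.conv hs' h1 (eraseArgs_conv _ _)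
        · have ht : d.defn = some t := ht
          rw [bind_congr hθ (hdef t ht).consts]
          obtain ⟨h2, _⟩ := (hdef t ht).eraseArgs h.wf h.closed h.mor hs hd
          refine Conv.trans ?_ (eraseArgs_conv _ _)
          change Conv _ (eraser P (d :: E) d.name) _
          rw [e0]
          refine keepTele_conv hW' _ _ Ctx.nil hs (hA.mono hsub) hU.2.1 (h2.mono hsub)
            (hU.2.2 t ht) ?_
          exact Conv.of_step (.delta (cleanDecl P E d).local _ hmem (by
            change d.defn.map _ = _; rw [ht]; rfl))
      · obtain ⟨h1, h2⟩ := h.mor e he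
        obtain ⟨⟨s', _, hty'⟩, hdef'⟩ := hW.typed e he
        rw [hθ _ ⟨e, he, rfl⟩, bind_congr hθ hty'.consts]
        refine ⟨h1.mono hsub, fun t ht => ?_⟩
        rw [bind_congr hθ (hdef' t ht).consts]
        exact (h2 t ht).mono hsub

end Eraser
/-! ### Renaming of constants -/

section MapConst

variable {M M' : Type u}

theorem const_closed (c : N) : (const c : Exp N).Closed := fun _ h => h

theorem mapConst_rename (k : N → N') (t : Exp N) (ρ : ℕ → ℕ) :
    (t.rename ρ).mapConst k = (t.mapConst k).rename ρ := bind_rename (fun _ => const_closed _) t ρ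

theorem mapConst_mapConst {N'' : Type u} (k : N → N') (k' : N' → N'') (t : Exp N) :
    (t.mapConst k).mapConst k' = t.mapConst fun c => k' (k c) := bind_bind _ _ t

theorem Exp.Closed.mapConst {t : Exp N} (ht : t.Closed) (k : N → N') : (t.mapConst k).Closed :=
  ht.bind fun _ => const_closed _

theorem betaApp_mapConst (k : N → N') (f s : Exp N) :
    (betaApp f s).mapConst k = betaApp (f.mapConst k) (s.mapConst k) := by
  cases f with
  | lam A t => exact bind_inst (fun _ => const_closed _) t s
  | _ => rfl

theorem piRel_mapConst (k : N → N') (mA mAB : Exp N) (oA : Option (Exp N)) (RB : Exp N) :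
    (piRel mA mAB oA RB).mapConst k = piRel (mA.mapConst k) (mAB.mapConst k)
      (oA.map (mapConst k)) (RB.mapConst k) := by
  cases oA with
  | none =>
    change lam _ (pi _ ((betaApp _ _).mapConst k)) = lam _ (pi _ _)
    rw [betaApp_mapConst, mapConst_rename]
    congr 2
    exact mapConst_rename _ _ _
  | some RA =>
    change lam _ (pi _ (pi ((betaApp _ _).mapConst k) ((betaApp _ _).mapConst k))) =
      lam _ (pi _ (pi _ _))
    have h1 : mapConst k (RA.lift.lift) = (mapConst k RA).lift.lift := by
      rw [lift, mapConst_rename, lift, mapConst_rename]; rfl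
    rw [betaApp_mapConst, betaApp_mapConst, mapConst_rename, h1]
    exact congrArg (fun x => lam _ (pi x _)) (mapConst_rename k mA Nat.succ)

theorem lamRel_mapConst (k : N → N') (mA : Exp N) (oA : Option (Exp N)) (Rt : Exp N) :
    (lamRel mA oA Rt).mapConst k = lamRel (mA.mapConst k) (oA.map (mapConst k))
      (Rt.mapConst k) := by
  cases oA with
  | none => rfl
  | some RA =>
    change lam _ (lam ((betaApp _ _).mapConst k) _) = _
    rw [betaApp_mapConst, lift, mapConst_rename]; rfl

theorem appRel_mapConst (k : N → N') (mt : Exp N) (ot : Option (Exp N)) (Rf : Exp N) :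
    (appRel mt ot Rf).mapConst k = appRel (mt.mapConst k) (ot.map (mapConst k))
      (Rf.mapConst k) := by
  cases ot <;> rfl

/-- `rel` is natural in the names of constants. This transports r from S and T to theories that
include them; with unchanged names, it shows that `rel` depends only on the values at the constants
that occur. -/
theorem rel_mapConst {m : N → Exp N'} {m' : M → Exp M'} {r : N → Option (Exp N')}
    {r' : M → Option (Exp M')} (g : N → M) (k : N' → M') {Q : N → Prop}
    (hm : ∀ c, Q c → m' (g c) = (m c).mapConst k)
    (hr : ∀ c, Q c → r' (g c) = (r c).map (mapConst k)) (e : Exp N) : Consts Q e →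
    ∀ ε : List Bool, rel m' r' ε (e.mapConst g) = (rel m r ε e).map (mapConst k) := by
  have hb : ∀ (e : Exp N), Consts Q e → ∀ ε : List Bool,
      ((e.mapConst g).bind m').rename (idx ε) = ((e.bind m).rename (idx ε)).mapConst k := by
    intro e he ε
    rw [mapConst_rename, mapConst, mapConst, bind_bind, bind_bind]
    exact congrArg _ (bind_congr hm he)
  induction e with
  | const c => intro hc ε; exact hr c hc
  | var i => intro _ ε; simp only [mapConst, Exp.bind, rel, Option.map_map]; rfl
  | type => intro _ ε; rfl
  | kind => intro _ ε; rfl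
  | lam A t ih1 ih2 =>
    intro hc ε
    change rel m' r' ε (Exp.lam (A.mapConst g) (t.mapConst g)) = _
    rw [rel_lam, rel_lam, ih1 hc.1, Option.isSome_map, ih2 hc.2, Option.map_map, Option.map_map,
      hb A hc.1]
    congr 1; funext R
    exact (lamRel_mapConst _ _ _ _).symm
  | pi A t ih1 ih2 =>
    intro hc ε
    have h3 := hb (Exp.pi A t) hc ε
    change rel m' r' ε (Exp.pi (A.mapConst g) (t.mapConst g)) = _
    change ((Exp.pi (A.mapConst g) (t.mapConst g)).bind m').rename (idx ε) = _ at h3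
    rw [rel_pi, rel_pi, ih1 hc.1, Option.isSome_map, ih2 hc.2, Option.map_map, Option.map_map,
      hb A hc.1, h3]
    congr 1; funext R
    exact (piRel_mapConst _ _ _ _ _).symm
  | app f t ih1 ih2 =>
    intro hc ε
    change rel m' r' ε (Exp.app (f.mapConst g) (t.mapConst g)) = _
    rw [rel_app, rel_app, ih1 hc.1, ih2 hc.2, Option.map_map, Option.map_map, hb t hc.2]
    congr 1; funext R
    exact (appRel_mapConst _ _ _ _).symm

theorem rel_congr {m m' : N → Exp N'} {r r' : N → Option (Exp N')} {Q : N → Prop}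
    (hm : ∀ c, Q c → m' c = m c) (hr : ∀ c, Q c → r' c = r c) {e : Exp N} (he : Consts Q e)
    (ε : List Bool) : rel m' r' ε e = rel m r ε e := by
  have hid : (mapConst id : Exp N' → Exp N') = id := funext bind_const
  have := rel_mapConst (m := m) (m' := m') (r := r) (r' := r') id id (Q := Q)
    (by simpa [hid] using hm) (by simpa [hid] using hr) e he ε
  rw [hid, Option.map_id, id] at this
  rwa [show e.mapConst id = e from bind_const e] at this

variable {S : List (Decl N N)} {T : List (Decl N' N')}

theorem IsLogRel.congr (hS : WF S) {m m' : N → Exp N'} {r r' : N → Option (Exp N')}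
    (hm : ∀ c, Declared S c → m' c = m c) (hr : ∀ c, Declared S c → r' c = r c)
    (h : IsLogRel S T m r) : IsLogRel S T m' r' := by
  intro d hd
  obtain ⟨⟨s, _, hty⟩, hdef⟩ := hS.typed d hd
  obtain ⟨h1, h2⟩ := h d hd
  rw [hm _ ⟨d, hd, rfl⟩, hr _ ⟨d, hd, rfl⟩, rel_congr hm hr hty.consts]
  refine ⟨h1, fun t ht => ?_⟩
  rw [rel_congr hm hr (hdef t ht).consts]
  exact h2 t ht

theorem option_rel_mono {α β : Type*} {p q : α → β → Prop} {a : Option α} {b : Option β}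
    (h : Option.Rel p a b) (hpq : ∀ a b, p a b → q a b) : Option.Rel q a b := by
  cases h with
  | some h => exact .some (hpq _ _ h)
  | none => exact .none

theorem IsLogRel.mono {T' : List (Decl N' N')} (hsub : ∀ d ∈ T, d ∈ T') {m : N → Exp N'}
    {r : N → Option (Exp N')} (h : IsLogRel S T m r) : IsLogRel S T' m r := by
  intro d hd
  obtain ⟨h1, h2⟩ := h d hd
  refine ⟨fun R hR => ?_, fun t ht => ?_⟩
  · obtain ⟨RA, hRA, h3⟩ := h1 R hR
    exact ⟨RA, hRA, h3.mono hsub⟩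
  · exact option_rel_mono (h2 t ht) fun _ _ h => Conv.mono hsub h

theorem TermTotal.congr (hS : WF S) {m m' : N → Exp N'} {r r' : N → Option (Exp N')}
    (hm : ∀ c, Declared S c → m' c = m c) (hr : ∀ c, Declared S c → r' c = r c)
    (h : TermTotal S m r) : TermTotal S m' r' := by
  intro d hd ht
  obtain ⟨⟨s, _, hty⟩, hdef⟩ := hS.typed d hd
  rw [hr _ ⟨d, hd, rfl⟩, rel_congr hm hr hty.consts]
  exact h d hd ht

end MapConst

/-! ### Pushouts and the translation of theories -/

section Translation

variable {L : Type u} {S : List (Decl N N)} {T : List (Decl N' N')} {m : N → Exp N'}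
  {r : N → Option (Exp N')}

theorem isMorphism_base (T : List (Decl N N)) (E : List (Decl L (N ⊕ L))) :
    IsMorphism T (full T E) fun c => const (Sum.inl c) := by
  intro d hd
  have hd' : d.base L ∈ full T E := List.mem_append_right _ (List.mem_map_of_mem hd)
  exact ⟨.const [] (d.base L) hd', fun t ht => .of_step
    (.delta (d.base L) _ hd' (by rw [Decl.base, ht]; rfl))⟩

theorem mem_base {N : Type u} {T : List (Decl N N)} {E : List (Decl L (N ⊕ L))}
    {e : Decl (N ⊕ L) (N ⊕ L)} (he : e ∈ full T E)
    (hE : e ∉ E.map Decl.local) : ∃ d ∈ T, e = d.base L := by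
  rcases List.mem_append.1 he with he | he
  · exact (hE he).elim
  · obtain ⟨d, hd, rfl⟩ := List.mem_map.1 he
    exact ⟨d, hd, rfl⟩

theorem closed_push (hm : ∀ c, (m c).Closed) (c : N ⊕ L) : (push L m c).Closed := by
  cases c with
  | inl c => exact (hm c).mapConst _
  | inr c => exact const_closed _

theorem mapConst_inl_bind_push (t : Exp N) :
    (t.mapConst Sum.inl).bind (push L m) = (t.bind m).mapConst Sum.inl := by
  rw [mapConst, mapConst, bind_bind, bind_bind]; rfl

theorem isMorphism_push_base (hmor : IsMorphism S T m) (E : List (Decl L (N' ⊕ L))) :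
    ∀ d ∈ S, HasType (full T E) [] (push L m (d.base L).name) ((d.base L).type.bind (push L m)) ∧
      ∀ t, (d.base L).defn = some t →
        Conv (full T E) (push L m (d.base L).name) (t.bind (push L m)) := by
  intro d hd
  have hb := isMorphism_base T E
  refine ⟨?_, fun t ht => ?_⟩
  · change HasType _ _ ((m d.name).mapConst Sum.inl) ((d.type.mapConst Sum.inl).bind _)
    rw [mapConst_inl_bind_push]
    exact (hmor d hd).1.bind (fun _ => const_closed _) hb
  · obtain ⟨t, ht', rfl⟩ := Option.map_eq_some_iff.1 ht
    rw [mapConst_inl_bind_push]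
    exact ((hmor d hd).2 t ht').bind (fun _ => const_closed _) hb

/-- The presentation agrees with the literal pushout only up to conversion over the earlier
declarations. The conversion rule absorbs the difference at every declaration. -/
theorem IsPushout.isMorphism (hm : ∀ c, (m c).Closed) (hmor : IsMorphism S T m)
    {E : List (Decl L (N ⊕ L))} {E' : List (Decl L (N' ⊕ L))} (h : IsPushout T m E E') :
    WF (full S E) → IsMorphism (full S E) (full T E') (push L m) := by
  induction h with
  | nil =>
    intro _ e he
    obtain ⟨d, hd, rfl⟩ := mem_base he (by simp)
    exact isMorphism_push_base hmor [] d hd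
  | @cons E E' d d' _ hn hc hdc ih =>
    intro hW
    cases hW with
    | @cons _ _ s hW _ hs hd hdef =>
    have ih := ih hW
    have hsub : ∀ e ∈ full T E', e ∈ full T (d' :: E') := fun e he => List.mem_cons_of_mem _ he
    intro e he
    rcases List.mem_cons.1 he with rfl | he
    · have hmem : d'.local ∈ full T (d' :: E') := List.mem_cons_self
      have hname : push L m d.local.name = const d'.local.name := by
        change const (Sum.inr d.name) = const (Sum.inr d'.name); rw [hn]
      refine ⟨?_, fun t ht => ?_⟩
      · rw [hname]
        exact (HasType.const [] d'.local hmem).conv hs.bind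
          ((hd.bind (closed_push hm) ih).mono hsub) (hc.mono hsub).symm
      · have ht : d.defn = some t := ht
        rw [ht] at hdc
        generalize ho : d'.defn = o at hdc
        cases hdc with
        | some hdc =>
        rw [hname]
        exact (Conv.of_step (.delta d'.local _ hmem ho)).trans (hdc.mono hsub).symm
    · exact ⟨(ih e he).1.mono hsub, fun t ht => ((ih e he).2 t ht).mono hsub⟩

/-- A declaration of the pushout as one of the translation. -/
def Decl.plain (e : Decl (N' ⊕ L) (N' ⊕ L)) : Decl (N' ⊕ (L ⊕ L)) (N' ⊕ (L ⊕ L)) where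
  name := LF.plain e.name
  type := e.type.mapConst LF.plain
  defn := e.defn.map (mapConst LF.plain)

theorem isMorphism_plain {A : List (Decl (N' ⊕ L) (N' ⊕ L))}
    {B : List (Decl (N' ⊕ (L ⊕ L)) (N' ⊕ (L ⊕ L)))} (h : ∀ e ∈ A, e.plain ∈ B) :
    IsMorphism A B fun c => const (plain c) := by
  intro d hd
  exact ⟨.const [] d.plain (h d hd), fun t ht => .of_step
    (.delta d.plain _ (h d hd) (by rw [Decl.plain, ht]; rfl))⟩

theorem base_plain (d : Decl N' N') : (d.base L).plain = d.base (L ⊕ L) := by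
  cases d with
  | mk n A t =>
    cases t with
    | none => simp only [Decl.plain, Decl.base, mapConst_mapConst]; rfl
    | some t => simp only [Decl.plain, Decl.base, mapConst_mapConst, Option.map]; rfl

variable [DecidableEq L] {P : L → Finset ℕ}

/-- The factorization of m_E into the pushout, the removal of arguments and a renaming of constants.
All three are morphisms, hence so is m_E. -/
theorem softMor_eq (E' : List (Decl L (N' ⊕ L))) : softMor m P E' =
    fun c => ((push L m c).bind (fix (eraser P E'))).bind fun c => const (plain c) := by
  funext c
  cases c with
  | inl c =>
    change (m c).mapConst Sum.inl = ((((m c).mapConst Sum.inl).bind _)).bind _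
    rw [mapConst, mapConst, bind_bind, bind_bind]; rfl
  | inr c => rfl

theorem closed_softMor (hm : ∀ c, (m c).Closed) {E' : List (Decl L (N' ⊕ L))}
    (hE : EraserData T P E') (c : N ⊕ L) : (softMor m P E' c).Closed := by
  rw [softMor_eq]
  exact ((closed_push hm c).bind hE.closed).bind fun _ => const_closed _

theorem isMorphism_softMor (hm : ∀ c, (m c).Closed) (hmor : IsMorphism S T m)
    {E : List (Decl L (N ⊕ L))} {E' : List (Decl L (N' ⊕ L))} (h : IsPushout T m E E')
    (hW : WF (full S E)) (hE : EraserData T P E') {X : List (Decl (L ⊕ L) (N' ⊕ (L ⊕ L)))}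
    (hX : ∀ e ∈ full T (cleanDecls P E'), e.plain ∈ full T X) :
    IsMorphism (full S E) (full T X) (softMor m P E') := by
  rw [softMor_eq]
  exact ((h.isMorphism hm hmor hW).comp hE.mor hE.closed).comp (isMorphism_plain hX)
    fun _ => const_closed _

/-- The plain declaration for the first constant of a theory. -/
def softPlain (P : L → Finset ℕ) (E' : List (Decl L (N' ⊕ L))) (d' : Decl L (N' ⊕ L)) :
    Decl (L ⊕ L) (N' ⊕ (L ⊕ L)) :=
  ⟨Sum.inl d'.name, (cleanDecl P E' d').type.mapConst plain,
    (cleanDecl P E' d').defn.map (mapConst plain)⟩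

theorem softDecls_cons (d : Decl L (N ⊕ L)) (E : List (Decl L (N ⊕ L))) (d' : Decl L (N' ⊕ L))
    (E' : List (Decl L (N' ⊕ L))) : softDecls m r P (d :: E) (d' :: E') =
      (starDecl (softMor m P (d' :: E')) (softRel m r P E E') d).toList ++
        softPlain P E' d' :: softDecls m r P E E' := rfl

theorem plain_mem_cons {E' : List (Decl L (N' ⊕ L))} {X : List (Decl (L ⊕ L) (N' ⊕ (L ⊕ L)))}
    (hX : ∀ e ∈ full T (cleanDecls P E'), e.plain ∈ full T X) (d' : Decl L (N' ⊕ L)) :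
    ∀ e ∈ full T (cleanDecls P (d' :: E')), e.plain ∈ full T (softPlain P E' d' :: X) := by
  intro e he
  rcases List.mem_cons.1 he with rfl | he
  · exact List.mem_cons_self
  · exact List.mem_cons_of_mem _ (hX e he)

theorem full_append_sub {N L : Type u} {T : List (Decl N N)} {X Y : List (Decl L (N ⊕ L))} :
    ∀ e ∈ full T X, e ∈ full T (Y ++ X) := by
  intro e he
  rw [full, List.map_append, List.append_assoc]
  exact List.mem_append_right _ he

theorem IsPushout.plain_mem {E : List (Decl L (N ⊕ L))} {E' : List (Decl L (N' ⊕ L))}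
    (h : IsPushout T m E E') :
    ∀ e ∈ full T (cleanDecls P E'), e.plain ∈ full T (softDecls m r P E E') := by
  induction h with
  | nil =>
    intro e he
    obtain ⟨d, hd, rfl⟩ := mem_base he (by simp [cleanDecls])
    rw [base_plain]
    exact List.mem_append_right _ (List.mem_map_of_mem hd)
  | cons _ _ _ _ ih =>
    intro e he
    rw [softDecls_cons]
    exact full_append_sub _ (plain_mem_cons ih _ e he)

theorem starDecl_some {mE : N ⊕ L → Exp (N' ⊕ (L ⊕ L))}
    {rE : N ⊕ L → Option (Exp (N' ⊕ (L ⊕ L)))} {d : Decl L (N ⊕ L)}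
    {s : Decl (L ⊕ L) (N' ⊕ (L ⊕ L))} (h : starDecl mE rE d = some s) :
    s.name = Sum.inr d.name ∧ (∃ RA, rel mE rE [] d.type = some RA ∧
      s.type = betaApp RA (mE (Sum.inr d.name))) ∧
    (d.defn = none ∧ s.defn = none ∨ ∃ t Rt, d.defn = some t ∧ rel mE rE [] t = some Rt ∧
      s.defn = some Rt) := by
  rw [starDecl] at h
  cases hA : rel mE rE [] d.type with
  | none => rw [hA] at h; cases h
  | some RA =>
    rw [hA] at h
    cases ht : d.defn with
    | none =>
      rw [ht] at h
      cases h
      exact ⟨rfl, ⟨RA, rfl, rfl⟩, Or.inl ⟨rfl, rfl⟩⟩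
    | some t =>
      rw [ht] at h
      obtain ⟨Rt, hRt, rfl⟩ := Option.map_eq_some_iff.1 h
      exact ⟨rfl, ⟨RA, rfl, rfl⟩, Or.inr ⟨t, Rt, rfl, hRt, rfl⟩⟩

theorem starDecl_isSome {mE : N ⊕ L → Exp (N' ⊕ (L ⊕ L))}
    {rE : N ⊕ L → Option (Exp (N' ⊕ (L ⊕ L)))} {d : Decl L (N ⊕ L)}
    (h : (rel mE rE [] d.type).isSome)
    (h' : ∀ t, d.defn = some t → (rel mE rE [] t).isSome) : (starDecl mE rE d).isSome := by
  obtain ⟨RA, hA⟩ := Option.isSome_iff_exists.1 h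
  rw [starDecl, hA]
  cases ht : d.defn with
  | none => rfl
  | some t => simpa using h' t ht

/-- Serves to show that a newly added name is fresh. -/
theorem IsPushout.soft_names {E : List (Decl L (N ⊕ L))} {E' : List (Decl L (N' ⊕ L))}
    (h : IsPushout T m E E') : ∀ e ∈ full T (softDecls m r P E E'),
      (∃ c, e.name = Sum.inl c) ∨
      ∃ d ∈ E, e.name = Sum.inr (Sum.inl d.name) ∨ e.name = Sum.inr (Sum.inr d.name) := by
  induction h with
  | nil =>
    intro e he
    obtain ⟨d, hd, rfl⟩ := mem_base he (by simp [softDecls])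
    exact Or.inl ⟨_, rfl⟩
  | @cons E E' d d' _ hn _ _ ih =>
    intro e he
    rw [softDecls_cons, full, List.map_append, List.append_assoc] at he
    rcases List.mem_append.1 he with he | he
    · obtain ⟨s, hs, rfl⟩ := List.mem_map.1 he
      obtain ⟨h1, _⟩ := starDecl_some (Option.mem_toList.1 hs)
      exact Or.inr ⟨d, List.mem_cons_self, Or.inr (congrArg Sum.inr h1)⟩
    · rcases List.mem_cons.1 he with rfl | he
      · exact Or.inr ⟨d, List.mem_cons_self, Or.inl (congrArg (fun x => Sum.inr (Sum.inl x)) hn)⟩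
      · rcases ih e he with h | ⟨d, hd, h⟩
        · exact Or.inl h
        · exact Or.inr ⟨d, List.mem_cons_of_mem _ hd, h⟩

theorem softRel_self (d : Decl L (N ⊕ L)) (E : List (Decl L (N ⊕ L))) (d' : Decl L (N' ⊕ L))
    (E' : List (Decl L (N' ⊕ L))) : softRel m r P (d :: E) (d' :: E') (Sum.inr d.name) =
      (starDecl (softMor m P (d' :: E')) (softRel m r P E E') d).map
        fun s => const (Sum.inr s.name) := if_pos rfl

/-- The values of the morphism and of the relation at the other constants do not change when a
declaration is added. -/
theorem soft_declared {d : Decl L (N ⊕ L)} {E : List (Decl L (N ⊕ L))} {d' : Decl L (N' ⊕ L)}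
    (E' : List (Decl L (N' ⊕ L))) (hn : ∀ e ∈ full S E, e.name ≠ d.local.name)
    (hd : d'.name = d.name) (c : N ⊕ L) (hc : Declared (full S E) c) :
    softMor m P (d' :: E') c = softMor m P E' c ∧
      softRel m r P (d :: E) (d' :: E') c = softRel m r P E E' c := by
  obtain ⟨e, he, rfl⟩ := hc
  have hne := hn e he
  revert hne
  cases e.name with
  | inl c => intro _; exact ⟨rfl, rfl⟩
  | inr c =>
    intro hne
    have hne : c ≠ d.name := by rintro rfl; exact hne rfl
    constructor
    · change (eraser P (d' :: E') c).mapConst plain = (eraser P E' c).mapConst plain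
      rw [eraser, if_neg (by rwa [hd])]
    · exact if_neg hne

end Translation
/-! ### The translation of a theory -/

section Soft

variable {L : Type u} [DecidableEq L] {S : List (Decl N N)} {T : List (Decl N' N')}
  {m : N → Exp N'} {r : N → Option (Exp N')} {P : L → Finset ℕ}

/-- The properties of the translation of a theory. -/
structure SoftData (S : List (Decl N N)) (T : List (Decl N' N')) (m : N → Exp N')
    (r : N → Option (Exp N')) (P : L → Finset ℕ) (E : List (Decl L (N ⊕ L)))
    (E' : List (Decl L (N' ⊕ L))) : Prop where
  wf : WF (full T (softDecls m r P E E'))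
  log : IsLogRel (full S E) (full T (softDecls m r P E E')) (softMor m P E') (softRel m r P E E')
  total : TermTotal (full S E) (softMor m P E') (softRel m r P E E')

theorem WF.full_nil (h : WF T) : WF (full T ([] : List (Decl L (N' ⊕ L)))) := by
  induction h with
  | nil => exact .nil
  | @cons T d s hT hn hs hd hdef ih =>
    have hb := isMorphism_base T ([] : List (Decl L (N' ⊕ L)))
    refine .cons (d := d.base L) ih ?_ hs.bind (hd.bind (fun _ => const_closed _) hb) ?_
    · intro e he hne
      obtain ⟨d', hd', rfl⟩ := List.mem_map.1 (show e ∈ T.map (Decl.base L) from he)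
      exact hn d' hd' (Sum.inl.inj hne)
    · intro t ht
      obtain ⟨t, ht', rfl⟩ := Option.map_eq_some_iff.1 ht
      exact (hdef t ht').bind (fun _ => const_closed _) hb

/-- All data come from S and T by renaming constants. For term-totality, uniqueness of sorts shows
that a constant whose type has sort `type` in the extension already had such a type in S. -/
theorem SoftData.nil (hS : WF S) (hr : IsLogRel S T m r) (htot : TermTotal S m r)
    (hSE : WF (full S ([] : List (Decl L (N ⊕ L))))) (hT : WF T) :
    SoftData S T m r P [] [] := by
  have hrel : ∀ {e : Exp N}, rel (softMor m P []) (softRel m r P [] []) [] (e.mapConst Sum.inl) =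
      (rel m r [] e).map (mapConst Sum.inl) := fun {e} =>
    rel_mapConst (Q := fun _ => True) Sum.inl Sum.inl (fun _ _ => rfl) (fun _ _ => rfl) e
      (by induction e <;> simp_all [Consts]) []
  have hb := isMorphism_base T ([] : List (Decl (L ⊕ L) (N' ⊕ (L ⊕ L))))
  refine ⟨hT.full_nil, ?_, ?_⟩
  · intro e he
    obtain ⟨d, hd, rfl⟩ := mem_base he (by simp)
    obtain ⟨h1, h2⟩ := hr d hd
    refine ⟨fun R hR => ?_, fun t ht => ?_⟩
    · obtain ⟨R, hR', rfl⟩ := Option.map_eq_some_iff.1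
        (show (r d.name).map (mapConst Sum.inl) = some R from hR)
      obtain ⟨RA, hRA, h3⟩ := h1 R hR'
      refine ⟨RA.mapConst Sum.inl, ?_, ?_⟩
      · exact hrel.trans (by rw [hRA]; rfl)
      · have := h3.bind (fun _ => const_closed _) hb
        change HasType _ _ _ ((betaApp _ _).mapConst Sum.inl) at this
        rw [betaApp_mapConst] at this
        exact this
    · obtain ⟨t, ht', rfl⟩ := Option.map_eq_some_iff.1 ht
      rw [hrel]
      change Option.Rel _ ((r d.name).map (mapConst Sum.inl)) _
      have := h2 t ht'
      revert this
      generalize r d.name = a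
      generalize rel m r [] t = b
      intro this
      cases this with
      | none => exact .none
      | some h => exact .some (h.bind (fun _ => const_closed _) hb)
  · intro e he ht hs
    obtain ⟨d, hd, rfl⟩ := mem_base he (by simp)
    obtain ⟨⟨s, hsort, hty⟩, _⟩ := hS.typed d hd
    have h1 := hty.bind (fun _ => const_closed _)
      (isMorphism_base S ([] : List (Decl L (N ⊕ L))))
    have := h1.sort_unique hSE Ctx.nil hsort.bind (Or.inl rfl) ht
    have : s = type := by
      rcases hsort with rfl | rfl
      · rfl
      · cases this
    subst this
    change (rel _ _ [] (d.type.mapConst Sum.inl)).isSome at hs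
    rw [hrel, Option.isSome_map] at hs
    change ((r d.name).map (mapConst Sum.inl)).isSome
    rw [Option.isSome_map]
    exact htot d hd hty hs

/-- The plain declaration is added before the starred one. The basic lemma is applied to the earlier
declarations of E as source, but with the new plain constant already in the target, so that r_E(A)
can be applied to m_E(c). -/
theorem SoftData.cons (hm : ∀ c, (m c).Closed) (hmor : IsMorphism S T m)
    {E : List (Decl L (N ⊕ L))} {E' : List (Decl L (N' ⊕ L))} {d : Decl L (N ⊕ L)}
    {d' : Decl L (N' ⊕ L)} (h : IsPushout T m E E') (h' : IsPushout T m (d :: E) (d' :: E'))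
    (hname : d'.name = d.name)
    (hSE : WF (full S (d :: E))) (hTE : WF (full T (d' :: E'))) (hU : Unused P (d' :: E'))
    (ih : SoftData S T m r P E E') : SoftData S T m r P (d :: E) (d' :: E') := by
  have hEr := EraserData.of_wf hTE hU
  have hW0 := hSE
  have hTE0 := hTE
  cases hSE with
  | @cons _ _ s hW hn hs hd hdef =>
  cases hTE with
  | @cons _ _ s' hTW hn' hs' hd' hdef' =>
  have hW : WF (full S E) := hW
  have hd : HasType (full S E) [] d.type s := hd
  have hdef : ∀ t, d.defn = some t → HasType (full S E) [] t d.type := hdef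
  have hEr' := EraserData.of_wf hTW hU.1
  obtain ⟨_, hcl2, hcl3⟩ := cleanDecl_hasType hEr' hs' hd' hdef' hU
  have hpl := h.plain_mem (r := r) (P := P)
  have hplm := isMorphism_plain hpl
  have hsubS : ∀ e ∈ full S E, e ∈ full S (d :: E) := fun e he => List.mem_cons_of_mem _ he
  have hX : ∀ e ∈ full T (softDecls m r P E E'),
      e ∈ full T (softPlain P E' d' :: softDecls m r P E E') :=
    fun e he => List.mem_cons_of_mem _ he
  have fresh : ∀ e ∈ E, e.name ≠ d.name := fun e he hne =>
    hn e.local (List.mem_append_left _ (List.mem_map_of_mem he)) (congrArg Sum.inr hne)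
  have hWX : WF (full T (softPlain P E' d' :: softDecls m r P E E')) := by
    refine .cons ih.wf ?_ hs'.bind (hcl2.bind (fun _ => const_closed _) hplm) ?_
    · intro e he hne
      have hne : e.name = Sum.inr (Sum.inl d.name) := hname ▸ hne
      rcases h.soft_names e he with ⟨c, hc⟩ | ⟨d₁, hd₁, h1 | h1⟩
      · rw [hc] at hne; cases hne
      · rw [h1] at hne; exact fresh d₁ hd₁ (Sum.inl.inj (Sum.inr.inj hne))
      · rw [h1] at hne; cases hne
    · intro t ht
      obtain ⟨t, ht', rfl⟩ := Option.map_eq_some_iff.1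
        (show (cleanDecl P E' d').defn.map (mapConst plain) = some t from ht)
      exact (hcl3 t ht').bind (fun _ => const_closed _) hplm
  have hmX : IsMorphism (full S (d :: E)) (full T (softPlain P E' d' :: softDecls m r P E E'))
      (softMor m P (d' :: E')) :=
    isMorphism_softMor hm hmor h' hW0 hEr (plain_mem_cons hpl d')
  have hcongr := soft_declared (m := m) (r := r) (P := P) E' hn hname
  have hlog : IsLogRel (full S E) (full T (softPlain P E' d' :: softDecls m r P E E'))
      (softMor m P (d' :: E')) (softRel m r P (d :: E) (d' :: E')) :=
    (ih.log.mono hX).congr hW (fun c hc => (hcongr c hc).1) fun c hc => (hcongr c hc).2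
  have htot : TermTotal (full S E) (softMor m P (d' :: E')) (softRel m r P (d :: E) (d' :: E')) :=
    ih.total.congr hW (fun c hc => (hcongr c hc).1) fun c hc => (hcongr c hc).2
  obtain ⟨sh, hsh⟩ := hW.exists_shaping fun c => (softRel m r P (d :: E) (d' :: E') c).isSome
  have D : RelData (full S E) (full T (softPlain P E' d' :: softDecls m r P E E'))
      (softMor m P (d' :: E')) (softRel m r P (d :: E) (d' :: E')) sh :=
    ⟨hW, hWX, closed_softMor hm hEr, fun e he => hmX e (hsubS e he), hlog, htot, hsh⟩
  have hrel : ∀ {e : Exp (N ⊕ L)}, Consts (Declared (full S E)) e →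
      rel (softMor m P (d' :: E')) (softRel m r P (d :: E) (d' :: E')) [] e =
        rel (softMor m P (d' :: E')) (softRel m r P E E') [] e := fun he =>
    rel_congr (fun _ _ => rfl) (fun c hc => (hcongr c hc).2) he []
  have hmd := hmX d.local List.mem_cons_self
  have hnk : ∀ {t : Exp (N ⊕ L)}, HasType (full S E) [] t d.type → d.type ≠ kind := by
    intro t _ hk
    have h2 : HasType (full S E) [] kind s := hk ▸ hd
    exact h2.not_conv_kind hW Ctx.nil hs (Conv.refl _ _)
  -- The type of c* is well-typed. If A is a kind, the basic lemma yields only an applied predicate,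
  -- which is just what the declaration contains.
  have hpred : ∀ RA, rel (softMor m P (d' :: E')) (softRel m r P (d :: E) (d' :: E')) []
      d.type = some RA → HasType (full T (softPlain P E' d' :: softDecls m r P E E')) []
        (betaApp RA (softMor m P (d' :: E') (Sum.inr d.name)))
        (s.bind (softMor m P (d' :: E'))) := by
    intro RA hRA
    obtain ⟨h1, h2⟩ := D.basic hd Ctx.nil Ctx.nil hRA
    have hid : ∀ t : Exp (N' ⊕ (L ⊕ L)), t.rename (idx []) = t := rename_id
    have hF : HasType (full T (softPlain P E' d' :: softDecls m r P E E')) []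
      (softMor m P (d' :: E') (Sum.inr d.name))
      ((d.type.bind (softMor m P (d' :: E'))).rename (idx [])) := by
      rw [hid]; exact hmd.1
    rcases hs with rfl | rfl
    · obtain ⟨RA', hRA', h2⟩ := h2 (by simp)
      cases hRA'
      exact (IsPred.of_hasType hWX h2).betaApp hWX Ctx.nil hF
    · exact (h1 rfl).betaApp hWX Ctx.nil hF
  have hdefn : ∀ t, d.defn = some t → ∀ Rt, rel (softMor m P (d' :: E'))
      (softRel m r P (d :: E) (d' :: E')) [] t = some Rt → ∃ RA, rel (softMor m P (d' :: E'))
      (softRel m r P (d :: E) (d' :: E')) [] d.type = some RA ∧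
      HasType (full T (softPlain P E' d' :: softDecls m r P E E')) [] Rt
        (betaApp RA (softMor m P (d' :: E') (Sum.inr d.name))) := by
    intro t ht Rt hRt
    obtain ⟨RA, hRA, h1⟩ := (D.basic (hdef t ht) Ctx.nil Ctx.nil hRt).2 (hnk (hdef t ht))
    refine ⟨RA, hRA, h1.conv hs.bind (hpred RA hRA) (Conv.betaApp_congr (Conv.refl _ _) ?_)⟩
    refine Conv.trans (.of_eq ?_) (hmd.2 t ht).symm
    exact rename_id _
  obtain ⟨X, hXeq, hWX', hstar⟩ : ∃ X, softDecls m r P (d :: E) (d' :: E') =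
      X ++ softPlain P E' d' :: softDecls m r P E E' ∧
      WF (full T (softDecls m r P (d :: E) (d' :: E'))) ∧
      ∀ st, starDecl (softMor m P (d' :: E')) (softRel m r P E E') d = some st →
        st.local ∈ full T (softDecls m r P (d :: E) (d' :: E')) := by
    refine ⟨_, softDecls_cons _ _ _ _, ?_⟩
    rw [softDecls_cons]
    cases hst : starDecl (softMor m P (d' :: E')) (softRel m r P E E') d with
    | none => exact ⟨hWX, fun st h => by cases h⟩
    | some st =>
      obtain ⟨hname', ⟨RA, hRA, hty⟩, hdd⟩ := starDecl_some hst
      rw [← hrel hd.consts] at hRA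
      refine ⟨?_, fun st' h => ?_⟩
      · refine .cons hWX ?_ (hs.bind (m := softMor m P (d' :: E'))) ?_ ?_
        · intro e he hne
          have hne : e.name = Sum.inr (Sum.inr d.name) := hne.trans (congrArg Sum.inr hname')
          rcases List.mem_cons.1 he with rfl | he
          · cases hne
          rcases h.soft_names e he with ⟨c, hc⟩ | ⟨d₁, hd₁, h1 | h1⟩
          · rw [hc] at hne; cases hne
          · rw [h1] at hne; cases hne
          · rw [h1] at hne; exact fresh d₁ hd₁ (Sum.inr.inj (Sum.inr.inj hne))
        · change HasType _ [] st.type _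
          rw [hty]
          exact hpred RA hRA
        · intro Rt hRt
          have hRt : st.defn = some Rt := hRt
          change HasType _ [] Rt st.type
          rw [hty]
          rcases hdd with ⟨_, hdd⟩ | ⟨t, Rt', ht, h2, h3⟩
          · rw [hdd] at hRt; cases hRt
          · obtain rfl := Option.some.inj (h3.symm.trans hRt)
            rw [← hrel (hdef t ht).consts] at h2
            obtain ⟨RA', hRA', h4⟩ := hdefn t ht _ h2
            obtain rfl := Option.some.inj (hRA.symm.trans hRA')
            exact h4
      · obtain rfl := Option.some.inj h
        exact List.mem_cons_self
  have hX2 : ∀ e ∈ full T (softPlain P E' d' :: softDecls m r P E E'),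
      e ∈ full T (softDecls m r P (d :: E) (d' :: E')) := by
    rw [hXeq]; exact full_append_sub
  refine ⟨hWX', ?_, ?_⟩
  · intro e he
    rcases List.mem_cons.1 he with rfl | he
    · change (∀ R, softRel m r P (d :: E) (d' :: E') (Sum.inr d.name) = some R → _) ∧
        ∀ t, d.defn = some t →
          Option.Rel _ (softRel m r P (d :: E) (d' :: E') (Sum.inr d.name)) _
      rw [softRel_self]
      refine ⟨fun R hR => ?_, fun t ht => ?_⟩
      · obtain ⟨st, hst, rfl⟩ := Option.map_eq_some_iff.1 hR
        obtain ⟨hname', ⟨RA, hRA, hty⟩, hdd⟩ := starDecl_some hst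
        rw [← hrel hd.consts] at hRA
        refine ⟨RA, hRA, ?_⟩
        have := HasType.const [] st.local (hstar st hst)
        rw [show st.local.type = _ from hty] at this
        exact this
      · cases hRt : rel (softMor m P (d' :: E')) (softRel m r P (d :: E) (d' :: E')) [] t with
        | none =>
          cases hst : starDecl (softMor m P (d' :: E')) (softRel m r P E E') d with
          | none => exact .none
          | some st =>
            obtain ⟨hname', _, ⟨hdd, _⟩ | ⟨t', Rt', ht', h2, h3⟩⟩ := starDecl_some hst
            · rw [hdd] at ht; cases ht
            · obtain rfl := Option.some.inj (ht.symm.trans ht')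
              rw [← hrel (hdef t ht).consts, hRt] at h2; cases h2
        | some Rt =>
          -- By the basic lemma the relation is defined for the type whenever it is for the
          -- definition. So c* is declared as soon as r_E(t) is defined.
          obtain ⟨RA, hRA, _⟩ := hdefn t ht Rt hRt
          have : (starDecl (softMor m P (d' :: E')) (softRel m r P E E') d).isSome := by
            refine starDecl_isSome ?_ fun t' ht' => ?_
            · rw [← hrel hd.consts, hRA]; rfl
            · obtain rfl := Option.some.inj (ht.symm.trans ht')
              rw [← hrel (hdef t ht).consts, hRt]; rfl
          obtain ⟨st, hst⟩ := Option.isSome_iff_exists.1 this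
          rw [hst]
          refine .some (Conv.of_step (.delta st.local _ (hstar st hst) ?_))
          obtain ⟨hname', _, ⟨hdd, _⟩ | ⟨t', Rt', ht', h2, h3⟩⟩ := starDecl_some hst
          · rw [hdd] at ht; cases ht
          · obtain rfl := Option.some.inj (ht.symm.trans ht')
            rw [← hrel (hdef t ht).consts, hRt] at h2
            cases h2
            exact h3
    · obtain ⟨h1, h2⟩ := (hlog.mono hX2) e he
      exact ⟨h1, h2⟩
  · intro e he hty hsome
    rcases List.mem_cons.1 he with rfl | he
    · change (softRel m r P (d :: E) (d' :: E') (Sum.inr d.name)).isSome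
      rw [softRel_self, Option.isSome_map]
      have hsome : (rel (softMor m P (d' :: E')) (softRel m r P (d :: E) (d' :: E')) []
        d.type).isSome := hsome
      have hst : s = Exp.type := (hd.mono hsubS).sort_unique hW0 Ctx.nil hs (Or.inl rfl) hty
      subst hst
      refine starDecl_isSome ?_ fun t ht => ?_
      · rwa [← hrel hd.consts]
      · rw [← hrel (hdef t ht).consts]
        -- For an object, the relation is defined for the definition exactly when it is for the
        -- type. So the definition cannot prevent c* from being declared.
        have h1 := D.bits.isSome_rel (m := softMor m P (d' :: E')) hW hsh (hdef t ht) Ctx.nil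
        obtain ⟨a, ha, h0, hbit⟩ := hsh.ebit_type hW CtxSh.nil hd
        have h2 := rel_isSome_ctx D Ctx.nil hd
        rw [index_of_shape ha, setStar_of_lev h0, ← hbit, ← h2] at h1
        exact h1.trans hsome
    · obtain ⟨⟨s, hsort, hty'⟩, _⟩ := hW.typed e he
      have := (hty'.mono hsubS).sort_unique hW0 Ctx.nil hsort (Or.inl rfl) hty
      exact htot e he (this ▸ hty') hsome

theorem SoftData.of_isPushout (hS : WF S) (hm : ∀ c, (m c).Closed) (hmor : IsMorphism S T m)
    (hr : IsLogRel S T m r) (htot : TermTotal S m r) (hT : WF T)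
    {E : List (Decl L (N ⊕ L))} {E' : List (Decl L (N' ⊕ L))} (h : IsPushout T m E E') :
    WF (full S E) → WF (full T E') → Unused P E' → SoftData S T m r P E E' := by
  induction h with
  | nil => intro h1 _ _; exact .nil hS hr htot h1 hT
  | cons h hn hc hdc ih =>
    intro h1 h2 hU
    have h3 := h1
    have h4 := h2
    cases h3 with
    | cons hW _ _ _ _ =>
    cases h4 with
    | cons hW' _ _ _ _ =>
    exact .cons hm hmor h (.cons h hn hc hdc) hn h1 h2 hU (ih hW hW' hU.1)

end Soft
/-! ### Morphisms and logical relations -/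

section Commutation

variable {M M' : Type u}

theorem Conv.bind_of_consts {T : List (Decl N' N')} {Q : N → Prop} {m m' : N → Exp N'}
    (h : ∀ c, Q c → Conv T (m c) (m' c)) {e : Exp N} (he : Consts Q e) :
    Conv T (e.bind m) (e.bind m') := by
  induction e with
  | const c => exact h c he
  | lam A t ih1 ih2 => exact Conv.lam (ih1 he.1) (ih2 he.2)
  | pi A t ih1 ih2 => exact Conv.pi (ih1 he.1) (ih2 he.2)
  | app A t ih1 ih2 => exact Conv.app (ih1 he.1) (ih2 he.2)
  | _ => exact Conv.refl _ _

theorem Conv.betaApp_bind {T : List (Decl N' N')} {γ : N → Exp N'} {f s : Exp N} {f' s' : Exp N'}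
    (hγ : ∀ c, (γ c).Closed) (hf : Conv T (Exp.bind γ f) f') (hs : Conv T (Exp.bind γ s) s') :
    Conv T (Exp.bind γ (Exp.betaApp f s)) (Exp.betaApp f' s') := by
  refine Conv.trans ?_ ((Conv.app hf hs).trans (Conv.betaApp _ _).symm)
  cases f with
  | lam A t =>
    change Conv T (Exp.bind γ (t.inst s))
      (Exp.app (Exp.lam (Exp.bind γ A) (Exp.bind γ t)) (Exp.bind γ s))
    rw [bind_inst hγ]
    exact (Conv.beta _ _ _).symm
  | _ => exact Conv.refl _ _

variable {X : List (Decl M' M')} {γ : N' → Exp M'}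

theorem Conv.rename_bind (hX : Sane X) (hγ : ∀ c, (γ c).Closed) {t : Exp N'} {t' : Exp M'}
    (h : Conv X (t.bind γ) t') (ρ : ℕ → ℕ) :
    Conv X ((t.rename ρ).bind γ) (t'.rename ρ) := by
  rw [bind_rename hγ]
  exact h.rename hX ρ

theorem piRel_bind_conv (hX : Sane X) (hγ : ∀ c, (γ c).Closed)
    {mA mAB RB : Exp N'} {oA : Option (Exp N')} {mA' mAB' RB' : Exp M'}
    {oA' : Option (Exp M')} (h1 : Conv X (mA.bind γ) mA') (h2 : Conv X (mAB.bind γ) mAB')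
    (h3 : Option.Rel (Conv X) (oA.map (Exp.bind γ)) oA') (h4 : Conv X (RB.bind γ) RB') :
    Conv X ((piRel mA mAB oA RB).bind γ) (piRel mA' mAB' oA' RB') := by
  have hv : ∀ t : Exp M', Conv X t t := Conv.refl X
  have hl := fun {t : Exp N'} {t' : Exp M'} (h : Conv X (t.bind γ) t') =>
    Conv.rename_bind hX hγ h Nat.succ
  cases oA with
  | none =>
    cases h3
    exact Conv.lam h2 (Conv.pi (hl h1)
      (Conv.betaApp_bind hγ (Conv.rename_bind hX hγ h4 _) (hv _)))
  | some RA =>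
    cases h3 with
    | some h3 =>
    exact Conv.lam h2 (Conv.pi (hl h1) (Conv.pi (Conv.betaApp_bind hγ (hl (hl h3)) (hv _))
      (Conv.betaApp_bind hγ (Conv.rename_bind hX hγ h4 _) (hv _))))

theorem lamRel_bind_conv (hX : Sane X) (hγ : ∀ c, (γ c).Closed)
    {mA Rt : Exp N'} {oA : Option (Exp N')} {mA' Rt' : Exp M'}
    {oA' : Option (Exp M')} (h1 : Conv X (mA.bind γ) mA')
    (h3 : Option.Rel (Conv X) (oA.map (Exp.bind γ)) oA') (h4 : Conv X (Rt.bind γ) Rt') :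
    Conv X ((lamRel mA oA Rt).bind γ) (lamRel mA' oA' Rt') := by
  cases oA with
  | none =>
    cases h3
    exact Conv.lam h1 h4
  | some RA =>
    cases h3 with
    | some h3 =>
    exact Conv.lam h1 (Conv.lam (Conv.betaApp_bind hγ (Conv.rename_bind hX hγ h3 _)
      (Conv.refl _ _)) h4)

theorem appRel_bind_conv {mt Rf : Exp N'} {ot : Option (Exp N')} {mt' Rf' : Exp M'}
    {ot' : Option (Exp M')} (h1 : Conv X (mt.bind γ) mt')
    (h3 : Option.Rel (Conv X) (ot.map (Exp.bind γ)) ot') (h4 : Conv X (Rf.bind γ) Rf') :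
    Conv X ((appRel mt ot Rf).bind γ) (appRel mt' ot' Rf') := by
  cases ot with
  | none =>
    cases h3
    exact Conv.app h4 h1
  | some RA =>
    cases h3 with
    | some h3 => exact Conv.app (Conv.app h4 h1) h3

theorem option_rel_isSome {α β : Type*} {p : α → β → Prop} {a : Option α} {b : Option β}
    (h : Option.Rel p a b) : a.isSome = b.isSome := by
  cases h <;> rfl

theorem option_rel_map {α β α' β' : Type*} {p : α → β → Prop} {q : α' → β' → Prop} {f : α → α'}
    {g : β → β'} {a : Option α} {b : Option β} (h : Option.Rel p a b)
    (hf : ∀ a b, p a b → q (f a) (g b)) : Option.Rel q (a.map f) (b.map g) := by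
  cases h with
  | some h => exact .some (hf _ _ h)
  | none => exact .none

theorem option_rel_of_map {α β γ : Type*} {p : β → γ → Prop} {f : α → β} {a : Option α}
    {b : Option γ} (h : Option.Rel p (a.map f) b) : Option.Rel (fun x y => p (f x) y) a b := by
  cases a with
  | none => cases h; exact .none
  | some a =>
    cases h with
    | some h => exact .some h

/-- Logical relations and morphisms commute, if they do so at constants. -/
theorem rel_bind_conv (hX : Sane X) (hγ : ∀ c, (γ c).Closed)
    {m₁ : N → Exp N'} {r₁ : N → Option (Exp N')} {m₂ : M → Exp M'}
    {r₂ : M → Option (Exp M')} {a : N → Exp M} {Q : N → Prop} (hm₂ : ∀ c, (m₂ c).Closed)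
    (ha : ∀ c, Q c → (a c).Closed ∧ Consts (RelClosed r₂) (a c))
    (hm : ∀ c, Q c → Conv X ((m₁ c).bind γ) ((a c).bind m₂))
    (hr : ∀ c, Q c → Option.Rel (Conv X) ((r₁ c).map (Exp.bind γ)) (rel m₂ r₂ [] (a c)))
    (e : Exp N) : Consts Q e → ∀ ε : List Bool,
    Option.Rel (Conv X) ((rel m₁ r₁ ε e).map (Exp.bind γ)) (rel m₂ r₂ ε (e.bind a)) := by
  have hb : ∀ (e : Exp N), Consts Q e → ∀ ε : List Bool,
      Conv X (((e.bind m₁).rename (idx ε)).bind γ) (((e.bind a).bind m₂).rename (idx ε)) := by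
    intro e he ε
    refine Conv.rename_bind hX hγ ?_ _
    rw [bind_bind, bind_bind]
    exact Conv.bind_of_consts hm he
  induction e with
  | const c =>
    intro hc ε
    change Option.Rel _ _ (rel m₂ r₂ ε (a c))
    -- Since the image of a constant is closed, its translation does not depend on the context.
    rw [rel_of_closed hm₂ (ha c hc).2 (ha c hc).1]
    exact hr c hc
  | var i =>
    intro _ ε
    simp only [rel, Exp.bind]
    cases starIdx ε i with
    | none => exact .none
    | some j => exact .some (Conv.refl _ _)
  | type => intro _ ε; exact .some (Conv.refl _ _)
  | kind => intro _ ε; exact .none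
  | lam A t ih1 ih2 =>
    intro hc ε
    change Option.Rel _ _ (rel m₂ r₂ ε (Exp.lam (A.bind a) (t.bind a)))
    have h1 := ih1 hc.1 ε
    have hs := option_rel_isSome h1
    rw [Option.isSome_map] at hs
    rw [rel_lam, rel_lam, ← hs, Option.map_map]
    have h2 := ih2 hc.2 ((rel m₁ r₁ ε A).isSome :: ε)
    exact option_rel_map (option_rel_of_map h2) fun _ _ h =>
      lamRel_bind_conv hX hγ (hb A hc.1 ε) h1 h
  | pi A t ih1 ih2 =>
    intro hc ε
    have h3 := hb (Exp.pi A t) hc ε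
    change Option.Rel _ _ (rel m₂ r₂ ε (Exp.pi (A.bind a) (t.bind a)))
    change Conv X _ ((Exp.bind m₂ (Exp.pi (A.bind a) (t.bind a))).rename (idx ε)) at h3
    have h1 := ih1 hc.1 ε
    have hs := option_rel_isSome h1
    rw [Option.isSome_map] at hs
    rw [rel_pi, rel_pi, ← hs, Option.map_map]
    have h2 := ih2 hc.2 ((rel m₁ r₁ ε A).isSome :: ε)
    exact option_rel_map (option_rel_of_map h2) fun _ _ h =>
      piRel_bind_conv hX hγ (hb A hc.1 ε) h3 h1 h
  | app f t ih1 ih2 =>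
    intro hc ε
    change Option.Rel _ _ (rel m₂ r₂ ε (Exp.app (f.bind a) (t.bind a)))
    rw [rel_app, rel_app, Option.map_map]
    have h1 := ih1 hc.1 ε
    have h2 := ih2 hc.2 ε
    exact option_rel_map (option_rel_of_map h1) fun _ _ h =>
      appRel_bind_conv (hb t hc.2 ε) h2 h

open Classical in
/-- Replace the values of `m` that are not closed. -/
noncomputable def closeMap (m : N → Exp N') (c : N) : Exp N' :=
  if (m c).Closed then m c else type

theorem closeMap_closed (m : N → Exp N') (c : N) : (closeMap m c).Closed := by
  rw [closeMap]
  split_ifs with h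
  · exact h
  · exact fun _ h => h

theorem closeMap_of_closed {m : N → Exp N'} {c : N} (h : (m c).Closed) : closeMap m c = m c :=
  if_pos h

/-- The homomorphic extension is well-behaved only if all values are closed, including those at
undeclared names. Repairing the latter does not affect a morphism, whose values at declared
constants are typed in the empty context. -/
theorem IsMorphism.closeMap_eq {S : List (Decl N N)} {T : List (Decl N' N')} {m : N → Exp N'}
    (hm : IsMorphism S T m) (c : N) (hc : Declared S c) : closeMap m c = m c := by
  obtain ⟨d, hd, rfl⟩ := hc
  exact closeMap_of_closed (hm d hd).1.closed

theorem IsMorphism.congr {S : List (Decl N N)} {T : List (Decl N' N')} {m m' : N → Exp N'}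
    (hS : WF S) (hm : IsMorphism S T m) (h : ∀ c, Declared S c → m' c = m c) :
    IsMorphism S T m' := by
  intro d hd
  obtain ⟨⟨s, _, hty⟩, hdef⟩ := hS.typed d hd
  rw [h _ ⟨d, hd, rfl⟩, bind_congr h hty.consts]
  refine ⟨(hm d hd).1, fun t ht => ?_⟩
  rw [bind_congr h (hdef t ht).consts]
  exact (hm d hd).2 t ht

/-- Replacing constants by closed expressions creates no occurrences of variables, so unused
positions remain unused. -/
theorem dropBinders_bind (P : Finset ℕ) {m : N → Exp N'} (hm : ∀ c, (m c).Closed) :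
    ∀ (k i : ℕ) (A : Exp N), UnusedBinders P i k A →
      (dropBinders P i k A).bind m = dropBinders P i k (A.bind m) ∧
      UnusedBinders P i k (A.bind m) := by
  intro k
  induction k with
  | zero =>
    intro i A _
    refine ⟨?_, by simp only [UnusedBinders]⟩
    have h : ∀ {N : Type u} (A : Exp N), dropBinders P i 0 A = A := by
      intro N A; cases A <;> rfl
    rw [h, h]
  | succ k ih =>
    intro i A hU
    cases A with
    | pi A B =>
      obtain ⟨h1, h2⟩ := ih (i + 1) B hU.2
      have hocc : i ∈ P → ¬ (dropBinders P (i + 1) k (B.bind m)).Occurs 0 := by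
        intro hi ho
        rw [← h1] at ho
        exact hU.1 hi (occurs_bind hm ho)
      refine ⟨?_, hocc, h2⟩
      simp only [dropBinders, Exp.bind]
      rw [← h1]
      split_ifs
      · exact bind_rename hm _ _
      · rfl
    | lam A B =>
      obtain ⟨h1, h2⟩ := ih (i + 1) B hU.2
      have hocc : i ∈ P → ¬ (dropBinders P (i + 1) k (B.bind m)).Occurs 0 := by
        intro hi ho
        rw [← h1] at ho
        exact hU.1 hi (occurs_bind hm ho)
      refine ⟨?_, hocc, h2⟩
      simp only [dropBinders, Exp.bind]
      rw [← h1]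
      split_ifs
      · exact bind_rename hm _ _
      · rfl
    | _ => exact hU.elim

end Commutation
/-! ### The translation of morphisms -/

section CleanArr

variable {L : Type u} [DecidableEq L] {T : List (Decl N N)}

/-- The assignments to local constants, with argument positions removed. -/
def dropArr (P P₂ : L → Finset ℕ) (E₂ : List (Decl L (N ⊕ L))) (arr : L → Exp (N ⊕ L)) (c : L) :
    Exp (N ⊕ L) :=
  dropBinders (P c) 0 (arity (P c)) (eraseArgs (fix (eraser P₂ E₂)) (arr c))

theorem eraser_self {P : L → Finset ℕ} {E : List (Decl L (N ⊕ L))} {d : Decl L (N ⊕ L)}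
    (hW : WF (full T (d :: E))) (hU : Unused P (d :: E)) :
    ∃ s, IsSort s ∧ HasType (full T (cleanDecls P E)) [] (eraseArgs (fix (eraser P E)) d.type) s ∧
      eraser P (d :: E) d.name = keepTele (P d.name) 0 (arity (P d.name))
        (eraseArgs (fix (eraser P E)) d.type) (const (Sum.inr d.name)) := by
  cases hW with
  | @cons _ _ s hW hn hs hd hdef =>
  have h := EraserData.of_wf hW hU.1
  obtain ⟨hA, _, _⟩ := cleanDecl_hasType h hs hd hdef hU
  refine ⟨s, hs, hA, ?_⟩
  rw [eraser, if_pos rfl]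
  have := keepTele_eq (P d.name) (const_closed (Sum.inr d.name)) _ _ _ _ hs _ hA hU.2.1 h.wf
  rw [Nat.zero_add] at this
  exact this.symm

theorem eraser_declared {P : L → Finset ℕ} {E : List (Decl L (N ⊕ L))} {d : Decl L (N ⊕ L)}
    (hn : ∀ e ∈ full T E, e.name ≠ d.local.name) (c : N ⊕ L) (hc : Declared (full T E) c) :
    fix (eraser P (d :: E)) c = fix (eraser P E) c := by
  obtain ⟨e, he, rfl⟩ := hc
  have hne := hn e he
  revert hne
  cases e.name with
  | inl c => intro _; rfl
  | inr c =>
    intro hne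
    exact if_neg (by rintro rfl; exact hne rfl)

theorem closeMap_inl (a : L → Exp (N ⊕ L)) (c : N) :
    closeMap (fix a) (Sum.inl c) = const (Sum.inl c) :=
  closeMap_of_closed (const_closed _)

/-- A morphism of the pushouts induces one of the theories with argument positions removed. -/
theorem clean_arr {P P₂ : L → Finset ℕ} {E₂ : List (Decl L (N ⊕ L))} (h₂ : EraserData T P₂ E₂)
    (arr : L → Exp (N ⊕ L)) {E : List (Decl L (N ⊕ L))} :
    WF (full T E) → Unused P E → IsMorphism (full T E) (full T E₂) (fix arr) →
    (∀ d ∈ E, UnusedBinders (P d.name) 0 (arity (P d.name))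
      (eraseArgs (fix (eraser P₂ E₂)) (arr d.name))) →
    IsMorphism (full T (cleanDecls P E)) (full T (cleanDecls P₂ E₂))
      (closeMap (fix (dropArr P P₂ E₂ arr))) ∧
    ∀ c, Declared (full T E) c → Conv (full T (cleanDecls P₂ E₂))
      ((fix (eraser P E) c).bind (closeMap (fix (dropArr P P₂ E₂ arr))))
      ((closeMap (fix arr) c).bind (fix (eraser P₂ E₂))) := by
  have hW₂ := h₂.wf
  have hT := hW₂.sane
  have hβ := closeMap_closed (fix (dropArr P P₂ E₂ arr))
  have hα := closeMap_closed (fix arr)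
  induction E with
  | nil =>
    intro _ _ _ _
    constructor
    · intro e he
      obtain ⟨d, hd, rfl⟩ := mem_base he (by simp [cleanDecls])
      have hmem : d.base L ∈ full T (cleanDecls P₂ E₂) :=
        List.mem_append_right _ (List.mem_map_of_mem hd)
      have hb : ∀ t : Exp N, (t.mapConst Sum.inl).bind (closeMap (fix (dropArr P P₂ E₂ arr))) =
          t.mapConst Sum.inl := by
        intro t
        rw [mapConst, bind_bind]
        exact congrArg (fun f => t.bind f) (funext fun c => closeMap_inl _ c)
      have hname : closeMap (fix (dropArr P P₂ E₂ arr)) (d.base L).name =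
        const (d.base L).name := closeMap_inl _ _
      rw [hname]
      refine ⟨?_, fun t ht => ?_⟩
      · change HasType _ _ _ ((d.type.mapConst Sum.inl).bind _)
        rw [hb]
        exact .const [] (d.base L) hmem
      · obtain ⟨t, ht', rfl⟩ := Option.map_eq_some_iff.1 ht
        rw [hb]
        exact Conv.of_step (.delta (d.base L) _ hmem ht)
    · rintro c ⟨e, he, rfl⟩
      obtain ⟨d, hd, rfl⟩ := mem_base he (by simp)
      change Conv _ (closeMap _ (Sum.inl d.name)) ((closeMap _ (Sum.inl d.name)).bind _)
      rw [closeMap_inl, closeMap_inl]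
      exact Conv.refl _ _
  | cons d E ih =>
    intro hW hU harr hUarr
    have hW0 := hW
    obtain ⟨s, hs, hA, hself⟩ := eraser_self hW hU
    cases hW with
    | @cons _ _ s₀ hW hn hs₀ hd hdef =>
    have hW : WF (full T E) := hW
    have hd : HasType (full T E) [] d.type s₀ := hd
    have hdef : ∀ t, d.defn = some t → HasType (full T E) [] t d.type := hdef
    have hEr := EraserData.of_wf hW hU.1
    have hsub : ∀ e ∈ full T E, e ∈ full T (d :: E) := fun e he => List.mem_cons_of_mem _ he
    obtain ⟨ih1, ih2⟩ := ih hW hU.1 (fun e he => harr e (hsub e he))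
      fun e he => hUarr e (List.mem_cons_of_mem _ he)
    have hαm : IsMorphism (full T (d :: E)) (full T E₂) (closeMap (fix arr)) :=
      harr.congr hW0 harr.closeMap_eq
    have hmemd : d.local ∈ full T (d :: E) := List.mem_cons_self
    have hαd : closeMap (fix arr) (Sum.inr d.name) = arr d.name :=
      harr.closeMap_eq (Sum.inr d.name) ⟨d.local, hmemd, rfl⟩
    have hUd := hUarr d List.mem_cons_self
    -- the translated assignment
    have hαdm := hαm d.local hmemd
    have harrd : HasType (full T E₂) [] (arr d.name) (d.type.bind (closeMap (fix arr))) := by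
      rw [← hαd]; exact hαdm.1
    have hdα : HasType (full T E₂) [] (d.type.bind (closeMap (fix arr)))
        (s₀.bind (closeMap (fix arr))) :=
      hd.bind hα fun e he => hαm e (hsub e he)
    obtain ⟨hu, _⟩ := harrd.eraseArgs h₂.wf h₂.closed h₂.mor hs₀.bind hdα
    -- The square commutes for constants by induction, hence for expressions over them; the
    -- contractions made by `eraseArgs` do not matter up to conversion.
    have comm : ∀ {e : Exp (N ⊕ L)}, Consts (Declared (full T E)) e →
        Conv (full T (cleanDecls P₂ E₂))
          ((eraseArgs (fix (eraser P E)) e).bind (closeMap (fix (dropArr P P₂ E₂ arr))))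
          ((e.bind (closeMap (fix arr))).bind (fix (eraser P₂ E₂))) := by
      intro e he
      refine ((eraseArgs_conv (T := full T (cleanDecls P E)) _ e).bind hβ ih1).trans ?_
      rw [bind_bind, bind_bind]
      exact Conv.bind_of_consts ih2 he
    have hAβ : HasType (full T (cleanDecls P₂ E₂)) []
        ((eraseArgs (fix (eraser P E)) d.type).bind (closeMap (fix (dropArr P P₂ E₂ arr))))
        (s.bind (closeMap (fix (dropArr P P₂ E₂ arr)))) := hA.bind hβ ih1
    have hu' := hu.conv hs.bind hAβ ((eraseArgs_conv _ _).trans (comm hd.consts).symm)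
    obtain ⟨hdrop, hUβ⟩ := dropBinders_bind (P d.name) hβ _ _ _ hU.2.1
    have hdr := HasType.dropBinders hW₂ _ _ Ctx.nil hs.bind hAβ hUβ hu' hUd
    have hβd : closeMap (fix (dropArr P P₂ E₂ arr)) (Sum.inr d.name) =
        dropBinders (P d.name) 0 (arity (P d.name))
          (eraseArgs (fix (eraser P₂ E₂)) (arr d.name)) :=
      closeMap_of_closed hdr.closed
    refine ⟨?_, ?_⟩
    · intro e he
      rcases List.mem_cons.1 he with rfl | he
      · change HasType _ [] (closeMap _ (Sum.inr d.name))
            ((dropBinders _ _ _ _).bind _) ∧ ∀ t, d.defn.map _ = some t → Conv _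
            (closeMap _ (Sum.inr d.name)) _
        rw [hβd, hdrop]
        refine ⟨hdr, fun t ht => ?_⟩
        obtain ⟨t, ht', rfl⟩ := Option.map_eq_some_iff.1 ht
        obtain ⟨hdrop', hUβ'⟩ := dropBinders_bind (P d.name) hβ _ _ _ (hU.2.2 t ht')
        rw [hdrop']
        obtain ⟨hτ, _⟩ := (hdef t ht').eraseArgs hEr.wf hEr.closed hEr.mor hs₀ hd
        have hτβ := hτ.bind hβ ih1
        have key : Conv (full T (cleanDecls P₂ E₂))
            (eraseArgs (fix (eraser P₂ E₂)) (arr d.name))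
            ((eraseArgs (fix (eraser P E)) t).bind (closeMap (fix (dropArr P P₂ E₂ arr)))) := by
          refine (eraseArgs_conv _ _).trans (Conv.trans ?_ (comm (hdef t ht').consts).symm)
          refine Conv.bind h₂.closed h₂.mor ?_
          rw [← hαd]
          exact hαdm.2 t ht'
        -- Convertibility is known before the removal of positions. Since `keepTele` restores the
        -- removed positions and is injective up to conversion, it holds after the removal too.
        refine Conv.of_keepTele hW₂ (arity (P d.name)) 0 hs.bind hs.bind hAβ hAβ hUβ hUβ ?_
        exact (keepTele_conv hW₂ _ _ Ctx.nil hs.bind hAβ hUβ hu' hUd (Conv.refl _ _)).trans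
          (key.trans (keepTele_conv hW₂ _ _ Ctx.nil hs.bind hAβ hUβ hτβ hUβ'
            (Conv.refl _ _)).symm)
      · exact ih1 e he
    · rintro c ⟨e, he, rfl⟩
      rcases List.mem_cons.1 he with rfl | he
      · change Conv _ ((eraser P (d :: E) d.name).bind _)
          ((closeMap (fix arr) (Sum.inr d.name)).bind _)
        rw [hself, keepTele_bind _ hβ _ _ _ _ _ _ hs hA hU.2.1 hEr.wf, hαd]
        refine (keepTele_conv hW₂ _ _ Ctx.nil hs.bind hAβ hUβ hu' hUd ?_).trans
          (eraseArgs_conv _ _)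
        exact Conv.of_eq hβd
      · rw [eraser_declared hn _ ⟨e, he, rfl⟩]
        exact ih2 _ ⟨e, he, rfl⟩

end CleanArr

/-! ### The translation of morphisms at starred constants -/

section SoftArr

variable {L : Type u} [DecidableEq L] {S : List (Decl N N)} {T : List (Decl N' N')}
  {m : N → Exp N'} {r : N → Option (Exp N')} {P : L → Finset ℕ}

/-- For an object, its type decides whether the relation is defined. Therefore the translations of
morphisms need to be assumed defined only at type-level constants. -/
theorem relData_isSome_of_type {M M' : Type u} {S : List (Decl M M)} {X : List (Decl M' M')}
    {m : M → Exp M'} {r : M → Option (Exp M')} {sh : M → Option Sh} (D : RelData S X m r sh)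
    {t A : Exp M} (ht : HasType S [] t A) (hA : HasType S [] A type) :
    (rel m r [] t).isSome = (rel m r [] A).isSome := by
  have h1 := D.bits.isSome_rel (m := m) D.wf D.shaping ht Ctx.nil
  obtain ⟨a, ha, h0, hbit⟩ := D.shaping.ebit_type D.wf CtxSh.nil hA
  have h2 := rel_isSome_ctx D Ctx.nil hA
  rw [index_of_shape ha, setStar_of_lev h0, ← hbit] at h1
  exact h1.trans h2.symm

theorem ne_kind_of_hasType {S : List (Decl N N)} (hS : WF S) {A s : Exp N} (hs : IsSort s)
    (hA : HasType S [] A s) : A ≠ kind := by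
  rintro rfl
  exact hA.not_conv_kind hS Ctx.nil hs (Conv.refl _ _)

/-- A morphism of theories over `S` induces one of their translations, which commutes with the
logical relations. -/
theorem soft_arr {M₂ : Type u} {X₂ : Type u} {B₂ : List (Decl M₂ M₂)} {Y₂ : List (Decl X₂ X₂)}
    {mor₂ : M₂ → Exp X₂} {rel₂ : M₂ → Option (Exp X₂)} {sh₂ : M₂ → Option Sh}
    (D₂ : RelData B₂ Y₂ mor₂ rel₂ sh₂) {a : N ⊕ L → Exp M₂} (ha : ∀ c, (a c).Closed)
    {g : N' ⊕ (L ⊕ L) → Exp X₂}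
    (hg : ∀ c, g (Sum.inr (Sum.inr c)) = (rel mor₂ rel₂ [] (a (Sum.inr c))).getD type)
    (hbase : ∀ c, Declared S c → Option.Rel (Conv Y₂)
      ((r c).map fun e => (e.mapConst Sum.inl).bind (closeMap g))
      (rel mor₂ rel₂ [] (a (Sum.inl c))))
    {E : List (Decl L (N ⊕ L))} {E' : List (Decl L (N' ⊕ L))} (h : IsPushout T m E E') :
    WF (full S E) → WF (full T E') → WF (full T (softDecls m r P E E')) →
    IsMorphism (full S E) B₂ a →
    (∀ e ∈ full T (cleanDecls P E'), HasType Y₂ [] (closeMap g e.plain.name)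
      (e.plain.type.bind (closeMap g)) ∧ ∀ t, e.plain.defn = some t →
        Conv Y₂ (closeMap g e.plain.name) (t.bind (closeMap g))) →
    (∀ c, Declared (full S E) c →
      Conv Y₂ ((softMor m P E' c).bind (closeMap g)) ((a c).bind mor₂)) →
    (∀ d ∈ E, d.defn = none → HasType (full S E) [] d.type kind →
      (rel mor₂ rel₂ [] (a (Sum.inr d.name))).isSome) →
    IsMorphism (full T (softDecls m r P E E')) Y₂ (closeMap g) ∧
    ∀ c, Declared (full S E) c → Option.Rel (Conv Y₂)
      ((softRel m r P E E' c).map (Exp.bind (closeMap g))) (rel mor₂ rel₂ [] (a c)) := by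
  have hγ := closeMap_closed g
  have hT₂ := D₂.wfT.sane
  induction h with
  | nil =>
    intro _ _ _ _ hplain _ _
    refine ⟨?_, ?_⟩
    · intro e he
      obtain ⟨d, hd, rfl⟩ := mem_base he (by simp [softDecls])
      have := hplain (d.base L) (List.mem_append_right _ (List.mem_map_of_mem hd))
      rwa [base_plain] at this
    · rintro c ⟨e, he, rfl⟩
      obtain ⟨d, hd, rfl⟩ := mem_base he (by simp)
      have := hbase d.name ⟨d, hd, rfl⟩
      change Option.Rel _ (((r d.name).map _).map _) _
      rw [Option.map_map]
      exact this
  | @cons E E' d d' h hname hc hdc ih =>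
    intro hSE hTE hX hma hplain hsq hstar
    have hSE0 := hSE
    cases hSE with
    | @cons _ _ s hW hn hs hd hdef =>
    cases hTE with
    | @cons _ _ s' hTW hn' hs' hd' hdef' =>
    have hW : WF (full S E) := hW
    have hd : HasType (full S E) [] d.type s := hd
    have hdef : ∀ t, d.defn = some t → HasType (full S E) [] t d.type := hdef
    have hsubS : ∀ e ∈ full S E, e ∈ full S (d :: E) := fun e he => List.mem_cons_of_mem _ he
    have hcongr := soft_declared (m := m) (r := r) (P := P) E' hn hname
    have hma' : IsMorphism (full S E) B₂ a := fun e he => hma e (hsubS e he)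
    have hX' : WF (full T (softPlain P E' d' :: softDecls m r P E E')) ∧
        ∀ st, starDecl (softMor m P (d' :: E')) (softRel m r P E E') d = some st →
        ∃ s₁, IsSort s₁ ∧ HasType (full T (softPlain P E' d' :: softDecls m r P E E')) []
          st.type s₁ := by
      rw [softDecls_cons] at hX
      cases hst : starDecl (softMor m P (d' :: E')) (softRel m r P E E') d with
      | none => rw [hst] at hX; exact ⟨hX, fun _ h => by cases h⟩
      | some st =>
        rw [hst] at hX
        have hX : WF (st.local :: full T (softPlain P E' d' :: softDecls m r P E E')) := hX
        cases hX with
        | cons h1 _ h2 h3 _ =>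
        refine ⟨h1, fun st' h => ?_⟩
        cases h
        exact ⟨_, h2, h3⟩
    obtain ⟨hX1, hX2⟩ := hX'
    have hX0 : WF (full T (softDecls m r P E E')) := by
      have hX1 : WF ((softPlain P E' d').local :: full T (softDecls m r P E E')) := hX1
      cases hX1 with
      | cons h1 _ _ _ _ => exact h1
    have hdecl : ∀ c, Declared (full S E) c → Declared (full S (d :: E)) c :=
      fun c ⟨e, he, hc⟩ => ⟨e, hsubS e he, hc⟩
    obtain ⟨ih1, ih2⟩ := ih hW hTW hX0 hma' (fun e he => hplain e (List.mem_cons_of_mem _ he))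
      (fun c hc => by rw [← (hcongr c hc).1]; exact hsq c (hdecl c hc))
      fun e he hdn hk => hstar e (List.mem_cons_of_mem _ he) hdn (hk.mono hsubS)
    have hγ1 : IsMorphism (full T (softPlain P E' d' :: softDecls m r P E E')) Y₂
        (closeMap g) := by
      intro e he
      rcases List.mem_cons.1 he with rfl | he
      · exact hplain (cleanDecl P E' d').local List.mem_cons_self
      · exact ih1 e he
    -- commutation for expressions of the smaller theory
    have hK : ∀ {e : Exp (N ⊕ L)}, Consts (Declared (full S E)) e → Option.Rel (Conv Y₂)
        ((rel (softMor m P (d' :: E')) (softRel m r P E E') [] e).map (Exp.bind (closeMap g)))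
        (rel mor₂ rel₂ [] (e.bind a)) := by
      intro e he
      refine rel_bind_conv hT₂ hγ D₂.closed (fun c hc => ⟨ha c, ?_⟩)
        (fun c hc => hsq c (hdecl c hc)) ih2 e he []
      obtain ⟨e, he, rfl⟩ := hc
      exact D₂.relClosed (hma' e he).1
    have hmemd : d.local ∈ full S (d :: E) := List.mem_cons_self
    have had := hma d.local hmemd
    have had1 : HasType B₂ [] (a (Sum.inr d.name)) (d.type.bind a) := had.1
    have hda : HasType B₂ [] (d.type.bind a) (s.bind a) := hd.bind ha hma'
    -- The basic lemma over the target; it will type the image of c*.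
    have hsomeA : ∀ {R}, rel mor₂ rel₂ [] (a (Sum.inr d.name)) = some R →
        ∃ RA, rel mor₂ rel₂ [] (d.type.bind a) = some RA ∧
          HasType Y₂ [] R (betaApp RA ((a (Sum.inr d.name)).bind mor₂)) := by
      intro R hR
      obtain ⟨RA, hRA, h1⟩ := (D₂.basic had1 Ctx.nil Ctx.nil hR).2
        (ne_kind_of_hasType D₂.wf hs.bind hda)
      refine ⟨RA, hRA, ?_⟩
      have hid : ∀ t : Exp X₂, t.rename (idx []) = t := rename_id
      rwa [List.map_nil, hid] at h1
    have hdefn : ∀ t, d.defn = some t → Option.Rel (Conv Y₂)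
        ((rel (softMor m P (d' :: E')) (softRel m r P E E') [] t).map (Exp.bind (closeMap g)))
        (rel mor₂ rel₂ [] (a (Sum.inr d.name))) := by
      intro t ht
      have h1 := hK (hdef t ht).consts
      have h2 := D₂.rel_conv Ctx.nil ((hdef t ht).bind ha hma') had1 (had.2 t ht).symm
      rw [List.map_nil] at h2
      generalize rel mor₂ rel₂ [] (t.bind a) = x at h1 h2
      generalize rel mor₂ rel₂ [] (a (Sum.inr d.name)) = z at h2 ⊢
      cases h2 with
      | none => exact h1
      | some h2 =>
        generalize Option.map _ _ = y at h1
        cases h1 with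
        | some h1 => exact .some (h1.trans h2)
    have hsq_d : Conv Y₂ ((softMor m P (d' :: E') (Sum.inr d.name)).bind (closeMap g))
      ((a (Sum.inr d.name)).bind mor₂) := hsq _ ⟨d.local, hmemd, rfl⟩
    have hfinal : IsMorphism (full T (softDecls m r P (d :: E) (d' :: E'))) Y₂ (closeMap g) ∧
        Option.Rel (Conv Y₂) ((softRel m r P (d :: E) (d' :: E') (Sum.inr d.name)).map
          (Exp.bind (closeMap g))) (rel mor₂ rel₂ [] (a (Sum.inr d.name))) := by
      rw [softDecls_cons, softRel_self]
      cases hst : starDecl (softMor m P (d' :: E')) (softRel m r P E E') d with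
      | none =>
        refine ⟨hγ1, ?_⟩
        -- If c* is not declared, then the image of c has no translation either: otherwise the
        -- relation would be defined for the type of c, and for its definition, if any, so that c*
        -- would have been declared.
        suffices hnone : rel mor₂ rel₂ [] (a (Sum.inr d.name)) = none by rw [hnone]; exact .none
        cases hR : rel mor₂ rel₂ [] (a (Sum.inr d.name)) with
        | none => rfl
        | some R =>
          obtain ⟨RA, hRA, _⟩ := hsomeA hR
          have h1 := option_rel_isSome (hK hd.consts)
          rw [hRA, Option.isSome_map] at h1
          have : (starDecl (softMor m P (d' :: E')) (softRel m r P E E') d).isSome := by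
            refine starDecl_isSome h1 fun t ht => ?_
            have h2 := option_rel_isSome (hdefn t ht)
            rw [Option.isSome_map, hR] at h2
            exact h2
          rw [hst] at this; cases this
      | some st =>
        obtain ⟨hname', ⟨RA, hRA, hty⟩, hdd⟩ := starDecl_some hst
        obtain ⟨s₁, hs₁, hty₁⟩ := hX2 st hst
        have hKA := hK hd.consts
        rw [hRA] at hKA
        -- Conversely, the image of a declared c* exists: for a primitive object by term-totality of
        -- the target relation, for a primitive family by `hstar`, and for a defined constant
        -- because its definition is translated.
        obtain ⟨R, hR⟩ : ∃ R, rel mor₂ rel₂ [] (a (Sum.inr d.name)) = some R := by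
          rw [← Option.isSome_iff_exists]
          rcases hdd with ⟨hdn, _⟩ | ⟨t, Rt, ht, hRt, _⟩
          · rcases hs with rfl | rfl
            · rw [relData_isSome_of_type D₂ had1 hda, ← option_rel_isSome hKA]; rfl
            · exact hstar d List.mem_cons_self hdn (hd.mono hsubS)
          · have h1 := option_rel_isSome (hdefn t ht)
            rw [Option.isSome_map, hRt] at h1
            exact h1.symm
        obtain ⟨RA₂, hRA₂, hRty⟩ := hsomeA hR
        rw [hRA₂] at hKA
        cases hKA with
        | some hKA =>
        have hty₁γ := hty₁.bind hγ hγ1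
        have htyconv : Conv Y₂ (betaApp RA₂ ((a (Sum.inr d.name)).bind mor₂))
            (st.type.bind (closeMap g)) := by
          rw [hty]
          exact (Conv.betaApp_bind hγ hKA hsq_d).symm
        have hRty' := hRty.conv hs₁.bind hty₁γ htyconv
        -- As R exists, the default value in g is not used, and as R is typed in the empty context,
        -- `closeMap` leaves it alone.
        have hgst : closeMap g (Sum.inr st.name) = R := by
          have e : g (Sum.inr st.name) = R := by rw [hname', hg, hR]; rfl
          rw [← e]
          exact closeMap_of_closed (by rw [e]; exact hRty'.closed)
        refine ⟨?_, ?_⟩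
        · intro e he
          rcases List.mem_cons.1 he with rfl | he
          · change HasType _ _ (closeMap g (Sum.inr st.name)) (st.type.bind _) ∧
              ∀ t, st.defn = some t → Conv _ (closeMap g (Sum.inr st.name)) _
            rw [hgst]
            refine ⟨hRty', fun t ht => ?_⟩
            rcases hdd with ⟨_, hdn⟩ | ⟨t', Rt, ht', hRt, hdn⟩
            · rw [hdn] at ht; cases ht
            · have h1 := hdefn t' ht'
              rw [hRt, hR] at h1
              obtain rfl := Option.some.inj (hdn.symm.trans ht)
              cases h1 with
              | some h1 => exact h1.symm
          · exact hγ1 e he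
        · rw [hR]
          exact .some (Conv.of_eq hgst)
    refine ⟨hfinal.1, ?_⟩
    rintro c ⟨e, he, rfl⟩
    rcases List.mem_cons.1 he with rfl | he
    · exact hfinal.2
    · rw [(hcongr _ ⟨e, he, rfl⟩).2]
      exact ih2 _ ⟨e, he, rfl⟩

end SoftArr
/-! ### Morphisms out of the translation of a theory -/

section SoftExt

variable {L : Type u} [DecidableEq L] {S : List (Decl N N)} {T : List (Decl N' N')}
  {m : N → Exp N'} {r : N → Option (Exp N')} {P : L → Finset ℕ}

theorem HasType.type_inv {T : List (Decl N N)} {Γ : List (Exp N)} {A : Exp N}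
    (h : HasType T Γ Exp.type A) : Conv T A Exp.kind := by
  generalize ht : Exp.type = t at h
  induction h with
  | type => exact Conv.refl _ _
  | conv _ _ _ hc ih _ => exact hc.symm.trans (ih ht)
  | _ => cases ht

/-- A value that has been replaced would be `type`, all of whose types are convertible to `kind`;
but the type of a declared constant has a sort and so is never convertible to `kind`. -/
theorem IsMorphism.of_closeMap {S : List (Decl N N)} {T : List (Decl N' N')} {m : N → Exp N'}
    (hS : WF S) (hT : WF T) (hm : IsMorphism S T (closeMap m)) (c : N) (hc : Declared S c) :
    closeMap m c = m c := by
  obtain ⟨d, hd, rfl⟩ := hc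
  by_contra hne
  have h1 : closeMap m d.name = Exp.type := if_neg fun h => hne (closeMap_of_closed h)
  obtain ⟨⟨s, hs, hty⟩, _⟩ := hS.typed d hd
  have h2 := (hm d hd).1
  rw [h1] at h2
  exact (hty.bind (closeMap_closed m) hm).not_conv_kind hT Ctx.nil hs.bind h2.type_inv

theorem eraser_eq_keepTele {T : List (Decl N N)} {P : L → Finset ℕ}
    {E : List (Decl L (N ⊕ L))} : WF (full T E) → Unused P E → ∀ d ∈ E, ∃ A s, IsSort s ∧
      HasType (full T (cleanDecls P E)) [] A s ∧
      UnusedBinders (P d.name) 0 (arity (P d.name)) A ∧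
      eraser P E d.name = keepTele (P d.name) 0 (arity (P d.name)) A
        (const (Sum.inr d.name)) := by
  induction E with
  | nil => intro _ _ d hd; cases hd
  | cons d E ih =>
    intro hW hU e he
    obtain ⟨s, hs, hA, hself⟩ := eraser_self hW hU
    have hsub : ∀ e ∈ full T (cleanDecls P E), e ∈ full T (cleanDecls P (d :: E)) :=
      fun e he => List.mem_cons_of_mem _ he
    rcases List.mem_cons.1 he with rfl | he
    · exact ⟨_, s, hs, hA.mono hsub, hU.2.1, hself⟩
    · cases hW with
      | @cons _ _ s₀ hW hn _ _ _ =>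
      have hmem : e.local ∈ full T E := List.mem_append_left _ (List.mem_map_of_mem he)
      obtain ⟨A, s, hs, hA, hU', h⟩ := ih hW hU.1 e he
      refine ⟨A, s, hs, hA.mono hsub, hU', ?_⟩
      rw [← h]
      exact eraser_declared (T := T) hn (Sum.inr e.name) ⟨e.local, hmem, rfl⟩

theorem IsPushout.softRel_star {E : List (Decl L (N ⊕ L))} {E' : List (Decl L (N' ⊕ L))}
    (h : IsPushout T m E E') : WF (full S E) → ∀ e ∈ full T (softDecls m r P E E'), ∀ c,
      e.name = Sum.inr (Sum.inr c) →
      softRel m r P E E' (Sum.inr c) = some (const (Sum.inr (Sum.inr c))) := by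
  induction h with
  | nil =>
    intro _ e he c hc
    obtain ⟨d, hd, rfl⟩ := mem_base he (by simp [softDecls])
    cases hc
  | @cons E E' d d' h hn _ _ ih =>
    intro hW e he c hc
    cases hW with
    | @cons _ _ s₀ hW hfresh _ _ _ =>
    rw [softDecls_cons, full, List.map_append, List.append_assoc] at he
    rcases List.mem_append.1 he with he | he
    · obtain ⟨s, hs, rfl⟩ := List.mem_map.1 he
      have hs := Option.mem_toList.1 hs
      obtain ⟨h1, _⟩ := starDecl_some hs
      have hc : s.name = Sum.inr c := Sum.inr.inj hc
      obtain rfl := Sum.inr.inj (h1.symm.trans hc)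
      rw [softRel_self, hs, ← hc]
      rfl
    · rcases List.mem_cons.1 he with rfl | he
      · cases hc
      · rcases h.soft_names e he with ⟨c', hc'⟩ | ⟨d₁, hd₁, h1 | h1⟩
        · rw [hc'] at hc; cases hc
        · rw [h1] at hc; cases hc
        · rw [h1] at hc
          obtain rfl := Sum.inr.inj (Sum.inr.inj hc)
          rw [← ih hW e he _ h1]
          exact (soft_declared E' hfresh hn (Sum.inr d₁.name)
            ⟨d₁.local, List.mem_append_left _ (List.mem_map_of_mem hd₁), rfl⟩).2

theorem IsPushout.exists_name {E : List (Decl L (N ⊕ L))} {E' : List (Decl L (N' ⊕ L))}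
    (h : IsPushout T m E E') :
    (∀ d' ∈ E', ∃ d ∈ E, d.name = d'.name) ∧ ∀ d ∈ E, ∃ d' ∈ E', d'.name = d.name := by
  induction h with
  | nil => exact ⟨fun _ h => (List.not_mem_nil h).elim, fun _ h => (List.not_mem_nil h).elim⟩
  | cons h hn _ _ ih =>
    constructor
    · intro e he
      rcases List.mem_cons.1 he with rfl | he
      · exact ⟨_, List.mem_cons_self, hn.symm⟩
      · obtain ⟨d, hd, h⟩ := ih.1 e he
        exact ⟨d, List.mem_cons_of_mem _ hd, h⟩
    · intro e he
      rcases List.mem_cons.1 he with rfl | he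
      · exact ⟨_, List.mem_cons_self, hn⟩
      · obtain ⟨d, hd, h⟩ := ih.2 e he
        exact ⟨d, List.mem_cons_of_mem _ hd, h⟩

/-- A morphism out of the translation of a theory is determined by its compositions with the
inclusion, with the morphism, and with the logical relation. -/
theorem soft_ext {M : Type u} {Y : List (Decl M M)} (hY : WF Y)
    {E : List (Decl L (N ⊕ L))} {E' : List (Decl L (N' ⊕ L))} (h : IsPushout T m E E')
    (hSE : WF (full S E)) (hTE : WF (full T E')) (hU : Unused P E')
    {φ ψ : N' ⊕ (L ⊕ L) → Exp M} (hφ : ∀ c, (φ c).Closed) (hψ : ∀ c, (ψ c).Closed)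
    (hφm : IsMorphism (full T (softDecls m r P E E')) Y φ)
    (hψm : IsMorphism (full T (softDecls m r P E E')) Y ψ)
    (hbase : ∀ c, Conv Y (φ (Sum.inl c)) (ψ (Sum.inl c)))
    (hmor : ∀ c, Declared (full S E) c →
      Conv Y ((softMor m P E' c).bind φ) ((softMor m P E' c).bind ψ))
    (hrel : ∀ c, Declared (full S E) c → Option.Rel (Conv Y)
      ((softRel m r P E E' c).map (Exp.bind φ)) ((softRel m r P E E' c).map (Exp.bind ψ))) :
    ∀ e ∈ full T (softDecls m r P E E'), Conv Y (φ e.name) (ψ e.name) := by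
  have hdecl : ∀ d ∈ E, Declared (full S E) (Sum.inr d.name) := fun d hd =>
    ⟨d.local, List.mem_append_left _ (List.mem_map_of_mem hd), rfl⟩
  intro e he
  rcases h.soft_names e he with ⟨c, hc⟩ | ⟨d, hd, hc | hc⟩
  · rw [hc]; exact hbase c
  -- The morphism maps c to an abstraction built by `keepTele` around the cleaned constant. Two
  -- morphisms that agree on it agree on the constant, since `keepTele` is injective up to
  -- conversion.
  · rw [hc]
    obtain ⟨d', hd', hn⟩ := h.exists_name.2 d hd
    obtain ⟨A, s, hs, hA, hUA, hk⟩ := eraser_eq_keepTele hTE hU d' hd'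
    rw [hn] at hUA hk
    have hEr := EraserData.of_wf hTE hU
    have key : ∀ {χ : N' ⊕ (L ⊕ L) → Exp M}, (∀ c, (χ c).Closed) →
        IsMorphism (full T (softDecls m r P E E')) Y χ → ∃ A' s', IsSort s' ∧
          HasType Y [] A' s' ∧ UnusedBinders (P d.name) 0 (arity (P d.name)) A' ∧
          (softMor m P E' (Sum.inr d.name)).bind χ =
            keepTele (P d.name) 0 (arity (P d.name)) A' (χ (Sum.inr (Sum.inl d.name))) := by
      intro χ hχ hχm
      have hm' := (isMorphism_plain (h.plain_mem (r := r) (P := P))).comp hχm hχ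
      refine ⟨A.bind fun c => χ (plain c), _, hs.bind (m := fun c => χ (plain c)),
        hA.bind (fun c => hχ (plain c)) hm',
        (dropBinders_bind _ (fun c => hχ (plain c)) _ _ _ hUA).2, ?_⟩
      change ((eraser P E' d.name).mapConst plain).bind χ = _
      rw [mapConst, bind_bind, hk]
      exact keepTele_bind _ (fun c => hχ (plain c)) _ _ _ _ _ _ hs hA hUA hEr.wf
    obtain ⟨A₁, s₁, hs₁, hA₁, hU₁, e₁⟩ := key hφ hφm
    obtain ⟨A₂, s₂, hs₂, hA₂, hU₂, e₂⟩ := key hψ hψm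
    have := hmor _ (hdecl d hd)
    rw [e₁, e₂] at this
    exact Conv.of_keepTele hY _ _ hs₁ hs₂ hA₁ hA₂ hU₁ hU₂ this
  · have h1 := hrel _ (hdecl d hd)
    rw [h.softRel_star hSE e he _ hc] at h1
    rw [hc]
    cases h1 with
    | some h1 => exact h1

end SoftExt
/-! ### The functor -/

section Functor

theorem closed_of_mapConst {k : N → N'} {t : Exp N} (h : (t.mapConst k).Closed) : t.Closed := by
  have key : ∀ (t : Exp N) (i : ℕ), t.Occurs i → (t.mapConst k).Occurs i := by
    intro t
    induction t with
    | const c => intro i hi; exact hi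
    | var j => intro i hi; exact hi
    | type => intro i hi; exact hi
    | kind => intro i hi; exact hi
    | lam A t ihA iht | pi A t ihA iht => intro i hi; exact hi.imp (ihA i) (iht (i + 1))
    | app f t ihf iht => intro i hi; exact hi.imp (ihf i) (iht i)
  exact fun i hi => h i (key t i hi)

theorem option_rel_trans {T : List (Decl N N)} {a b c : Option (Exp N)}
    (h : Option.Rel (Conv T) a b) (h' : Option.Rel (Conv T) b c) : Option.Rel (Conv T) a c := by
  cases h with
  | none => exact h'
  | some h =>
    cases h' with
    | some h' => exact .some (h.trans h')

theorem option_rel_symm {T : List (Decl N N)} {a b : Option (Exp N)}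
    (h : Option.Rel (Conv T) a b) : Option.Rel (Conv T) b a := by
  cases h with
  | none => exact .none
  | some h => exact .some h.symm

namespace ThyOver

variable {S : Thy.{u}} {L : Type u} {E E' E'' : ThyOver S L}

/-- A representative of a morphism. -/
noncomputable def raw (φ : E ⟶ E') : RawHom E.thy E'.thy := Quotient.out φ.1

/-- The values of a representative of a morphism. -/
noncomputable def img (φ : E ⟶ E') : S.Con ⊕ L → Exp (S.Con ⊕ L) := (raw φ).toFun

theorem img_closed (φ : E ⟶ E') (c : S.Con ⊕ L) : (img φ c).Closed := (raw φ).closed c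

theorem img_isMorphism (φ : E ⟶ E') :
    IsMorphism (full S.decls E.decls) (full S.decls E'.decls) (img φ) := (raw φ).isMorphism

theorem mk_raw (φ : E ⟶ E') : Quotient.mk _ (raw φ) = φ.1 := Quotient.out_eq _

theorem img_inl (φ : E ⟶ E') {c : S.Con} (hc : Declared S.decls c) :
    Conv (full S.decls E'.decls) (img φ (Sum.inl c)) (const (Sum.inl c)) := by
  obtain ⟨d, hd, rfl⟩ := hc
  have h := φ.2
  rw [← mk_raw φ] at h
  exact Quotient.exact h d hd

theorem img_id {d : Decl (S.Con ⊕ L) (S.Con ⊕ L)} (hd : d ∈ full S.decls E.decls) :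
    Conv (full S.decls E.decls) (img (𝟙 E) d.name) (const d.name) :=
  Quotient.exact (mk_raw (𝟙 E)) d hd

theorem img_comp (φ : E ⟶ E') (ψ : E' ⟶ E'') {d : Decl (S.Con ⊕ L) (S.Con ⊕ L)}
    (hd : d ∈ full S.decls E.decls) :
    Conv (full S.decls E''.decls) (img (φ ≫ ψ) d.name) ((img φ d.name).bind (img ψ)) := by
  have h : (Quotient.mk _ (raw (φ ≫ ψ)) : E.thy ⟶ E''.thy) =
      Quotient.mk _ ((raw φ).comp (raw ψ)) := by
    rw [mk_raw]
    change φ.1 ≫ ψ.1 = _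
    rw [← mk_raw φ, ← mk_raw ψ]
    rfl
  exact Quotient.exact h d hd

end ThyOver

namespace Heuristic

open ThyOver

variable {S T : Thy.{u}} {L : Type u} [DecidableEq L] {m : RawHom S T}
  {J : Type v} [Category.{w} J] {D : J ⥤ ThyOver S L} (H : Heuristic m D)
  {r : S.Con → Option (Exp T.Con)}

theorem eraserData (j : J) : EraserData T.decls (H.pos j) (H.decls j) :=
  .of_wf (H.decls_wf j) (H.unused j)

theorem softData (hr : IsLogRel S.decls T.decls m.toFun r) (htot : TermTotal S.decls m.toFun r)
    (j : J) : SoftData S.decls T.decls m.toFun r (H.pos j) (D.obj j).decls (H.decls j) :=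
  .of_isPushout S.wf m.closed m.isMorphism hr htot T.wf (H.isPushout j) (D.obj j).wf
    (H.decls_wf j) (H.unused j)

theorem mor_closed (j : J) (c : S.Con ⊕ L) : (H.mor j c).Closed :=
  closed_softMor m.closed (H.eraserData j) c

theorem plain_isMorphism (r : S.Con → Option (Exp T.Con)) (j : J) :
    IsMorphism (full T.decls (cleanDecls (H.pos j) (H.decls j))) (full T.decls (H.lrDecls r j))
      fun c => const (plain c) :=
  isMorphism_plain (H.isPushout j).plain_mem

theorem mor_isMorphism (r : S.Con → Option (Exp T.Con)) (j : J) :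
    IsMorphism (full S.decls (D.obj j).decls) (full T.decls (H.lrDecls r j)) (H.mor j) :=
  isMorphism_softMor m.closed m.isMorphism (H.isPushout j) (D.obj j).wf (H.eraserData j)
    (H.isPushout j).plain_mem

theorem exists_relData (hr : IsLogRel S.decls T.decls m.toFun r)
    (htot : TermTotal S.decls m.toFun r) (j : J) :
    ∃ sh, RelData (full S.decls (D.obj j).decls) (full T.decls (H.lrDecls r j)) (H.mor j)
      (H.logRel r j) sh := by
  have h := H.softData hr htot j
  obtain ⟨sh, hsh⟩ := (D.obj j).wf.exists_shaping fun c => (H.logRel r j c).isSome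
  exact ⟨sh, (D.obj j).wf, h.wf, H.mor_closed j, H.mor_isMorphism r j, h.log, h.total, hsh⟩

variable {i j k : J} (f : i ⟶ j)

/-- The assignments of the translation of `f`. -/
noncomputable def lrFun (r : S.Con → Option (Exp T.Con)) :
    T.Con ⊕ (L ⊕ L) → Exp (T.Con ⊕ (L ⊕ L)) := closeMap (H.lrMap r f)

theorem lrFun_closed (c : T.Con ⊕ (L ⊕ L)) : (H.lrFun f r c).Closed := closeMap_closed _ c

theorem lrFun_inl (c : T.Con) : H.lrFun f r (Sum.inl c) = const (Sum.inl c) := closeMap_inl _ c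

theorem mapConst_inl_bind_lrFun (t : Exp T.Con) :
    (t.mapConst Sum.inl).bind (H.lrFun f r) = t.mapConst Sum.inl := by
  rw [mapConst, bind_bind]
  exact congrArg (fun a => t.bind a) (funext fun c => H.lrFun_inl f c)

/-- The assignments with argument positions removed. -/
noncomputable def cleanFun : T.Con ⊕ L → Exp (T.Con ⊕ L) :=
  closeMap (fix (dropArr (H.pos i) (H.pos j) (H.decls j) (H.arr f)))

theorem lrFun_plain (c : T.Con ⊕ L) :
    H.lrFun f r (plain c) = (H.cleanFun f c).mapConst plain := by
  have h : H.lrMap r f (plain c) =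
      (fix (dropArr (H.pos i) (H.pos j) (H.decls j) (H.arr f)) c).mapConst plain := by
    cases c <;> rfl
  -- Renaming constants preserves and reflects closedness, so `closeMap` decides alike on both
  -- sides; the replacement `type` contains no constants.
  by_cases hc : (fix (dropArr (H.pos i) (H.pos j) (H.decls j) (H.arr f)) c).Closed
  · rw [lrFun, cleanFun, closeMap_of_closed hc, closeMap_of_closed (h ▸ hc.mapConst plain), h]
  · rw [lrFun, cleanFun, closeMap, closeMap, if_neg hc,
      if_neg fun h' => hc (closed_of_mapConst (h ▸ h'))]
    rfl

theorem mapConst_plain_bind_lrFun (t : Exp (T.Con ⊕ L)) :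
    (t.mapConst plain).bind (H.lrFun f r) = (t.bind (H.cleanFun f)).mapConst plain := by
  rw [mapConst, mapConst, bind_bind, bind_bind]
  exact congrArg (fun a => t.bind a) (funext fun c => H.lrFun_plain f c)

theorem clean_isMorphism :
    IsMorphism (full T.decls (cleanDecls (H.pos i) (H.decls i)))
      (full T.decls (cleanDecls (H.pos j) (H.decls j))) (H.cleanFun f) ∧
    ∀ c, Declared (full T.decls (H.decls i)) c →
      Conv (full T.decls (cleanDecls (H.pos j) (H.decls j)))
        ((fix (eraser (H.pos i) (H.decls i)) c).bind (H.cleanFun f))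
        ((closeMap (fix (H.arr f)) c).bind (fix (eraser (H.pos j) (H.decls j)))) := by
  refine clean_arr (H.eraserData j) (H.arr f) (H.decls_wf i) (H.unused i)
    (H.arr_isMorphism f) fun d' hd' => ?_
  obtain ⟨d, hd, hn⟩ := (H.isPushout i).exists_name.1 d' hd'
  rw [← hn]
  exact H.arr_unused f d hd

/-- The translation of `f` commutes with the morphisms to the translations. -/
theorem mor_lrFun {d : Decl (S.Con ⊕ L) (S.Con ⊕ L)}
    (hd : d ∈ full S.decls (D.obj i).decls) :
    Conv (full T.decls (H.lrDecls r j)) ((H.mor i d.name).bind (H.lrFun f r))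
      ((img (D.map f) d.name).bind (H.mor j)) := by
  have hEr := H.eraserData j
  have hpm := (H.isPushout i).isMorphism m.closed m.isMorphism (D.obj i).wf
  have hpm' := (H.isPushout j).isMorphism m.closed m.isMorphism (D.obj j).wf
  have e₁ : ∀ c, H.mor i c = ((push L m.toFun c).bind
      (fix (eraser (H.pos i) (H.decls i)))).mapConst plain := fun c =>
    congrFun (softMor_eq (H.decls i)) c
  have e₂ : ∀ t : Exp (S.Con ⊕ L), t.bind (H.mor j) = ((t.bind (push L m.toFun)).bind
      (fix (eraser (H.pos j) (H.decls j)))).mapConst plain := by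
    intro t
    rw [mapConst, bind_bind, bind_bind]
    exact congrArg (fun a => t.bind a)
      ((softMor_eq (H.decls j)).trans (funext fun c => (bind_bind _ _ _).symm ▸ rfl))
  -- The square before the removal of arguments. At local constants it is what a presentation of the
  -- pushout provides; at those of S it holds because the morphisms of the diagram fix S.
  have harr : Conv (full T.decls (H.decls j))
      ((push L m.toFun d.name).bind (closeMap (fix (H.arr f))))
      ((img (D.map f) d.name).bind (push L m.toFun)) := by
    rcases List.mem_append.1 hd with h | h
    · obtain ⟨d, hd', rfl⟩ := List.mem_map.1 h
      obtain ⟨d', hd'', hn⟩ := (H.isPushout i).exists_name.2 d hd'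
      have hcl := (H.arr_isMorphism f).closeMap_eq (Sum.inr d.name)
        ⟨d'.local, List.mem_append_left _ (List.mem_map_of_mem hd''), congrArg Sum.inr hn⟩
      change Conv _ (closeMap _ (Sum.inr d.name)) _
      rw [hcl]
      exact (H.arr_conv f d hd').symm
    · obtain ⟨d, hd', rfl⟩ := List.mem_map.1 h
      have h1 : ((m.toFun d.name).mapConst Sum.inl).bind (closeMap (fix (H.arr f))) =
          (m.toFun d.name).mapConst Sum.inl := by
        rw [mapConst, bind_bind]
        exact congrArg (fun a => (m.toFun d.name).bind a) (funext fun c => closeMap_inl _ c)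
      exact (Conv.of_eq h1).trans
        ((img_inl (D.map f) ⟨d, hd', rfl⟩).symm.bind (closed_push m.closed) hpm')
  rw [e₁, e₂, mapConst_plain_bind_lrFun]
  refine Conv.bind (fun _ => const_closed _) (H.plain_isMorphism r j) ?_
  refine Conv.trans ?_ (harr.bind hEr.closed hEr.mor)
  rw [bind_bind, bind_bind]
  exact Conv.bind_of_consts (H.clean_isMorphism f).2 (hpm d hd).1.consts

variable (hr : IsLogRel S.decls T.decls m.toFun r) (htot : TermTotal S.decls m.toFun r)
  (hst : H.StarsDefined r)

include hr htot

/-- Morphisms of the diagram are known only up to conversion; this makes the values at starred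
constants independent of the representatives. -/
theorem rel_conv_of_conv {t t' A : Exp (S.Con ⊕ L)}
    (ht : HasType (full S.decls (D.obj j).decls) [] t A)
    (ht' : HasType (full S.decls (D.obj j).decls) [] t' A)
    (h : Conv (full S.decls (D.obj j).decls) t t') :
    Option.Rel (Conv (full T.decls (H.lrDecls r j))) (rel (H.mor j) (H.logRel r j) [] t)
      (rel (H.mor j) (H.logRel r j) [] t') := by
  obtain ⟨sh, Dj⟩ := H.exists_relData hr htot j
  exact Dj.rel_conv Ctx.nil ht ht' h

include hst

theorem lrFun_isMorphism :
    IsMorphism (full T.decls (H.lrDecls r i)) (full T.decls (H.lrDecls r j)) (H.lrFun f r) ∧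
    ∀ c, Declared (full S.decls (D.obj i).decls) c →
      Option.Rel (Conv (full T.decls (H.lrDecls r j)))
        ((H.logRel r i c).map (Exp.bind (H.lrFun f r)))
        (rel (H.mor j) (H.logRel r j) [] (img (D.map f) c)) := by
  obtain ⟨sh, Dj⟩ := H.exists_relData hr htot j
  refine soft_arr (m := m.toFun) (r := r) (P := H.pos i) Dj (img_closed (D.map f))
    (g := H.lrMap r f) (fun _ => rfl) ?_ (H.isPushout i) (D.obj i).wf
    (H.decls_wf i) (H.softData hr htot i).wf (img_isMorphism (D.map f)) ?_ ?_ ?_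
  -- The representative fixes the constants of S only up to conversion, so the invariance of `rel`
  -- under conversion is needed even here.
  · rintro c ⟨d, hd, rfl⟩
    have hb := List.mem_append_right ((D.obj j).decls.map Decl.local)
      (List.mem_map_of_mem (f := Decl.base L) hd)
    have hbi := List.mem_append_right ((D.obj i).decls.map Decl.local)
      (List.mem_map_of_mem (f := Decl.base L) hd)
    have h0 : Conv (full S.decls (D.obj j).decls) (const (Sum.inl d.name))
        (img (D.map f) (Sum.inl d.name)) := (img_inl (D.map f) ⟨d, hd, rfl⟩).symm
    have h1 : HasType (full S.decls (D.obj j).decls) [] (const (Sum.inl d.name))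
      (d.type.mapConst Sum.inl) := .const [] (d.base L) hb
    obtain ⟨⟨s, hs, hty⟩, _⟩ := (D.obj j).wf.typed _ hb
    obtain ⟨⟨s', hs', hty'⟩, _⟩ := S.wf.typed d hd
    have h2 := ((img_isMorphism (D.map f)) _ hbi).1.conv hs hty (by
      change Conv (full S.decls (D.obj j).decls) ((d.type.mapConst Sum.inl).bind _)
        (d.type.mapConst Sum.inl)
      rw [mapConst, bind_bind]
      exact Conv.bind_of_consts (fun c hc => img_inl (D.map f) hc) hty'.consts)
    have := H.rel_conv_of_conv hr htot h1 h2 h0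
    change Option.Rel _ ((r d.name).map (mapConst Sum.inl)) _ at this
    rw [show (fun e : Exp T.Con => (e.mapConst Sum.inl).bind (closeMap (H.lrMap r f))) =
      mapConst Sum.inl from funext fun e => H.mapConst_inl_bind_lrFun f e]
    exact this
  · intro e he
    have hp := H.plain_isMorphism r j
    obtain ⟨h1, h2⟩ := (H.clean_isMorphism f).1 e he
    have e₁ : closeMap (H.lrMap r f) e.plain.name = (H.cleanFun f e.name).mapConst plain :=
      H.lrFun_plain f e.name
    have e₂ : ∀ t : Exp (T.Con ⊕ L), (t.mapConst plain).bind (closeMap (H.lrMap r f)) =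
      (t.bind (H.cleanFun f)).mapConst plain := H.mapConst_plain_bind_lrFun f
    rw [e₁]
    refine ⟨?_, fun t ht => ?_⟩
    · change HasType _ _ _ ((e.type.mapConst plain).bind _)
      rw [e₂]
      exact h1.bind (fun _ => const_closed _) hp
    · obtain ⟨t, ht', rfl⟩ := Option.map_eq_some_iff.1 ht
      rw [e₂]
      exact (h2 t ht').bind (fun _ => const_closed _) hp
  · rintro c ⟨d, hd, rfl⟩
    exact H.mor_lrFun f hd
  · exact fun d hd hdn hk => hst f d hd hdn hk

/-- The translation of a morphism of the diagram. -/
noncomputable def lrHom :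
    RawHom ⟨_, full T.decls (H.lrDecls r i), (H.softData hr htot i).wf⟩
      ⟨_, full T.decls (H.lrDecls r j), (H.softData hr htot j).wf⟩ where
  toFun := H.lrFun f r
  closed := H.lrFun_closed f
  isMorphism := (H.lrFun_isMorphism f hr htot hst).1

/-- By `soft_ext` it suffices to compare on the values of m_E and r_E. There the two commutation
laws reduce the claim to the preservation of identities by D; nothing of the kind is required of the
assignments in the presentation. -/
theorem lrFun_id {e : Decl (T.Con ⊕ (L ⊕ L)) (T.Con ⊕ (L ⊕ L))}
    (he : e ∈ full T.decls (H.lrDecls r j)) :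
    Conv (full T.decls (H.lrDecls r j)) (H.lrFun (𝟙 j) r e.name) (const e.name) := by
  obtain ⟨h1, h2⟩ := H.lrFun_isMorphism (𝟙 j) hr htot hst
  have hid : ∀ {c}, Declared (full S.decls (D.obj j).decls) c →
      Conv (full S.decls (D.obj j).decls) (img (D.map (𝟙 j)) c) (const c) := by
    rintro c ⟨d, hd, rfl⟩
    rw [D.map_id]
    exact img_id hd
  refine soft_ext (H.softData hr htot j).wf (H.isPushout j) (D.obj j).wf (H.decls_wf j)
    (H.unused j) (H.lrFun_closed _) const_closed h1
    (RawHom.id ⟨_, _, (H.softData hr htot j).wf⟩).isMorphism ?_ ?_ ?_ e he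
  · intro c
    rw [lrFun_inl]
    exact Conv.refl _ _
  · rintro c ⟨d, hd, rfl⟩
    rw [bind_const]
    exact (H.mor_lrFun (𝟙 j) hd).trans
      ((hid ⟨d, hd, rfl⟩).bind (H.mor_closed j) (H.mor_isMorphism r j))
  · rintro c ⟨d, hd, rfl⟩
    have hc := h2 _ ⟨d, hd, rfl⟩
    have hr1 := ((img_isMorphism (D.map (𝟙 j))) d hd).1
    obtain ⟨⟨s, hs, hty⟩, _⟩ := (D.obj j).wf.typed d hd
    have hr2 := hr1.conv hs hty (by
      refine Conv.trans (Conv.bind_of_consts (fun c hc => hid hc) hty.consts) ?_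
      exact Conv.of_eq (bind_const _))
    have h3 := H.rel_conv_of_conv hr htot hr2 (.const [] d hd) (hid ⟨d, hd, rfl⟩)
    rw [show (Exp.bind const : Exp (T.Con ⊕ (L ⊕ L)) → _) = fun t => t from funext bind_const,
      Option.map_id']
    exact option_rel_trans hc h3

/-- As for identities, the claim is reduced to the preservation of composition by D. On the values
of r_E, `rel_bind_conv` moves the translation of g past the relation. -/
theorem lrFun_comp (g : j ⟶ k) {e : Decl (T.Con ⊕ (L ⊕ L)) (T.Con ⊕ (L ⊕ L))}
    (he : e ∈ full T.decls (H.lrDecls r i)) :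
    Conv (full T.decls (H.lrDecls r k)) (H.lrFun (f ≫ g) r e.name)
      ((H.lrFun f r e.name).bind (H.lrFun g r)) := by
  obtain ⟨h1, h2⟩ := H.lrFun_isMorphism (f ≫ g) hr htot hst
  obtain ⟨hf1, hf2⟩ := H.lrFun_isMorphism f hr htot hst
  obtain ⟨hg1, hg2⟩ := H.lrFun_isMorphism g hr htot hst
  obtain ⟨sh, Dk⟩ := H.exists_relData hr htot k
  have hcomp : ∀ {c}, Declared (full S.decls (D.obj i).decls) c →
      Conv (full S.decls (D.obj k).decls) (img (D.map (f ≫ g)) c)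
        ((img (D.map f) c).bind (img (D.map g))) := by
    rintro c ⟨d, hd, rfl⟩
    rw [D.map_comp]
    exact img_comp _ _ hd
  have hmg : ∀ c, Declared (full S.decls (D.obj j).decls) c →
      Conv (full T.decls (H.lrDecls r k)) ((H.mor j c).bind (H.lrFun g r))
        ((img (D.map g) c).bind (H.mor k)) := by
    rintro c ⟨d, hd, rfl⟩
    exact H.mor_lrFun g hd
  refine soft_ext (H.softData hr htot k).wf (H.isPushout i) (D.obj i).wf (H.decls_wf i)
    (H.unused i) (H.lrFun_closed _) (fun c => (H.lrFun_closed f c).bind (H.lrFun_closed g)) h1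
    (hf1.comp hg1 (H.lrFun_closed g)) ?_ ?_ ?_ e he
  · intro c
    rw [lrFun_inl, lrFun_inl]
    change Conv _ _ (H.lrFun g r (Sum.inl c))
    rw [lrFun_inl]
    exact Conv.refl _ _
  · rintro c ⟨d, hd, rfl⟩
    rw [← bind_bind]
    refine (H.mor_lrFun (f ≫ g) hd).trans ?_
    refine ((hcomp ⟨d, hd, rfl⟩).bind (H.mor_closed k) (H.mor_isMorphism r k)).trans ?_
    refine Conv.trans ?_ ((H.mor_lrFun f hd).bind (H.lrFun_closed g) hg1).symm
    rw [bind_bind, bind_bind]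
    exact (Conv.bind_of_consts hmg (((img_isMorphism (D.map f)) d hd).1.consts)).symm
  · rintro c ⟨d, hd, rfl⟩
    have hcd : Declared (full S.decls (D.obj i).decls) d.name := ⟨d, hd, rfl⟩
    have hty1 := ((img_isMorphism (D.map (f ≫ g))) d hd).1
    have hty2 := (((img_isMorphism (D.map f)) d hd).1.bind (img_closed (D.map g))
      (img_isMorphism (D.map g)))
    obtain ⟨⟨s, hs, hty⟩, _⟩ := (D.obj i).wf.typed d hd
    have hty' := hty.bind (img_closed (D.map (f ≫ g))) (img_isMorphism (D.map (f ≫ g)))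
    have hty2' := hty2.conv hs.bind hty' (by
      rw [bind_bind]
      exact Conv.bind_of_consts (fun c hc => (hcomp hc).symm) hty.consts)
    have h3 := H.rel_conv_of_conv hr htot hty1 hty2' (hcomp hcd)
    have h4 := rel_bind_conv Dk.wfT.sane (H.lrFun_closed g) Dk.closed
      (fun c ⟨d, hd, hc⟩ => ⟨img_closed (D.map g) c,
        hc ▸ Dk.relClosed ((img_isMorphism (D.map g)) d hd).1⟩)
      hmg hg2 _ (((img_isMorphism (D.map f)) d hd).1.consts) []
    have h5 := option_rel_map (hf2 _ hcd) (f := Exp.bind (H.lrFun g r))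
      (g := Exp.bind (H.lrFun g r)) (q := Conv (full T.decls (H.lrDecls r k)))
      fun _ _ h => h.bind (H.lrFun_closed g) hg1
    rw [Option.map_map] at h5
    have e : (Exp.bind fun c => (H.lrFun f r c).bind (H.lrFun g r)) =
        Exp.bind (H.lrFun g r) ∘ Exp.bind (H.lrFun f r) :=
      funext fun t => (bind_bind _ _ t).symm
    rw [e]
    exact option_rel_trans (option_rel_trans (h2 _ hcd) h3)
      (option_rel_symm (option_rel_trans h5 h4))

end Heuristic

end Functor
end LF

/-! ### The main theorem -/

theorem mainTheorem2 {S T : Thy.{u}} {L : Type u} [DecidableEq L] (m : RawHom S T)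
    (r : S.Con → Option (Exp T.Con)) (hr : IsLogRel S.decls T.decls m.toFun r)
    (htot : TermTotal S.decls m.toFun r)
    {J : Type v} [Category.{w} J] (D : J ⥤ ThyOver S L) (H : Heuristic m D) :
    (∀ j, WF (full T.decls (H.lrDecls r j)) ∧
      IsMorphism (D.obj j).thy.decls (full T.decls (H.lrDecls r j)) (H.mor j) ∧
      IsLogRel (D.obj j).thy.decls (full T.decls (H.lrDecls r j)) (H.mor j) (H.logRel r j) ∧
      TermTotal (D.obj j).thy.decls (H.mor j) (H.logRel r j)) ∧
    (H.StarsDefined r →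
      ∃ (F : J ⥤ ThyOver T (L ⊕ L)) (α : D ⋙ ThyOver.forget S L ⟶ F ⋙ ThyOver.forget T (L ⊕ L)),
        (∀ j, (F.obj j).decls = H.lrDecls r j) ∧
        (∀ {i j : J} (f : i ⟶ j), Represents (F.map f).1 (H.lrMap r f)) ∧
        ∀ j, Represents (α.app j) (H.mor j)) := by
  have hD := H.softData hr htot
  refine ⟨fun j => ⟨(hD j).wf, H.mor_isMorphism r j, (hD j).log, (hD j).total⟩, fun hst => ?_⟩
  let X : J → ThyOver T (L ⊕ L) := fun j => ⟨H.lrDecls r j, (hD j).wf⟩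
  let φ : ∀ {i j : J}, (i ⟶ j) → RawHom (X i).thy (X j).thy := fun f => H.lrHom f hr htot hst
  let F : J ⥤ ThyOver T (L ⊕ L) :=
    { obj := X
      map := fun {i j} f => ⟨Quotient.mk _ (φ f), Quotient.sound fun d _ =>
        Conv.of_eq (H.lrFun_inl f d.name)⟩
      map_id := fun j => Subtype.ext (Quotient.sound fun e he => H.lrFun_id hr htot hst he)
      map_comp := fun {i j k} f g =>
        Subtype.ext (Quotient.sound fun e he => H.lrFun_comp f hr htot hst g he) }
  let μ : ∀ j, RawHom (D.obj j).thy (X j).thy := fun j =>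
    { toFun := H.mor j
      closed := H.mor_closed j
      isMorphism := H.mor_isMorphism r j }
  let α : D ⋙ ThyOver.forget S L ⟶ F ⋙ ThyOver.forget T (L ⊕ L) :=
    { app := fun j => Quotient.mk _ (μ j)
      naturality := fun i j f => by
        change (D.map f).1 ≫ _ = _
        rw [← ThyOver.mk_raw (D.map f)]
        exact Quotient.sound fun d hd => (H.mor_lrFun f hd).symm }
  refine ⟨F, α, fun _ => rfl, fun {i j} f => ⟨φ f, rfl, fun e he => ?_⟩,
    fun j => ⟨μ j, rfl, fun _ _ => rfl⟩⟩
  -- The functor was built from the closed version of the assignments; at declared constants it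
  -- agrees with the prescribed one.
  exact IsMorphism.of_closeMap (hD i).wf (hD j).wf (H.lrFun_isMorphism f hr htot hst).1 e.name
    ⟨e, he, rfl⟩
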